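/- **Setting.** Fix $M>0$, $t_0\in\mathbb R$. Let $\mathcal M=[t_0,\infty)\times[2M,\infty)\times S^2$ with coordinates $(t^*,r,\omega)$ carry the Schwarzschild metric $$g_M=-(1-\mu)\,dt^{*2}+2\mu\,dt^*dr+(1+\mu)\,dr^2+r^2\mathring g,\qquad \mu=2M/r,$$ and let $\Sigma=\{t^*=t_0\}$, $n=(1+\mu)^{1/2}\partial_{t^*}-\mu(1+\mu)^{-1/2}\partial_r$ its future unit normal, $\nu=(1+\mu)^{-1/2}\partial_r$, $P=(dr)^\sharp$. $\nabla$ is the Levi-Civita connection of $g_M$; $\tilde\nabla$, $\tilde\Box$, $\tilde\star$ belong to the quotient metric $\tilde g$ on the $(t^*,r)$-plane, and slashed operators to the spheres of radius $r$ with metric $\slashed g=r^2\mathring g$. For a tensor $T$ tangent to the spheres of $\Sigma$ put $|\mathfrak D^mT|=\sum_{i+j\le m}|(r\slashed\nabla_\nu)^i(r\slashed\nabla)^jT|_{\slashed g}$. A symmetric 2-tensor $X$ on $\mathcal M$ is decomposed into its $(t^*,r)$-part $\tilde X$ (traceless part $\hat{\tilde X}$ and trace), its mixed part $X_{\mathcal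 Q\otimes S}$ and its sphere part $\slashed X$ (traceless part $\hat{\slashed X}$ and trace); these, through their components with respect to $n,\nu$, are called the parts of $X$. Functions, and mixed 1-forms through potentials $(e,o)$ in $\xi=\mathcal D_1^\ast(e,o):=-\slashed\nabla e-\star\slashed\nabla o$, have vanishing projection to $l=0,1$ (resp. are supported only on $l=0,1$) if they are orthogonal to (resp. lie in) the span of the spherical harmonics with $l\le1$ on every sphere; traceless sphere tensors always have vanishing projection. $X$ has one of these properties if all its parts do (so $\hat{\slashed X}=0$ if $X$ is supported only on $l=0,1$); $(\cdot)_{l=0}$ is the spherical mean. **Linearised gravity.** For symmetric $X$ let $f(X)=\frac2rX(P,\cdot)-\frac1r(\hat{\tilde X}_{l=0})(P,\cdot)-\frac1r\,\mathrm{tr}\slashed X\,dr$. A smooth symmetric $h$ on $\mathcal M$ solves the equations of linearised gravity if $$\Box h_{ab}+2R_{acbd}h^{cd}=\nabla_af_b+\nabla_bf_a,\qquad \nabla^bh_{ab}-\tfrac12\nabla_a\mathrm{tr}\,h=f_a,\qquad f=f(h).$$ The initial data $\mathscr A(h)$ induced by $h$ on $\Sigma$ are: the linearised lapse $-\frac12(1+\mu)^{-1/2}h_{nn}$;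 the linearised shift, with radial part $h(\partial_{t^*},\partial_r)$ and spherical part $h(\partial_{t^*},\cdot)$; the linearised induced metric, split into $\frac12(1+\mu)^{1/2}h_{\nu\nu}$, $h(\partial_r,\cdot)$ restricted to the spheres, $\hat{\slashed h}$ and $\mathrm{tr}\slashed h$; and the linearised second fundamental form $K$ of $\Sigma$, split into the linearisations of the $\nu\nu$, mixed and traceless spherical parts of the traceless part of $K$ (taken with respect to the perturbed unit normal of the spheres and the perturbed metrics) and of the trace of $K$. The sign of $K$ is such that $\delta K(u,w)=\frac12\{(\nabla_nh)(u,w)-(\nabla_uh)(w,n)-(\nabla_wh)(u,n)\}-\frac12h_{nn}k(u,w)$, where $k$ is the background second fundamental form. **Seed data.** A smooth seed data set $\mathscr D$ consists of smooth functions $\Phi_0,\Phi_1,\Psi_0,\Psi_1$ on $\Sigma$ with vanishing projection to $l=0,1$; smooth functions $v_n,v_\nu,w_n,w_\nu$ and smooth sphere 1-forms $v_S,w_S$ on $\Sigma$; a number $\mathfrak m$; and a function $\mathfrak a$ in the span of the $l=1$ spherical harmonics on $S^2$. For $0<s\le1$ and $N\in\mathbb N$ it is *strongly asymptotically flat with weight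 $s$ to order $N$, with constant $C$*, if on $\Sigma$, for $i=0,1$ and $\psi_i\in\{\Phi_i,\Psi_i\}$, $v\in\{v_n,v_\nu,v_S\}$, $w\in\{w_n,w_\nu,w_S\}$, $$|\mathfrak D^{N-2}(r^{\frac12+s}\psi_0)|,\ |\mathfrak D^{N-3}(r^{\frac32+s}\psi_1)|,\ |\mathfrak D^{N+1}(r^{\frac12+s}v)|,\ |\mathfrak D^{N}(r^{\frac32+s}w)|\ \le\ C .$$ **Data constructed from the seed.** Let $\zeta$ be the inverse of $r^2\slashed\Delta+2(1-\frac{3M}r)$ on functions with vanishing projection to $l=0,1$, and let $\mathcal T_ff=r^4\,\mathrm{div}\,\mathrm{div}(\slashed\nabla\hat\otimes\slashed\nabla f)$, $\mathcal T_\xi\xi=\mathcal D_1^\ast\big(r^4\,\mathrm{div}\,\mathrm{div}(\slashed\nabla\hat\otimes\xi),\,r^4\,\mathrm{curl}\,\mathrm{div}(\slashed\nabla\hat\otimes\xi)\big)$, with $\mathrm{div},\mathrm{curl}$ those of the spheres and $(\slashed\nabla\hat\otimes\xi)_{AB}=\slashed\nabla_A\xi_B+\slashed\nabla_B\xi_A-\slashed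 g_{AB}\mathrm{div}\,\xi$. 1. Let $\Phi,\Psi$ be the smooth solutions on $\mathcal M$, with vanishing projection to $l=0,1$, of $$\tilde\Box\Phi+\slashed\Delta\Phi=-\tfrac{6M}{r^3}\Phi,\qquad \tilde\Box\Psi+\slashed\Delta\Psi=-\tfrac{6M}{r^3}\Psi+\tfrac{24M}{r^4}(r-3M)\zeta\Psi+\tfrac{72M^2}{r^5}(r-2M)\zeta^2\Psi$$ with $(\Phi,n\Phi)|_\Sigma=(\Phi_0,\Phi_1)$, $(\Psi,n\Psi)|_\Sigma=(\Psi_0,\Psi_1)$, and $h_1$ the smooth symmetric 2-tensor with vanishing projection to $l=0,1$ such that $$\mathcal T_f\hat{\tilde h}_1=\tilde\nabla\hat\otimes d(r\Psi)+6\mu\,dr\hat\otimes\zeta d\Psi,\quad \mathrm{tr}\,\tilde h_1=0,\quad \mathcal T_\xi (h_1)_{\mathcal Q\otimes S}=\mathcal D_1^\ast(0,\eta),\quad \hat{\slashed h}_1=0,$$ $$\mathcal T_f\mathrm{tr}\slashed h_1=-2r\slashed\Delta\Psi+4\tilde\nabla_P\Psi+12\tfrac\mu r(1-\mu)\zeta\Psi,\qquad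 \eta=-\tilde\star d(r\Phi),\ \text{ i.e. } \eta_n=\nu(r\Phi),\ \eta_\nu=n(r\Phi).$$ Here $\alpha\hat\otimes\beta$ and $\tilde\nabla\hat\otimes\alpha$ are twice the symmetrised traceless parts with respect to $\tilde g$, and $\zeta d\Psi$ has components $\zeta(n\Psi),\zeta(\nu\Psi)$. 2. Let $\mathscr K_{\mathfrak m,\mathfrak a}$ be the linearised Kerr solution: $\frac{2\mathfrak m}r(dt^*+dr)^2$ plus the symmetric tensor whose mixed part is $(\mu\,dt^*+(1+\mu)dr)\otimes\star\slashed\nabla\mathfrak a$. 3. Let $h_3=\mathcal L_vg_M$ be the pure gauge solution, where the smooth 1-form $v$ solves $\Box v=f(\mathcal L_vg_M)$ with $(v(n),v(\nu),v|_{S^2})=(v_n,v_\nu,v_S)$ and $((\nabla_nv)(n),(\nabla_nv)(\nu),(\nabla_nv)|_{S^2})=(w_n,w_\nu,w_S)$ on $\Sigma$. The initial data set constructed from $\mathscr D$ is $\mathscr A=\mathscr A(h_1)+\mathscr A(\mathscr K_{\mathfrak m,\mathfrak a})+\mathscr A(h_3)$. A smooth solution $h$ of the equations of linearised gravity arises from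 $\mathscr D$ if $\mathscr A(h)=\mathscr A$. **Statement.** Let $M>0$, $0<s\le1$ and $N\ge7$. There is a constant $B=B(M,s,N)>0$ such that for every $t_0$ and every smooth seed data set $\mathscr D$ that is strongly asymptotically flat with weight $s$ to order $N$, with constant $C$, the following holds. (i) For $\mathscr A'=\mathscr A-\mathscr A(\mathscr K_{\mathfrak m,\mathfrak a})$, every lapse, shift and induced metric quantity $\mathfrak g'$ and every second fundamental form quantity $\mathfrak k'$ of $\mathscr A'$ satisfies on $\Sigma$ $$|\mathfrak D^{N-4}(r^{\frac32+s}\mathfrak g')|\le BC,\qquad |\mathfrak D^{N-5}(r^{\frac52+s}\mathfrak k')|\le BC .$$ (ii) Let $h$ be a smooth solution of the equations of linearised gravity arising from $\mathscr D$, and let $h'$ be either $h-\mathscr K_{\mathfrak m,\mathfrak a}$ or the projection of $h$ away from $l=0,1$ (the part of $h$ with vanishing projection to $l=0,1$ whose complement $h-h'$ is supported only on $l=0,1$). Then every part $\mathfrak h'$ of $h'$ and every part $n(\mathfrak h')$ of $\nabla_nh'$ satisfies on $\Sigma$ $$|\mathfrak D^{N-4}(r^{\frac32+s}\mathfrak h')|\le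 BC,\qquad |\mathfrak D^{N-5}(r^{\frac52+s}\,n(\mathfrak h'))|\le BC .$$ -/

import Mathlib

open scoped ContDiff

noncomputable section

namespace LinearisedGravity

open MeasureTheory

/-! ## The Schwarzschild exterior and the Cauchy hypersurface

The hypersurface `Σ = {t₀} × [2M, ∞) × S²` is identified with `{x ∈ ℝ³ : 2M ≤ |x|}` through
`x = r ω`, and `D⁺(Σ) = [t₀, ∞) × [2M, ∞) × S²` with `{(t, x) : t₀ ≤ t, 2M ≤ |x|}`.  These are the
Schwarzschild-star coordinates `(t*, r, θ, φ)` with `(r, θ, φ)` written in Cartesian form. All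
tensors are written in Cartesian components. Derivatives are taken within the (closed) regions. -/

abbrev Space := EuclideanSpace ℝ (Fin 3)

/-- Points `(t*, x)`. -/
abbrev Spacetime := ℝ × Space

/-- Covariant `k`-tensor fields on `Σ`, in Cartesian components. -/
abbrev SField (k : ℕ) := Space → (Fin k → Fin 3) → ℝ

/-- Covariant `k`-tensor fields on spacetime, in the coordinates `(t*, x¹, x², x³)`. -/
abbrev TField (k : ℕ) := Spacetime → (Fin k → Fin 4) → ℝ

/-- The hypersurface `Σ`. -/
def ext (M : ℝ) : Set Space := {x | 2 * M ≤ ‖x‖}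

/-- The region `D⁺(Σ)`. -/
def future (M t₀ : ℝ) : Set Spacetime := {p | t₀ ≤ p.1 ∧ 2 * M ≤ ‖p.2‖}

/-- The mass aspect function `μ = 2M/r`. -/
def mu (M : ℝ) (x : Space) : ℝ := 2 * M / ‖x‖

/-- The background quantity `√(1 + μ)`: `h_M = (1 + μ) dr² + r² g̊` on `Σ`. -/
def hbar (M : ℝ) (x : Space) : ℝ := √(1 + mu M x)

/-- The background lapse `N = (1 + μ)^{-1/2}` of the foliation by level sets of `t*`. -/
def lapse (M : ℝ) (x : Space) : ℝ := 1 / hbar M x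

/-- The outward unit radial vector `x/|x|`. -/
def xhat (x : Space) (i : Fin 3) : ℝ := x i / ‖x‖

/-- The projection onto the tangent space of the sphere through `x`; as a covariant tensor it is
the induced metric of that sphere, which is the same for `h_M` and for the Euclidean metric. -/
def proj (x : Space) (i j : Fin 3) : ℝ := (if i = j then 1 else 0) - xhat x i * xhat x j

/-- Area form `ε_{ij}` of the sphere through `x`. -/
def areaForm (x : Space) (i j : Fin 3) : ℝ :=
  Matrix.det ![Pi.single i (1 : ℝ), Pi.single j (1 : ℝ), xhat x]

/-! ## Calculus of `S_ν`-tensors on `Σ` -/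

/-- `T` is an `S_ν`-tensor: it vanishes when the radial vector is inserted in any slot. -/
def IsAngular (M : ℝ) {k : ℕ} (T : SField k) : Prop :=
  ∀ x ∈ ext M, ∀ (m : Fin k) (I : Fin k → Fin 3),
    ∑ i, x i * T x (Function.update I m i) = 0

def SmoothS (M : ℝ) {k : ℕ} (T : SField k) : Prop :=
  ∀ I, ContDiffOn ℝ ∞ (fun x => T x I) (ext M)

/-- A function, regarded as a tensor field of rank `0`. -/
def fn (f : Space → ℝ) : SField 0 := fun x _ => f x

/-- The angular covariant derivative: `(∇̸T)_{j i₁ … i_k}`, the derivative index being the first. It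
is the tangential projection, in every slot, of the Euclidean derivative. -/
def angD (M : ℝ) {k : ℕ} (T : SField k) : SField (k + 1) := fun x I =>
  ∑ J : Fin (k + 1) → Fin 3, (∏ m, proj x (I m) (J m)) *
    fderivWithin ℝ (fun y => T y (Fin.tail J)) (ext M) x (EuclideanSpace.single (J 0) 1)

/-- Covariant differentiation (with respect to `h_M`) of `S_ν`-tensors in the direction
`ν = (1 + μ)^{-1/2} ∂_r`. In Cartesian components it is the componentwise derivative; in angular
components it reads `𝓛_ν - (k/r)(1 + μ)^{-1/2}` on rank `k`. -/
def nuD (M : ℝ) {k : ℕ} (T : SField k) : SField k := fun x I =>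
  1 / hbar M x * fderivWithin ℝ (fun y => T y I) (ext M) x (‖x‖⁻¹ • x)

/-- `r ∇̸_ν`. -/
def rNu (M : ℝ) {k : ℕ} (T : SField k) : SField k := fun x I => ‖x‖ * nuD M T x I

/-- `(r ∇̸)^j`. -/
def rAng (M : ℝ) {k : ℕ} : (j : ℕ) → SField k → SField (k + j)
  | 0, T => T
  | j + 1, T => fun x I => ‖x‖ * angD M (rAng M j T) x I

/-- The pointwise norm on `S_ν`-tensors. -/
def snorm {k : ℕ} (T : SField k) (x : Space) : ℝ := √(∑ I, T x I ^ 2)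

/-- `|𝔇^m T| = ∑_{i + j = 0}^{m} |(r∇̸_ν)^i (r∇̸)^j T|`. -/
def dnorm (M : ℝ) (m : ℕ) {k : ℕ} (T : SField k) (x : Space) : ℝ :=
  ∑ i ∈ Finset.range (m + 1), ∑ j ∈ Finset.range (m + 1 - i),
    snorm ((rNu M)^[i] (rAng M j T)) x

/-- `r^q T`. -/
def wt (q : ℝ) {k : ℕ} (T : SField k) : SField k := fun x I => ‖x‖ ^ q * T x I

/-- `|𝔇^m (r^q T)| ≤ B` everywhere on `Σ`. -/
def BoundedBy (M : ℝ) (m : ℕ) (q B : ℝ) {k : ℕ} (T : SField k) : Prop :=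
  ∀ x ∈ ext M, dnorm M m (wt q T) x ≤ B

/-- Divergence on the spheres. -/
def sdiv (M : ℝ) {k : ℕ} (T : SField (k + 1)) : SField k := fun x I =>
  ∑ j, angD M T x (Fin.cons j (Fin.cons j I))

/-- Hodge star of a 1-form on the spheres: `(⋆ξ)_b = ε_{ab} ξ^a`. -/
def star (ξ : SField 1) : SField 1 := fun x I => ∑ a, areaForm x a (I 0) * ξ x ![a]

/-- Curl of a 1-form on the spheres: `ε^{ab} ∇̸_a ξ_b`. -/
def scurl (M : ℝ) (ξ : SField 1) : SField 0 := fun x _ =>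
  ∑ a, ∑ b, areaForm x a b * angD M ξ x ![a, b]

/-- The traceless symmetrised derivative
`(∇̸ ⊗̂ ξ)_{ab} = ∇̸_a ξ_b + ∇̸_b ξ_a - g̸_{ab} div ξ`. -/
def tfD (M : ℝ) (ξ : SField 1) : SField 2 := fun x I =>
  angD M ξ x ![I 0, I 1] + angD M ξ x ![I 1, I 0] - proj x (I 0) (I 1) * sdiv M ξ x ![]

/-- `𝒟₁^*(ρ, σ) = -∇̸ρ - ⋆∇̸σ`. -/
def D1star (M : ℝ) (ρ σ : SField 0) : SField 1 := fun x I =>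
  -angD M ρ x I - star (angD M σ) x I

/-- `𝒯_f f = r⁴ div div (∇̸ ⊗̂ ∇̸f)`. -/
def Tf (M : ℝ) (f : SField 0) : SField 0 := fun x I =>
  ‖x‖ ^ 4 * sdiv M (sdiv M (tfD M (angD M f))) x I

/-- `𝒯_ξ ξ = 𝒟₁^*(r⁴ div div (∇̸ ⊗̂ ξ), r⁴ curl div (∇̸ ⊗̂ ξ))`. -/
def Tv (M : ℝ) (ξ : SField 1) : SField 1 :=
  D1star M (fun x I => ‖x‖ ^ 4 * sdiv M (sdiv M (tfD M ξ)) x I)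
    (fun x I => ‖x‖ ^ 4 * scurl M (sdiv M (tfD M ξ)) x I)

/-! ## Spherical harmonics `l = 0, 1` -/

/-- Integration over the unit sphere with its surface measure. -/
def sphereInt (f : Space → ℝ) : ℝ :=
  ∫ y : Metric.sphere (0 : Space) 1, f y ∂((volume : Measure Space).toSphere)

/-- The restriction of `f` to the sphere of radius `R` is orthogonal to the `l = 0, 1` spherical
harmonics (spanned by `1, ω₁, ω₂, ω₃`). -/
def OrthoL01 (f : Space → ℝ) (R : ℝ) : Prop :=
  sphereInt (fun y => f (R • y)) = 0 ∧ ∀ i, sphereInt (fun y => f (R • y) * y i) = 0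

/-- Functions on `D⁺(Σ)` with vanishing projection to `l = 0, 1`. -/
def VanishingL01 (M t₀ : ℝ) (F : Spacetime → ℝ) : Prop :=
  ∀ t, t₀ ≤ t → ∀ R, 2 * M ≤ R → OrthoL01 (fun x => F (t, x)) R

/-- Functions on `D⁺(Σ)` supported only on `l = 0, 1`. -/
def SupportedL01 (M t₀ : ℝ) (F : Spacetime → ℝ) : Prop :=
  ∀ t, t₀ ≤ t → ∀ R, 2 * M ≤ R → ∃ (c : ℝ) (b : Fin 3 → ℝ),
    ∀ y : Space, ‖y‖ = 1 → F (t, R • y) = c + ∑ i, b i * y i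

/-- The spherically symmetric (`l = 0`) part of a function on spacetime. -/
def sphAvg (F : Spacetime → ℝ) (p : Spacetime) : ℝ :=
  1 / (4 * Real.pi) * sphereInt (fun y => F (p.1, ‖p.2‖ • y))

/-! ## The Schwarzschild metric and its Levi-Civita calculus -/

/-- The coordinate basis vectors `∂_{t*}, ∂_{x¹}, ∂_{x²}, ∂_{x³}`. -/
def basis4 : Fin 4 → Spacetime :=
  Fin.cons (1, 0) (fun i => (0, EuclideanSpace.single i 1))

/-- The covector `dr`. -/
def drCov (p : Spacetime) : Fin 4 → ℝ := Fin.cons 0 (xhat p.2)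

/-- The covector `dt* + dr`. -/
def ell (p : Spacetime) : Fin 4 → ℝ := Fin.cons 1 (xhat p.2)

/-- The Minkowski metric `-dt*² + |dx|²`. -/
def eta (a b : Fin 4) : ℝ := if a = b then (if a = 0 then -1 else 1) else 0

/-- The Schwarzschild metric
`-(1 - μ) dt*² + 2μ dt* dr + (1 + μ) dr² + r² g̊ = -dt*² + |dx|² + μ (dt* + dr)²`. -/
def gM (M : ℝ) (p : Spacetime) (a b : Fin 4) : ℝ := eta a b + mu M p.2 * (ell p a * ell p b)

/-- The inverse metric. -/
def gInv (M : ℝ) (p : Spacetime) (a b : Fin 4) : ℝ :=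
  eta a b - mu M p.2 *
    ((Fin.cons (-1) (xhat p.2) : Fin 4 → ℝ) a * (Fin.cons (-1) (xhat p.2) : Fin 4 → ℝ) b)

/-- Partial derivatives of functions on `D⁺(Σ)`. -/
def pd (M t₀ : ℝ) (a : Fin 4) (F : Spacetime → ℝ) (p : Spacetime) : ℝ :=
  fderivWithin ℝ F (future M t₀) p (basis4 a)

/-- Christoffel symbols `Γ^c_{ab}`. -/
def Gam (M t₀ : ℝ) (p : Spacetime) (c a b : Fin 4) : ℝ :=
  1 / 2 * ∑ d, gInv M p c d *
    (pd M t₀ a (fun q => gM M q b d) p + pd M t₀ b (fun q => gM M q a d) p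
      - pd M t₀ d (fun q => gM M q a b) p)

/-- The Levi-Civita derivative `(∇T)_{a b₁ … b_k} = ∇_a T_{b₁ … b_k}`. -/
def covD (M t₀ : ℝ) {k : ℕ} (T : TField k) : TField (k + 1) := fun p I =>
  pd M t₀ (I 0) (fun q => T q (Fin.tail I)) p
    - ∑ m, ∑ c, Gam M t₀ p c (I 0) (Fin.tail I m) * T p (Function.update (Fin.tail I) m c)

/-- The tensorial wave operator `□ = g^{ab} ∇_a ∇_b`. -/
def box (M t₀ : ℝ) {k : ℕ} (T : TField k) : TField k := fun p I =>
  ∑ a, ∑ b, gInv M p a b * covD M t₀ (covD M t₀ T) p (Fin.cons a (Fin.cons b I))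

/-- `R^d_{cab} = ∂_a Γ^d_{bc} - ∂_b Γ^d_{ac} + Γ^d_{ae} Γ^e_{bc} - Γ^d_{be} Γ^e_{ac}`. -/
def riemUp (M t₀ : ℝ) (p : Spacetime) (d c a b : Fin 4) : ℝ :=
  pd M t₀ a (fun q => Gam M t₀ q d b c) p - pd M t₀ b (fun q => Gam M t₀ q d a c) p
    + ∑ e, (Gam M t₀ p d a e * Gam M t₀ p e b c - Gam M t₀ p d b e * Gam M t₀ p e a c)

/-- `R_{abcd}`, with all indices lowered. -/
def riem (M t₀ : ℝ) (p : Spacetime) (a b c d : Fin 4) : ℝ :=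
  ∑ e, gM M p a e * riemUp M t₀ p e b c d

def SmoothT (M t₀ : ℝ) {k : ℕ} (T : TField k) : Prop :=
  ∀ I, ContDiffOn ℝ ∞ (fun p => T p I) (future M t₀)

/-- Symmetric 2-tensor fields on `D⁺(Σ)`. -/
def SymmT (M t₀ : ℝ) (X : TField 2) : Prop :=
  ∀ p ∈ future M t₀, ∀ a b, X p ![a, b] = X p ![b, a]

/-! ## Frame and 2+2 decomposition -/

/-- The future unit normal to the level sets of `t*`: `n = (1+μ)^{1/2} ∂_{t*} - μ (1+μ)^{-1/2} ∂_r`. -/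
def nVec (M : ℝ) (p : Spacetime) : Fin 4 → ℝ :=
  Fin.cons (hbar M p.2) (fun i => -(mu M p.2 / hbar M p.2) * xhat p.2 i)

/-- `ν = (1+μ)^{-1/2} ∂_r`. -/
def nuVec (M : ℝ) (p : Spacetime) : Fin 4 → ℝ :=
  Fin.cons 0 (fun i => 1 / hbar M p.2 * xhat p.2 i)

/-- The projection of `∂_{xⁱ}` onto the sphere through `p`. -/
def angVec (i : Fin 3) (p : Spacetime) : Fin 4 → ℝ := Fin.cons 0 (proj p.2 i)

/-- `P = (dr)^♯`. -/
def PVec (M : ℝ) (p : Spacetime) (a : Fin 4) : ℝ := ∑ b, gInv M p a b * drCov p b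

/-- Index lowering. -/
def lower (M : ℝ) (u : Spacetime → Fin 4 → ℝ) (p : Spacetime) (a : Fin 4) : ℝ :=
  ∑ b, gM M p a b * u p b

/-- `X(u)`. -/
def ev1 (X : TField 1) (u : Spacetime → Fin 4 → ℝ) (p : Spacetime) : ℝ := ∑ a, u p a * X p ![a]

/-- `X(u, w)`. -/
def ev2 (X : TField 2) (u w : Spacetime → Fin 4 → ℝ) (p : Spacetime) : ℝ :=
  ∑ a, ∑ b, u p a * w p b * X p ![a, b]

/-- The `𝒬`-trace `-X_{nn} + X_{νν}`. -/
def trQ (M : ℝ) (X : TField 2) (p : Spacetime) : ℝ :=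
  -ev2 X (nVec M) (nVec M) p + ev2 X (nuVec M) (nuVec M) p

/-- The `nn`-component of the traceless part `X̃ - ½ g̃ tr X̃` of the `𝒬`-part of a symmetric `X`
(equal to its `νν`-component). -/
def hatNN (M : ℝ) (X : TField 2) (p : Spacetime) : ℝ :=
  (ev2 X (nVec M) (nVec M) p + ev2 X (nuVec M) (nuVec M) p) / 2

/-- The `nν`-component of the traceless part of the `𝒬`-part of a symmetric `X`. -/
def hatNV (M : ℝ) (X : TField 2) (p : Spacetime) : ℝ := ev2 X (nVec M) (nuVec M) p

/-- The `𝒬 ⊗ S` part `X(u, ·)` for a `𝒬`-vector `u`, on the slice at time `t`. -/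
def mixed (X : TField 2) (u : Spacetime → Fin 4 → ℝ) (t : ℝ) : SField 1 := fun x I =>
  ev2 X u (angVec (I 0)) (t, x)

/-- The trace of the `S`-part. -/
def trS (X : TField 2) (p : Spacetime) : ℝ := ∑ i, ev2 X (angVec i) (angVec i) p

/-- The traceless part of the `S`-part, on the slice at time `t`. -/
def hatS (X : TField 2) (t : ℝ) : SField 2 := fun x I =>
  ev2 X (angVec (I 0)) (angVec (I 1)) (t, x) - 1 / 2 * proj x (I 0) (I 1) * trS X (t, x)

/-- A function on spacetime restricted to the slice at time `t`. -/
def slice (F : Spacetime → ℝ) (t : ℝ) : SField 0 := fun x _ => F (t, x)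

/-- `𝒬 ⊗ S` 1-forms (through their `u`-component) with vanishing projection to `l = 0, 1`:
`ω = 𝒟₁^*(ω_e, ω_o)` where `ω_e, ω_o` have vanishing projection to `l = 0, 1`. -/
def MixedVanishing (M t₀ : ℝ) (X : TField 2) (u : Spacetime → Fin 4 → ℝ) : Prop :=
  ∃ e o : Spacetime → ℝ, ContDiffOn ℝ ∞ e (future M t₀) ∧ ContDiffOn ℝ ∞ o (future M t₀) ∧
    VanishingL01 M t₀ e ∧ VanishingL01 M t₀ o ∧
    ∀ t, t₀ ≤ t → ∀ x ∈ ext M, ∀ I, mixed X u t x I = D1star M (slice e t) (slice o t) x I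

/-- `𝒬 ⊗ S` 1-forms (through their `u`-component) supported only on `l = 0, 1`. -/
def MixedSupported (M t₀ : ℝ) (X : TField 2) (u : Spacetime → Fin 4 → ℝ) : Prop :=
  ∃ e o : Spacetime → ℝ, ContDiffOn ℝ ∞ e (future M t₀) ∧ ContDiffOn ℝ ∞ o (future M t₀) ∧
    SupportedL01 M t₀ e ∧ SupportedL01 M t₀ o ∧
    ∀ t, t₀ ≤ t → ∀ x ∈ ext M, ∀ I, mixed X u t x I = D1star M (slice e t) (slice o t) x I

/-- Linearised metrics with vanishing projection to `l = 0, 1`. (A traceless `S`-tensor always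
has vanishing projection.) -/
def MetricVanishing (M t₀ : ℝ) (X : TField 2) : Prop :=
  VanishingL01 M t₀ (hatNN M X) ∧ VanishingL01 M t₀ (hatNV M X) ∧ VanishingL01 M t₀ (trQ M X) ∧
  MixedVanishing M t₀ X (nVec M) ∧ MixedVanishing M t₀ X (nuVec M) ∧ VanishingL01 M t₀ (trS X)

/-- Linearised metrics supported only on `l = 0, 1`. -/
def MetricSupported (M t₀ : ℝ) (X : TField 2) : Prop :=
  SupportedL01 M t₀ (hatNN M X) ∧ SupportedL01 M t₀ (hatNV M X) ∧ SupportedL01 M t₀ (trQ M X) ∧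
  MixedSupported M t₀ X (nVec M) ∧ MixedSupported M t₀ X (nuVec M) ∧ SupportedL01 M t₀ (trS X) ∧
  ∀ t, t₀ ≤ t → ∀ x ∈ ext M, ∀ I, hatS X t x I = 0

/-! ## The equations of linearised gravity -/

/-- The spherically symmetric part of the traceless `𝒬`-part of `X`. -/
def hatZero (M : ℝ) (X : TField 2) (p : Spacetime) (a b : Fin 4) : ℝ :=
  sphAvg (hatNN M X) p * (lower M (nVec M) p a * lower M (nVec M) p b
      + lower M (nuVec M) p a * lower M (nuVec M) p b)
    - sphAvg (hatNV M X) p * (lower M (nVec M) p a * lower M (nuVec M) p b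
      + lower M (nuVec M) p a * lower M (nVec M) p b)

/-- The linearised gauge map
`f(X) = (2/r) X̃_P - (1/r) (X̃^_{l=0})_P + (2/r) X_{𝒬⊗S}(P, ·) - (1/r) dr tr X̸`
(the first and third term add up to `(2/r) X(P, ·)`). -/
def gaugeMap (M : ℝ) (X : TField 2) : TField 1 := fun p I =>
  2 / ‖p.2‖ * ∑ a, PVec M p a * X p ![a, I 0]
    - 1 / ‖p.2‖ * ∑ a, PVec M p a * hatZero M X p a (I 0)
    - 1 / ‖p.2‖ * drCov p (I 0) * trS X p

/-- The metric trace. -/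
def trace4 (M : ℝ) (X : TField 2) : TField 0 := fun p _ => ∑ a, ∑ b, gInv M p a b * X p ![a, b]

/-- Smooth solutions of the equations of linearised gravity on `D⁺(Σ)`: the linearised Einstein
equations `□h_{ab} + 2 R_{acbd} h^{cd} = ∇_a f_b + ∇_b f_a` together with the generalised wave gauge
condition `∇^b h_{ab} - ½ ∇_a tr h = f_a`, where `f = f(h)` is the gauge map above. -/
structure IsSolution (M t₀ : ℝ) (h : TField 2) : Prop where
  smooth : SmoothT M t₀ h
  symm : SymmT M t₀ h
  einstein : ∀ p ∈ future M t₀, ∀ a b,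
    box M t₀ h p ![a, b]
      + 2 * ∑ c, ∑ d, ∑ c', ∑ d', riem M t₀ p a c b d * gInv M p c c' * gInv M p d d' * h p ![c', d']
    = covD M t₀ (gaugeMap M h) p ![a, b] + covD M t₀ (gaugeMap M h) p ![b, a]
  gauge : ∀ p ∈ future M t₀, ∀ a,
    (∑ b, ∑ c, gInv M p b c * covD M t₀ h p ![b, c, a])
      - 1 / 2 * covD M t₀ (trace4 M h) p ![a] = gaugeMap M h p ![a]

/-- `∇_n X`. -/
def nablaN (M t₀ : ℝ) (X : TField 2) : TField 2 := fun p I =>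
  ∑ c, nVec M p c * covD M t₀ X p (Fin.cons c I)

/-- `|𝔇^m(r^q ·)| ≤ B` on `Σ` for the projections to `Σ` of all parts of the 2+2 decomposition of a
symmetric 2-tensor field. -/
def PartsBoundedBy (M t₀ : ℝ) (m : ℕ) (q B : ℝ) (X : TField 2) : Prop :=
  BoundedBy M m q B (slice (hatNN M X) t₀) ∧
  BoundedBy M m q B (slice (hatNV M X) t₀) ∧
  BoundedBy M m q B (slice (trQ M X) t₀) ∧
  BoundedBy M m q B (mixed X (nVec M) t₀) ∧
  BoundedBy M m q B (mixed X (nuVec M) t₀) ∧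
  BoundedBy M m q B (hatS X t₀) ∧
  BoundedBy M m q B (slice (trS X) t₀)

/-! ## Initial data -/

/-- Linearised initial data on `Σ`: the linearised lapse, shift (radial and angular part), induced
metric (radial lapse, mixed part, traceless part and trace of the angular part) and second
fundamental form `K` (`νν`, mixed and traceless angular part of the traceless part of `K`, and the
trace of `K`). -/
structure InitialData where
  lapse : SField 0
  shiftR : SField 0
  shiftS : SField 1
  hR : SField 0
  hS : SField 1
  hHat : SField 2
  hTr : SField 0
  kR : SField 0
  kS : SField 1
  kHat : SField 2
  kTr : SField 0

instance : Add InitialData where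
  add A B :=
    { lapse := A.lapse + B.lapse, shiftR := A.shiftR + B.shiftR, shiftS := A.shiftS + B.shiftS,
      hR := A.hR + B.hR, hS := A.hS + B.hS, hHat := A.hHat + B.hHat, hTr := A.hTr + B.hTr,
      kR := A.kR + B.kR, kS := A.kS + B.kS, kHat := A.kHat + B.kHat, kTr := A.kTr + B.kTr }

instance : Sub InitialData where
  sub A B :=
    { lapse := A.lapse - B.lapse, shiftR := A.shiftR - B.shiftR, shiftS := A.shiftS - B.shiftS,
      hR := A.hR - B.hR, hS := A.hS - B.hS, hHat := A.hHat - B.hHat, hTr := A.hTr - B.hTr,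
      kR := A.kR - B.kR, kS := A.kS - B.kS, kHat := A.kHat - B.kHat, kTr := A.kTr - B.kTr }

/-- Equality of initial data on `Σ`. -/
def InitialData.EqOn (M : ℝ) (A B : InitialData) : Prop :=
  ∀ x ∈ ext M, A.lapse x = B.lapse x ∧ A.shiftR x = B.shiftR x ∧ A.shiftS x = B.shiftS x ∧
    A.hR x = B.hR x ∧ A.hS x = B.hS x ∧ A.hHat x = B.hHat x ∧ A.hTr x = B.hTr x ∧
    A.kR x = B.kR x ∧ A.kS x = B.kS x ∧ A.kHat x = B.kHat x ∧ A.kTr x = B.kTr x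

/-- `|𝔇^m(r^q ·)| ≤ B` for the linearised lapse, shift and induced metric. -/
def InitialData.MetricBoundedBy (M : ℝ) (m : ℕ) (q B : ℝ) (A : InitialData) : Prop :=
  BoundedBy M m q B A.lapse ∧ BoundedBy M m q B A.shiftR ∧ BoundedBy M m q B A.shiftS ∧
  BoundedBy M m q B A.hR ∧ BoundedBy M m q B A.hS ∧ BoundedBy M m q B A.hHat ∧
  BoundedBy M m q B A.hTr

/-- `|𝔇^m(r^q ·)| ≤ B` for the linearised second fundamental form. -/
def InitialData.KBoundedBy (M : ℝ) (m : ℕ) (q B : ℝ) (A : InitialData) : Prop :=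
  BoundedBy M m q B A.kR ∧ BoundedBy M m q B A.kS ∧ BoundedBy M m q B A.kHat ∧
  BoundedBy M m q B A.kTr

/-- Background second fundamental form, `νν`-component. -/
def kNuNu (M : ℝ) (x : Space) : ℝ := mu M x * (2 + mu M x) / (2 * hbar M x ^ 3 * ‖x‖)

/-- Background second fundamental form, trace of the angular part (the angular part is pure trace,
and the mixed part vanishes). -/
def kTrS (M : ℝ) (x : Space) : ℝ := -(2 * mu M x / (hbar M x * ‖x‖))

/-- `½ ((∇_n X)(u, w) - (∇_u X)(w, n) - (∇_w X)(u, n))`. -/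
def dGam (M t₀ : ℝ) (X : TField 2) (u w : Spacetime → Fin 4 → ℝ) (p : Spacetime) : ℝ :=
  1 / 2 * ∑ a, ∑ b, ∑ c, u p a * w p b * nVec M p c *
    (covD M t₀ X p ![c, a, b] - covD M t₀ X p ![a, b, c] - covD M t₀ X p ![b, a, c])

/-- Linearised second fundamental form, `νν`-component. In general, for vectors tangent to `Σ`,
`δK(u, w) = ½ ((∇_n h)(u, w) - (∇_u h)(w, n) - (∇_w h)(u, n)) - ½ h(n, n) k(u, w)`. -/
def dkNuNu (M t₀ : ℝ) (h : TField 2) : SField 0 := fun x _ =>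
  dGam M t₀ h (nuVec M) (nuVec M) (t₀, x) - 1 / 2 * ev2 h (nVec M) (nVec M) (t₀, x) * kNuNu M x

/-- Linearised second fundamental form, mixed component. -/
def dkNuS (M t₀ : ℝ) (h : TField 2) : SField 1 := fun x I =>
  dGam M t₀ h (nuVec M) (angVec (I 0)) (t₀, x)

/-- Linearised second fundamental form, angular part. -/
def dkS (M t₀ : ℝ) (h : TField 2) : SField 2 := fun x I =>
  dGam M t₀ h (angVec (I 0)) (angVec (I 1)) (t₀, x)
    - 1 / 2 * ev2 h (nVec M) (nVec M) (t₀, x) * (1 / 2 * kTrS M x * proj x (I 0) (I 1))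

/-- Trace of the angular part of the linearised second fundamental form. -/
def dkSTr (M t₀ : ℝ) (h : TField 2) : SField 0 := fun x _ => ∑ i, dkS M t₀ h x ![i, i]

/-- The linearisation of the trace of `K` with respect to the induced metric. -/
def dTrK (M t₀ : ℝ) (h : TField 2) : SField 0 := fun x I =>
  dkNuNu M t₀ h x I + dkSTr M t₀ h x I
    - (kNuNu M x * ev2 h (nuVec M) (nuVec M) (t₀, x) + 1 / 2 * kTrS M x * trS h (t₀, x))

/-- The initial data induced on `Σ` by a linearised metric `h`: the linearisations of
* the lapse `N`, from `h_{nn} = -2 δN/N`;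
* the shift 1-form, whose components are `h(∂_{t*}, ∂_r)` and `h(∂_{t*}, e_A)`, where
  `∂_{t*} = (1 + μ)^{-1/2} (n + μ ν)`;
* the radial lapse `|∂_r|`-coefficient `δ√(h_{rr}) = ½ (1 + μ)^{1/2} h_{νν}`, the mixed part
  `h(∂_r, e_A)` and the angular part of the induced metric;
* the traceless part of the second fundamental form, decomposed with respect to the perturbed unit
  normal of the spheres into `νν`, mixed and traceless angular components, and its trace. -/
def induced (M t₀ : ℝ) (h : TField 2) : InitialData where
  lapse := fun x _ => -(lapse M x / 2) * ev2 h (nVec M) (nVec M) (t₀, x)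
  shiftR := fun x _ => ev2 h (nVec M) (nuVec M) (t₀, x) + mu M x * ev2 h (nuVec M) (nuVec M) (t₀, x)
  shiftS := fun x I => 1 / hbar M x * (mixed h (nVec M) t₀ x I + mu M x * mixed h (nuVec M) t₀ x I)
  hR := fun x _ => hbar M x / 2 * ev2 h (nuVec M) (nuVec M) (t₀, x)
  hS := fun x I => hbar M x * mixed h (nuVec M) t₀ x I
  hHat := hatS h t₀
  hTr := slice (trS h) t₀
  kR := fun x I => dkNuNu M t₀ h x I - kNuNu M x * ev2 h (nuVec M) (nuVec M) (t₀, x)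
    - 1 / 3 * dTrK M t₀ h x I
  kS := fun x I => dkNuS M t₀ h x I - 1 / 2 * kTrS M x * mixed h (nuVec M) t₀ x I
  kHat := fun x I => dkS M t₀ h x I - 1 / 2 * proj x (I 0) (I 1) * dkSTr M t₀ h x ![]
    - 1 / 2 * kTrS M x * hatS h t₀ x I
  kTr := dTrK M t₀ h

/-! ## Seed data -/

/-- Seed data: Cauchy data `(Φ₀, Φ₁)`, `(Ψ₀, Ψ₁)` for the Regge--Wheeler and Zerilli quantities;
Cauchy data `(v_n, v_ν, v_S)`, `(w_n, w_ν, w_S)` for the generator of a pure gauge solution; the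
mass parameter and the function `𝔞(ω) = spin · ω` in the span of the `l = 1` spherical harmonics. -/
structure SeedData where
  Φ₀ : Space → ℝ
  Φ₁ : Space → ℝ
  Ψ₀ : Space → ℝ
  Ψ₁ : Space → ℝ
  vn : Space → ℝ
  vν : Space → ℝ
  vS : SField 1
  wn : Space → ℝ
  wν : Space → ℝ
  wS : SField 1
  mass : ℝ
  spin : Fin 3 → ℝ

/-- Smooth seed data sets. -/
structure SeedData.IsSmooth (M : ℝ) (𝒟 : SeedData) : Prop where
  Φ₀ : ContDiffOn ℝ ∞ 𝒟.Φ₀ (ext M)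
  Φ₁ : ContDiffOn ℝ ∞ 𝒟.Φ₁ (ext M)
  Ψ₀ : ContDiffOn ℝ ∞ 𝒟.Ψ₀ (ext M)
  Ψ₁ : ContDiffOn ℝ ∞ 𝒟.Ψ₁ (ext M)
  Φ₀_ortho : ∀ R, 2 * M ≤ R → OrthoL01 𝒟.Φ₀ R
  Φ₁_ortho : ∀ R, 2 * M ≤ R → OrthoL01 𝒟.Φ₁ R
  Ψ₀_ortho : ∀ R, 2 * M ≤ R → OrthoL01 𝒟.Ψ₀ R
  Ψ₁_ortho : ∀ R, 2 * M ≤ R → OrthoL01 𝒟.Ψ₁ R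
  vn : ContDiffOn ℝ ∞ 𝒟.vn (ext M)
  vν : ContDiffOn ℝ ∞ 𝒟.vν (ext M)
  wn : ContDiffOn ℝ ∞ 𝒟.wn (ext M)
  wν : ContDiffOn ℝ ∞ 𝒟.wν (ext M)
  vS : SmoothS M 𝒟.vS
  wS : SmoothS M 𝒟.wS
  vS_angular : IsAngular M 𝒟.vS
  wS_angular : IsAngular M 𝒟.wS

/-- Strong asymptotic flatness with weight `s` to order `n`, with constant `C`. -/
structure SeedData.StronglyAF (M s : ℝ) (n : ℕ) (C : ℝ) (𝒟 : SeedData) : Prop where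
  Φ₀ : BoundedBy M (n - 2) (1 / 2 + s) C (fn 𝒟.Φ₀)
  Ψ₀ : BoundedBy M (n - 2) (1 / 2 + s) C (fn 𝒟.Ψ₀)
  Φ₁ : BoundedBy M (n - 3) (3 / 2 + s) C (fn 𝒟.Φ₁)
  Ψ₁ : BoundedBy M (n - 3) (3 / 2 + s) C (fn 𝒟.Ψ₁)
  vn : BoundedBy M (n + 1) (1 / 2 + s) C (fn 𝒟.vn)
  vν : BoundedBy M (n + 1) (1 / 2 + s) C (fn 𝒟.vν)
  vS : BoundedBy M (n + 1) (1 / 2 + s) C 𝒟.vS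
  wn : BoundedBy M n (3 / 2 + s) C (fn 𝒟.wn)
  wν : BoundedBy M n (3 / 2 + s) C (fn 𝒟.wν)
  wS : BoundedBy M n (3 / 2 + s) C 𝒟.wS

/-! ## From seed data to initial data -/

/-- A function on spacetime as a tensor field of rank `0`. -/
def scal (F : Spacetime → ℝ) : TField 0 := fun p _ => F p

/-- The derivative `u(F)`. -/
def dirD (M t₀ : ℝ) (u : Spacetime → Fin 4 → ℝ) (F : Spacetime → ℝ) (p : Spacetime) : ℝ :=
  ∑ a, u p a * pd M t₀ a F p

/-- The Hessian `∇∇F` (on `𝒬`-vectors it is the Hessian of the `𝒬`-metric). -/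
def hess (M t₀ : ℝ) (F : Spacetime → ℝ) : TField 2 := covD M t₀ (covD M t₀ (scal F))

/-- The wave operator of the `𝒬`-metric on functions. -/
def boxQ (M t₀ : ℝ) (F : Spacetime → ℝ) : Spacetime → ℝ := trQ M (hess M t₀ F)

/-- The Laplacian on the spheres. -/
def angLap (M : ℝ) (F : Spacetime → ℝ) (p : Spacetime) : ℝ :=
  sdiv M (angD M (slice F p.1)) p.2 ![]

/-- `G = ζ F`: `G` has vanishing projection to `l = 0, 1` and `r² Δ̸ G + 2 (1 - 3M/r) G = F`. -/
structure IsZeta (M t₀ : ℝ) (F G : Spacetime → ℝ) : Prop where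
  smooth : ContDiffOn ℝ ∞ G (future M t₀)
  vanishing : VanishingL01 M t₀ G
  eq : ∀ p ∈ future M t₀,
    ‖p.2‖ ^ 2 * (angLap M G p + 2 / ‖p.2‖ ^ 2 * (1 - 3 * M / ‖p.2‖) * G p) = F p

/-- `Φ` is the smooth solution of the Regge--Wheeler equation with the given seed data. -/
structure IsReggeWheeler (M t₀ : ℝ) (𝒟 : SeedData) (Φ : Spacetime → ℝ) : Prop where
  smooth : ContDiffOn ℝ ∞ Φ (future M t₀)
  vanishing : VanishingL01 M t₀ Φ
  eq : ∀ p ∈ future M t₀,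
    boxQ M t₀ Φ p + angLap M Φ p = -(6 / ‖p.2‖ ^ 2 * (M / ‖p.2‖) * Φ p)
  init : ∀ x ∈ ext M, Φ (t₀, x) = 𝒟.Φ₀ x ∧ dirD M t₀ (nVec M) Φ (t₀, x) = 𝒟.Φ₁ x

/-- `Ψ` is the smooth solution of the Zerilli equation with the given seed data; `Z₁ = ζ Ψ` and
`Z₂ = ζ² Ψ`. -/
structure IsZerilli (M t₀ : ℝ) (𝒟 : SeedData) (Ψ Z₁ Z₂ : Spacetime → ℝ) : Prop where
  smooth : ContDiffOn ℝ ∞ Ψ (future M t₀)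
  vanishing : VanishingL01 M t₀ Ψ
  zeta₁ : IsZeta M t₀ Ψ Z₁
  zeta₂ : IsZeta M t₀ Z₁ Z₂
  eq : ∀ p ∈ future M t₀,
    boxQ M t₀ Ψ p + angLap M Ψ p = -(6 / ‖p.2‖ ^ 2 * (M / ‖p.2‖) * Ψ p)
      + 24 / ‖p.2‖ ^ 3 * (M / ‖p.2‖) * (‖p.2‖ - 3 * M) * Z₁ p
      + 72 / ‖p.2‖ ^ 3 * (M / ‖p.2‖) * (M / ‖p.2‖) * (‖p.2‖ - 2 * M) * Z₂ p
  init : ∀ x ∈ ext M, Ψ (t₀, x) = 𝒟.Ψ₀ x ∧ dirD M t₀ (nVec M) Ψ (t₀, x) = 𝒟.Ψ₁ x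

/-- The function `r F`. -/
def rTimes (F : Spacetime → ℝ) : Spacetime → ℝ := fun p => ‖p.2‖ * F p

/-- The function `r`. -/
def rFun : Spacetime → ℝ := fun p => ‖p.2‖

/-- The linearised metric `h` with vanishing projection to `l = 0, 1` determined by `Φ` and `Ψ`,
where `Z₁ = ζΨ`:
* `𝒯_f ĝ = ∇̃ ⊗̂ d(rΨ) + 6μ dr ⊗̂ ζ dΨ`, in the components `nn` (equal to `νν`) and `nν`;
* `tr g̃ = 0`;
* `𝒯_ξ g_{𝒬⊗S} = 𝒟₁^*(0, η)` with `η = -⋆̃ d(rΦ)`, that is `η_n = ν(rΦ)`, `η_ν = n(rΦ)`;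
* `ĝ̸ = 0`;
* `𝒯_f tr g̸ = -2r Δ̸Ψ + 4 ∇̃_P Ψ + 12 μ r⁻¹ (1 - μ) ζΨ`. -/
structure IsRWMetric (M t₀ : ℝ) (Φ Ψ Z₁ : Spacetime → ℝ) (h : TField 2) : Prop where
  smooth : SmoothT M t₀ h
  symm : SymmT M t₀ h
  vanishing : MetricVanishing M t₀ h
  hatQ : ∃ W_n W_ν : Spacetime → ℝ,
    IsZeta M t₀ (dirD M t₀ (nVec M) Ψ) W_n ∧ IsZeta M t₀ (dirD M t₀ (nuVec M) Ψ) W_ν ∧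
    ∀ t, t₀ ≤ t → ∀ x ∈ ext M,
      Tf M (slice (hatNN M h) t) x ![] =
        2 * hatNN M (hess M t₀ (rTimes Ψ)) (t, x)
          + 6 * mu M x * (dirD M t₀ (nVec M) rFun (t, x) * W_n (t, x)
            + dirD M t₀ (nuVec M) rFun (t, x) * W_ν (t, x)) ∧
      Tf M (slice (hatNV M h) t) x ![] =
        2 * hatNV M (hess M t₀ (rTimes Ψ)) (t, x)
          + 6 * mu M x * (dirD M t₀ (nVec M) rFun (t, x) * W_ν (t, x)
            + dirD M t₀ (nuVec M) rFun (t, x) * W_n (t, x))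
  traceQ : ∀ p ∈ future M t₀, trQ M h p = 0
  mixed : ∀ t, t₀ ≤ t → ∀ x ∈ ext M, ∀ I,
    Tv M (mixed h (nVec M) t) x I
        = D1star M (fun _ _ => 0) (slice (dirD M t₀ (nuVec M) (rTimes Φ)) t) x I ∧
    Tv M (mixed h (nuVec M) t) x I
        = D1star M (fun _ _ => 0) (slice (dirD M t₀ (nVec M) (rTimes Φ)) t) x I
  hatS : ∀ t, t₀ ≤ t → ∀ x ∈ ext M, ∀ I, hatS h t x I = 0
  traceS : ∀ t, t₀ ≤ t → ∀ x ∈ ext M,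
    Tf M (slice (trS h) t) x ![] =
      -(2 * ‖x‖ * angLap M Ψ (t, x)) + 4 * dirD M t₀ (PVec M) Ψ (t, x)
        + 12 * mu M x * ‖x‖⁻¹ * (1 - mu M x) * Z₁ (t, x)

/-- The Lie derivative `𝓛_v g_M`, i.e. `∇_a v_b + ∇_b v_a`. -/
def lieMetric (M t₀ : ℝ) (v : TField 1) : TField 2 := fun p I =>
  covD M t₀ v p ![I 0, I 1] + covD M t₀ v p ![I 1, I 0]

/-- `v = ṽ + v̸` is the smooth 1-form generating the pure gauge solution `𝓛_v g_M` with the given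
seed data. The wave equation `□v = f(𝓛_v g_M)` expresses that `𝓛_v g_M` satisfies the linearised
generalised wave gauge condition. -/
structure IsGaugeGenerator (M t₀ : ℝ) (𝒟 : SeedData) (v : TField 1) : Prop where
  smooth : SmoothT M t₀ v
  eq : ∀ p ∈ future M t₀, ∀ a, box M t₀ v p ![a] = gaugeMap M (lieMetric M t₀ v) p ![a]
  init : ∀ x ∈ ext M,
    ev1 v (nVec M) (t₀, x) = 𝒟.vn x ∧ ev1 v (nuVec M) (t₀, x) = 𝒟.vν x ∧
    (∀ i, ev1 v (angVec i) (t₀, x) = 𝒟.vS x ![i]) ∧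
    ev2 (covD M t₀ v) (nVec M) (nVec M) (t₀, x) = 𝒟.wn x ∧
    ev2 (covD M t₀ v) (nVec M) (nuVec M) (t₀, x) = 𝒟.wν x ∧
    ∀ i, ev2 (covD M t₀ v) (nVec M) (angVec i) (t₀, x) = 𝒟.wS x ![i]

/-- The covector `μ dt* + (1 + μ) dr`. -/
def kerrCov (M : ℝ) (p : Spacetime) : Fin 4 → ℝ :=
  Fin.cons (mu M p.2) (fun i => (1 + mu M p.2) * xhat p.2 i)

/-- The 1-form `⋆∇̸𝔞` on the spheres, `𝔞(ω) = spin · ω`, as a spacetime covector. -/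
def spinCov (M : ℝ) (spin : Fin 3 → ℝ) (p : Spacetime) : Fin 4 → ℝ :=
  Fin.cons 0 (fun i => star (angD M (fn fun x => ∑ j, spin j * xhat x j)) p.2 ![i])

/-- The linearised Kerr solution with parameters `mass` and `𝔞`: the derivative of `g_M` with
respect to the mass, `(2 mass / r) (dt* + dr)²`, plus the symmetric tensor whose `𝒬 ⊗ S` part is
`(μ dt* + (1 + μ) dr) ⊗ ⋆∇̸𝔞`. -/
def kerr (M mass : ℝ) (spin : Fin 3 → ℝ) : TField 2 := fun p I =>
  2 * mass / ‖p.2‖ * (ell p (I 0) * ell p (I 1))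
    + (kerrCov M p (I 0) * spinCov M spin p (I 1) + spinCov M spin p (I 0) * kerrCov M p (I 1))

/-- `A` is the initial data set constructed from the seed data: the sum of the data induced by the
solution determined by `Φ, Ψ`, by the linearised Kerr solution and by the pure gauge solution. -/
def IsConstructed (M t₀ : ℝ) (𝒟 : SeedData) (A : InitialData) : Prop :=
  ∃ (Φ Ψ Z₁ Z₂ : Spacetime → ℝ) (h : TField 2) (v : TField 1),
    IsReggeWheeler M t₀ 𝒟 Φ ∧ IsZerilli M t₀ 𝒟 Ψ Z₁ Z₂ ∧ IsRWMetric M t₀ Φ Ψ Z₁ h ∧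
    IsGaugeGenerator M t₀ 𝒟 v ∧
    A.EqOn M (induced M t₀ h + induced M t₀ (kerr M 𝒟.mass 𝒟.spin)
      + induced M t₀ (lieMetric M t₀ v))

/-- `h` is a smooth solution of the equations of linearised gravity arising from the seed data: it
induces on `Σ` the initial data constructed from it. -/
def ArisesFrom (M t₀ : ℝ) (𝒟 : SeedData) (h : TField 2) : Prop :=
  IsSolution M t₀ h ∧ IsConstructed M t₀ 𝒟 (induced M t₀ h)

/-- `h'` is the projection of `h` away from `l = 0, 1`. -/
def IsProjectionAway (M t₀ : ℝ) (h h' : TField 2) : Prop :=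
  SmoothT M t₀ h' ∧ SymmT M t₀ h' ∧ MetricVanishing M t₀ h' ∧ MetricSupported M t₀ (h - h')

end LinearisedGravity

end

open LinearisedGravity

noncomputable section

namespace LinearisedGravity

open MeasureTheory

/-! ## Directional derivatives within a set and the algebra of smooth functions -/

section Smooth

variable {E : Type*} [NormedAddCommGroup E] [NormedSpace ℝ E]

/-- Sets on which derivatives within the set are well behaved. -/
structure GoodSet (s : Set E) : Prop where
  unique : UniqueDiffOn ℝ s
  clos : s ⊆ closure (interior s)

/-- The directional derivative within `s`. -/
def dd (s : Set E) (v : E) (f : E → ℝ) : E → ℝ := fun x => fderivWithin ℝ f s x v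

variable {s : Set E} {f g : E → ℝ} {v w x : E}

theorem dd_congr (h : Set.EqOn f g s) : Set.EqOn (dd s v f) (dd s v g) s := fun x hx => by
  simp only [dd]; rw [fderivWithin_congr h (h hx)]

theorem GoodSet.contDiffOn_dd (hs : GoodSet s) (hf : ContDiffOn ℝ ∞ f s) :
    ContDiffOn ℝ ∞ (dd s v f) s :=
  (hf.fderivWithin hs.unique (m := ∞) (by simp)).clm_apply contDiffOn_const

theorem dd_add (hs : GoodSet s) (hf : ContDiffOn ℝ ∞ f s) (hg : ContDiffOn ℝ ∞ g s) (hx : x ∈ s) :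
    dd s v (fun y => f y + g y) x = dd s v f x + dd s v g x := by
  simp only [dd]
  rw [fderivWithin_fun_add (hs.unique x hx) (hf.differentiableOn (by simp) x hx)
    (hg.differentiableOn (by simp) x hx)]; rfl

theorem dd_mul (hs : GoodSet s) (hf : ContDiffOn ℝ ∞ f s) (hg : ContDiffOn ℝ ∞ g s) (hx : x ∈ s) :
    dd s v (fun y => f y * g y) x = f x * dd s v g x + g x * dd s v f x := by
  simp only [dd]
  rw [fderivWithin_fun_mul (hs.unique x hx) (hf.differentiableOn (by simp) x hx)
    (hg.differentiableOn (by simp) x hx)]; rfl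

theorem dd_const (c : ℝ) : dd s v (fun _ => c) x = 0 := by
  simp [dd]

theorem dd_comm (hs : GoodSet s) (hf : ContDiffOn ℝ ∞ f s) (hx : x ∈ s) :
    dd s v (dd s w f) x = dd s w (dd s v f) x := by
  have h := (hf x hx).isSymmSndFDerivWithinAt (by simp only [minSmoothness_of_isRCLikeNormedField]; exact WithTop.coe_le_coe.2 (le_top : (2 : ℕ∞) ≤ ⊤)) hs.unique (hs.clos hx) hx
  have h1 : ContDiffOn ℝ ∞ (fderivWithin ℝ f s) s := hf.fderivWithin hs.unique (m := ∞) (by simp)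
  have h2 := h1.differentiableOn (by simp) x hx
  have h3 := h v w
  have key : ∀ u z : E, dd s u (dd s z f) x = fderivWithin ℝ (fderivWithin ℝ f s) s x u z := by
    intro u z
    change fderivWithin ℝ (fun y => fderivWithin ℝ f s y z) s x u = _
    rw [fderivWithin_clm_apply (hs.unique x hx) h2 (by fun_prop)]
    simp
  rw [key, key, h3]

/-- The algebra of smooth functions on `s`. -/
def Sm (s : Set E) : Subalgebra ℝ (s → ℝ) where
  carrier := {g | ∃ f, ContDiffOn ℝ ∞ f s ∧ ∀ x : s, g x = f x}
  mul_mem' := by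
    rintro a b ⟨f, hf, h1⟩ ⟨g, hg, h2⟩
    exact ⟨_, hf.mul hg, fun x => by simp [h1, h2]⟩
  add_mem' := by
    rintro a b ⟨f, hf, h1⟩ ⟨g, hg, h2⟩
    exact ⟨_, hf.add hg, fun x => by simp [h1, h2]⟩
  algebraMap_mem' c := ⟨fun _ => c, contDiffOn_const, fun x => by simp⟩

instance : CommRing (Sm s) := (Sm s).toCommRing
instance : CommSemiring (Sm s) := CommRing.toCommSemiring
instance : Semiring (Sm s) := CommSemiring.toSemiring
instance : Algebra ℝ (Sm s) := (Sm s).algebra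
instance : Module ℝ (Sm s) := Algebra.toModule

/-- The element of `Sm s` given by a smooth function. -/
def Sm.mk (f : E → ℝ) (hf : ContDiffOn ℝ ∞ f s) : Sm s := ⟨fun x => f x, f, hf, fun _ => rfl⟩

/-- A smooth function representing an element of `Sm s`. -/
def Sm.rep (g : Sm s) : E → ℝ := g.2.choose

theorem Sm.rep_smooth (g : Sm s) : ContDiffOn ℝ ∞ (Sm.rep g) s := g.2.choose_spec.1

theorem Sm.rep_apply (g : Sm s) (x : s) : (Sm.rep g) x = g.1 x := (g.2.choose_spec.2 x).symm

@[simp] theorem Sm.mk_apply (f : E → ℝ) (hf : ContDiffOn ℝ ∞ f s) (x : s) :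
    (Sm.mk f hf).1 x = f x := rfl

@[simp] theorem Sm.mk_rep (g : Sm s) : Sm.mk (Sm.rep g) (Sm.rep_smooth g) = g :=
  Subtype.ext (funext fun x => Sm.rep_apply g x)

theorem Sm.ext' {a b : Sm s} (h : ∀ x : s, a.1 x = b.1 x) : a = b := Subtype.ext (funext h)

theorem Sm.mk_eq {hf : ContDiffOn ℝ ∞ f s} {hg : ContDiffOn ℝ ∞ g s} (h : Set.EqOn f g s) :
    Sm.mk f hf = Sm.mk g hg := Sm.ext' fun x => h x.2

theorem Sm.rep_mk (hf : ContDiffOn ℝ ∞ f s) : Set.EqOn (Sm.rep (Sm.mk f hf)) f s := fun x hx => by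
  rw [Sm.rep_apply _ ⟨x, hx⟩]; rfl

/-- Directional differentiation as a derivation of the algebra of smooth functions. -/
def GoodSet.der (hs : GoodSet s) (v : E) : Derivation ℝ (Sm s) (Sm s) where
  toFun g := Sm.mk (dd s v (Sm.rep g)) (hs.contDiffOn_dd (Sm.rep_smooth g))
  map_add' a b := Sm.ext' fun x => by
    have h : Set.EqOn (Sm.rep (a + b)) (fun y => (Sm.rep a) y + (Sm.rep b) y) s := fun y hy => by
      beta_reduce
      rw [Sm.rep_apply _ ⟨y, hy⟩, Sm.rep_apply _ ⟨y, hy⟩, Sm.rep_apply _ ⟨y, hy⟩]; rfl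
    have := dd_add hs (Sm.rep_smooth a) (Sm.rep_smooth b) x.2 (v := v)
    simp only [Sm.mk_apply]
    rw [dd_congr h x.2, this]; rfl
  map_smul' c a := Sm.ext' fun x => by
    have h : Set.EqOn (Sm.rep (c • a)) (fun y => (fun _ => c) y * (Sm.rep a) y) s := fun y hy => by
      simp only []
      rw [Sm.rep_apply _ ⟨y, hy⟩, Sm.rep_apply _ ⟨y, hy⟩]; rfl
    have := dd_mul hs contDiffOn_const (Sm.rep_smooth a) x.2 (v := v) (f := fun _ => c)
    simp only [Sm.mk_apply]
    rw [dd_congr h x.2, this, dd_const]; simp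
  map_one_eq_zero' := Sm.ext' fun x => by
    have h : Set.EqOn (Sm.rep (1 : Sm s)) (fun _ => 1) s := fun y hy => by
      rw [Sm.rep_apply _ ⟨y, hy⟩]; rfl
    change dd s v (Sm.rep (1 : Sm s)) x = 0
    rw [dd_congr h x.2, dd_const]
  leibniz' a b := Sm.ext' fun x => by
    have h : Set.EqOn (Sm.rep (a * b)) (fun y => (Sm.rep a) y * (Sm.rep b) y) s := fun y hy => by
      beta_reduce
      rw [Sm.rep_apply _ ⟨y, hy⟩, Sm.rep_apply _ ⟨y, hy⟩, Sm.rep_apply _ ⟨y, hy⟩]; rfl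
    have := dd_mul hs (Sm.rep_smooth a) (Sm.rep_smooth b) x.2 (v := v)
    change dd s v (Sm.rep (a * b)) x = a.1 x * dd s v (Sm.rep b) x + b.1 x * dd s v (Sm.rep a) x
    rw [dd_congr h x.2, this, Sm.rep_apply, Sm.rep_apply]

theorem GoodSet.der_mk (hs : GoodSet s) (hf : ContDiffOn ℝ ∞ f s) :
    hs.der v (Sm.mk f hf) = Sm.mk (dd s v f) (hs.contDiffOn_dd hf) :=
  Sm.mk_eq (hf := hs.contDiffOn_dd (Sm.rep_smooth _)) (dd_congr (Sm.rep_mk hf))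

theorem GoodSet.der_comm (hs : GoodSet s) (g : Sm s) :
    hs.der v (hs.der w g) = hs.der w (hs.der v g) := by
  rw [← Sm.mk_rep g, hs.der_mk, hs.der_mk, hs.der_mk, hs.der_mk]
  exact Sm.mk_eq fun x hx => dd_comm hs (Sm.rep_smooth g) hx

end Smooth

theorem goodSet_ext {M : ℝ} (hM : 0 < M) : GoodSet (ext M) := by
  have hint : {x : Space | 2 * M < ‖x‖} ⊆ interior (ext M) :=
    interior_maximal (fun x (hx : 2 * M < ‖x‖) => hx.le) (isOpen_lt continuous_const continuous_norm)
  refine ⟨fun x hx => ?_, fun x hx => ?_⟩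
  · have hx' : 0 < ‖x‖ := lt_of_lt_of_le (by linarith) hx
    have hxx : (0 : ℝ) < inner ℝ x x := by rw [real_inner_self_eq_norm_sq]; positivity
    have hsub : {y : Space | inner ℝ x x ≤ inner ℝ x y} ⊆ ext M := fun y hy => by
      have h1 : ‖x‖ ^ 2 ≤ inner ℝ x y := by rw [← real_inner_self_eq_norm_sq]; exact hy
      have h2 := real_inner_le_norm x y
      have h3 : ‖x‖ ≤ ‖y‖ := by nlinarith
      exact le_trans hx h3
    refine UniqueDiffWithinAt.mono (uniqueDiffWithinAt_convex ?_ ?_ (subset_closure ?_)) hsub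
    · exact convex_halfSpace_ge (f := fun y => inner ℝ x y) ⟨fun a b => inner_add_right _ _ _,
        fun c a => by simp [inner_smul_right]⟩ _
    · refine ⟨(2 : ℝ) • x, interior_maximal (s := {y : Space | inner ℝ x x ≤ inner ℝ x y})
        (t := {y : Space | inner ℝ x x < inner ℝ x y}) (fun y hy => by simp only [Set.mem_ofPred_eq] at hy ⊢; exact hy.le) ?_ ?_⟩
      · exact isOpen_lt continuous_const (by fun_prop)
      · simp only [Set.mem_ofPred_eq, inner_smul_right]; linarith
    · exact le_refl (inner ℝ x x : ℝ)
  · refine closure_mono hint ?_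
    have hx' : 0 < ‖x‖ := lt_of_lt_of_le (by linarith) hx
    have h1 : Filter.Tendsto (fun a : ℝ => a • x) (nhdsWithin 1 (Set.Ioi 1)) (nhds x) := by
      have : Filter.Tendsto (fun a : ℝ => a • x) (nhds 1) (nhds ((1 : ℝ) • x)) :=
        (continuous_id.smul continuous_const).tendsto 1
      rw [one_smul] at this
      exact this.mono_left nhdsWithin_le_nhds
    refine mem_closure_of_tendsto h1 ?_
    filter_upwards [self_mem_nhdsWithin] with a (ha : 1 < a)
    have : 2 * M ≤ ‖x‖ := hx
    simp only [norm_smul, Real.norm_eq_abs, abs_of_pos (lt_trans one_pos ha)]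
    nlinarith

theorem future_eq (M t₀ : ℝ) : future M t₀ = Set.Ici t₀ ×ˢ ext M := rfl

theorem goodSet_future {M : ℝ} (hM : 0 < M) (t₀ : ℝ) : GoodSet (future M t₀) := by
  refine ⟨(uniqueDiffOn_Ici t₀).prod (goodSet_ext hM).unique, ?_⟩
  rw [future_eq, interior_prod_eq, closure_prod_eq]
  exact Set.prod_mono (by simp) (goodSet_ext hM).clos

end LinearisedGravity

end

noncomputable section

set_option linter.unusedSimpArgs false

namespace LinearisedGravity

open MeasureTheory

/-! ## The algebra of rotation fields -/

/-- The relations between the rotation fields `Ω = x × ∇` and the coordinates `y = x/|x|`. -/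
structure RotAlg {A : Type*} [CommRing A] [Algebra ℝ A] (Ω : Fin 3 → Derivation ℝ A A)
    (y : Fin 3 → A) : Prop where
  sq : y 0 * y 0 + y 1 * y 1 + y 2 * y 2 = 1
  y00 : Ω 0 (y 0) = 0
  y01 : Ω 0 (y 1) = -y 2
  y02 : Ω 0 (y 2) = y 1
  y10 : Ω 1 (y 0) = y 2
  y11 : Ω 1 (y 1) = 0
  y12 : Ω 1 (y 2) = -y 0
  y20 : Ω 2 (y 0) = -y 1
  y21 : Ω 2 (y 1) = y 0
  y22 : Ω 2 (y 2) = 0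
  c01 : ∀ f, Ω 1 (Ω 0 f) = Ω 0 (Ω 1 f) + Ω 2 f
  c12 : ∀ f, Ω 2 (Ω 1 f) = Ω 1 (Ω 2 f) + Ω 0 f
  c02 : ∀ f, Ω 2 (Ω 0 f) = Ω 0 (Ω 2 f) - Ω 1 f
  rad : ∀ f, y 0 * Ω 0 f + y 1 * Ω 1 f + y 2 * Ω 2 f = 0

namespace RotAlg

variable {A : Type*} [CommRing A] [Algebra ℝ A] {Ω : Fin 3 → Derivation ℝ A A} {y : Fin 3 → A}

/-- The Laplacian of the unit sphere. -/
def lap (Ω : Fin 3 → Derivation ℝ A A) (f : A) : A :=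
  Ω 0 (Ω 0 f) + Ω 1 (Ω 1 f) + Ω 2 (Ω 2 f)

theorem lap_add (f g : A) : lap Ω (f + g) = lap Ω f + lap Ω g := by
  simp only [lap, map_add]; ring

theorem lap_sub (f g : A) : lap Ω (f - g) = lap Ω f - lap Ω g := by
  simp only [lap, map_sub]; ring

theorem lap_neg (f : A) : lap Ω (-f) = -lap Ω f := by
  simp only [lap, map_neg]; ring

theorem lap_mul (f g : A) : lap Ω (f * g) = f * lap Ω g + g * lap Ω f
    + 2 * (Ω 0 f * Ω 0 g + Ω 1 f * Ω 1 g + Ω 2 f * Ω 2 g) := by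
  simp only [lap, map_add, Derivation.leibniz, smul_eq_mul]; ring

/-- The rescaled tangential gradient `r ∇̸`. -/
def del (Ω : Fin 3 → Derivation ℝ A A) (y : Fin 3 → A) : Fin 3 → Derivation ℝ A A :=
  ![y 2 • Ω 1 - y 1 • Ω 2, y 0 • Ω 2 - y 2 • Ω 0, y 1 • Ω 0 - y 0 • Ω 1]

theorem del_zero (f : A) : del Ω y 0 f = y 2 * Ω 1 f - y 1 * Ω 2 f := rfl
theorem del_one (f : A) : del Ω y 1 f = y 0 * Ω 2 f - y 2 * Ω 0 f := rfl
theorem del_two (f : A) : del Ω y 2 f = y 1 * Ω 0 f - y 0 * Ω 1 f := rfl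

variable (h : RotAlg Ω y)
include h

theorem lap_y (c : Fin 3) : lap Ω (y c) = -2 * y c := by
  fin_cases c <;> simp [lap, h.y00, h.y01, h.y02, h.y10, h.y11, h.y12, h.y20, h.y21, h.y22] <;> ring

theorem lap_rot (c : Fin 3) (f : A) : lap Ω (Ω c f) = Ω c (lap Ω f) := by
  fin_cases c <;> simp [lap, h.c01, h.c12, h.c02] <;> ring

omit h in
theorem y_del (f : A) : y 0 * del Ω y 0 f + y 1 * del Ω y 1 f + y 2 * del Ω y 2 f = 0 := by
  simp only [del_zero, del_one, del_two]; ring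

theorem del_y (a b : Fin 3) : del Ω y a (y b) = (if a = b then 1 else 0) - y a * y b := by
  have := h.sq
  fin_cases a <;> fin_cases b <;>
    simp [del_zero, del_one, del_two, h.y00, h.y01, h.y02, h.y10, h.y11, h.y12, h.y20, h.y21, h.y22] <;>
    first | linear_combination this | linear_combination -this | ring

theorem rot_eq (f : A) : Ω 0 f = y 1 * del Ω y 2 f - y 2 * del Ω y 1 f ∧
    Ω 1 f = y 2 * del Ω y 0 f - y 0 * del Ω y 2 f ∧
    Ω 2 f = y 0 * del Ω y 1 f - y 1 * del Ω y 0 f := by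
  have h1 := h.sq
  have h2 := h.rad f
  simp only [del_zero, del_one, del_two]
  refine ⟨?_, ?_, ?_⟩
  · linear_combination (-Ω 0 f) * h1 + y 0 * h2
  · linear_combination (-Ω 1 f) * h1 + y 1 * h2
  · linear_combination (-Ω 2 f) * h1 + y 2 * h2

theorem rot_del (f : A) :
    Ω 0 (del Ω y 0 f) + Ω 1 (del Ω y 1 f) + Ω 2 (del Ω y 2 f) = 0 := by
  have h2 := h.rad f
  simp only [del_zero, del_one, del_two, map_sub, Derivation.leibniz, smul_eq_mul,
    h.y00, h.y01, h.y02, h.y10, h.y11, h.y12, h.y20, h.y21, h.y22, h.c01, h.c12, h.c02]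
  linear_combination h2

theorem del_rot (f : A) :
    del Ω y 0 (Ω 0 f) + del Ω y 1 (Ω 1 f) + del Ω y 2 (Ω 2 f) = 0 := by
  have h2 := h.rad f
  simp only [del_zero, del_one, del_two, h.c01, h.c12, h.c02]
  linear_combination h2

theorem sum_del_mul_del (f g : A) :
    del Ω y 0 f * del Ω y 0 g + del Ω y 1 f * del Ω y 1 g + del Ω y 2 f * del Ω y 2 g =
      Ω 0 f * Ω 0 g + Ω 1 f * Ω 1 g + Ω 2 f * Ω 2 g := by
  have h1 := h.sq
  have h2 := h.rad f
  simp only [del_zero, del_one, del_two]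
  linear_combination (Ω 0 f * Ω 0 g + Ω 1 f * Ω 1 g + Ω 2 f * Ω 2 g) * h1 -
    (y 0 * Ω 0 g + y 1 * Ω 1 g + y 2 * Ω 2 g) * h2

theorem lap_eq_del (f : A) :
    del Ω y 0 (del Ω y 0 f) + del Ω y 1 (del Ω y 1 f) + del Ω y 2 (del Ω y 2 f) = lap Ω f := by
  have h1 := h.sq
  have r0 := congrArg (Ω 0) (h.rad f)
  have r1 := congrArg (Ω 1) (h.rad f)
  have r2 := congrArg (Ω 2) (h.rad f)
  have h2 := h.rad f
  simp only [del_zero, del_one, del_two, map_sub, map_add, map_zero, Derivation.leibniz,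
    smul_eq_mul, lap, h.y00, h.y01, h.y02, h.y10, h.y11, h.y12, h.y20, h.y21, h.y22,
    h.c01, h.c12, h.c02] at r0 r1 r2 ⊢
  linear_combination (Ω 0 (Ω 0 f) + Ω 1 (Ω 1 f) + Ω 2 (Ω 2 f)) * h1 - y 0 * r0 - y 1 * r1 - y 2 * r2

theorem lap_del (c : Fin 3) (f : A) :
    lap Ω (del Ω y c f) = del Ω y c (lap Ω f) - 2 * y c * lap Ω f := by
  have l0 := h.lap_rot 0 f
  have l1 := h.lap_rot 1 f
  have l2 := h.lap_rot 2 f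
  have r0 := congrArg (Ω 0) (h.rad f)
  have r1 := congrArg (Ω 1) (h.rad f)
  have r2 := congrArg (Ω 2) (h.rad f)
  have e : ∀ f, lap Ω f = Ω 0 (Ω 0 f) + Ω 1 (Ω 1 f) + Ω 2 (Ω 2 f) := fun _ => rfl
  have e0 := e f
  simp only [map_add, map_zero, Derivation.leibniz,
    smul_eq_mul, h.y00, h.y01, h.y02, h.y10, h.y11, h.y12, h.y20, h.y21, h.y22,
    h.c01, h.c12, h.c02] at r0 r1 r2
  fin_cases c <;>
    simp only [Fin.zero_eta, Fin.mk_one, Fin.reduceFinMk, del_zero, del_one, del_two, lap_sub,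
      lap_mul, h.lap_y, h.y00, h.y01, h.y02, h.y10, h.y11, h.y12, h.y20, h.y21, h.y22,
      h.c01, h.c12, h.c02, l0, l1, l2]
  · linear_combination 2 * r0 + 2 * y 0 * e0
  · linear_combination 2 * r1 + 2 * y 1 * e0
  · linear_combination 2 * r2 + 2 * y 2 * e0

theorem del_comm (a b : Fin 3) (f : A) :
    del Ω y a (del Ω y b f) = del Ω y b (del Ω y a f) + y a * del Ω y b f - y b * del Ω y a f := by
  have h1 := h.sq
  have h2 := h.rad f
  fin_cases a <;> fin_cases b <;>
    simp only [Fin.zero_eta, Fin.mk_one, Fin.reduceFinMk, del_zero, del_one, del_two, map_sub,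
      Derivation.leibniz, smul_eq_mul, h.y00, h.y01, h.y02, h.y10, h.y11, h.y12, h.y20, h.y21,
      h.y22, h.c01, h.c12, h.c02] <;> try ring
  · linear_combination y 2 * h2
  · linear_combination -y 1 * h2
  · linear_combination -y 2 * h2
  · linear_combination y 0 * h2
  · linear_combination y 1 * h2
  · linear_combination -y 0 * h2

omit [Algebra ℝ A] h in
theorem sq_tracefree_part (B : Fin 3 → Fin 3 → A) (u : Fin 3 → A) (L : A)
    (hy : y 0 * y 0 + y 1 * y 1 + y 2 * y 2 = 1)
    (h1 : ∀ b, y 0 * B 0 b + y 1 * B 1 b + y 2 * B 2 b = 0)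
    (h2 : ∀ a, y 0 * B a 0 + y 1 * B a 1 + y 2 * B a 2 = -u a)
    (hu : y 0 * u 0 + y 1 * u 1 + y 2 * u 2 = 0) (ht : B 0 0 + B 1 1 + B 2 2 = L) :
    2 * (2 * (∑ a, ∑ b, B a b * B a b) - 2 * (∑ a, u a * u a) - L * L)
      = ∑ a, ∑ b, (2 * (B a b + y b * u a) - ((if a = b then 1 else 0) - y a * y b) * L) *
        (2 * (B a b + y b * u a) - ((if a = b then 1 else 0) - y a * y b) * L) := by
  have e1 : ∑ a, ∑ b, (B a b + y b * u a) * (B a b + y b * u a) =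
      (∑ a, ∑ b, B a b * B a b) - ∑ a, u a * u a := by
    simp only [Fin.sum_univ_three]
    linear_combination 2 * u 0 * h2 0 + 2 * u 1 * h2 1 + 2 * u 2 * h2 2 +
      (u 0 * u 0 + u 1 * u 1 + u 2 * u 2) * hy
  have e2 : ∑ a, ∑ b, (B a b + y b * u a) * ((if a = b then 1 else 0) - y a * y b) = L := by
    simp only [Fin.sum_univ_three]
    simp
    linear_combination ht - y 0 * h1 0 - y 1 * h1 1 - y 2 * h1 2 +
      (1 - (y 0 * y 0 + y 1 * y 1 + y 2 * y 2)) * hu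
  have e3 : ∑ a, ∑ b, ((if a = b then 1 else 0) - y a * y b) *
      ((if a = b then 1 else 0) - y a * y b) = (2 : A) := by
    simp only [Fin.sum_univ_three]
    simp
    linear_combination (y 0 * y 0 + y 1 * y 1 + y 2 * y 2 - 1) * hy
  have e4 : ∑ a, ∑ b, (2 * (B a b + y b * u a) - ((if a = b then 1 else 0) - y a * y b) * L) *
        (2 * (B a b + y b * u a) - ((if a = b then 1 else 0) - y a * y b) * L) =
      4 * (∑ a, ∑ b, (B a b + y b * u a) * (B a b + y b * u a)) - 4 * L *
        (∑ a, ∑ b, (B a b + y b * u a) * ((if a = b then 1 else 0) - y a * y b)) +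
      L * L * ∑ a, ∑ b, ((if a = b then 1 else 0) - y a * y b) *
      ((if a = b then 1 else 0) - y a * y b) := by
    simp only [Finset.mul_sum, ← Finset.sum_sub_distrib, ← Finset.sum_add_distrib]
    exact Finset.sum_congr rfl fun a _ => Finset.sum_congr rfl fun b _ => by ring
  rw [e4, e1, e2, e3]; ring

/-- The Bochner inequality in algebraic form: the difference is a sum of squares. -/
theorem bochner (f : A) : ∃ C : Fin 3 → Fin 3 → A,
    2 * (2 * (∑ a, ∑ b, Ω a (Ω b f) * Ω a (Ω b f)) - 2 * (∑ a, Ω a f * Ω a f)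
      - lap Ω f * lap Ω f) = ∑ a, ∑ b, C a b * C a b := by
  have hs := h.sq
  have hf := h.rad f
  have r0 := congrArg (Ω 0) hf
  have r1 := congrArg (Ω 1) hf
  have r2 := congrArg (Ω 2) hf
  simp only [map_add, map_zero, Derivation.leibniz, smul_eq_mul, h.y00, h.y01, h.y02, h.y10,
    h.y11, h.y12, h.y20, h.y21, h.y22] at r0 r1 r2
  set u : Fin 3 → A := ![-y 2 * Ω 1 f + y 1 * Ω 2 f, y 2 * Ω 0 f - y 0 * Ω 2 f,
    -y 1 * Ω 0 f + y 0 * Ω 1 f] with hu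
  have u0 : u 0 = -y 2 * Ω 1 f + y 1 * Ω 2 f := rfl
  have u1 : u 1 = y 2 * Ω 0 f - y 0 * Ω 2 f := rfl
  have u2 : u 2 = -y 1 * Ω 0 f + y 0 * Ω 1 f := rfl
  have key := sq_tracefree_part (y := y) (fun a b => Ω a (Ω b f)) u (lap Ω f) hs
    (fun b => h.rad _) (fun a => by
      fin_cases a <;> simp only [Fin.zero_eta, Fin.mk_one, Fin.reduceFinMk, u0, u1, u2]
      · linear_combination r0
      · linear_combination r1
      · linear_combination r2) (by rw [u0, u1, u2]; ring) rfl
  have hu2 : ∑ a, u a * u a = ∑ a, Ω a f * Ω a f := by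
    simp only [Fin.sum_univ_three, u0, u1, u2]
    linear_combination (Ω 0 f * Ω 0 f + Ω 1 f * Ω 1 f + Ω 2 f * Ω 2 f) * hs -
      (y 0 * Ω 0 f + y 1 * Ω 1 f + y 2 * Ω 2 f) * hf
  rw [hu2] at key
  exact ⟨_, key⟩

/-- The divergence of the rescaled symmetrised traceless derivative of a tangential field. -/
theorem div_sym (ζ : Fin 3 → A) (hζ : y 0 * ζ 0 + y 1 * ζ 1 + y 2 * ζ 2 = 0) (c : Fin 3) :
    ∑ a, del Ω y a (del Ω y a (ζ c) + y c * ζ a + (del Ω y c (ζ a) + y a * ζ c)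
      - ((if a = c then 1 else 0) - y a * y c) * ∑ b, del Ω y b (ζ b)) =
    lap Ω (ζ c) + 2 * ζ c + 2 * y c * ∑ b, del Ω y b (ζ b) := by
  set S := ∑ b, del Ω y b (ζ b) with hS
  have hs := h.sq
  have hd := congrArg (del Ω y c) hζ
  have hl := h.lap_eq_del (ζ c)
  have hr := y_del (Ω := Ω) (y := y) (ζ c)
  have hrS := y_del (Ω := Ω) (y := y) S
  have h0 := h.del_comm 0 c (ζ 0)
  have h1 := h.del_comm 1 c (ζ 1)
  have h2 := h.del_comm 2 c (ζ 2)
  have hc := congrArg (del Ω y c) hS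
  simp only [Fin.sum_univ_three, map_add, map_zero, map_sub, Derivation.leibniz, smul_eq_mul,
    h.del_y] at hd hc hS ⊢
  have hone : ∀ a, del Ω y a (1 : A) = 0 := fun a => by simp
  fin_cases c <;>
    simp only [Fin.zero_eta, Fin.mk_one, Fin.reduceFinMk, Fin.isValue, if_true, Fin.reduceEq,
      if_false, zero_ne_one, one_ne_zero, map_zero, hone] at hd hc hS h0 h1 h2 hl hr hrS ⊢
  · linear_combination hl + h0 + h1 + h2 - hc + hd + hr + y 0 * hrS - ζ 0 * hs - 2 * y 0 * S * hs
  · linear_combination hl + h0 + h1 + h2 - hc + hd + hr + y 1 * hrS - ζ 1 * hs - 2 * y 1 * S * hs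
  · linear_combination hl + h0 + h1 + h2 - hc + hd + hr + y 2 * hrS - ζ 2 * hs - 2 * y 2 * S * hs

end RotAlg

end LinearisedGravity

end

noncomputable section

set_option linter.unusedSimpArgs false

namespace LinearisedGravity

open MeasureTheory

/-! ## Coordinates and rotation fields on the exterior region -/

section Coordinates

variable {M : ℝ} (hM : 0 < M)

theorem norm_pos_of_mem_ext {M : ℝ} (hM : 0 < M) {x : Space} (hx : x ∈ ext M) : 0 < ‖x‖ :=
  lt_of_lt_of_le (by linarith) (show 2 * M ≤ ‖x‖ from hx)

theorem ext_nonempty (M : ℝ) : Nonempty (ext M) := by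
  refine ⟨⟨EuclideanSpace.single 0 (2 * M), ?_⟩⟩
  change 2 * M ≤ ‖_‖
  simpa using le_abs_self (2 * M)

instance : Nontrivial (Sm (ext M)) :=
  ⟨0, 1, fun h => by
    obtain ⟨x⟩ := ext_nonempty M
    exact zero_ne_one (congrFun (congrArg Subtype.val h) x)⟩

instance : CharZero (Sm (ext M)) :=
  charZero_of_injective_algebraMap (algebraMap ℝ (Sm (ext M))).injective

/-- Partial derivatives on `Σ`. -/
def ds (M : ℝ) (i : Fin 3) : (Space → ℝ) → Space → ℝ := dd (ext M) (EuclideanSpace.single i 1)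

/-- Partial derivatives as derivations. -/
def dS (i : Fin 3) : Derivation ℝ (Sm (ext M)) (Sm (ext M)) :=
  (goodSet_ext hM).der (EuclideanSpace.single i 1)

theorem dS_mk_apply {f : Space → ℝ} (hf : ContDiffOn ℝ ∞ f (ext M)) (i : Fin 3) (x : ext M) :
    (dS hM i (Sm.mk f hf)).1 x = ds M i f x := by
  rw [dS, GoodSet.der_mk]; rfl

theorem dS_comm (i j : Fin 3) (f : Sm (ext M)) : dS hM i (dS hM j f) = dS hM j (dS hM i f) :=
  (goodSet_ext hM).der_comm f

theorem contDiff_coord (i : Fin 3) : ContDiff ℝ ∞ (fun x : Space => x i) :=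
  (EuclideanSpace.proj (𝕜 := ℝ) i).contDiff

include hM in
theorem contDiffOn_norm_ext : ContDiffOn ℝ ∞ (fun x : Space => ‖x‖) (ext M) := fun _ hx =>
  (contDiffAt_norm ℝ (norm_pos_iff.1 (norm_pos_of_mem_ext hM hx))).contDiffWithinAt

include hM in
theorem contDiffOn_norm_rpow (p : ℝ) : ContDiffOn ℝ ∞ (fun x : Space => ‖x‖ ^ p) (ext M) :=
  (contDiffOn_norm_ext hM).rpow_const_of_ne fun _ hx => (norm_pos_of_mem_ext hM hx).ne'

include hM in
theorem contDiffOn_norm_inv : ContDiffOn ℝ ∞ (fun x : Space => ‖x‖⁻¹) (ext M) :=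
  (contDiffOn_norm_ext hM).inv fun _ hx => (norm_pos_of_mem_ext hM hx).ne'

/-- The coordinate functions. -/
def XS (M : ℝ) (i : Fin 3) : Sm (ext M) := Sm.mk (fun x => x i) (contDiff_coord i).contDiffOn

/-- The function `r`. -/
def rS : Sm (ext M) := Sm.mk (fun x => ‖x‖) (contDiffOn_norm_ext hM)

/-- The function `1/r`. -/
def qS : Sm (ext M) := Sm.mk (fun x => ‖x‖⁻¹) (contDiffOn_norm_inv hM)

/-- The functions `x/|x|`. -/
def yS (i : Fin 3) : Sm (ext M) := XS M i * qS hM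

@[simp] theorem XS_apply (i : Fin 3) (x : ext M) : (XS M i).1 x = x.1 i := rfl
@[simp] theorem rS_apply (x : ext M) : (rS hM).1 x = ‖x.1‖ := rfl
@[simp] theorem qS_apply (x : ext M) : (qS hM).1 x = ‖x.1‖⁻¹ := rfl
@[simp] theorem yS_apply (i : Fin 3) (x : ext M) : (yS hM i).1 x = xhat x.1 i := rfl

theorem norm_sq_eq (x : Space) : ‖x‖ * ‖x‖ = x 0 * x 0 + x 1 * x 1 + x 2 * x 2 := by
  have h := EuclideanSpace.real_norm_sq_eq x
  rw [Fin.sum_univ_three] at h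
  linear_combination h

theorem rS_sq : rS hM * rS hM = XS M 0 * XS M 0 + XS M 1 * XS M 1 + XS M 2 * XS M 2 :=
  Sm.ext' fun x => norm_sq_eq x.1

theorem rS_qS : rS hM * qS hM = 1 :=
  Sm.ext' fun x => mul_inv_cancel₀ (norm_pos_of_mem_ext hM x.2).ne'

theorem dS_XS (i j : Fin 3) : dS hM i (XS M j) = if i = j then 1 else 0 := by
  refine Sm.ext' fun x => ?_
  rw [XS, dS_mk_apply, ds, dd]
  rw [show (fun y : Space => y j) = ⇑(EuclideanSpace.proj (𝕜 := ℝ) j) from rfl,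
    ContinuousLinearMap.fderivWithin _ ((goodSet_ext hM).unique x x.2)]
  by_cases h : i = j
  · subst h; simp
  · have : j ≠ i := fun h' => h h'.symm
    simp [h, this]

theorem dS_rS (i : Fin 3) : dS hM i (rS hM) = XS M i * qS hM := by
  have h := congrArg (dS hM i) (rS_sq hM)
  have h1 := rS_qS hM
  have h2 : (2 : Sm (ext M)) * rS hM * dS hM i (rS hM) = 2 * XS M i := by
    simp only [Derivation.leibniz, map_add, smul_eq_mul, dS_XS] at h
    fin_cases i <;> simp at h ⊢ <;> linear_combination h
  have h3 : (algebraMap ℝ (Sm (ext M)) (1 / 2)) * 2 = 1 := by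
    rw [← map_ofNat (algebraMap ℝ (Sm (ext M))) 2, ← map_mul]; norm_num
  linear_combination (algebraMap ℝ (Sm (ext M)) (1 / 2)) * qS hM * h2 - dS hM i (rS hM) * h1 +
    (XS M i * qS hM - rS hM * qS hM * dS hM i (rS hM)) * h3

theorem dS_qS (i : Fin 3) : dS hM i (qS hM) = -(XS M i * (qS hM * qS hM * qS hM)) := by
  have h := congrArg (dS hM i) (rS_qS hM)
  have h1 := rS_qS hM
  simp only [Derivation.leibniz, smul_eq_mul, dS_rS, Derivation.map_one_eq_zero] at h
  linear_combination qS hM * h - dS hM i (qS hM) * h1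

/-- The rotation fields `x × ∇`. -/
def rot : Fin 3 → Derivation ℝ (Sm (ext M)) (Sm (ext M)) :=
  ![XS M 1 • dS hM 2 - XS M 2 • dS hM 1, XS M 2 • dS hM 0 - XS M 0 • dS hM 2,
    XS M 0 • dS hM 1 - XS M 1 • dS hM 0]

theorem rot_zero (f : Sm (ext M)) : rot hM 0 f = XS M 1 * dS hM 2 f - XS M 2 * dS hM 1 f := rfl
theorem rot_one (f : Sm (ext M)) : rot hM 1 f = XS M 2 * dS hM 0 f - XS M 0 * dS hM 2 f := rfl
theorem rot_two (f : Sm (ext M)) : rot hM 2 f = XS M 0 * dS hM 1 f - XS M 1 * dS hM 0 f := rfl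

/-- The Euler field `x · ∇ = r ∂_r`. -/
def euler : Derivation ℝ (Sm (ext M)) (Sm (ext M)) :=
  XS M 0 • dS hM 0 + XS M 1 • dS hM 1 + XS M 2 • dS hM 2

theorem euler_apply (f : Sm (ext M)) :
    euler hM f = XS M 0 * dS hM 0 f + XS M 1 * dS hM 1 f + XS M 2 * dS hM 2 f := rfl

theorem qS_sq : qS hM * qS hM * (XS M 0 * XS M 0 + XS M 1 * XS M 1 + XS M 2 * XS M 2) = 1 := by
  rw [← rS_sq hM]; linear_combination (rS hM * qS hM + 1) * rS_qS hM

theorem rot_qS (i : Fin 3) : rot hM i (qS hM) = 0 := by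
  fin_cases i <;> simp [rot_zero, rot_one, rot_two, dS_qS] <;> ring

theorem rotAlg : RotAlg (rot hM) (yS hM) where
  sq := by simp only [yS]; linear_combination qS_sq hM
  y00 := by simp only [yS, Derivation.leibniz, smul_eq_mul, rot_qS]; simp [rot_zero, dS_XS]
  y01 := by simp only [yS, Derivation.leibniz, smul_eq_mul, rot_qS]; simp [rot_zero, dS_XS]; ring
  y02 := by simp only [yS, Derivation.leibniz, smul_eq_mul, rot_qS]; simp [rot_zero, dS_XS]; ring
  y10 := by simp only [yS, Derivation.leibniz, smul_eq_mul, rot_qS]; simp [rot_one, dS_XS]; ring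
  y11 := by simp only [yS, Derivation.leibniz, smul_eq_mul, rot_qS]; simp [rot_one, dS_XS]
  y12 := by simp only [yS, Derivation.leibniz, smul_eq_mul, rot_qS]; simp [rot_one, dS_XS]; ring
  y20 := by simp only [yS, Derivation.leibniz, smul_eq_mul, rot_qS]; simp [rot_two, dS_XS]; ring
  y21 := by simp only [yS, Derivation.leibniz, smul_eq_mul, rot_qS]; simp [rot_two, dS_XS]; ring
  y22 := by simp only [yS, Derivation.leibniz, smul_eq_mul, rot_qS]; simp [rot_two, dS_XS]
  c01 f := by
    simp only [rot_zero, rot_one, rot_two, map_sub, Derivation.leibniz, smul_eq_mul, dS_XS,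
      dS_comm hM 1 0, dS_comm hM 2 0, dS_comm hM 2 1]; simp; ring
  c12 f := by
    simp only [rot_zero, rot_one, rot_two, map_sub, Derivation.leibniz, smul_eq_mul, dS_XS,
      dS_comm hM 1 0, dS_comm hM 2 0, dS_comm hM 2 1]; simp; ring
  c02 f := by
    simp only [rot_zero, rot_one, rot_two, map_sub, Derivation.leibniz, smul_eq_mul, dS_XS,
      dS_comm hM 1 0, dS_comm hM 2 0, dS_comm hM 2 1]; simp; ring
  rad f := by simp only [rot_zero, rot_one, rot_two, yS]; ring

theorem rot_euler (i : Fin 3) (f : Sm (ext M)) :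
    rot hM i (euler hM f) = euler hM (rot hM i f) := by
  fin_cases i <;>
    simp only [Fin.zero_eta, Fin.mk_one, Fin.reduceFinMk, rot_zero, rot_one, rot_two, euler_apply,
      map_sub, map_add, Derivation.leibniz, smul_eq_mul, dS_XS,
      dS_comm hM 1 0, dS_comm hM 2 0, dS_comm hM 2 1] <;> simp <;> ring

theorem lap_euler (f : Sm (ext M)) :
    RotAlg.lap (rot hM) (euler hM f) = euler hM (RotAlg.lap (rot hM) f) := by
  simp only [RotAlg.lap, rot_euler, map_add]

theorem euler_qS : euler hM (qS hM) = -qS hM := by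
  simp only [euler_apply, dS_qS]; linear_combination (-qS hM) * qS_sq hM

theorem euler_yS (i : Fin 3) : euler hM (yS hM i) = 0 := by
  simp only [yS, Derivation.leibniz, smul_eq_mul, euler_qS]
  fin_cases i <;> simp [euler_apply, dS_XS] <;> ring

/-- Cartesian derivatives in terms of the Euler and the rotation fields. -/
theorem dS_eq (f : Sm (ext M)) :
    dS hM 0 f = qS hM * (yS hM 0 * euler hM f + (rot hM 1 f * yS hM 2 - rot hM 2 f * yS hM 1)) ∧
    dS hM 1 f = qS hM * (yS hM 1 * euler hM f + (rot hM 2 f * yS hM 0 - rot hM 0 f * yS hM 2)) ∧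
    dS hM 2 f = qS hM * (yS hM 2 * euler hM f + (rot hM 0 f * yS hM 1 - rot hM 1 f * yS hM 0)) := by
  have h := qS_sq hM
  simp only [euler_apply, rot_zero, rot_one, rot_two, yS]
  refine ⟨?_, ?_, ?_⟩
  · linear_combination (-dS hM 0 f) * h
  · linear_combination (-dS hM 1 f) * h
  · linear_combination (-dS hM 2 f) * h

/-- The tangential derivative in terms of Cartesian derivatives. -/
theorem del_eq (i : Fin 3) (f : Sm (ext M)) : RotAlg.del (rot hM) (yS hM) i f =
    rS hM * ∑ j, ((if i = j then 1 else 0) - yS hM i * yS hM j) * dS hM j f := by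
  have h := qS_sq hM
  have h1 := rS_qS hM
  have h2 : rS hM * (qS hM * qS hM) = qS hM := by linear_combination qS hM * h1
  have h3 : rS hM = qS hM * (XS M 0 * XS M 0 + XS M 1 * XS M 1 + XS M 2 * XS M 2) := by
    linear_combination (-rS hM) * h + qS hM * (XS M 0 * XS M 0 + XS M 1 * XS M 1 + XS M 2 * XS M 2) * h1
  fin_cases i <;> simp only [Fin.zero_eta, Fin.mk_one, Fin.reduceFinMk, RotAlg.del_zero,
    RotAlg.del_one, RotAlg.del_two, Fin.sum_univ_three, rot_zero, rot_one, rot_two, yS] <;> simp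
  · linear_combination (-dS hM 0 f) * h3 + (XS M 0 * (XS M 0 * dS hM 0 f + XS M 1 * dS hM 1 f + XS M 2 * dS hM 2 f)) * h2
  · linear_combination (-dS hM 1 f) * h3 + (XS M 1 * (XS M 0 * dS hM 0 f + XS M 1 * dS hM 1 f + XS M 2 * dS hM 2 f)) * h2
  · linear_combination (-dS hM 2 f) * h3 + (XS M 2 * (XS M 0 * dS hM 0 f + XS M 1 * dS hM 1 f + XS M 2 * dS hM 2 f)) * h2

end Coordinates

end LinearisedGravity

end

noncomputable section

set_option linter.unusedSimpArgs false

namespace LinearisedGravity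

open MeasureTheory

/-! ## Differentiation under the integral sign over a compact space -/

section ParamIntegral

variable {Y : Type*} [TopologicalSpace Y] [CompactSpace Y] [MeasurableSpace Y] [BorelSpace Y]
  {μ : Measure Y} [IsFiniteMeasure μ] {V : Type*} [NormedAddCommGroup V] [NormedSpace ℝ V]

theorem integrable_of_continuous {W : Type*} [NormedAddCommGroup W] [SecondCountableTopologyEither Y W] {f : Y → W} (hf : Continuous f) :
    Integrable f μ :=
  hf.integrable_of_hasCompactSupport (HasCompactSupport.of_compactSpace f)

theorem hasFDerivWithinAt_integral_of_continuousOn [SecondCountableTopology Y] {Q : Set V} (hQ : Convex ℝ Q) {G : V → Y → ℝ}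
    {G' : V → Y → V →L[ℝ] ℝ}
    (hG : ∀ τ ∈ Q, ∀ y, HasFDerivWithinAt (fun τ => G τ y) (G' τ y) Q τ)
    (hc : ContinuousOn (fun p : V × Y => G' p.1 p.2) (Q ×ˢ Set.univ))
    (hGc : ∀ τ ∈ Q, Continuous (G τ)) {τ : V} (hτ : τ ∈ Q) :
    HasFDerivWithinAt (fun τ => ∫ y, G τ y ∂μ) (∫ y, G' τ y ∂μ) Q τ := by
  have hG'c : Continuous (G' τ) := by
    have : ContinuousOn (fun y : Y => G' τ y) Set.univ :=
      hc.comp (f := fun y : Y => (τ, y)) (by fun_prop) fun y _ => ⟨hτ, trivial⟩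
    exact continuousOn_univ.1 this
  refine HasFDerivWithinAt.of_isLittleO (Asymptotics.isLittleO_iff.2 fun ε hε => ?_)
  set m := μ.real Set.univ with hm
  have hm0 : 0 ≤ m := measureReal_nonneg
  set e := ε / (m + 1) with he
  have he0 : 0 < e := by positivity
  have h1 : ∀ᶠ τ' in nhds τ, ∀ y ∈ (Set.univ : Set Y), τ' ∈ Q → ‖G' τ' y - G' τ y‖ ≤ e := by
    refine isCompact_univ.eventually_forall_of_forall_eventually
      (P := fun τ' y => τ' ∈ Q → ‖G' τ' y - G' τ y‖ ≤ e) fun y _ => ?_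
    have h2 : ContinuousWithinAt (fun p : V × Y => ‖G' p.1 p.2 - G' τ p.2‖) (Q ×ˢ Set.univ) (τ, y) :=
      ((hc (τ, y) ⟨hτ, trivial⟩).sub (hG'c.comp continuous_snd).continuousWithinAt).norm
    have h3 : ∀ᶠ p in nhdsWithin (τ, y) (Q ×ˢ Set.univ), ‖G' p.1 p.2 - G' τ p.2‖ < e :=
      h2.eventually (gt_mem_nhds (by simpa using he0))
    rw [eventually_nhdsWithin_iff] at h3
    filter_upwards [h3] with p hp hpQ
    exact (hp ⟨hpQ, trivial⟩).le
  obtain ⟨δ, hδ, hb⟩ := Metric.eventually_nhds_iff_ball.1 h1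
  filter_upwards [inter_mem_nhdsWithin Q (Metric.ball_mem_nhds τ hδ)] with τ' hτ'
  have hi : ∀ σ ∈ Q, Integrable (G σ) μ := fun σ hσ => integrable_of_continuous (hGc σ hσ)
  have hi' : Integrable (fun y => G' τ y (τ' - τ)) μ :=
    integrable_of_continuous (hG'c.clm_apply continuous_const)
  have e1 : (∫ y, G τ' y ∂μ) - (∫ y, G τ y ∂μ) - (∫ y, G' τ y ∂μ) (τ' - τ) =
      ∫ y, (G τ' y - G τ y - G' τ y (τ' - τ)) ∂μ := by
    rw [integral_sub (f := fun y => G τ' y - G τ y) ((hi τ' hτ'.1).sub (hi τ hτ)) hi', integral_sub (hi τ' hτ'.1) (hi τ hτ),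
      ContinuousLinearMap.integral_apply (integrable_of_continuous hG'c)]
  rw [e1]
  have h4 : ∀ y, ‖G τ' y - G τ y - G' τ y (τ' - τ)‖ ≤ e * ‖τ' - τ‖ := fun y =>
    (hQ.inter (convex_ball τ δ)).norm_image_sub_le_of_norm_hasFDerivWithin_le'
      (f := fun σ => G σ y) (f' := fun σ => G' σ y)
      (fun σ hσ => (hG σ hσ.1 y).mono Set.inter_subset_left)
      (fun σ hσ => hb σ hσ.2 y trivial hσ.1) ⟨hτ, Metric.mem_ball_self hδ⟩ hτ'
  refine (norm_integral_le_of_norm_le_const (Filter.Eventually.of_forall h4)).trans ?_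
  have : e * (m + 1) = ε := by rw [he]; field_simp
  have h5 := norm_nonneg (τ' - τ)
  rw [← hm, ← this]
  nlinarith

theorem hasFDerivWithinAt_integral_comp [SecondCountableTopology Y] {E : Type*} [NormedAddCommGroup E]
    [NormedSpace ℝ E] {s : Set E} (hs : GoodSet s) {f : E → ℝ} (hf : ContDiffOn ℝ ∞ f s)
    {Q : Set V} (hQ : Convex ℝ Q) {c : V → Y → E} {c' : V → Y → V →L[ℝ] E}
    (hc : ∀ τ ∈ Q, ∀ y, HasFDerivWithinAt (fun τ => c τ y) (c' τ y) Q τ)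
    (hm : ∀ τ ∈ Q, ∀ y, c τ y ∈ s) (h1 : Continuous (fun p : V × Y => c p.1 p.2))
    (h2 : Continuous (fun p : V × Y => c' p.1 p.2)) {τ : V} (hτ : τ ∈ Q) :
    HasFDerivWithinAt (fun τ => ∫ y, f (c τ y) ∂μ)
      (∫ y, (fderivWithin ℝ f s (c τ y)).comp (c' τ y) ∂μ) Q τ := by
  refine hasFDerivWithinAt_integral_of_continuousOn hQ
    (G := fun τ y => f (c τ y)) (G' := fun τ y => (fderivWithin ℝ f s (c τ y)).comp (c' τ y))
    (fun σ hσ y => ?_) ?_ (fun σ hσ => ?_) hτ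
  · exact ((hf.differentiableOn (by simp) _ (hm σ hσ y)).hasFDerivWithinAt).comp σ (hc σ hσ y)
      fun σ' hσ' => hm σ' hσ' y
  · have h3 : ContinuousOn (fderivWithin ℝ f s) s := hf.continuousOn_fderivWithin hs.unique (by simp)
    exact (h3.comp h1.continuousOn fun p hp => hm p.1 hp.1 p.2).clm_comp h2.continuousOn
  · have : ContinuousOn (fun y => f (c σ y)) Set.univ :=
      hf.continuousOn.comp (h1.comp (Continuous.prodMk_right σ)).continuousOn fun y _ => hm σ hσ y
    exact continuousOn_univ.1 this

end ParamIntegral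

/-! ## Rotation invariance of the surface measure -/

abbrev Sph := Metric.sphere (0 : Space) 1

/-- The surface measure of the unit sphere. -/
abbrev sphMeas : Measure Sph := (volume : Measure Space).toSphere

/-- The action of an isometry on the unit sphere. -/
def sphMap (T : Space ≃ₗᵢ[ℝ] Space) (y : Sph) : Sph := ⟨T y, by simp⟩

theorem continuous_sphMap (T : Space ≃ₗᵢ[ℝ] Space) : Continuous (sphMap T) :=
  Continuous.subtype_mk (T.continuous.comp continuous_subtype_val) _

open scoped Pointwise in
theorem map_sphMap (T : Space ≃ₗᵢ[ℝ] Space) : Measure.map (sphMap T) sphMeas = sphMeas := by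
  refine Measure.ext fun s hs => ?_
  have hm : Measurable (sphMap T) := (continuous_sphMap T).measurable
  rw [Measure.map_apply hm hs, Measure.toSphere_apply' _ hs, Measure.toSphere_apply' _ (hm hs)]
  congr 1
  have h1 : Set.Ioo (0 : ℝ) 1 • (Subtype.val '' (sphMap T ⁻¹' s)) =
      T ⁻¹' (Set.Ioo (0 : ℝ) 1 • (Subtype.val '' s)) := by
    ext x
    simp only [Set.mem_smul, Set.mem_image, Set.mem_preimage]
    constructor
    · rintro ⟨a, ha, _, ⟨y, hy, rfl⟩, rfl⟩
      exact ⟨a, ha, T y, ⟨sphMap T y, hy, rfl⟩, by simp⟩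
    · rintro ⟨a, ha, _, ⟨y, hy, rfl⟩, h⟩
      refine ⟨a, ha, T.symm y, ⟨sphMap T.symm y, ?_, rfl⟩, ?_⟩
      · have : sphMap T (sphMap T.symm y) = y := Subtype.ext (by simp [sphMap])
        rwa [this]
      · apply T.injective; simpa using h
  rw [h1]
  exact (T.measurePreserving).measure_preimage_equiv (f := T.toMeasurableEquiv) _

theorem integral_sphMap (T : Space ≃ₗᵢ[ℝ] Space) {f : Sph → ℝ} (hf : Continuous f) :
    ∫ y, f (sphMap T y) ∂sphMeas = ∫ y, f y ∂sphMeas := by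
  conv_rhs => rw [← map_sphMap T]
  rw [integral_map (continuous_sphMap T).measurable.aemeasurable hf.aestronglyMeasurable]

/-- Rotation by the angle `θ` in the plane of the coordinates `j, k`. -/
def rotFun (j k : Fin 3) (θ : ℝ) (x : Space) : Space :=
  x + (((Real.cos θ - 1) * x j - Real.sin θ * x k) • EuclideanSpace.single j (1 : ℝ)
    + (Real.sin θ * x j + (Real.cos θ - 1) * x k) • EuclideanSpace.single k (1 : ℝ))

theorem norm_rotFun {j k : Fin 3} (hjk : j ≠ k) (θ : ℝ) (x : Space) : ‖rotFun j k θ x‖ = ‖x‖ := by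
  have h := norm_sq_eq x
  have h2 := norm_sq_eq (rotFun j k θ x)
  have h3 := Real.sin_sq_add_cos_sq θ
  have : ‖rotFun j k θ x‖ * ‖rotFun j k θ x‖ = ‖x‖ * ‖x‖ := by
    rw [h, h2]
    clear h h2
    fin_cases j <;> fin_cases k <;> first | exact absurd rfl hjk | skip
    all_goals
      simp [rotFun]
      first
      | linear_combination (x 0 * x 0 + x 1 * x 1) * h3
      | linear_combination (x 0 * x 0 + x 2 * x 2) * h3
      | linear_combination (x 1 * x 1 + x 2 * x 2) * h3
  nlinarith [norm_nonneg x, norm_nonneg (rotFun j k θ x)]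

/-- Rotations as isometries. -/
def rotIso {j k : Fin 3} (hjk : j ≠ k) (θ : ℝ) : Space ≃ₗᵢ[ℝ] Space :=
  LinearIsometry.toLinearIsometryEquiv
    { toFun := rotFun j k θ
      map_add' := fun x y => by simp only [rotFun, PiLp.add_apply]; module
      map_smul' := fun c x => by
        simp only [rotFun, PiLp.smul_apply, smul_eq_mul, RingHom.id_apply]; module
      norm_map' := norm_rotFun hjk θ } rfl

theorem integral_rot_deriv {M : ℝ} (hM : 0 < M) {f : Space → ℝ} (hf : ContDiffOn ℝ ∞ f (ext M))
    {R : ℝ} (hR : 2 * M ≤ R) {j k : Fin 3} (hjk : j ≠ k) :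
    ∫ y : Sph, ((R * y.1 j) * ds M k f (R • y.1) - (R * y.1 k) * ds M j f (R • y.1)) ∂sphMeas = 0 := by
  have hR0 : 0 < R := by linarith
  have hmem : ∀ (θ : ℝ) (y : Sph), R • rotFun j k θ y ∈ ext M := fun θ y => by
    change 2 * M ≤ ‖_‖
    have : ‖(y : Space)‖ = 1 := by simp
    rw [norm_smul, norm_rotFun hjk, this]; simpa [abs_of_pos hR0] using hR
  have hcd : ∀ (θ : ℝ) (y : Sph), HasDerivAt (fun θ => R • rotFun j k θ y.1)
      (R • ((-Real.sin θ * y.1 j - Real.cos θ * y.1 k) • EuclideanSpace.single j (1 : ℝ)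
    + (Real.cos θ * y.1 j + -Real.sin θ * y.1 k) • EuclideanSpace.single k (1 : ℝ))) θ := fun θ y => by
    have h1 : HasDerivAt (fun θ => ((Real.cos θ - 1) * y.1 j - Real.sin θ * y.1 k))
        (-Real.sin θ * y.1 j - Real.cos θ * y.1 k) θ :=
      (((Real.hasDerivAt_cos θ).sub_const 1).mul_const _).sub ((Real.hasDerivAt_sin θ).mul_const _)
    have h2 : HasDerivAt (fun θ => (Real.sin θ * y.1 j + (Real.cos θ - 1) * y.1 k))
        (Real.cos θ * y.1 j + -Real.sin θ * y.1 k) θ :=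
      ((Real.hasDerivAt_sin θ).mul_const _).add (((Real.hasDerivAt_cos θ).sub_const 1).mul_const _)
    exact (((h1.smul_const _).add (h2.smul_const _)).const_add _).const_smul R
  have hcoord : ∀ i, Continuous fun y : Sph => y.1 i := fun i =>
    (contDiff_coord i).continuous.comp continuous_subtype_val
  have key := hasFDerivWithinAt_integral_comp (μ := sphMeas) (goodSet_ext hM) hf (V := ℝ) convex_univ
    (c := fun θ y => R • rotFun j k θ y.1)
    (c' := fun θ y => ContinuousLinearMap.toSpanSingleton ℝ
      (R • ((-Real.sin θ * y.1 j - Real.cos θ * y.1 k) • EuclideanSpace.single j (1 : ℝ)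
    + (Real.cos θ * y.1 j + -Real.sin θ * y.1 k) • EuclideanSpace.single k (1 : ℝ))))
    (fun θ _ y => (hcd θ y).hasDerivWithinAt.hasFDerivWithinAt) (fun θ _ y => hmem θ y)
    (by
      have h1 := fun i => (hcoord i).comp (continuous_snd (X := ℝ) (Y := Sph))
      have h2 := h1 j
      have h3 := h1 k
      simp only [Function.comp_def] at h2 h3
      unfold rotFun
      fun_prop)
    (by
      have h1 := fun i => (hcoord i).comp (continuous_snd (X := ℝ) (Y := Sph))
      have h2 := h1 j
      have h3 := h1 k
      simp only [Function.comp_def] at h2 h3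
      have h4 : Continuous (fun v : Space => ContinuousLinearMap.toSpanSingleton ℝ v) := by
        exact (ContinuousLinearMap.toSpanSingletonCLE (𝕜 := ℝ) (E := Space)).continuous
      refine h4.comp ?_
      fun_prop) (τ := 0) (Set.mem_univ _)
  have hconst : ∀ θ, ∫ y : Sph, f (R • rotFun j k θ y.1) ∂sphMeas = ∫ y : Sph, f (R • y.1) ∂sphMeas := by
    intro θ
    have hcont : Continuous fun y : Sph => f (R • y.1) := by
      have : ContinuousOn (fun y : Sph => f (R • y.1)) Set.univ :=
        hf.continuousOn.comp (by fun_prop) fun y _ => by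
          have := hmem 0 y
          simpa [rotFun] using this
      exact continuousOn_univ.1 this
    exact integral_sphMap (rotIso hjk θ) hcont
  simp only [hconst] at key
  rw [hasFDerivWithinAt_univ] at key
  have h0 := key.unique (hasFDerivAt_const _ _)
  have h1 := congrArg (fun L => L (1 : ℝ)) h0
  have hint : Integrable (fun y : Sph => (fderivWithin ℝ f (ext M) (R • rotFun j k 0 y.1)).comp
      (ContinuousLinearMap.toSpanSingleton ℝ
      (R • ((-Real.sin 0 * y.1 j - Real.cos 0 * y.1 k) • EuclideanSpace.single j (1 : ℝ)
    + (Real.cos 0 * y.1 j + -Real.sin 0 * y.1 k) • EuclideanSpace.single k (1 : ℝ))))) sphMeas := by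
    refine integrable_of_continuous ?_
    have h3 : ContinuousOn (fderivWithin ℝ f (ext M)) (ext M) :=
      hf.continuousOn_fderivWithin (goodSet_ext hM).unique (by simp)
    have h4 : Continuous (fun v : Space => ContinuousLinearMap.toSpanSingleton ℝ v) := by
      exact (ContinuousLinearMap.toSpanSingletonCLE (𝕜 := ℝ) (E := Space)).continuous
    have h5 := hcoord j
    have h6 := hcoord k
    refine Continuous.clm_comp ?_ (h4.comp (by fun_prop))
    have : ContinuousOn (fun y : Sph => fderivWithin ℝ f (ext M) (R • rotFun j k 0 y.1)) Set.univ :=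
      h3.comp (by unfold rotFun; fun_prop) fun y _ => hmem 0 y
    exact continuousOn_univ.1 this
  rw [ContinuousLinearMap.integral_apply hint] at h1
  rw [← show _ = (0 : ℝ) from h1]
  refine integral_congr_ae (Filter.Eventually.of_forall fun y => ?_)
  simp only [ds, dd, rotFun]
  simp
  ring

end LinearisedGravity

end

noncomputable section

set_option linter.unusedSimpArgs false

namespace LinearisedGravity

open MeasureTheory

/-! ## Kernels on the sphere: algebraic part -/

namespace RotAlg

variable {A : Type*} [CommRing A] [Algebra ℝ A] {Ω : Fin 3 → Derivation ℝ A A} {y : Fin 3 → A}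

/-- The zonal function `c · y`. -/
def zonal (y : Fin 3 → A) (c : Fin 3 → ℝ) : A :=
  algebraMap ℝ A (c 0) * y 0 + algebraMap ℝ A (c 1) * y 1 + algebraMap ℝ A (c 2) * y 2

variable (h : RotAlg Ω y) {c : Fin 3 → ℝ}
include h

theorem lap_zonal : lap Ω (zonal y c) = -2 * zonal y c := by
  have e : ∀ i, lap Ω (algebraMap ℝ A (c i) * y i) = algebraMap ℝ A (c i) * (-2 * y i) := fun i => by
    rw [← h.lap_y i]; simp [lap, Derivation.leibniz]; ring
  rw [zonal, lap_add, lap_add, e, e, e]; ring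

theorem rot_zonal_sq (hc : c 0 * c 0 + c 1 * c 1 + c 2 * c 2 = 1) :
    Ω 0 (zonal y c) * Ω 0 (zonal y c) + Ω 1 (zonal y c) * Ω 1 (zonal y c)
      + Ω 2 (zonal y c) * Ω 2 (zonal y c) = 1 - zonal y c * zonal y c := by
  have hc' := congrArg (algebraMap ℝ A) hc
  simp only [map_add, map_mul, map_one] at hc'
  simp only [zonal, map_add, Derivation.leibniz, smul_eq_mul, Derivation.map_algebraMap,
    h.y00, h.y01, h.y02, h.y10, h.y11, h.y12, h.y20, h.y21, h.y22]
  linear_combination (algebraMap ℝ A (c 0) * algebraMap ℝ A (c 0) +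
    algebraMap ℝ A (c 1) * algebraMap ℝ A (c 1) + algebraMap ℝ A (c 2) * algebraMap ℝ A (c 2)) * h.sq + hc'

variable {a : ℝ} {w L : A}
  (hc : c 0 * c 0 + c 1 * c 1 + c 2 * c 2 = 1)
  (hw : (algebraMap ℝ A a - zonal y c) * w = 1)
  (hL : ∀ i, Ω i L = w * Ω i (algebraMap ℝ A a - zonal y c))
include hc hw hL

theorem lap_log : lap Ω L = (algebraMap ℝ A a * algebraMap ℝ A a - 1) * (w * w) - 1 := by
  have h1 := h.rot_zonal_sq hc
  have h2 := h.lap_zonal (c := c)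
  have hΩw : ∀ i, Ω i w = w * w * Ω i (zonal y c) := fun i => by
    have := congrArg (Ω i) hw
    simp only [Derivation.leibniz, smul_eq_mul, map_sub, Derivation.map_algebraMap,
      Derivation.map_one_eq_zero] at this
    linear_combination w * this - Ω i w * hw
  have hΩL : ∀ i, Ω i L = -(w * Ω i (zonal y c)) := fun i => by rw [hL i]; simp
  set z := zonal y c
  set α := algebraMap ℝ A a
  simp only [lap] at h2 ⊢
  simp only [hΩL, map_neg, Derivation.leibniz, smul_eq_mul, hΩw]
  linear_combination (-w) * h2 - w * w * h1 + (-z * w - α * w - 1) * hw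

theorem lap_zonal_log : lap Ω (zonal y c * L) + 2 * (zonal y c * L) =
    (algebraMap ℝ A a * algebraMap ℝ A a - 1) * (algebraMap ℝ A a * (w * w) + w)
      - 2 * algebraMap ℝ A a - 3 * zonal y c := by
  have h1 := h.rot_zonal_sq hc
  have h2 := h.lap_zonal (c := c)
  have h3 := h.lap_log hc hw hL
  have hΩL : ∀ i, Ω i L = -(w * Ω i (zonal y c)) := fun i => by rw [hL i]; simp
  rw [lap_mul, h2, h3]
  simp only [hΩL]
  set z := zonal y c
  set α := algebraMap ℝ A a
  linear_combination (-2 * w) * h1 - (2 * α + 2 * z + (α * α - 1) * w) * hw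

theorem lap_mul_log_sq : lap Ω ((algebraMap ℝ A a - zonal y c) * (L * L)) =
    -2 * (algebraMap ℝ A a * algebraMap ℝ A a - 1) * w * L
      + (2 * algebraMap ℝ A a + 6 * zonal y c) * L
      + 2 * w * (1 - zonal y c * zonal y c) + 2 * zonal y c * (L * L) := by
  have h1 := h.rot_zonal_sq hc
  have h2 := h.lap_zonal (c := c)
  have h3 := h.lap_log hc hw hL
  have hΩL : ∀ i, Ω i L = -(w * Ω i (zonal y c)) := fun i => by rw [hL i]; simp
  have h4 : lap Ω (algebraMap ℝ A a - zonal y c) = 2 * zonal y c := by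
    rw [lap_sub, h2]; simp [lap]
  rw [lap_mul, lap_mul, h3, h4]
  simp only [Derivation.leibniz, smul_eq_mul, map_sub, Derivation.map_algebraMap, hΩL]
  set z := zonal y c
  set α := algebraMap ℝ A a
  linear_combination (4 * w * L + 2 * (α - z) * w * w) * h1 +
    (2 * (1 - z * z) * w + 4 * L * (α + z) + 2 * (α * α - 1) * w * L) * hw

end RotAlg

/-! ## Integration over spheres -/

section SphereIntegral

variable {M : ℝ} (hM : 0 < M) {R : ℝ} (hR : 2 * M ≤ R)

theorem norm_sph (y : Sph) : ‖(y : Space)‖ = 1 := by simp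

/-- The point `R y` of the exterior region. -/
def sphPt (y : Sph) : ext M := ⟨R • y.1, by
  change 2 * M ≤ ‖_‖
  have : 0 < R := by linarith
  rw [norm_smul, norm_sph, Real.norm_eq_abs, abs_of_pos this]; simpa using hR⟩

theorem norm_sphPt (y : Sph) : ‖(sphPt hM hR y).1‖ = R := by
  have : 0 < R := by linarith
  simp [sphPt, norm_smul, abs_of_pos this]

theorem continuous_sphPt : Continuous (sphPt hM hR) :=
  Continuous.subtype_mk (by fun_prop) _

theorem Sm.continuous {E : Type*} [NormedAddCommGroup E] [NormedSpace ℝ E] {s : Set E} (g : Sm s) :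
    Continuous g.1 := by
  have h := continuousOn_iff_continuous_domRestrict.1 (Sm.rep_smooth g).continuousOn
  refine h.congr fun x => ?_
  exact Sm.rep_apply g x

theorem continuous_comp_sphPt (g : Sm (ext M)) : Continuous fun y => g.1 (sphPt hM hR y) :=
  (Sm.continuous g).comp (continuous_sphPt hM hR)

theorem integrable_sphPt (g : Sm (ext M)) : Integrable (fun y => g.1 (sphPt hM hR y)) sphMeas :=
  integrable_of_continuous (continuous_comp_sphPt hM hR g)

/-- Evaluation at a point. -/
def Sm.ev {E : Type*} [NormedAddCommGroup E] [NormedSpace ℝ E] {s : Set E} (x : s) :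
    Sm s →ₐ[ℝ] ℝ := (Pi.evalAlgHom ℝ (fun _ : s => ℝ) x).comp (Sm s).val

theorem Sm.ev_apply {E : Type*} [NormedAddCommGroup E] [NormedSpace ℝ E] {s : Set E} (x : s)
    (g : Sm s) : Sm.ev x g = g.1 x := rfl

/-- Integration over the sphere of radius `R`, normalised to the unit sphere. -/
def sI : Sm (ext M) →ₗ[ℝ] ℝ where
  toFun g := ∫ y, g.1 (sphPt hM hR y) ∂sphMeas
  map_add' f g := integral_add (integrable_sphPt hM hR f) (integrable_sphPt hM hR g)
  map_smul' c _ := integral_const_mul c _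

theorem sI_apply (g : Sm (ext M)) : sI hM hR g = ∫ y, g.1 (sphPt hM hR y) ∂sphMeas := rfl

theorem sI_mk {f : Space → ℝ} (hf : ContDiffOn ℝ ∞ f (ext M)) :
    sI hM hR (Sm.mk f hf) = sphereInt fun y => f (R • y) := rfl

theorem sI_mono {f g : Sm (ext M)} (h : ∀ x : ext M, ‖x.1‖ = R → f.1 x ≤ g.1 x) :
    sI hM hR f ≤ sI hM hR g :=
  integral_mono (integrable_sphPt hM hR f) (integrable_sphPt hM hR g)
    fun y => h _ (norm_sphPt hM hR y)

theorem sI_congr {f g : Sm (ext M)} (h : ∀ x : ext M, ‖x.1‖ = R → f.1 x = g.1 x) :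
    sI hM hR f = sI hM hR g :=
  integral_congr_ae (Filter.Eventually.of_forall fun y => h _ (norm_sphPt hM hR y))

/-- The area of the unit sphere. -/
def area : ℝ := sphMeas.real Set.univ

theorem area_pos : 0 < area := by
  have : NeZero sphMeas := ⟨Measure.toSphere_ne_zero _⟩
  exact measureReal_univ_pos

theorem sI_one : sI hM hR 1 = area := by
  rw [sI_apply]; simp [area]

theorem sI_const (c : ℝ) : sI hM hR (algebraMap ℝ _ c) = c * area := by
  rw [Algebra.algebraMap_eq_smul_one, map_smul, sI_one]; rfl

theorem sI_const_mul (c : ℝ) (f : Sm (ext M)) :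
    sI hM hR (algebraMap ℝ _ c * f) = c * sI hM hR f := by
  rw [← Algebra.smul_def, map_smul]; rfl

theorem sI_rot (i : Fin 3) (f : Sm (ext M)) : sI hM hR (rot hM i f) = 0 := by
  have key : ∀ j k : Fin 3, j ≠ k →
      sI hM hR (XS M j * dS hM k f - XS M k * dS hM j f) = 0 := fun j k hjk => by
    have := integral_rot_deriv hM (Sm.rep_smooth f) hR hjk
    rw [sI_apply, ← this]
    refine integral_congr_ae (Filter.Eventually.of_forall fun y => ?_)
    rw [← Sm.mk_rep f]
    change (sphPt hM hR y).1 j * (dS hM k (Sm.mk _ _)).1 _ - (sphPt hM hR y).1 k * (dS hM j (Sm.mk _ _)).1 _ = _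
    rw [dS_mk_apply, dS_mk_apply, Sm.mk_rep]; rfl
  fin_cases i
  · exact key 1 2 (by decide)
  · exact key 2 0 (by decide)
  · exact key 0 1 (by decide)

theorem sI_rot_mul (i : Fin 3) (f g : Sm (ext M)) :
    sI hM hR (rot hM i f * g) = -sI hM hR (f * rot hM i g) := by
  have := sI_rot hM hR i (f * g)
  simp only [Derivation.leibniz, smul_eq_mul, map_add] at this
  rw [mul_comm g] at this; linarith

theorem sI_lap (f : Sm (ext M)) : sI hM hR (RotAlg.lap (rot hM) f) = 0 := by
  simp [RotAlg.lap, sI_rot]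

theorem sI_lap_mul (f g : Sm (ext M)) :
    sI hM hR (RotAlg.lap (rot hM) f * g) =
      -sI hM hR (∑ a, rot hM a f * rot hM a g) := by
  simp only [RotAlg.lap, add_mul, map_add, sI_rot_mul, Fin.sum_univ_three]; ring

theorem sI_lap_symm (f g : Sm (ext M)) :
    sI hM hR (RotAlg.lap (rot hM) f * g) = sI hM hR (f * RotAlg.lap (rot hM) g) := by
  rw [sI_lap_mul, mul_comm f, sI_lap_mul]
  simp only [mul_comm]

theorem sI_hessian (f : Sm (ext M)) :
    sI hM hR (∑ a, ∑ b, rot hM a (rot hM b f) * rot hM a (rot hM b f)) =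
      sI hM hR (RotAlg.lap (rot hM) f * RotAlg.lap (rot hM) f) := by
  rw [Finset.sum_comm, map_sum]
  have : ∀ b, sI hM hR (∑ a, rot hM a (rot hM b f) * rot hM a (rot hM b f)) =
      sI hM hR (rot hM b (rot hM b f) * RotAlg.lap (rot hM) f) := fun b => by
    have e1 := sI_lap_mul hM hR (rot hM b f) (rot hM b f)
    rw [(rotAlg hM).lap_rot, sI_rot_mul] at e1
    rw [mul_comm]; linarith
  rw [Finset.sum_congr rfl fun b _ => this b, ← map_sum, ← Finset.sum_mul, Fin.sum_univ_three]
  rfl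

theorem sI_two_mul (g : Sm (ext M)) : sI hM hR (2 * g) = 2 * sI hM hR g := by
  rw [two_mul, map_add]; ring

theorem sI_nonneg {f : Sm (ext M)} (h : ∀ x : ext M, ‖x.1‖ = R → 0 ≤ f.1 x) : 0 ≤ sI hM hR f := by
  rw [← map_zero (sI hM hR)]
  exact sI_mono hM hR h

theorem sI_bochner (f : Sm (ext M)) :
    2 * sI hM hR (∑ a, rot hM a f * rot hM a f) ≤
      sI hM hR (RotAlg.lap (rot hM) f * RotAlg.lap (rot hM) f) := by
  obtain ⟨C, hC⟩ := (rotAlg hM).bochner f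
  have h1 := sI_hessian hM hR f
  have h2 : 0 ≤ sI hM hR (∑ a, ∑ b, C a b * C a b) := by
    refine sI_nonneg hM hR fun x _ => ?_
    rw [← Sm.ev_apply, map_sum]
    refine Finset.sum_nonneg fun a _ => ?_
    rw [map_sum]
    refine Finset.sum_nonneg fun b _ => ?_
    rw [map_mul]
    exact mul_self_nonneg _
  rw [← hC, sI_two_mul, map_sub, map_sub, sI_two_mul, sI_two_mul, h1] at h2
  linarith

end SphereIntegral

end LinearisedGravity

end

noncomputable section

set_option linter.unusedSimpArgs false

namespace LinearisedGravity

open MeasureTheory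

/-! ## Kernels on the sphere: estimates -/

section Kernel

/-- The key pointwise inequality for the square of the logarithmic kernel. -/
theorem log_sq_le {a z : ℝ} (ha : 1 < a) (ha2 : a ≤ 2) (hz : |z| ≤ 1) :
    Real.log (a - z) ^ 2 ≤ -2 * (a * a - 1) * (a - z)⁻¹ * Real.log (a - z)
      + (2 * a + 6 * z) * Real.log (a - z) + 2 * (a - z)⁻¹ * (1 - z * z)
      + 2 * z * (Real.log (a - z) * Real.log (a - z)) + 200 := by
  obtain ⟨hz1, hz2⟩ := abs_le.1 hz
  have hu : 0 < a - z := by linarith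
  have hw : 0 < (a - z)⁻¹ := inv_pos.2 hu
  have hz3 : 0 ≤ 1 - z * z := by nlinarith
  have hp : 0 ≤ 2 * (a - z)⁻¹ * (1 - z * z) := by positivity
  have ha3 : 0 ≤ a * a - 1 := by nlinarith
  set L := Real.log (a - z) with hL
  rcases le_total (a - z) (1 / 4) with h | h
  · have hL0 : L ≤ 0 := Real.log_nonpos hu.le (by linarith)
    have hz4 : 3 / 4 ≤ z := by linarith
    have h1 : 0 ≤ -2 * (a * a - 1) * (a - z)⁻¹ * L := by
      have : 0 ≤ (a * a - 1) * (a - z)⁻¹ * (-L) := by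
        have : 0 ≤ -L := by linarith
        positivity
      linarith
    have h2 : -16 * (-L) ≤ (2 * a + 6 * z) * L := by nlinarith
    have h3 : 3 / 2 * (L * L) ≤ 2 * z * (L * L) := by nlinarith [mul_self_nonneg L]
    linarith [sq_nonneg (L + 16)]
  · have hL1 : -2 ≤ L := by
      have : Real.log (1 / 4) ≤ L := Real.log_le_log (by norm_num) h
      have h4 : Real.log (1 / 4) = -(2 * Real.log 2) := by
        rw [one_div, Real.log_inv, show (4 : ℝ) = 2 ^ 2 by norm_num, Real.log_pow]; norm_num
      have := Real.log_two_lt_d9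
      linarith
    have hL2 : L ≤ 2 := by
      have := Real.log_le_sub_one_of_pos hu
      linarith
    have hw4 : (a - z)⁻¹ ≤ 4 := by
      rw [inv_le_comm₀ hu (by norm_num)]; linarith
    have hLa : |L| ≤ 2 := abs_le.2 ⟨hL1, hL2⟩
    have h1 : |(a * a - 1) * (a - z)⁻¹ * L| ≤ 3 * 4 * 2 := by
      rw [abs_mul, abs_mul, abs_of_nonneg ha3, abs_of_pos hw]
      have : a * a - 1 ≤ 3 := by nlinarith
      gcongr
    have h2 : |(2 * a + 6 * z) * L| ≤ 10 * 2 := by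
      rw [abs_mul]
      have : |2 * a + 6 * z| ≤ 10 := abs_le.2 ⟨by linarith, by linarith⟩
      gcongr
    have h3 : L ^ 2 ≤ 4 := by nlinarith
    have h4 : |z * (L * L)| ≤ 1 * (2 * 2) := by
      rw [abs_mul, abs_mul]; gcongr
    have := (abs_le.1 h1)
    have := (abs_le.1 h2)
    have := (abs_le.1 h4)
    linarith

variable {M : ℝ} (hM : 0 < M) {R : ℝ} (hR : 2 * M ≤ R)

/-- The function `c · x/|x|`. -/
def zonalFun (c : Fin 3 → ℝ) (x : Space) : ℝ := c 0 * xhat x 0 + c 1 * xhat x 1 + c 2 * xhat x 2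

include hM in
theorem contDiffOn_xhat (i : Fin 3) : ContDiffOn ℝ ∞ (fun x => xhat x i) (ext M) := by
  have := (contDiff_coord i).contDiffOn.mul (contDiffOn_norm_inv hM)
  exact this

include hM in
theorem contDiffOn_zonalFun (c : Fin 3 → ℝ) : ContDiffOn ℝ ∞ (zonalFun c) (ext M) :=
  ((contDiffOn_const.mul (contDiffOn_xhat hM 0)).add
    (contDiffOn_const.mul (contDiffOn_xhat hM 1))).add (contDiffOn_const.mul (contDiffOn_xhat hM 2))

theorem xhat_sq {x : Space} (hx : 0 < ‖x‖) :
    xhat x 0 * xhat x 0 + xhat x 1 * xhat x 1 + xhat x 2 * xhat x 2 = 1 := by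
  have := norm_sq_eq x
  simp only [xhat]; field_simp; linarith

theorem abs_zonalFun_le {c : Fin 3 → ℝ} (hc : c 0 * c 0 + c 1 * c 1 + c 2 * c 2 = 1) {x : Space}
    (hx : 0 < ‖x‖) : |zonalFun c x| ≤ 1 := by
  have := xhat_sq hx
  rw [zonalFun, abs_le]
  constructor
  · linarith [sq_nonneg (c 0 + xhat x 0), sq_nonneg (c 1 + xhat x 1), sq_nonneg (c 2 + xhat x 2)]
  · linarith [sq_nonneg (c 0 - xhat x 0), sq_nonneg (c 1 - xhat x 1), sq_nonneg (c 2 - xhat x 2)]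

variable {c : Fin 3 → ℝ} (hc : c 0 * c 0 + c 1 * c 1 + c 2 * c 2 = 1) {a : ℝ} (ha : 1 < a)

include hM hc ha in
theorem kernel_pos {x : Space} (hx : x ∈ ext M) : 0 < a - zonalFun c x := by
  have := (abs_le.1 (abs_zonalFun_le hc (norm_pos_of_mem_ext hM hx))).2
  linarith

include hM in
theorem contDiffOn_kernel : ContDiffOn ℝ ∞ (fun x => a - zonalFun c x) (ext M) :=
  contDiffOn_const.sub (contDiffOn_zonalFun hM c)

/-- The kernel `1/(a - c · y)`. -/
def wK : Sm (ext M) := Sm.mk (fun x => (a - zonalFun c x)⁻¹)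
  ((contDiffOn_kernel hM).inv fun _ hx => (kernel_pos hM hc ha hx).ne')

/-- The kernel `log (a - c · y)`. -/
def LK : Sm (ext M) := Sm.mk (fun x => Real.log (a - zonalFun c x))
  ((contDiffOn_kernel hM).log fun _ hx => (kernel_pos hM hc ha hx).ne')

theorem kernel_mul_wK : (algebraMap ℝ (Sm (ext M)) a - RotAlg.zonal (yS hM) c) * wK hM hc ha = 1 :=
  Sm.ext' fun x => mul_inv_cancel₀ (kernel_pos hM hc ha x.2).ne'

theorem dS_LK (i : Fin 3) : dS hM i (LK hM hc ha) =
    wK hM hc ha * dS hM i (algebraMap ℝ (Sm (ext M)) a - RotAlg.zonal (yS hM) c) := by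
  have e : algebraMap ℝ (Sm (ext M)) a - RotAlg.zonal (yS hM) c =
      Sm.mk (fun x => a - zonalFun c x) (contDiffOn_kernel hM) := rfl
  rw [e]
  refine Sm.ext' fun x => ?_
  rw [LK, dS_mk_apply]
  change _ = _ * (dS hM i (Sm.mk _ _)).1 x
  rw [dS_mk_apply, ds, dd, fderivWithin.log
    ((contDiffOn_kernel hM).differentiableOn (by simp) x.1 x.2) (kernel_pos hM hc ha x.2).ne'
    ((goodSet_ext hM).unique x.1 x.2)]
  rfl

theorem rot_LK (i : Fin 3) : rot hM i (LK hM hc ha) =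
    wK hM hc ha * rot hM i (algebraMap ℝ (Sm (ext M)) a - RotAlg.zonal (yS hM) c) := by
  fin_cases i <;>
    simp only [Fin.zero_eta, Fin.mk_one, Fin.reduceFinMk, rot_zero, rot_one, rot_two, dS_LK] <;> ring

include hR in
theorem sI_LK_sq (ha2 : a ≤ 2) : sI hM hR (LK hM hc ha * LK hM hc ha) ≤ 200 * area := by
  have h := (rotAlg hM).lap_mul_log_sq hc (kernel_mul_wK hM hc ha) (rot_LK hM hc ha)
  have h1 := sI_lap hM hR ((algebraMap ℝ _ a - RotAlg.zonal (yS hM) c) *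
    (LK hM hc ha * LK hM hc ha))
  have h2 : sI hM hR (LK hM hc ha * LK hM hc ha) ≤
      sI hM hR (RotAlg.lap (rot hM) ((algebraMap ℝ _ a - RotAlg.zonal (yS hM) c) *
        (LK hM hc ha * LK hM hc ha)) + algebraMap ℝ _ 200) := by
    refine sI_mono hM hR fun x _ => ?_
    rw [h]
    have := log_sq_le ha ha2 (abs_zonalFun_le hc (norm_pos_of_mem_ext hM x.2))
    rw [pow_two] at this
    exact this
  rw [map_add, h1, sI_const] at h2
  linarith

theorem abs_sI_LK_mul_le (ha2 : a ≤ 2) (g : Sm (ext M)) : |sI hM hR (LK hM hc ha * g)| ≤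
    100 * area + 1 / 2 * sI hM hR (g * g) := by
  have h := sI_LK_sq hM hR hc ha ha2
  have h1 : ∀ s : ℝ, s * s = 1 → s * sI hM hR (LK hM hc ha * g) ≤
      1 / 2 * sI hM hR (LK hM hc ha * LK hM hc ha) + 1 / 2 * sI hM hR (g * g) := fun s hs => by
    rw [← sI_const_mul, ← sI_const_mul, ← sI_const_mul, ← map_add]
    refine sI_mono hM hR fun x _ => ?_
    change s * ((LK hM hc ha).1 x * g.1 x) ≤ 1 / 2 * ((LK hM hc ha).1 x * (LK hM hc ha).1 x)
      + 1 / 2 * (g.1 x * g.1 x)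
    nlinarith [sq_nonneg ((LK hM hc ha).1 x - s * g.1 x)]
  have h2 := h1 1 (by norm_num)
  have h3 := h1 (-1) (by norm_num)
  rw [abs_le]; constructor <;> linarith

theorem sI_wK_sq : (a * a - 1) * sI hM hR (wK hM hc ha * wK hM hc ha) = area := by
  have h := (rotAlg hM).lap_log hc (kernel_mul_wK hM hc ha) (rot_LK hM hc ha)
  have h1 := sI_lap hM hR (LK hM hc ha)
  rw [h, map_sub, sI_one, ← map_mul, ← map_one (algebraMap ℝ (Sm (ext M))), ← map_sub,
    sI_const_mul] at h1
  linarith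

end Kernel

section SupBounds

variable {M : ℝ} (hM : 0 < M) {R : ℝ} (hR : 2 * M ≤ R)

include hM in
/-- Concentration of the kernel at a point. -/
theorem concentration (f : Sm (ext M)) (x₀ : ext M) (hx₀ : ‖x₀.1‖ = R) {t : ℝ} (ht : |t| ≤ 1)
    {ε : ℝ} (hε : 0 < ε) : ∃ K : ℝ, 0 ≤ K ∧ ∀ a : ℝ, 1 < a → a ≤ 2 → ∀ x : ext M, ‖x.1‖ = R →
      |a * ((a - zonalFun (xhat x₀.1) x.1)⁻¹ * (a - zonalFun (xhat x₀.1) x.1)⁻¹) * (f.1 x₀ - f.1 x)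
        - t * (a - zonalFun (xhat x₀.1) x.1)⁻¹ * f.1 x| ≤
      ε * ((a - zonalFun (xhat x₀.1) x.1)⁻¹ * (a - zonalFun (xhat x₀.1) x.1)⁻¹) + K := by
  have hR : 2 * M ≤ R := hx₀ ▸ x₀.2
  have hR0 : 0 < R := by linarith
  have hc := xhat_sq (norm_pos_of_mem_ext hM x₀.2)
  have hsup : ∃ F : ℝ, 0 ≤ F ∧ ∀ x : ext M, ‖x.1‖ = R → |f.1 x| ≤ F := by
    obtain ⟨F, hF⟩ := (isCompact_univ (X := Sph)).exists_bound_of_continuousOn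
      (continuous_comp_sphPt hM hR f).continuousOn
    refine ⟨max F 0, le_max_right _ _, fun x hx => ?_⟩
    have hy : ‖R⁻¹ • x.1‖ = 1 := by
      rw [norm_smul, hx, norm_inv, Real.norm_eq_abs, abs_of_pos hR0, inv_mul_cancel₀ hR0.ne']
    have h1 := hF ⟨R⁻¹ • x.1, by simpa using hy⟩ trivial
    have h2 : sphPt hM hR ⟨R⁻¹ • x.1, by simpa using hy⟩ = x :=
      Subtype.ext (by simp [sphPt, smul_smul, hR0.ne'])
    rw [h2] at h1
    exact h1.trans (le_max_left _ _)
  obtain ⟨F, hF0, hF⟩ := hsup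
  obtain ⟨δ, hδ, hcont⟩ := Metric.continuous_iff.1 (Sm.continuous f) x₀ (ε / 4) (by positivity)
  set W := 2 * R ^ 2 / δ ^ 2 with hW
  have hW0 : 0 ≤ W := by positivity
  refine ⟨F ^ 2 / (2 * ε) + 2 * (W * W) * (2 * F), by positivity, fun a ha ha2 x hx => ?_⟩
  have hu := kernel_pos hM hc ha x.2
  set w := (a - zonalFun (xhat x₀.1) x.1)⁻¹ with hw
  have hw0 : 0 < w := inv_pos.2 hu
  have hb1 : |t * w * f.1 x| ≤ ε / 2 * (w * w) + F ^ 2 / (2 * ε) := by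
    rw [abs_mul, abs_mul, abs_of_pos hw0]
    have h1 : |t| * w * |f.1 x| ≤ 1 * w * F := by
      gcongr; exact hF x hx
    have h2 : w * F ≤ ε / 2 * (w * w) + F ^ 2 / (2 * ε) := by
      rw [← sub_nonneg]
      have : ε / 2 * (w * w) + F ^ 2 / (2 * ε) - w * F = (ε * w - F) ^ 2 / (2 * ε) := by
        field_simp; ring
      rw [this]; positivity
    linarith
  have hb2 : |a * (w * w) * (f.1 x₀ - f.1 x)| ≤ ε / 2 * (w * w) + 2 * (W * W) * (2 * F) := by
    rw [abs_mul, abs_mul, abs_of_pos (by linarith : 0 < a), abs_of_nonneg (mul_self_nonneg w)]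
    rcases lt_or_ge (dist x x₀) δ with hd | hd
    · have h1 := (hcont x hd).le
      rw [dist_comm, Real.dist_eq] at h1
      have h2 : a * (w * w) * |f.1 x₀ - f.1 x| ≤ 2 * (w * w) * (ε / 4) := by gcongr
      have : 0 ≤ 2 * (W * W) * (2 * F) := by positivity
      linarith
    · have hwW : w ≤ W := by
        have h1 : δ ^ 2 ≤ dist x x₀ ^ 2 := by gcongr
        have h2 : dist x x₀ ^ 2 = 2 * R ^ 2 * (1 - zonalFun (xhat x₀.1) x.1) := by
          rw [Subtype.dist_eq, dist_eq_norm, pow_two, norm_sq_eq]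
          have e1 := norm_sq_eq x.1
          have e2 := norm_sq_eq x₀.1
          rw [hx] at e1
          rw [hx₀] at e2
          simp only [zonalFun, xhat, hx, hx₀, PiLp.sub_apply]
          field_simp
          nlinarith
        have h3 : δ ^ 2 ≤ 2 * R ^ 2 * (a - zonalFun (xhat x₀.1) x.1) := by nlinarith [sq_nonneg R]
        rw [hw, hW, inv_le_comm₀ hu (by positivity), inv_div, div_le_iff₀ (by positivity)]
        linarith
      have h1 : |f.1 x₀ - f.1 x| ≤ 2 * F := by
        have := abs_sub (f.1 x₀) (f.1 x)
        have := hF x hx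
        have := hF x₀ hx₀
        linarith
      have h2 : a * (w * w) * |f.1 x₀ - f.1 x| ≤ 2 * (W * W) * (2 * F) := by gcongr
      have : 0 ≤ ε / 2 * (w * w) := by positivity
      linarith
  have := abs_sub (a * (w * w) * (f.1 x₀ - f.1 x)) (t * w * f.1 x)
  linarith

theorem bound_of_kernel (f : Sm (ext M)) (x₀ : ext M) (hx₀ : ‖x₀.1‖ = R) {t B : ℝ} (ht : |t| ≤ 1)
    (hc : xhat x₀.1 0 * xhat x₀.1 0 + xhat x₀.1 1 * xhat x₀.1 1 + xhat x₀.1 2 * xhat x₀.1 2 = 1)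
    (hB : ∀ (a : ℝ) (ha : 1 < a), a ≤ 2 → |(a * a - 1) * sI hM hR
      ((algebraMap ℝ _ a * (wK hM hc ha * wK hM hc ha) + algebraMap ℝ _ t * wK hM hc ha) * f)| ≤ B) :
    |f.1 x₀| * area ≤ B := by
  refine le_of_forall_pos_le_add fun η hη => ?_
  have hA := area_pos
  obtain ⟨K, hK0, hK⟩ := concentration hM f x₀ hx₀ ht (ε := η / (2 * area)) (by positivity)
  obtain ⟨a, ha, ha2, haK⟩ : ∃ a : ℝ, 1 < a ∧ a ≤ 2 ∧ (a * a - 1) * (K * area) ≤ η / 2 := by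
    refine ⟨1 + min 1 (η / (6 * (K * area + 1))), ?_, ?_, ?_⟩
    · have : 0 < min 1 (η / (6 * (K * area + 1))) := lt_min one_pos (by positivity)
      linarith
    · have := min_le_left 1 (η / (6 * (K * area + 1))); linarith
    · set m := min 1 (η / (6 * (K * area + 1))) with hm
      have h0 : 0 < m := lt_min one_pos (by positivity)
      have h1 : m ≤ 1 := min_le_left _ _
      have h2 : m * (6 * (K * area + 1)) ≤ η := by
        have : m ≤ η / (6 * (K * area + 1)) := min_le_right _ _
        rwa [le_div_iff₀ (by positivity)] at this
      have h3 : 0 ≤ K * area := by positivity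
      have h4 : (1 + m) * (1 + m) - 1 ≤ 3 * m := by nlinarith
      calc _ ≤ 3 * m * (K * area) := by gcongr
        _ ≤ η / 2 := by nlinarith
  have h1 := hB a ha ha2
  have haa : 0 < a * a - 1 := by nlinarith
  have hw := sI_wK_sq hM hR hc ha
  set w := wK hM hc ha with hwdef
  have h2 : |sI hM hR (algebraMap ℝ _ a * (w * w) * (algebraMap ℝ _ (f.1 x₀) - f)
      - algebraMap ℝ _ t * w * f)| ≤ sI hM hR (algebraMap ℝ _ (η / (2 * area)) * (w * w)
        + algebraMap ℝ _ K) := by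
    rw [abs_le, ← map_neg]
    exact ⟨sI_mono hM hR fun x hx => neg_le_of_abs_le (hK a ha ha2 x hx),
      sI_mono hM hR fun x hx => le_of_abs_le (hK a ha ha2 x hx)⟩
  have e1 : algebraMap ℝ _ a * (w * w) * (algebraMap ℝ _ (f.1 x₀) - f) - algebraMap ℝ _ t * w * f =
      algebraMap ℝ _ (a * f.1 x₀) * (w * w)
        - (algebraMap ℝ _ a * (w * w) + algebraMap ℝ _ t * w) * f := by
    rw [map_mul]; ring
  rw [e1, map_sub, sI_const_mul, map_add, sI_const_mul, sI_const] at h2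
  set S := sI hM hR (w * w)
  set T := sI hM hR ((algebraMap ℝ _ a * (w * w) + algebraMap ℝ _ t * w) * f)
  have h3 : |a * f.1 x₀ * area| ≤ B + η := by
    have e2 : a * f.1 x₀ * area = (a * a - 1) * (a * f.1 x₀ * S - T) + (a * a - 1) * T := by
      rw [← hw]; ring
    rw [e2]
    have h4 : |(a * a - 1) * (a * f.1 x₀ * S - T)| ≤ (a * a - 1) * (η / (2 * area) * S + K * area) := by
      rw [abs_mul, abs_of_pos haa]; gcongr
    have h5 : (a * a - 1) * (η / (2 * area) * S + K * area) = η / 2 + (a * a - 1) * (K * area) := by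
      have : (a * a - 1) * (η / (2 * area) * S) = η / (2 * area) * ((a * a - 1) * S) := by ring
      rw [mul_add, this, hw]; field_simp
    have := abs_add_le ((a * a - 1) * (a * f.1 x₀ * S - T)) ((a * a - 1) * T)
    linarith
  rw [abs_mul, abs_mul, abs_of_pos hA, abs_of_pos (by linarith : 0 < a)] at h3
  nlinarith [mul_nonneg (abs_nonneg (f.1 x₀)) hA.le]

/-- A function of vanishing mean is controlled by its Laplacian in `L²`. -/
theorem abs_le_of_lap_sq (f : Sm (ext M)) (hf : sI hM hR f = 0) (x₀ : ext M) (hx₀ : ‖x₀.1‖ = R) :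
    |f.1 x₀| * area ≤ 200 * area +
      sI hM hR (RotAlg.lap (rot hM) f * RotAlg.lap (rot hM) f) := by
  have hc := xhat_sq (norm_pos_of_mem_ext hM x₀.2)
  refine bound_of_kernel hM hR f x₀ hx₀ (t := 0) (by simp) hc fun a ha ha2 => ?_
  have h := (rotAlg hM).lap_log hc (kernel_mul_wK hM hc ha) (rot_LK hM hc ha)
  have h1 := sI_lap_symm hM hR (LK hM hc ha) f
  have h2 := abs_sI_LK_mul_le hM hR hc ha ha2 (RotAlg.lap (rot hM) f)
  rw [h, sub_mul, one_mul, map_sub, hf, sub_zero] at h1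
  have e : (a * a - 1) * sI hM hR ((algebraMap ℝ _ a * (wK hM hc ha * wK hM hc ha)
      + algebraMap ℝ _ 0 * wK hM hc ha) * f) = a * sI hM hR (LK hM hc ha * RotAlg.lap (rot hM) f) := by
    rw [← h1, ← map_mul, ← map_one (algebraMap ℝ (Sm (ext M))), ← map_sub, mul_assoc, sI_const_mul,
      map_zero, zero_mul, add_zero, mul_assoc, sI_const_mul]
    ring
  rw [e, abs_mul, abs_of_pos (by linarith)]
  have h3 := abs_nonneg (sI hM hR (LK hM hc ha * RotAlg.lap (rot hM) f))
  nlinarith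

theorem lap_const_mul (a : ℝ) (f : Sm (ext M)) : RotAlg.lap (rot hM) (algebraMap ℝ _ a * f) =
    algebraMap ℝ _ a * RotAlg.lap (rot hM) f := by
  simp only [RotAlg.lap, Derivation.leibniz, smul_eq_mul, Derivation.map_algebraMap,
    mul_zero, add_zero]
  ring

theorem Sm.abs_const_mul_apply {a : ℝ} (ha : 0 < a) (f : Sm (ext M)) (x : ext M) :
    |(algebraMap ℝ (Sm (ext M)) a * f).1 x| = a * |f.1 x| := by
  change |a * f.1 x| = _
  rw [abs_mul, abs_of_pos ha]

theorem sI_mul_self_le {g : Sm (ext M)} {B : ℝ} (hB : 0 < B)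
    (h : ∀ x : ext M, ‖x.1‖ = R → |g.1 x| ≤ B) :
    sI hM hR (algebraMap ℝ _ B⁻¹ * g * (algebraMap ℝ _ B⁻¹ * g)) ≤ area := by
  rw [← one_mul area, ← sI_const hM hR]
  refine sI_mono hM hR fun x hx => ?_
  have h3 : |(algebraMap ℝ (Sm (ext M)) B⁻¹ * g).1 x| ≤ 1 := by
    rw [Sm.abs_const_mul_apply (inv_pos.2 hB), inv_mul_le_iff₀ hB, mul_one]; exact h x hx
  generalize algebraMap ℝ (Sm (ext M)) B⁻¹ * g = k at h3
  have := abs_le.1 h3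
  change k.1 x * k.1 x ≤ 1
  nlinarith

/-- A function of vanishing mean is controlled by its Laplacian. -/
theorem abs_le_of_abs_lap_le (f : Sm (ext M)) (hf : sI hM hR f = 0) {B : ℝ} (hB : 0 < B)
    (h : ∀ x : ext M, ‖x.1‖ = R → |(RotAlg.lap (rot hM) f).1 x| ≤ B)
    (x₀ : ext M) (hx₀ : ‖x₀.1‖ = R) : |f.1 x₀| ≤ 201 * B := by
  have hA := area_pos
  have h1 := abs_le_of_lap_sq hM hR (algebraMap ℝ _ B⁻¹ * f)
    (by rw [sI_const_mul, hf, mul_zero]) x₀ hx₀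
  rw [lap_const_mul, Sm.abs_const_mul_apply (inv_pos.2 hB)] at h1
  have h2 := sI_mul_self_le hM hR hB h
  have h5 : B⁻¹ * |f.1 x₀| * area ≤ 201 * area := by linarith
  have h6 := le_of_mul_le_mul_right h5 hA
  rw [inv_mul_le_iff₀ hB] at h6
  linarith

theorem abs_sI_LK_mul_le_sup {c : Fin 3 → ℝ} (hc : c 0 * c 0 + c 1 * c 1 + c 2 * c 2 = 1) {a : ℝ}
    (ha : 1 < a) (ha2 : a ≤ 2) {g : Sm (ext M)} {B : ℝ} (hB : 0 < B)
    (h : ∀ x : ext M, ‖x.1‖ = R → |g.1 x| ≤ B) : |sI hM hR (LK hM hc ha * g)| ≤ 101 * B * area := by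
  have hA := area_pos
  have h1 := abs_sI_LK_mul_le hM hR hc ha ha2 (algebraMap ℝ _ B⁻¹ * g)
  have h2 := sI_mul_self_le hM hR hB h
  rw [show LK hM hc ha * (algebraMap ℝ _ B⁻¹ * g) = algebraMap ℝ _ B⁻¹ * (LK hM hc ha * g) by ring,
    sI_const_mul, abs_mul, abs_of_pos (inv_pos.2 hB), inv_mul_le_iff₀ hB] at h1
  nlinarith

set_option maxHeartbeats 1000000 in
/-- A function with vanishing projection to `l = 0, 1` is controlled by `(r²Δ̸ + 2) f`. -/
theorem abs_le_of_abs_lap_add_le (f : Sm (ext M)) (hf : sI hM hR f = 0)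
    (hf1 : ∀ i, sI hM hR (f * yS hM i) = 0) {B : ℝ} (hB : 0 < B)
    (h : ∀ x : ext M, ‖x.1‖ = R → |(RotAlg.lap (rot hM) f + 2 * f).1 x| ≤ B)
    (x₀ : ext M) (hx₀ : ‖x₀.1‖ = R) : |f.1 x₀| ≤ 101 * B := by
  have hc := xhat_sq (norm_pos_of_mem_ext hM x₀.2)
  refine le_of_mul_le_mul_right (bound_of_kernel hM hR f x₀ hx₀ (t := 1) (by simp) hc
    fun a ha ha2 => ?_) area_pos
  have h1 := (rotAlg hM).lap_zonal_log hc (kernel_mul_wK hM hc ha) (rot_LK hM hc ha)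
  set z := RotAlg.zonal (yS hM) (xhat x₀.1) with hz
  have hzf : sI hM hR (z * f) = 0 := by
    have : z * f = algebraMap ℝ _ (xhat x₀.1 0) * (f * yS hM 0) +
      algebraMap ℝ _ (xhat x₀.1 1) * (f * yS hM 1) + algebraMap ℝ _ (xhat x₀.1 2) * (f * yS hM 2) := by
      rw [hz, RotAlg.zonal]; ring
    rw [this, map_add, map_add, sI_const_mul, sI_const_mul, sI_const_mul, hf1, hf1, hf1]; ring
  have h2 := sI_lap_symm hM hR (z * LK hM hc ha) f
  have h3 : sI hM hR ((RotAlg.lap (rot hM) (z * LK hM hc ha) + 2 * (z * LK hM hc ha)) * f) =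
      sI hM hR (LK hM hc ha * (z * (RotAlg.lap (rot hM) f + 2 * f))) := by
    have e1 : LK hM hc ha * (z * (RotAlg.lap (rot hM) f + 2 * f)) =
      z * LK hM hc ha * RotAlg.lap (rot hM) f + 2 * (z * LK hM hc ha * f) := by ring
    have e2 : (RotAlg.lap (rot hM) (z * LK hM hc ha) + 2 * (z * LK hM hc ha)) * f =
      RotAlg.lap (rot hM) (z * LK hM hc ha) * f + 2 * (z * LK hM hc ha * f) := by ring
    rw [e1, e2, map_add, map_add, h2]
  have e3 : ((algebraMap ℝ (Sm (ext M)) a * algebraMap ℝ _ a - 1) *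
      (algebraMap ℝ _ a * (wK hM hc ha * wK hM hc ha) + wK hM hc ha) - 2 * algebraMap ℝ _ a - 3 * z) * f =
      algebraMap ℝ _ (a * a - 1) * ((algebraMap ℝ _ a * (wK hM hc ha * wK hM hc ha) +
        algebraMap ℝ _ 1 * wK hM hc ha) * f) - algebraMap ℝ _ (2 * a) * f - algebraMap ℝ _ 3 * (z * f) := by
    simp only [map_sub, map_mul, map_one, map_ofNat]; ring
  rw [h1, e3, map_sub, map_sub, sI_const_mul, sI_const_mul, sI_const_mul, hf, hzf, mul_zero, mul_zero,
    sub_zero, sub_zero] at h3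
  rw [h3]
  refine abs_sI_LK_mul_le_sup hM hR hc ha ha2 hB fun x hx => ?_
  change |zonalFun (xhat x₀.1) x.1 * (RotAlg.lap (rot hM) f + 2 * f).1 x| ≤ B
  rw [abs_mul]
  have h5 := abs_zonalFun_le hc (norm_pos_of_mem_ext hM x.2)
  calc _ ≤ 1 * B := by gcongr; exact h x hx
    _ = B := one_mul B

set_option maxHeartbeats 1000000 in
/-- The operator `r²Δ̸ + 2(1 - 3M/r)` is boundedly invertible, up to a factor `r`. -/
theorem abs_le_of_zeta (G F : Sm (ext M)) (hG : sI hM hR G = 0) {B : ℝ} (hB : 0 < B)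
    (hF : ∀ x : ext M, ‖x.1‖ = R → |F.1 x| ≤ B)
    (h : RotAlg.lap (rot hM) G + (2 - algebraMap ℝ _ (6 * M) * qS hM) * G = F)
    (x₀ : ext M) (hx₀ : ‖x₀.1‖ = R) : |G.1 x₀| ≤ 201 * (R / (2 * M)) * B := by
  have hA := area_pos
  have hR0 : 0 < R := by linarith
  set D := RotAlg.lap (rot hM) G with hD
  set κ := 2 * M / R with hκ
  have hκ0 : 0 < κ := by positivity
  have hκ1 : κ ≤ 1 := by rw [hκ, div_le_one hR0]; exact hR
  have hb := sI_bochner hM hR G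
  have h1 := sI_lap_mul hM hR G G
  rw [← hD] at h1 hb
  have h0 : 0 ≤ sI hM hR (∑ a, rot hM a G * rot hM a G) := by
    refine sI_nonneg hM hR fun x _ => ?_
    rw [← Sm.ev_apply, map_sum]
    refine Finset.sum_nonneg fun a _ => ?_
    rw [map_mul]; exact mul_self_nonneg _
  set N := sI hM hR (∑ a, rot hM a G * rot hM a G)
  have h2 : sI hM hR (D * D) + (2 - 3 * κ) * sI hM hR (D * G) = sI hM hR (F * D) := by
    rw [← sI_const_mul, ← map_add]
    refine sI_congr hM hR fun x hx => ?_
    rw [← h]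
    change D.1 x * D.1 x + (2 - 3 * κ) * (D.1 x * G.1 x) =
      (D.1 x + (2 - 6 * M * ‖x.1‖⁻¹) * G.1 x) * D.1 x
    rw [hx, hκ]; ring
  have h3 : κ * sI hM hR (D * D) ≤ sI hM hR (F * D) := by
    rcases le_total 0 (2 - 3 * κ) with hs | hs
    · nlinarith
    · nlinarith
  have h4 : sI hM hR (F * D) ≤ B ^ 2 / (2 * κ) * area + κ / 2 * sI hM hR (D * D) := by
    rw [← sI_const_mul, ← sI_const hM hR, ← map_add]
    refine sI_mono hM hR fun x hx => ?_
    change F.1 x * D.1 x ≤ B ^ 2 / (2 * κ) + κ / 2 * (D.1 x * D.1 x)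
    have h5 := hF x hx
    have h6 : F.1 x * D.1 x ≤ B * |D.1 x| := by
      calc _ ≤ |F.1 x * D.1 x| := le_abs_self _
        _ = |F.1 x| * |D.1 x| := abs_mul _ _
        _ ≤ _ := by gcongr
    have h7 : B ^ 2 / (2 * κ) + κ / 2 * (D.1 x * D.1 x) - B * |D.1 x| =
        (B - κ * |D.1 x|) ^ 2 / (2 * κ) := by
      rw [← abs_mul_abs_self (D.1 x)]; field_simp; ring
    have : 0 ≤ (B - κ * |D.1 x|) ^ 2 / (2 * κ) := by positivity
    linarith
  have h5 : sI hM hR (D * D) ≤ (B / κ) ^ 2 * area := by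
    have h6 : κ / 2 * sI hM hR (D * D) ≤ B ^ 2 / (2 * κ) * area := by linarith
    have h7 : B ^ 2 / (2 * κ) * area = κ / 2 * ((B / κ) ^ 2 * area) := by field_simp
    rw [h7] at h6
    exact le_of_mul_le_mul_left h6 (by positivity)
  set lam := B / κ with hlam
  have hlam0 : 0 < lam := by positivity
  have h6 := abs_le_of_lap_sq hM hR (algebraMap ℝ _ lam⁻¹ * G)
    (by rw [sI_const_mul, hG, mul_zero]) x₀ hx₀
  have e2 : algebraMap ℝ (Sm (ext M)) lam⁻¹ * D * (algebraMap ℝ _ lam⁻¹ * D) =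
      algebraMap ℝ _ (lam⁻¹ * lam⁻¹) * (D * D) := by rw [map_mul]; ring
  rw [lap_const_mul, ← hD, e2, Sm.abs_const_mul_apply (inv_pos.2 hlam0), sI_const_mul] at h6
  have h7 : lam⁻¹ * lam⁻¹ * sI hM hR (D * D) ≤ area := by
    calc _ ≤ lam⁻¹ * lam⁻¹ * (lam ^ 2 * area) := by gcongr
      _ = area := by field_simp
  have h8 : lam⁻¹ * |G.1 x₀| * area ≤ 201 * area := by linarith
  have h9 := le_of_mul_le_mul_right h8 hA
  rw [inv_mul_le_iff₀ hlam0] at h9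
  calc |G.1 x₀| ≤ lam * 201 := h9
    _ = _ := by rw [hlam, hκ]; field_simp

end SupBounds

end LinearisedGravity

end

noncomputable section

set_option linter.unusedSimpArgs false

namespace LinearisedGravity

open MeasureTheory

/-! ## Families of functions with weighted derivative bounds -/

section Families

variable {M : ℝ} {ι : Type*}

/-- `|f_i| ≤ B C_i r^{-q}` on `Σ`, for smooth functions `f_i`. -/
def Wt (M : ℝ) {ι : Type*} (C : ι → ℝ) (q : ℝ) (F : ι → Space → ℝ) : Prop :=
  (∀ i, ContDiffOn ℝ ∞ (F i) (ext M)) ∧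
    ∃ B, 0 ≤ B ∧ ∀ i, ∀ x ∈ ext M, |F i x| ≤ B * C i * ‖x‖ ^ (-q)

/-- `|∂^α f_i| ≤ B C_i r^{-q-|α|}` on `Σ` for `|α| ≤ m`, for smooth functions `f_i`. -/
def SO (M : ℝ) {ι : Type*} (C : ι → ℝ) : ℕ → ℝ → (ι → Space → ℝ) → Prop
  | 0, q, F => Wt M C q F
  | m + 1, q, F => Wt M C q F ∧ ∀ j, SO M C m (q + 1) (fun i => ds M j (F i))

variable {C : ι → ℝ} {m : ℕ} {q q₁ q₂ : ℝ} {F G : ι → Space → ℝ}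

theorem SO.wt (h : SO M C m q F) : Wt M C q F := by
  cases m with
  | zero => exact h
  | succ m => exact h.1

theorem SO.smooth (h : SO M C m q F) (i : ι) : ContDiffOn ℝ ∞ (F i) (ext M) := h.wt.1 i

theorem SO.ds (h : SO M C (m + 1) q F) (j : Fin 3) : SO M C m (q + 1) (fun i => ds M j (F i)) :=
  h.2 j

theorem SO.congr (h : SO M C m q F) (hFG : ∀ i, ∀ x ∈ ext M, G i x = F i x) : SO M C m q G := by
  have hw : ∀ {q} {F G : ι → Space → ℝ}, Wt M C q F → (∀ i, ∀ x ∈ ext M, G i x = F i x) →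
      Wt M C q G := fun h hFG => by
    obtain ⟨h1, B, hB, h2⟩ := h
    exact ⟨fun i => (h1 i).congr (hFG i), B, hB, fun i x hx => by rw [hFG i x hx]; exact h2 i x hx⟩
  induction m generalizing q F G with
  | zero => exact hw h hFG
  | succ m ih => exact ⟨hw h.1 hFG, fun j => ih (h.2 j) fun i x hx => dd_congr (hFG i) hx⟩

theorem SO.of_succ (h : SO M C (m + 1) q F) : SO M C m q F := by
  induction m generalizing q F with
  | zero => exact h.1
  | succ m ih => exact ⟨h.1, fun j => ih (h.2 j)⟩

theorem SO.mono {m' : ℕ} (h : SO M C m q F) (hm : m' ≤ m) : SO M C m' q F := by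
  induction hm with
  | refl => exact h
  | step _ ih => exact ih h.of_succ

theorem SO.weaken (hM : 0 < M) (h : SO M C m q F) (hq : q₁ ≤ q) : SO M C m q₁ F := by
  have hw : ∀ {q q₁} {F : ι → Space → ℝ}, q₁ ≤ q → Wt M C q F → Wt M C q₁ F :=
    fun {q q₁ F} hq h => by
      obtain ⟨h1, B, hB, h2⟩ := h
      refine ⟨h1, B * (2 * M) ^ (q₁ - q), by positivity, fun i x hx => (h2 i x hx).trans ?_⟩
      have hx0 := norm_pos_of_mem_ext hM hx
      have h3 : 0 ≤ B * C i :=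
        nonneg_of_mul_nonneg_left ((abs_nonneg _).trans (h2 i x hx)) (by positivity)
      have h4 : ‖x‖ ^ (-q) = ‖x‖ ^ (q₁ - q) * ‖x‖ ^ (-q₁) := by
        rw [← Real.rpow_add hx0]; congr 1; ring
      have h5 : ‖x‖ ^ (q₁ - q) ≤ (2 * M) ^ (q₁ - q) :=
        Real.rpow_le_rpow_of_nonpos (by linarith) hx (by linarith)
      calc B * C i * ‖x‖ ^ (-q) = (B * C i) * (‖x‖ ^ (q₁ - q) * ‖x‖ ^ (-q₁)) := by rw [h4]
        _ ≤ (B * C i) * ((2 * M) ^ (q₁ - q) * ‖x‖ ^ (-q₁)) := by gcongr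
        _ = _ := by ring
  induction m generalizing q q₁ F with
  | zero => exact hw hq h
  | succ m ih => exact ⟨hw hq h.1, fun j => ih (h.2 j) (by linarith)⟩

theorem SO.add (hM : 0 < M) (hF : SO M C m q F) (hG : SO M C m q G) :
    SO M C m q (fun i x => F i x + G i x) := by
  have hw : ∀ {q} {F G : ι → Space → ℝ}, Wt M C q F → Wt M C q G →
      Wt M C q (fun i x => F i x + G i x) := by
    rintro q F G ⟨h1, B, hB, h2⟩ ⟨h3, B', hB', h4⟩
    refine ⟨fun i => (h1 i).add (h3 i), B + B', by positivity, fun i x hx => ?_⟩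
    refine (abs_add_le _ _).trans ?_
    have := h2 i x hx; have := h4 i x hx
    calc _ ≤ B * C i * ‖x‖ ^ (-q) + B' * C i * ‖x‖ ^ (-q) := by linarith
      _ = _ := by ring
  induction m generalizing q F G with
  | zero => exact hw hF hG
  | succ m ih =>
    exact ⟨hw hF.1 hG.1, fun j => (ih (hF.2 j) (hG.2 j)).congr fun i x hx =>
      dd_add (goodSet_ext hM) (hF.smooth i) (hG.smooth i) hx⟩

theorem SO.mul' (hM : 0 < M) {D : ι → ℝ} (hF : SO M C m q₁ F) (hG : SO M D m q₂ G) :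
    SO M (fun i => C i * D i) m (q₁ + q₂) (fun i x => F i x * G i x) := by
  have hw : ∀ {q₁ q₂} {F G : ι → Space → ℝ}, Wt M C q₁ F → Wt M D q₂ G →
      Wt M (fun i => C i * D i) (q₁ + q₂) (fun i x => F i x * G i x) := by
    rintro q₁ q₂ F G ⟨h1, B, hB, h2⟩ ⟨h3, B', hB', h4⟩
    refine ⟨fun i => (h1 i).mul (h3 i), B * B', by positivity, fun i x hx => ?_⟩
    have hx0 := norm_pos_of_mem_ext hM hx
    rw [abs_mul]
    calc _ ≤ (B * C i * ‖x‖ ^ (-q₁)) * (B' * D i * ‖x‖ ^ (-q₂)) :=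
          mul_le_mul (h2 i x hx) (h4 i x hx) (abs_nonneg _) ((abs_nonneg _).trans (h2 i x hx))
      _ = B * B' * (C i * D i) * (‖x‖ ^ (-q₁) * ‖x‖ ^ (-q₂)) := by ring
      _ = _ := by rw [← Real.rpow_add hx0]; congr 2; ring
  induction m generalizing q₁ q₂ F G with
  | zero => exact hw hF hG
  | succ m ih =>
    refine ⟨hw hF.1 hG.1, fun j => ?_⟩
    have h1 := ih hF.of_succ (hG.2 j)
    have h2 := ih (hF.2 j) hG.of_succ
    rw [show q₁ + (q₂ + 1) = q₁ + q₂ + 1 by ring] at h1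
    rw [show q₁ + 1 + q₂ = q₁ + q₂ + 1 by ring] at h2
    refine (h1.add hM h2).congr fun i x hx => ?_
    refine (dd_mul (goodSet_ext hM) (hF.smooth i) (hG.smooth i) hx).trans ?_
    simp only [LinearisedGravity.ds]; ring

theorem SO.of_one_mul (h : SO M (fun i => 1 * C i) m q F) : SO M C m q F := by
  simpa only [one_mul] using h

theorem SO.zero : SO M C m q (fun _ _ => 0) := by
  have hw : ∀ q, Wt M C q (fun _ _ => 0) := fun q => ⟨fun _ => contDiffOn_const, 0, le_rfl, by simp⟩
  induction m generalizing q with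
  | zero => exact hw q
  | succ m ih => exact ⟨hw q, fun j => ih.congr fun _ x _ => dd_const _⟩

theorem SO.sum (hM : 0 < M) {κ : Type*} (s : Finset κ) {F : κ → ι → Space → ℝ}
    (hF : ∀ k ∈ s, SO M C m q (F k)) : SO M C m q (fun i x => ∑ k ∈ s, F k i x) := by
  classical
  induction s using Finset.induction_on with
  | empty => simpa using SO.zero
  | insert a s ha ih =>
    simp only [Finset.sum_insert ha]
    exact (hF a (by simp)).add hM (ih fun k hk => hF k (by simp [hk]))

/-- Symbols of order `-q`. -/
def Sy (M : ℝ) (q : ℝ) (g : Space → ℝ) : Prop :=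
  ∀ m, SO M (fun _ : Unit => (1 : ℝ)) m q (fun _ => g)

variable {f g : Space → ℝ}

theorem Sy.so (hg : Sy M q g) (m : ℕ) : SO M (fun _ : ι => (1 : ℝ)) m q (fun _ => g) := by
  have key : ∀ {g : Space → ℝ} {q : ℝ}, SO M (fun _ : Unit => (1 : ℝ)) m q (fun _ => g) →
      SO M (fun _ : ι => (1 : ℝ)) m q (fun _ => g) := by
    have hw : ∀ {g : Space → ℝ} {q : ℝ}, Wt M (fun _ : Unit => (1 : ℝ)) q (fun _ => g) →
        Wt M (fun _ : ι => (1 : ℝ)) q (fun _ => g) := by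
      rintro g q ⟨h1, B, hB, h2⟩
      exact ⟨fun _ => h1 (), B, hB, fun _ => h2 ()⟩
    induction m with
    | zero => exact hw
    | succ m ih => exact fun h => ⟨hw h.1, fun j => ih (h.2 j)⟩
  exact key (hg m)

theorem Sy.smooth (hg : Sy M q g) : ContDiffOn ℝ ∞ g (ext M) := (hg 0).smooth ()

theorem Sy.congr (hg : Sy M q g) (h : ∀ x ∈ ext M, f x = g x) : Sy M q f := fun m =>
  (hg m).congr fun _ => h

theorem Sy.weaken (hM : 0 < M) (hg : Sy M q g) (h : q₁ ≤ q) : Sy M q₁ g := fun m => (hg m).weaken hM h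

theorem Sy.ds (hg : Sy M q g) (j : Fin 3) : Sy M (q + 1) (ds M j g) := fun m => (hg (m + 1)).2 j

theorem Sy.add (hM : 0 < M) (hf : Sy M q f) (hg : Sy M q g) : Sy M q (fun x => f x + g x) := fun m =>
  (hf m).add hM (hg m)

theorem Sy.mul (hM : 0 < M) (hf : Sy M q₁ f) (hg : Sy M q₂ g) (hq : q ≤ q₁ + q₂) :
    Sy M q (fun x => f x * g x) := fun m =>
  (((hf m).mul' hM (hg m)).of_one_mul).weaken hM hq

theorem SO.mul (hM : 0 < M) (hg : Sy M q₁ g) (hF : SO M C m q₂ F) (hq : q ≤ q₁ + q₂) :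
    SO M C m q (fun i x => g x * F i x) :=
  ((hg.so m).mul' hM hF).of_one_mul.weaken hM hq

theorem sy_const (hM : 0 < M) (c : ℝ) : Sy M 0 (fun _ => c) := by
  have hw : Wt M (fun _ : Unit => (1 : ℝ)) 0 (fun _ _ => c) :=
    ⟨fun _ => contDiffOn_const, |c|, abs_nonneg c, by simp⟩
  rintro (_ | m)
  · exact hw
  · exact ⟨hw, fun j => SO.zero.congr fun _ x _ => dd_const _⟩

theorem sy_zero : Sy M q (fun _ => 0) := fun _ => SO.zero

theorem Sy.const_mul (hM : 0 < M) (c : ℝ) (hg : Sy M q g) : Sy M q (fun x => c * g x) :=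
  (sy_const hM c).mul hM hg (by linarith)

theorem Sy.neg (hM : 0 < M) (hg : Sy M q g) : Sy M q (fun x => -g x) := by
  simpa using hg.const_mul hM (-1)

theorem Sy.sub (hM : 0 < M) (hf : Sy M q f) (hg : Sy M q g) : Sy M q (fun x => f x - g x) := by
  simpa [sub_eq_add_neg] using hf.add hM (hg.neg hM)

theorem Sy.sum (hM : 0 < M) {κ : Type*} (s : Finset κ) {g : κ → Space → ℝ}
    (hg : ∀ k ∈ s, Sy M q (g k)) : Sy M q (fun x => ∑ k ∈ s, g k x) := fun m =>
  SO.sum hM s fun k hk => hg k hk m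

theorem SO.const_mul (hM : 0 < M) (c : ℝ) (hF : SO M C m q F) : SO M C m q (fun i x => c * F i x) :=
  hF.mul hM (sy_const hM c) (by linarith)

theorem SO.neg (hM : 0 < M) (hF : SO M C m q F) : SO M C m q (fun i x => -F i x) := by
  simpa using hF.const_mul hM (-1)

theorem SO.sub (hM : 0 < M) (hF : SO M C m q F) (hG : SO M C m q G) :
    SO M C m q (fun i x => F i x - G i x) := by
  simpa [sub_eq_add_neg] using hF.add hM (hG.neg hM)

/-! ### The symbols of the Schwarzschild metric -/

theorem dd_comp_real {E : Type*} [NormedAddCommGroup E] [NormedSpace ℝ E] {s : Set E}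
    (hs : GoodSet s) {φ : ℝ → ℝ} {φ' : ℝ} {f : E → ℝ} {x v : E} (hf : ContDiffOn ℝ ∞ f s)
    (hx : x ∈ s) (hφ : HasDerivAt φ φ' (f x)) : dd s v (fun y => φ (f y)) x = φ' * dd s v f x := by
  have h := hφ.comp_hasFDerivWithinAt x (hf.differentiableOn (by simp) x hx).hasFDerivWithinAt
  rw [dd, show (fun y => φ (f y)) = φ ∘ f from rfl, h.fderivWithin (hs.unique x hx)]
  rfl

theorem ds_coord (hM : 0 < M) (i j : Fin 3) {x : Space} (hx : x ∈ ext M) :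
    ds M i (fun y => y j) x = if i = j then 1 else 0 := by
  have h := congrArg (fun g => g.1 ⟨x, hx⟩) (dS_XS hM i j)
  simp only [XS, dS_mk_apply] at h
  rw [h]; split_ifs <;> rfl

theorem ds_norm (hM : 0 < M) (i : Fin 3) {x : Space} (hx : x ∈ ext M) :
    ds M i (fun y => ‖y‖) x = x i * ‖x‖⁻¹ := by
  have h := congrArg (fun g => g.1 ⟨x, hx⟩) (dS_rS hM i)
  simp only [rS, dS_mk_apply] at h
  rw [h]; rfl

theorem sy_coord (hM : 0 < M) (i : Fin 3) : Sy M (-1) (fun x => x i) := by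
  have hw : Wt M (fun _ : Unit => (1 : ℝ)) (-1) (fun _ x => x i) :=
    ⟨fun _ => (contDiff_coord i).contDiffOn, 1, zero_le_one, fun _ x _ => by
      simpa using PiLp.norm_apply_le x i⟩
  rintro (_ | m)
  · exact hw
  · refine ⟨hw, fun j => ?_⟩
    rw [show (-1 : ℝ) + 1 = 0 by norm_num]
    exact (sy_const hM (if j = i then 1 else 0) m).congr fun _ x hx => ds_coord hM j i hx

theorem sy_rpow (hM : 0 < M) (p : ℝ) : Sy M (-p) (fun x => ‖x‖ ^ p) := by
  have hw : ∀ p, Wt M (fun _ : Unit => (1 : ℝ)) (-p) (fun _ x => ‖x‖ ^ p) := fun p =>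
    ⟨fun _ => contDiffOn_norm_rpow hM p, 1, zero_le_one, fun _ x hx => by
      rw [abs_of_nonneg (by positivity)]; simp⟩
  intro m
  induction m generalizing p with
  | zero => exact hw p
  | succ m ih =>
    refine ⟨hw p, fun j => ?_⟩
    have h := ((ih (p - 2)).mul hM (sy_coord hM j) (q := -p + 1) (by linarith)).const_mul hM p
    refine h.congr fun _ x hx => ?_
    have hx0 := norm_pos_of_mem_ext hM hx
    refine (dd_comp_real (goodSet_ext hM) (contDiffOn_norm_ext hM) hx
      (Real.hasDerivAt_rpow_const (Or.inl hx0.ne'))).trans ?_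
    have := ds_norm hM j hx
    simp only [LinearisedGravity.ds] at this
    rw [this, show p - 1 = (p - 2) + 1 by ring, Real.rpow_add_one hx0.ne']
    field_simp

theorem sy_norm (hM : 0 < M) : Sy M (-1) (fun x => ‖x‖) := by
  simpa using sy_rpow hM 1

theorem sy_norm_inv (hM : 0 < M) : Sy M 1 (fun x => ‖x‖⁻¹) := by
  simpa [Real.rpow_neg_one] using sy_rpow hM (-1)

theorem sy_xhat (hM : 0 < M) (i : Fin 3) : Sy M 0 (fun x => xhat x i) :=
  ((sy_coord hM i).mul hM (sy_norm_inv hM) (by norm_num)).congr fun _ _ => div_eq_mul_inv _ _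

theorem sy_mu (hM : 0 < M) : Sy M 1 (mu M) :=
  ((sy_norm_inv hM).const_mul hM (2 * M)).congr fun _ _ => div_eq_mul_inv _ _

theorem mu_pos (hM : 0 < M) {x : Space} (hx : x ∈ ext M) : 0 < mu M x :=
  div_pos (by linarith) (norm_pos_of_mem_ext hM hx)

theorem mu_le_one (hM : 0 < M) {x : Space} (hx : x ∈ ext M) : mu M x ≤ 1 :=
  (div_le_one (norm_pos_of_mem_ext hM hx)).2 hx

theorem sy_one_add_mu_rpow (hM : 0 < M) (p : ℝ) : Sy M 0 (fun x => (1 + mu M x) ^ p) := by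
  have hs : Sy M 0 (fun x => 1 + mu M x) :=
    (sy_const hM 1).add hM ((sy_mu hM).weaken hM zero_le_one)
  have hw : ∀ p : ℝ, Wt M (fun _ : Unit => (1 : ℝ)) 0 (fun _ x => (1 + mu M x) ^ p) := fun p =>
    ⟨fun _ => hs.smooth.rpow_const_of_ne fun x hx => by linarith [mu_pos hM hx],
      2 ^ |p|, by positivity, fun _ x hx => by
      have h1 := mu_pos hM hx
      have h2 := mu_le_one hM hx
      rw [abs_of_nonneg (by positivity), neg_zero, Real.rpow_zero, mul_one, mul_one]
      calc (1 + mu M x) ^ p ≤ (1 + mu M x) ^ |p| :=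
            Real.rpow_le_rpow_of_exponent_le (by linarith) (le_abs_self p)
        _ ≤ 2 ^ |p| := Real.rpow_le_rpow (by linarith) (by linarith) (abs_nonneg p)⟩
  intro m
  induction m generalizing p with
  | zero => exact hw p
  | succ m ih =>
    refine ⟨hw p, fun j => ?_⟩
    have h := (((ih (p - 1)).mul hM (hs.ds j) (q := 0 + 1) (by linarith))).const_mul hM p
    refine h.congr fun _ x hx => ?_
    refine (dd_comp_real (goodSet_ext hM) hs.smooth hx
      (Real.hasDerivAt_rpow_const (Or.inl (by linarith [mu_pos hM hx])))).trans ?_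
    simp only [LinearisedGravity.ds]; ring

theorem sy_hbar (hM : 0 < M) : Sy M 0 (hbar M) :=
  (sy_one_add_mu_rpow hM (1 / 2)).congr fun _ _ => Real.sqrt_eq_rpow _

theorem hbar_pos (hM : 0 < M) {x : Space} (hx : x ∈ ext M) : 0 < hbar M x :=
  Real.sqrt_pos.2 (by linarith [mu_pos hM hx])

theorem hbar_sq (hM : 0 < M) {x : Space} (hx : x ∈ ext M) : hbar M x ^ 2 = 1 + mu M x :=
  Real.sq_sqrt (by linarith [mu_pos hM hx])

theorem sy_hbar_inv (hM : 0 < M) : Sy M 0 (fun x => (hbar M x)⁻¹) :=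
  (sy_one_add_mu_rpow hM (-(1 / 2))).congr fun x hx => by
    rw [Real.rpow_neg (by linarith [mu_pos hM hx]), hbar, Real.sqrt_eq_rpow]

theorem sy_proj (hM : 0 < M) (i j : Fin 3) : Sy M 0 (fun x => proj x i j) :=
  (sy_const hM _).sub hM ((sy_xhat hM i).mul hM (sy_xhat hM j) (by norm_num))

theorem areaForm_eq (x : Space) (i j : Fin 3) : areaForm x i j =
    ![![0, xhat x 2, -xhat x 1], ![-xhat x 2, 0, xhat x 0], ![xhat x 1, -xhat x 0, 0]] i j := by
  have h := Matrix.det_fin_three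
    (Matrix.of ![Pi.single i (1 : ℝ), Pi.single j (1 : ℝ), xhat x])
  refine Eq.trans h ?_
  fin_cases i <;> fin_cases j <;> simp

theorem sy_areaForm (hM : 0 < M) (i j : Fin 3) : Sy M 0 (fun x => areaForm x i j) := by
  have h := sy_xhat hM
  have h0 : Sy M 0 (fun _ => 0) := sy_zero
  simp only [areaForm_eq]
  fin_cases i <;> fin_cases j <;> simp [h, h0, (h _).neg hM]

end Families

end LinearisedGravity

end

noncomputable section

set_option linter.unusedSimpArgs false

namespace LinearisedGravity

open MeasureTheory

/-! ## Comparison with the norms `|𝔇^m T|` -/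

section Projection

variable {A : Type*} [CommRing A]

theorem sum_cons {k : ℕ} (f : (Fin (k + 1) → Fin 3) → A) :
    ∑ J, f J = ∑ j, ∑ J' : Fin k → Fin 3, f (Fin.cons j J') := by
  rw [← Fintype.sum_prod_type', ← (Fin.consEquiv fun _ => Fin 3).sum_comp]
  rfl

theorem sum_proj_mul (y : Fin 3 → A) (i : Fin 3) (f : Fin 3 → A) :
    ∑ j, ((if i = j then 1 else 0) - y i * y j) * f j = f i - y i * ∑ j, y j * f j := by
  simp only [sub_mul, Finset.sum_sub_distrib, ite_mul, one_mul, zero_mul, Finset.sum_ite_eq,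
    Finset.mem_univ, if_true, Finset.mul_sum, mul_assoc]

/-- Tangential projection of a tensor whose radial contractions are those of the derivative of a
tangential tensor. -/
theorem sum_prod_proj {k : ℕ} (y : Fin 3 → A) (c : Fin 3) (V T : (Fin k → Fin 3) → A)
    (hT : ∀ m I, ∑ i, y i * T (Function.update I m i) = 0)
    (hV : ∀ m I, ∑ i, y i * V (Function.update I m i) = -T (Function.update I m c))
    (I : Fin k → Fin 3) :
    ∑ J, (∏ m, ((if I m = J m then 1 else 0) - y (I m) * y (J m))) * V J =
      V I + ∑ m, y (I m) * T (Function.update I m c) := by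
  induction k with
  | zero =>
    simp only [Finset.univ_unique, Finset.univ_eq_empty, Finset.prod_empty, one_mul,
      Finset.sum_singleton, Finset.sum_empty, add_zero]
    congr 1
    exact Subsingleton.elim _ _
  | succ k ih =>
    have hT' : ∀ j m I, ∑ i, y i * T (Fin.cons j (Function.update I m i)) = 0 := fun j m I => by
      have := hT m.succ (Fin.cons j I)
      simpa only [Fin.cons_update] using this
    have hV' : ∀ j m I, ∑ i, y i * V (Fin.cons j (Function.update I m i)) =
        -T (Fin.cons j (Function.update I m c)) := fun j m I => by
      have := hV m.succ (Fin.cons j I)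
      simpa only [Fin.cons_update] using this
    have h0 : ∀ I', ∑ i, y i * T (Fin.cons i I') = 0 := fun I' => by
      simpa only [Fin.update_cons_zero] using hT 0 (Fin.cons 0 I')
    have hV0 : ∀ I', ∑ i, y i * V (Fin.cons i I') = -T (Fin.cons c I') := fun I' => by
      simpa only [Fin.update_cons_zero] using hV 0 (Fin.cons 0 I')
    obtain ⟨i₀, I', rfl⟩ : ∃ i₀ I', I = Fin.cons i₀ I' := ⟨I 0, Fin.tail I, (Fin.cons_self_tail I).symm⟩
    rw [Fin.sum_univ_succ, sum_cons]
    simp only [Fin.prod_univ_succ, Fin.cons_zero, Fin.cons_succ, mul_assoc, ← Finset.mul_sum]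
    have e := fun j => ih (fun J => V (Fin.cons j J)) (fun J => T (Fin.cons j J)) (hT' j) (hV' j) I'
    simp only [e, sum_proj_mul, Fin.update_cons_zero, Fin.cons_zero, Fin.cons_succ,
      ← Fin.cons_update]
    simp only [mul_add (y _), Finset.sum_add_distrib, hV0]
    have h3 : ∑ j, ∑ m, y j * (y (I' m) * T (Fin.cons j (Function.update I' m c))) = 0 := by
      rw [Finset.sum_comm]
      refine Finset.sum_eq_zero fun m _ => ?_
      have := congrArg (fun z => y (I' m) * z) (h0 (Function.update I' m c))
      simp only [Finset.mul_sum, mul_zero] at this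
      rw [← this]
      exact Finset.sum_congr rfl fun j _ => by ring
    rw [Finset.sum_congr rfl fun j _ => Finset.mul_sum _ _ _, h3]; ring

end Projection

section Tensors

variable {M : ℝ} (hM : 0 < M) {k : ℕ}

theorem euler_del (i : Fin 3) (f : Sm (ext M)) :
    euler hM (RotAlg.del (rot hM) (yS hM) i f) = RotAlg.del (rot hM) (yS hM) i (euler hM f) := by
  fin_cases i <;>
    simp only [Fin.zero_eta, Fin.mk_one, Fin.reduceFinMk, RotAlg.del_zero, RotAlg.del_one,
      RotAlg.del_two, map_sub, Derivation.leibniz, smul_eq_mul, euler_yS, rot_euler] <;> ring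

theorem dS_eq_del (i : Fin 3) (f : Sm (ext M)) :
    dS hM i f = qS hM * (yS hM i * euler hM f + RotAlg.del (rot hM) (yS hM) i f) := by
  obtain ⟨h0, h1, h2⟩ := dS_eq hM f
  fin_cases i <;>
    simp only [Fin.zero_eta, Fin.mk_one, Fin.reduceFinMk, RotAlg.del_zero, RotAlg.del_one,
      RotAlg.del_two]
  · rw [h0]; ring
  · rw [h1]; ring
  · rw [h2]; ring

/-- The function `(1 + μ)^{-1/2}`. -/
def lapseS : Sm (ext M) := Sm.mk (fun x => (hbar M x)⁻¹) (sy_hbar_inv hM).smooth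

/-- The projection onto the spheres. -/
def projS (i j : Fin 3) : Sm (ext M) := (if i = j then 1 else 0) - yS hM i * yS hM j

theorem projS_apply (i j : Fin 3) (x : ext M) : (projS hM i j).1 x = proj x i j := by
  have h : (yS hM i * yS hM j).1 x = xhat x i * xhat x j := by
    change x.1 i * ‖x.1‖⁻¹ * (x.1 j * ‖x.1‖⁻¹) = _
    simp only [xhat, div_eq_mul_inv]
  have h2 : (projS hM i j).1 x = (if i = j then (1 : Sm (ext M)) else 0).1 x
    - (yS hM i * yS hM j).1 x := rfl
  rw [h2, h, proj]
  split_ifs <;> rfl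

theorem yS_apply' (i : Fin 3) (x : ext M) : (yS hM i).1 x = xhat x i := by
  change x.1 i * ‖x.1‖⁻¹ = _
  simp only [xhat, div_eq_mul_inv]

/-- `r ∇̸_ν` on smooth tensors. -/
def rNuS (T : (Fin k → Fin 3) → Sm (ext M)) : (Fin k → Fin 3) → Sm (ext M) := fun I =>
  lapseS hM * euler hM (T I)

/-- `r ∇̸` on smooth tensors. -/
def rAngS (T : (Fin k → Fin 3) → Sm (ext M)) : (Fin (k + 1) → Fin 3) → Sm (ext M) := fun I =>
  ∑ J, (∏ m, projS hM (I m.succ) (J m)) * RotAlg.del (rot hM) (yS hM) (I 0) (T J)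

theorem rot_lapseS (j : Fin 3) : rot hM j (lapseS hM) = 0 := by
  have h2 : lapseS hM * lapseS hM * (1 + algebraMap ℝ _ (2 * M) * qS hM) = 1 := by
    refine Sm.ext' fun x => ?_
    change (hbar M x.1)⁻¹ * (hbar M x.1)⁻¹ * (1 + 2 * M * ‖x.1‖⁻¹) = 1
    have h3 := hbar_sq hM x.2
    have h4 := (hbar_pos hM x.2).ne'
    rw [mu, div_eq_mul_inv] at h3
    rw [← h3]; field_simp
  have h3 := congrArg (rot hM j) h2
  simp only [Derivation.leibniz, smul_eq_mul, map_add, rot_qS, Derivation.map_algebraMap,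
    Derivation.map_one_eq_zero, mul_zero, add_zero] at h3
  have h4 : (2 : ℝ) • rot hM j (lapseS hM) = 0 := by
    rw [ofNat_smul_eq_nsmul, two_nsmul]
    linear_combination lapseS hM * h3 - 2 * rot hM j (lapseS hM) * h2
  exact (smul_eq_zero.1 h4).resolve_left two_ne_zero

theorem rAngS_rNuS (T : (Fin k → Fin 3) → Sm (ext M)) :
    rAngS hM (rNuS hM T) = rNuS hM (rAngS hM T) := by
  have hl : ∀ i, RotAlg.del (rot hM) (yS hM) i (lapseS hM) = 0 := fun i => by
    fin_cases i <;> simp [RotAlg.del_zero, RotAlg.del_one, RotAlg.del_two, rot_lapseS hM]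
  have hp : ∀ i j, euler hM (projS hM i j) = 0 := fun i j => by
    rw [projS, map_sub, Derivation.leibniz, euler_yS, euler_yS]
    split_ifs <;> simp
  have hpp : ∀ (I J : Fin k → Fin 3), euler hM (∏ m, projS hM (I m) (J m)) = 0 := fun I J =>
    Finset.prod_induction _ (fun w => euler hM w = 0)
      (fun a b ha hb => by rw [Derivation.leibniz, ha, hb]; simp) (by simp) (fun m _ => hp _ _)
  funext I
  simp only [rAngS, rNuS, map_sum, Derivation.leibniz, smul_eq_mul, hl, euler_del,
    hpp (fun m => I m.succ), mul_zero, add_zero, Finset.mul_sum]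
  exact Finset.sum_congr rfl fun J _ => by ring

/-- Tangential tensors. -/
def AngS (T : (Fin k → Fin 3) → Sm (ext M)) : Prop :=
  ∀ m I, ∑ i, yS hM i * T (Function.update I m i) = 0

theorem AngS.rNuS {T : (Fin k → Fin 3) → Sm (ext M)} (h : AngS hM T) : AngS hM (rNuS hM T) := by
  intro m I
  have := congrArg (fun z => lapseS hM * euler hM z) (h m I)
  simp only [map_sum, Derivation.leibniz, smul_eq_mul, euler_yS, mul_zero, add_zero, map_zero,
    Finset.mul_sum] at this
  rw [← this]
  exact Finset.sum_congr rfl fun i _ => by simp only [LinearisedGravity.rNuS]; ring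

theorem sum_y_projS (j : Fin 3) : ∑ i, yS hM i * projS hM i j = 0 := by
  have h := (rotAlg hM).sq
  simp only [projS, mul_sub, Finset.sum_sub_distrib, mul_ite, mul_one, mul_zero, Finset.sum_ite_eq',
    Finset.mem_univ, if_true, Fin.sum_univ_three]
  linear_combination (-yS hM j) * h

theorem angS_rAngS (T : (Fin k → Fin 3) → Sm (ext M)) : AngS hM (rAngS hM T) := by
  intro m
  refine Fin.cases ?_ (fun m => ?_) m
  · intro I
    simp only [rAngS, Function.update_self, ne_eq, Fin.succ_ne_zero, not_false_eq_true,
      Function.update_of_ne, Finset.mul_sum]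
    rw [Finset.sum_comm]
    refine Finset.sum_eq_zero fun J _ => ?_
    have := congrArg (fun z => (∏ m : Fin k, projS hM (I m.succ) (J m)) * z)
      (RotAlg.y_del (Ω := rot hM) (y := yS hM) (T J))
    rw [Fin.sum_univ_three]
    rw [mul_zero] at this
    rw [← this]; ring
  · intro I
    simp only [rAngS, ne_eq, (Fin.succ_ne_zero _).symm, not_false_eq_true, Function.update_of_ne,
      Finset.mul_sum]
    rw [Finset.sum_comm]
    refine Finset.sum_eq_zero fun J _ => ?_
    have e : ∀ i, ∏ l : Fin k, projS hM (Function.update I m.succ i l.succ) (J l) =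
        projS hM i (J m) * ∏ l ∈ Finset.univ.erase m, projS hM (I l.succ) (J l) := fun i => by
      rw [← Finset.mul_prod_erase _ _ (Finset.mem_univ m), Function.update_self]
      congr 1
      refine Finset.prod_congr rfl fun l hl => ?_
      rw [Function.update_of_ne (fun h => (Finset.mem_erase.1 hl).1 (Fin.succ_injective _ h))]
    have := congrArg (fun z => z * ((∏ l ∈ Finset.univ.erase m, projS hM (I l.succ) (J l)) *
      RotAlg.del (rot hM) (yS hM) (I 0) (T J))) (sum_y_projS hM (J m))
    simp only [Finset.sum_mul, zero_mul] at this
    rw [← this]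
    exact Finset.sum_congr rfl fun i _ => by rw [e]; ring

theorem del_eq_rAngS {T : (Fin k → Fin 3) → Sm (ext M)} (h : AngS hM T) (c : Fin 3)
    (I : Fin k → Fin 3) : RotAlg.del (rot hM) (yS hM) c (T I) =
      rAngS hM T (Fin.cons c I) - ∑ m, yS hM (I m) * T (Function.update I m c) := by
  have := sum_prod_proj (yS hM) c (fun J => RotAlg.del (rot hM) (yS hM) c (T J)) T h
    (fun m I => by
      have h1 := congrArg (RotAlg.del (rot hM) (yS hM) c) (h m I)
      simp only [map_sum, Derivation.leibniz, smul_eq_mul, (rotAlg hM).del_y, map_zero,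
        Finset.sum_add_distrib] at h1
      have h2 : ∑ i, T (Function.update I m i) * ((if c = i then 1 else 0) - yS hM c * yS hM i) =
          T (Function.update I m c) := by
        have := sum_proj_mul (yS hM) c fun i => T (Function.update I m i)
        rw [h m I, mul_zero, sub_zero] at this
        rw [← this]
        exact Finset.sum_congr rfl fun i _ => mul_comm _ _
      rw [h2] at h1
      exact eq_neg_of_add_eq_zero_left h1) I
  simp only [rAngS, Fin.cons_zero, Fin.cons_succ, projS]
  rw [this]; ring

end Tensors

end LinearisedGravity

end

noncomputable section

set_option linter.unusedSimpArgs false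

namespace LinearisedGravity

open MeasureTheory

section Comparison

variable {M : ℝ} (hM : 0 < M) {k : ℕ} {ι : Type*} {C : ι → ℝ} {m : ℕ} {q : ℝ}

/-- `S` represents the tensor field `T` on `Σ`. -/
def Reps (T : SField k) (S : (Fin k → Fin 3) → Sm (ext M)) : Prop :=
  ∀ (x : ext M) (I : Fin k → Fin 3), T x I = (S I).1 x

theorem SmoothS.reps {T : SField k} (hT : SmoothS M T) :
    Reps T (fun I => Sm.mk (fun x => T x I) (hT I)) := fun _ _ => rfl

theorem Reps.smooth {T : SField k} {S : (Fin k → Fin 3) → Sm (ext M)} (h : Reps T S) : SmoothS M T :=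
  fun I => (Sm.rep_smooth (S I)).congr fun x hx => by
    rw [h ⟨x, hx⟩ I, ← Sm.rep_apply]

theorem Reps.mk_eq {T : SField k} {S : (Fin k → Fin 3) → Sm (ext M)} (h : Reps T S) (I : Fin k → Fin 3) :
    Sm.mk (fun x => T x I) (h.smooth I) = S I := Sm.ext' fun x => h x I

theorem Reps.ds {T : SField k} {S : (Fin k → Fin 3) → Sm (ext M)} (h : Reps T S) (j : Fin 3)
    (x : ext M) (I : Fin k → Fin 3) : ds M j (fun y => T y I) x = (dS hM j (S I)).1 x := by
  rw [← h.mk_eq I, dS_mk_apply]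

theorem sum_coord_single (x : Space) : ∑ j, x j • EuclideanSpace.single j (1 : ℝ) = x := by
  ext i; fin_cases i <;> simp [Fin.sum_univ_three]

theorem fderivWithin_radial (f : Space → ℝ) (s : Set Space) (x : Space) (c : ℝ) :
    fderivWithin ℝ f s x (c • x) = c * ∑ j, x j * dd s (EuclideanSpace.single j 1) f x := by
  rw [map_smul, smul_eq_mul]
  congr 1
  conv_lhs => rw [← sum_coord_single x, map_sum]
  rw [sum_coord_single x]
  exact Finset.sum_congr rfl fun j _ => by rw [map_smul]; rfl

include hM in
theorem rNu_apply {x : Space} (hx : x ∈ ext M) (T : SField k) (I : Fin k → Fin 3) :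
    rNu M T x I = (hbar M x)⁻¹ * ∑ j, x j * ds M j (fun y => T y I) x := by
  have := norm_pos_of_mem_ext hM hx
  rw [rNu, nuD, fderivWithin_radial]
  simp only [ds]; field_simp

theorem rAng_apply (T : SField k) (x : Space) (I : Fin (k + 1) → Fin 3) :
    ‖x‖ * angD M T x I = ∑ J : Fin k → Fin 3, ∑ j, (∏ l, proj x (I (Fin.succ l)) (J l)) *
      (‖x‖ * (proj x (I 0) j * ds M j (fun y => T y J) x)) := by
  rw [angD, sum_cons, Finset.sum_comm, Finset.mul_sum]
  refine Finset.sum_congr rfl fun J _ => ?_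
  rw [Finset.mul_sum]
  refine Finset.sum_congr rfl fun j _ => ?_
  rw [Fin.prod_univ_succ]
  simp only [Fin.cons_zero, Fin.cons_succ, Fin.tail_cons, ds, dd]; ring

include hM in
theorem Reps.rNu {T : SField k} {S : (Fin k → Fin 3) → Sm (ext M)} (h : Reps T S) :
    Reps (rNu M T) (rNuS hM S) := fun x I => by
  refine (rNu_apply hM x.2 T I).trans ?_
  simp only [h.ds hM, Fin.sum_univ_three]
  rfl

include hM in
theorem Reps.rAng {T : SField k} {S : (Fin k → Fin 3) → Sm (ext M)} (h : Reps T S) :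
    Reps (fun x I => ‖x‖ * angD M T x I) (rAngS hM S) := fun x I => by
  refine (rAng_apply T x.1 I).trans ?_
  simp only [h.ds hM, rAngS, del_eq, Finset.mul_sum]
  rw [← Sm.ev_apply]
  simp only [map_sum, map_mul, map_prod, Sm.ev_apply, projS_apply, rS_apply]
  refine Finset.sum_congr rfl fun J _ => Finset.sum_congr rfl fun j _ => ?_
  rw [show (((if I 0 = j then 1 else 0) : Sm (ext M)) - yS hM (I 0) * yS hM j) = projS hM (I 0) j from rfl,
    projS_apply]

/-! ### From derivative bounds to `BoundedBy` -/

include hM in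
theorem SO.rNu {T : ι → SField k} (h : ∀ I, SO M C (m + 1) q fun i x => T i x I) (I : Fin k → Fin 3) :
    SO M C m q fun i x => rNu M (T i) x I := by
  have h1 : ∀ j, SO M C m q fun i x => x j * LinearisedGravity.ds M j (fun y => T i y I) x := fun j =>
    ((h I).ds j).mul hM (sy_coord hM j) (by linarith)
  exact ((SO.sum hM Finset.univ fun j _ => h1 j).mul hM (sy_hbar_inv hM) (by linarith)).congr
    fun i x hx => rNu_apply hM hx _ _

include hM in
theorem sy_prod {κ : Type*} (s : Finset κ) {g : κ → Space → ℝ} (hg : ∀ k ∈ s, Sy M 0 (g k)) :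
    Sy M 0 (fun x => ∏ k ∈ s, g k x) := by
  classical
  induction s using Finset.induction_on with
  | empty => simpa using sy_const hM 1
  | insert a s ha ih =>
    simp only [Finset.prod_insert ha]
    exact (hg a (by simp)).mul hM (ih fun k hk => hg k (by simp [hk])) (by norm_num)

include hM in
theorem SO.rAng {T : ι → SField k} (h : ∀ I, SO M C (m + 1) q fun i x => T i x I)
    (I : Fin (k + 1) → Fin 3) : SO M C m q fun i x => ‖x‖ * angD M (T i) x I := by
  refine (SO.sum hM (Finset.univ : Finset (Fin k → Fin 3)) fun J _ =>
    SO.sum hM (Finset.univ : Finset (Fin 3)) fun j _ =>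
      (((((h J).ds j).mul hM (sy_proj hM (I 0) j) (q := q + 1) (by linarith)).mul hM (sy_norm hM)
        (q := q) (by linarith)).mul hM (sy_prod hM Finset.univ fun l _ =>
          sy_proj hM (I (Fin.succ l)) (J l)) (q := q) (by linarith))).congr fun i x _ =>
    rAng_apply (T i) x I

include hM in
theorem SO.rAng_iter {T : ι → SField k} (h : ∀ I, SO M C m q fun i x => T i x I) (b : ℕ) {m' : ℕ}
    (hb : m' + b ≤ m) (I : Fin (k + b) → Fin 3) : SO M C m' q fun i x => LinearisedGravity.rAng M b (T i) x I := by
  induction b generalizing m' with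
  | zero => exact (h I).mono hb
  | succ b ih => exact SO.rAng hM (fun J => ih (m' := m' + 1) (by omega) J) I

include hM in
theorem SO.rNu_iter {T : ι → SField k} (h : ∀ I, SO M C m q fun i x => T i x I) (a : ℕ) {m' : ℕ}
    (ha : m' + a ≤ m) (I : Fin k → Fin 3) :
    SO M C m' q fun i x => (LinearisedGravity.rNu M)^[a] (T i) x I := by
  induction a generalizing m' I with
  | zero => exact (h I).mono ha
  | succ a ih =>
    simp only [Function.iterate_succ_apply']
    exact SO.rNu hM (fun J => ih (m' := m' + 1) (by omega) J) I

/-- `φ_i ≤ B C_i` on `Σ`. -/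
def Le (M : ℝ) {ι : Type*} (C : ι → ℝ) (φ : ι → Space → ℝ) : Prop :=
  ∃ B, 0 ≤ B ∧ ∀ i, ∀ x ∈ ext M, φ i x ≤ B * C i

theorem Le.sum {κ : Type*} (s : Finset κ) {φ : κ → ι → Space → ℝ} (h : ∀ k ∈ s, Le M C (φ k)) :
    Le M C fun i x => ∑ k ∈ s, φ k i x := by
  classical
  induction s using Finset.induction_on with
  | empty => exact ⟨0, le_rfl, by simp⟩
  | insert a s ha ih =>
    obtain ⟨B, hB, h1⟩ := h a (by simp)
    obtain ⟨B', hB', h2⟩ := ih fun k hk => h k (by simp [hk])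
    refine ⟨B + B', by positivity, fun i x hx => ?_⟩
    simp only [Finset.sum_insert ha]
    linarith [h1 i x hx, h2 i x hx]

theorem snorm_le {l : ℕ} (T : SField l) (x : Space) : snorm T x ≤ ∑ I, |T x I| := by
  refine Real.sqrt_le_iff.2 ⟨Finset.sum_nonneg fun _ _ => abs_nonneg _, ?_⟩
  have h := Finset.sum_sq_le_sq_sum_of_nonneg (s := Finset.univ) (f := fun I => |T x I|)
    fun _ _ => abs_nonneg _
  simpa only [sq_abs] using h

theorem abs_le_snorm {l : ℕ} (T : SField l) (x : Space) (I : Fin l → Fin 3) : |T x I| ≤ snorm T x := by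
  rw [← Real.sqrt_sq_eq_abs]
  exact Real.sqrt_le_sqrt (Finset.single_le_sum (f := fun I => T x I ^ 2)
    (fun _ _ => sq_nonneg _) (Finset.mem_univ I))

include hM in
theorem exists_boundedBy {T : ι → SField k} (h : ∀ I, SO M C m q fun i x => T i x I) :
    ∃ B, 0 ≤ B ∧ ∀ i, BoundedBy M m q (B * C i) (T i) := by
  have hw : ∀ I, SO M C m 0 fun i x => wt q (T i) x I := fun I =>
    (h I).mul hM (sy_rpow hM q) (by linarith)
  refine Le.sum (C := C) _ fun a ha => Le.sum _ fun b hb => ?_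
  simp only [Finset.mem_range] at ha hb
  have h1 : Le M C fun i x => ∑ I, |((rNu M)^[a] (rAng M b (wt q (T i)))) x I| :=
    Le.sum _ fun I _ => by
      obtain ⟨-, B, hB, h2⟩ := (SO.rNu_iter hM
        (fun J => SO.rAng_iter hM hw b (m' := m - b) (by omega) J) a (m' := 0) (by omega) I).wt
      exact ⟨B, hB, fun i x hx => by simpa using h2 i x hx⟩
  obtain ⟨B, hB, h2⟩ := h1
  exact ⟨B, hB, fun i x hx => (snorm_le _ _).trans (h2 i x hx)⟩

/-! ### From `BoundedBy` to derivative bounds -/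

/-- `(r ∇̸)^b` on smooth tensors. -/
def rAngIter (hM : 0 < M) (S : (Fin k → Fin 3) → Sm (ext M)) :
    (b : ℕ) → (Fin (k + b) → Fin 3) → Sm (ext M)
  | 0 => S
  | b + 1 => rAngS hM (rAngIter hM S b)

theorem Reps.rAng_iter {T : SField k} {S : (Fin k → Fin 3) → Sm (ext M)} (h : Reps T S) (b : ℕ) :
    Reps (LinearisedGravity.rAng M b T) (rAngIter hM S b) := by
  induction b with
  | zero => exact h
  | succ b ih => exact ih.rAng hM

theorem Reps.rNu_iter {T : SField k} {S : (Fin k → Fin 3) → Sm (ext M)} (h : Reps T S) (a : ℕ) :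
    Reps ((LinearisedGravity.rNu M)^[a] T) ((rNuS hM)^[a] S) := by
  induction a with
  | zero => exact h
  | succ a ih =>
    simp only [Function.iterate_succ_apply']
    exact ih.rNu hM

theorem angS_rAngIter {S : (Fin k → Fin 3) → Sm (ext M)} (h : AngS hM S) (b : ℕ) :
    AngS hM (rAngIter hM S b) := by
  cases b with
  | zero => exact h
  | succ b => exact angS_rAngS hM _

theorem angS_rNuS_iter {S : (Fin k → Fin 3) → Sm (ext M)} (h : AngS hM S) (a : ℕ) :
    AngS hM ((rNuS hM)^[a] S) := by
  induction a with
  | zero => exact h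
  | succ a ih => rw [Function.iterate_succ_apply']; exact ih.rNuS hM

theorem ds_eq_of_angular {T : SField k} {S : (Fin k → Fin 3) → Sm (ext M)} (h : Reps T S)
    (hS : AngS hM S) (c : Fin 3) {x : Space} (hx : x ∈ ext M) (I : Fin k → Fin 3) :
    ds M c (fun y => T y I) x = ‖x‖⁻¹ * (xhat x c * (hbar M x * rNu M T x I)
      + ‖x‖ * angD M T x (Fin.cons c I) - ∑ m, xhat x (I m) * T x (Function.update I m c)) := by
  have h1 := h.rAng hM ⟨x, hx⟩ (Fin.cons c I)
  have h2 := h.rNu hM ⟨x, hx⟩ I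
  have h3 : hbar M x * (rNuS hM S I).1 ⟨x, hx⟩ = (euler hM (S I)).1 ⟨x, hx⟩ := by
    have := (hbar_pos hM hx).ne'
    change hbar M x * ((hbar M x)⁻¹ * _) = _
    field_simp
  simp only at h1
  rw [h.ds hM c ⟨x, hx⟩ I, dS_eq_del, del_eq_rAngS hM hS, h1, h2, h3]
  simp only [h ⟨x, hx⟩, ← yS_apply' hM _ ⟨x, hx⟩]
  rw [← Sm.ev_apply]
  simp only [map_mul, map_add, map_sub, map_sum, Sm.ev_apply, qS_apply]
  ring

include hM in
theorem so_of_boundedBy {T : ι → SField k} (hT : ∀ i, SmoothS M (T i)) (hA : ∀ i, IsAngular M (T i))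
    (hB : ∀ i, BoundedBy M m q (C i) (T i)) (I : Fin k → Fin 3) : SO M C m q fun i x => T i x I := by
  have hw : ∀ i, SmoothS M (wt q (T i)) := fun i I => (contDiffOn_norm_rpow hM q).mul (hT i I)
  set S : ι → (Fin k → Fin 3) → Sm (ext M) := fun i I => Sm.mk (fun x => wt q (T i) x I) (hw i I)
  have hR : ∀ i, Reps (wt q (T i)) (S i) := fun i => (hw i).reps
  have hS : ∀ i, AngS hM (S i) := fun i l I => Sm.ext' fun x => by
    have h1 := hA i x.1 x.2 l I
    rw [← Sm.ev_apply]
    simp only [map_mul, map_sum, Sm.ev_apply, yS_apply', S, Sm.mk_apply, wt]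
    have h2 : ∀ j, xhat x.1 j * (‖x.1‖ ^ q * T i x.1 (Function.update I l j)) =
        ‖x.1‖⁻¹ * ‖x.1‖ ^ q * (x.1 j * T i x.1 (Function.update I l j)) := fun j => by
      rw [xhat, div_eq_mul_inv]; ring
    simp only [h2, ← Finset.mul_sum, h1, mul_zero]; rfl
  have key : ∀ (l a b : ℕ), a + b + l ≤ m → ∀ J, SO M C l 0 fun i x =>
      ((rNu M)^[a] (rAng M b (wt q (T i)))) x J := by
    have hRR : ∀ a b i, Reps ((rNu M)^[a] (rAng M b (wt q (T i))))
        ((rNuS hM)^[a] (rAngIter hM (S i) b)) := fun a b i =>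
      ((hR i).rAng_iter hM b).rNu_iter hM a
    have h0 : ∀ a b, a + b ≤ m → ∀ J, Wt M C 0 fun i x =>
        ((rNu M)^[a] (rAng M b (wt q (T i)))) x J := fun a b hab J => by
      refine ⟨fun i => (hRR a b i).smooth J, 1, zero_le_one, fun i x hx => ?_⟩
      rw [neg_zero, Real.rpow_zero, mul_one, one_mul]
      refine (abs_le_snorm _ x J).trans (le_trans ?_ (hB i x hx))
      refine le_trans ?_ (Finset.single_le_sum (f := fun a => ∑ j ∈ Finset.range (m + 1 - a),
        snorm ((rNu M)^[a] (rAng M j (wt q (T i)))) x)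
        (fun _ _ => Finset.sum_nonneg fun _ _ => Real.sqrt_nonneg _)
        (Finset.mem_range.2 (by omega : a < m + 1)))
      exact Finset.single_le_sum (f := fun j => snorm ((rNu M)^[a] (rAng M j (wt q (T i)))) x)
        (fun _ _ => Real.sqrt_nonneg _) (Finset.mem_range.2 (by omega : b < m + 1 - a))
    intro l
    induction l with
    | zero => exact fun a b hab J => h0 a b hab J
    | succ l ih =>
      intro a b hab J
      refine ⟨h0 a b (by omega) J, fun c => ?_⟩
      have e1 := ih (a + 1) b (by omega) J
      have e2 := ih a (b + 1) (by omega) (Fin.cons c J)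
      have e3 := fun l => ih a b (by omega) (Function.update J l c)
      have e := (((e1.mul hM (sy_hbar hM) (q := 0) (by norm_num)).mul hM (sy_xhat hM c) (q := 0)
        (by norm_num)).add hM e2).sub hM (SO.sum hM Finset.univ fun l _ =>
          (e3 l).mul hM (sy_xhat hM (J l)) (q := 0) (by norm_num))
      refine (e.mul hM (sy_norm_inv hM) (q := 0 + 1) (by norm_num)).congr fun i x hx => ?_
      rw [ds_eq_of_angular hM (hRR a b i) (angS_rNuS_iter hM (angS_rAngIter hM (hS i) b) a) c hx J]
      simp only [Function.iterate_succ_apply']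
      congr 4
      have e4 := (hRR a b i).rAng hM ⟨x, hx⟩ (Fin.cons c J)
      have e5 := hRR a (b + 1) i ⟨x, hx⟩ (Fin.cons c J)
      have e6 : rAngS hM ((rNuS hM)^[a] (rAngIter hM (S i) b)) =
          (rNuS hM)^[a] (rAngS hM (rAngIter hM (S i) b)) :=
        ((Function.Semiconj.iterate_right (f := rAngS hM) (ga := rNuS hM) (gb := rNuS hM)
          (fun S => rAngS_rNuS hM S)) a) _
      rw [e6] at e4
      exact e4.trans e5.symm
  have h := key m 0 0 (by omega) I
  refine (h.mul hM (sy_rpow hM (-q)) (q := q) (by linarith)).congr fun i x hx => ?_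
  have hx0 := norm_pos_of_mem_ext hM hx
  change _ = ‖x‖ ^ (-q) * (‖x‖ ^ q * T i x I)
  rw [← mul_assoc, ← Real.rpow_add hx0]; simp

end Comparison

end LinearisedGravity

end

noncomputable section

set_option linter.unusedSimpArgs false

namespace LinearisedGravity

open MeasureTheory

/-! ## Families of functions on spacetime -/

section Spacetime

variable {M : ℝ} (hM : 0 < M) {t₀ : ℝ} {F G : Spacetime → ℝ} {g : Space → ℝ}

theorem mem_future {t : ℝ} {x : Space} (ht : t₀ ≤ t) (hx : x ∈ ext M) : (t, x) ∈ future M t₀ := ⟨ht, hx⟩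

theorem pd_congr (h : ∀ p ∈ future M t₀, F p = G p) (a : Fin 4) {p : Spacetime}
    (hp : p ∈ future M t₀) : pd M t₀ a F p = pd M t₀ a G p := dd_congr h hp

include hM

theorem contDiffOn_pd (hF : ContDiffOn ℝ ∞ F (future M t₀)) (a : Fin 4) :
    ContDiffOn ℝ ∞ (pd M t₀ a F) (future M t₀) := (goodSet_future hM t₀).contDiffOn_dd hF

theorem pd_add (hF : ContDiffOn ℝ ∞ F (future M t₀)) (hG : ContDiffOn ℝ ∞ G (future M t₀)) (a : Fin 4)
    {p : Spacetime} (hp : p ∈ future M t₀) :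
    pd M t₀ a (fun q => F q + G q) p = pd M t₀ a F p + pd M t₀ a G p :=
  dd_add (goodSet_future hM t₀) hF hG hp

theorem pd_mul (hF : ContDiffOn ℝ ∞ F (future M t₀)) (hG : ContDiffOn ℝ ∞ G (future M t₀)) (a : Fin 4)
    {p : Spacetime} (hp : p ∈ future M t₀) :
    pd M t₀ a (fun q => F q * G q) p = F p * pd M t₀ a G p + G p * pd M t₀ a F p :=
  dd_mul (goodSet_future hM t₀) hF hG hp

omit hM in
theorem pd_const (c : ℝ) (a : Fin 4) (p : Spacetime) : pd M t₀ a (fun _ => c) p = 0 := dd_const c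

theorem pd_const_mul (c : ℝ) (hF : ContDiffOn ℝ ∞ F (future M t₀)) (a : Fin 4)
    {p : Spacetime} (hp : p ∈ future M t₀) :
    pd M t₀ a (fun q => c * F q) p = c * pd M t₀ a F p := by
  rw [pd_mul hM contDiffOn_const hF a hp, pd_const, mul_zero, add_zero]

theorem pd_neg (hF : ContDiffOn ℝ ∞ F (future M t₀)) (a : Fin 4)
    {p : Spacetime} (hp : p ∈ future M t₀) : pd M t₀ a (fun q => -F q) p = -pd M t₀ a F p := by
  simpa using pd_const_mul hM (-1) hF a hp

theorem pd_sub (hF : ContDiffOn ℝ ∞ F (future M t₀)) (hG : ContDiffOn ℝ ∞ G (future M t₀)) (a : Fin 4)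
    {p : Spacetime} (hp : p ∈ future M t₀) :
    pd M t₀ a (fun q => F q - G q) p = pd M t₀ a F p - pd M t₀ a G p := by
  simp only [sub_eq_add_neg]
  rw [pd_add hM hF hG.neg a hp, pd_neg hM hG a hp]

theorem pd_sum {κ : Type*} (s : Finset κ) {F : κ → Spacetime → ℝ}
    (hF : ∀ k ∈ s, ContDiffOn ℝ ∞ (F k) (future M t₀)) (a : Fin 4) {p : Spacetime}
    (hp : p ∈ future M t₀) :
    pd M t₀ a (fun q => ∑ k ∈ s, F k q) p = ∑ k ∈ s, pd M t₀ a (F k) p := by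
  classical
  induction s using Finset.induction_on with
  | empty => simpa using pd_const 0 a p
  | insert b s hb ih =>
    simp only [Finset.sum_insert hb]
    rw [pd_add hM (hF b (by simp)) (ContDiffOn.sum fun k hk => hF k (by simp [hk])) a hp,
      ih fun k hk => hF k (by simp [hk])]

theorem pd_comm (hF : ContDiffOn ℝ ∞ F (future M t₀)) (a b : Fin 4) {p : Spacetime}
    (hp : p ∈ future M t₀) : pd M t₀ a (pd M t₀ b F) p = pd M t₀ b (pd M t₀ a F) p :=
  dd_comm (goodSet_future hM t₀) hF hp

omit hM in
theorem contDiffOn_slice (hF : ContDiffOn ℝ ∞ F (future M t₀)) {t : ℝ} (ht : t₀ ≤ t) :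
    ContDiffOn ℝ ∞ (fun x => F (t, x)) (ext M) :=
  hF.comp (f := fun x : Space => (t, x)) (by fun_prop) fun _ hx => mem_future ht hx

theorem ds_slice (hF : ContDiffOn ℝ ∞ F (future M t₀)) {t : ℝ} (ht : t₀ ≤ t) {x : Space}
    (hx : x ∈ ext M) (j : Fin 3) : ds M j (fun y => F (t, y)) x = pd M t₀ j.succ F (t, x) := by
  have h1 : HasFDerivWithinAt (fun y : Space => (t, y)) (ContinuousLinearMap.inr ℝ ℝ Space) (ext M) x := by
    exact ((hasFDerivWithinAt_const (𝕜 := ℝ) t x (ext M)).prodMk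
      (hasFDerivWithinAt_id (𝕜 := ℝ) x (ext M)))
  have h2 := (hF.differentiableOn (by simp) (t, x) (mem_future ht hx)).hasFDerivWithinAt.comp x h1
    (fun _ hy => mem_future ht hy)
  rw [ds, dd, show (fun y => F (t, y)) = F ∘ (fun y : Space => (t, y)) from rfl,
    h2.fderivWithin ((goodSet_ext hM).unique x hx)]
  rfl

omit hM in
theorem contDiffOn_static (hg : ContDiffOn ℝ ∞ g (ext M)) :
    ContDiffOn ℝ ∞ (fun p : Spacetime => g p.2) (future M t₀) :=
  hg.comp contDiffOn_snd fun _ hp => hp.2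

theorem pd_zero_static (hg : ContDiffOn ℝ ∞ g (ext M)) {p : Spacetime} (hp : p ∈ future M t₀) :
    pd M t₀ 0 (fun q => g q.2) p = 0 := by
  have h := (hg.differentiableOn (by simp) p.2 hp.2).hasFDerivWithinAt.comp p
    (hasFDerivWithinAt_snd (s := future M t₀)) (fun _ hy => hy.2)
  rw [pd, show (fun q : Spacetime => g q.2) = g ∘ Prod.snd from rfl,
    h.fderivWithin ((goodSet_future hM t₀).unique p hp)]
  simp [basis4]

theorem pd_succ_static (hg : ContDiffOn ℝ ∞ g (ext M)) {p : Spacetime} (hp : p ∈ future M t₀)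
    (j : Fin 3) : pd M t₀ j.succ (fun q => g q.2) p = ds M j g p.2 :=
  (ds_slice hM (contDiffOn_static (t₀ := t₀) hg) hp.1 hp.2 j).symm

end Spacetime

section STFamilies

variable {M : ℝ} {ι : Type*} {t : ι → ℝ} {C : ι → ℝ}

/-- `|∂_t^j ∂^α f_i| ≤ B C_i r^{-q-j-|α|}` on `{t = t_i}` for `j ≤ k`, `j + |α| ≤ k + m`, for smooth
functions `f_i`. -/
def ST (M : ℝ) {ι : Type*} (t C : ι → ℝ) : ℕ → ℕ → ℝ → (ι → Spacetime → ℝ) → Prop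
  | 0, m, q, F => (∀ i, ContDiffOn ℝ ∞ (F i) (future M (t i))) ∧ SO M C m q fun i x => F i (t i, x)
  | k + 1, m, q, F => (∀ i, ContDiffOn ℝ ∞ (F i) (future M (t i))) ∧
      SO M C (m + k + 1) q (fun i x => F i (t i, x)) ∧
      ST M t C k m (q + 1) fun i => pd M (t i) 0 (F i)

variable {k m d m' : ℕ} {q q₁ q₂ e : ℝ} {F G : ι → Spacetime → ℝ}

theorem ST.smooth (h : ST M t C k m q F) (i : ι) : ContDiffOn ℝ ∞ (F i) (future M (t i)) := by
  cases k <;> exact h.1 i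

theorem ST.so (h : ST M t C k m q F) : SO M C (m + k) q fun i x => F i (t i, x) := by
  cases k with
  | zero => exact h.2
  | succ k => exact h.2.1

theorem ST.dt (h : ST M t C (k + 1) m q F) : ST M t C k m (q + 1) fun i => pd M (t i) 0 (F i) := h.2.2

theorem ST.congr (h : ST M t C k m q F) (hFG : ∀ i, ∀ p ∈ future M (t i), G i p = F i p) :
    ST M t C k m q G := by
  induction k generalizing q F G with
  | zero => exact ⟨fun i => (h.1 i).congr (hFG i),
      h.2.congr fun i x hx => hFG i _ (mem_future le_rfl hx)⟩
  | succ k ih => exact ⟨fun i => (h.1 i).congr (hFG i),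
      h.2.1.congr fun i x hx => hFG i _ (mem_future le_rfl hx),
      ih h.2.2 fun i p hp => pd_congr (hFG i) 0 hp⟩

theorem ST.mono (h : ST M t C k m q F) (hm : m' ≤ m) : ST M t C k m' q F := by
  induction k generalizing q F with
  | zero => exact ⟨h.1, h.2.mono hm⟩
  | succ k ih => exact ⟨h.1, h.2.1.mono (by omega), ih h.2.2⟩

theorem ST.shift (h : ST M t C (k + 1) m q F) : ST M t C k (m + 1) q F := by
  induction k generalizing q F with
  | zero => exact ⟨h.1, h.2.1⟩
  | succ k ih => exact ⟨h.1, h.2.1.mono (by omega), ih h.2.2⟩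

theorem ST.pred (h : ST M t C (k + 1) m q F) : ST M t C k m q F := h.shift.mono (by omega)

theorem ST.weaken (hM : 0 < M) (h : ST M t C k m q F) (hq : q₁ ≤ q) : ST M t C k m q₁ F := by
  induction k generalizing q q₁ F with
  | zero => exact ⟨h.1, h.2.weaken hM hq⟩
  | succ k ih => exact ⟨h.1, h.2.1.weaken hM hq, ih h.2.2 (by linarith)⟩

theorem ST.zero : ST M t C k m q fun _ _ => 0 := by
  induction k generalizing q with
  | zero => exact ⟨fun _ => contDiffOn_const, SO.zero⟩
  | succ k ih => exact ⟨fun _ => contDiffOn_const, SO.zero, ih.congr fun i p _ => pd_const 0 0 p⟩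

theorem ST.add (hM : 0 < M) (hF : ST M t C k m q F) (hG : ST M t C k m q G) :
    ST M t C k m q fun i p => F i p + G i p := by
  induction k generalizing q F G with
  | zero => exact ⟨fun i => (hF.1 i).add (hG.1 i), hF.2.add hM hG.2⟩
  | succ k ih => exact ⟨fun i => (hF.1 i).add (hG.1 i), hF.2.1.add hM hG.2.1,
      (ih hF.2.2 hG.2.2).congr fun i p hp => pd_add hM (hF.1 i) (hG.1 i) 0 hp⟩

/-- Stability of the classes `ST` under relations that are compatible with `∂_t`. -/
theorem ST.of_rel (R : ℝ → (Spacetime → ℝ) → (Spacetime → ℝ) → Prop)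
    (hs : ∀ t F G, R t F G → ContDiffOn ℝ ∞ G (future M t))
    (hpd : ∀ t F G, R t F G → R t (pd M t 0 F) (pd M t 0 G))
    (hso : ∀ (m : ℕ) (q : ℝ) (F G : ι → Spacetime → ℝ), (∀ i, R (t i) (F i) (G i)) →
      SO M C (m + d) q (fun i x => F i (t i, x)) → SO M C m (q + e) fun i x => G i (t i, x))
    (hF : ST M t C k (m + d) q F) (hR : ∀ i, R (t i) (F i) (G i)) :
    ST M t C k m (q + e) G := by
  induction k generalizing q F G with
  | zero => exact ⟨fun i => hs _ _ _ (hR i), hso _ _ _ _ hR hF.2⟩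
  | succ k ih =>
    refine ⟨fun i => hs _ _ _ (hR i), hso _ _ _ _ hR (hF.2.1.mono (by omega)), ?_⟩
    have := ih hF.2.2 fun i => hpd _ _ _ (hR i)
    rwa [show q + 1 + e = q + e + 1 by ring] at this

theorem ST.of_op (hM : 0 < M) (Op : ℝ → (Spacetime → ℝ) → (Spacetime → ℝ))
    (hs : ∀ t F, ContDiffOn ℝ ∞ F (future M t) → ContDiffOn ℝ ∞ (Op t F) (future M t))
    (hpd : ∀ t F, ContDiffOn ℝ ∞ F (future M t) → ∀ p ∈ future M t,
      pd M t 0 (Op t F) p = Op t (pd M t 0 F) p)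
    (hso : ∀ (m : ℕ) (q : ℝ) (F : ι → Spacetime → ℝ), (∀ i, ContDiffOn ℝ ∞ (F i) (future M (t i))) →
      SO M C (m + d) q (fun i x => F i (t i, x)) → SO M C m (q + e) fun i x => Op (t i) (F i) (t i, x))
    (hF : ST M t C k (m + d) q F) (hq : q₁ ≤ q + e) : ST M t C k m q₁ fun i => Op (t i) (F i) := by
  refine ST.weaken hM (ST.of_rel (fun t F G => ContDiffOn ℝ ∞ F (future M t) ∧
      ∀ p ∈ future M t, G p = Op t F p) ?_ ?_ ?_ hF fun i => ⟨hF.smooth i, fun _ _ => rfl⟩) hq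
  · exact fun t F G h => (hs t F h.1).congr h.2
  · exact fun t F G h => ⟨contDiffOn_pd hM h.1 0,
      fun p hp => (pd_congr h.2 0 hp).trans (hpd t F h.1 p hp)⟩
  · exact fun m q F G hR hF => (hso m q F (fun i => (hR i).1) hF).congr
      fun i x hx => (hR i).2 _ (mem_future le_rfl hx)

theorem ST.mul (hM : 0 < M) {g : Space → ℝ} (hF : ST M t C k m q₂ F) (hg : Sy M q₁ g)
    (hq : q ≤ q₁ + q₂) : ST M t C k m q fun i p => g p.2 * F i p :=
  ST.of_op (d := 0) (e := q₁) hM (fun _ F p => g p.2 * F p)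
    (fun _ _ hF => (contDiffOn_static hg.smooth).mul hF)
    (fun t F hF p hp => by
      rw [pd_mul hM (contDiffOn_static hg.smooth) hF 0 hp, pd_zero_static hM hg.smooth hp]; ring)
    (fun m q F _ hF => SO.mul hM hg hF (by linarith)) hF (by linarith)

theorem ST.const_mul (hM : 0 < M) (c : ℝ) (hF : ST M t C k m q F) :
    ST M t C k m q fun i p => c * F i p := hF.mul hM (sy_const hM c) (by linarith)

theorem ST.neg (hM : 0 < M) (hF : ST M t C k m q F) : ST M t C k m q fun i p => -F i p := by
  simpa using hF.const_mul hM (-1)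

theorem ST.sub (hM : 0 < M) (hF : ST M t C k m q F) (hG : ST M t C k m q G) :
    ST M t C k m q fun i p => F i p - G i p := by
  simpa [sub_eq_add_neg] using hF.add hM (hG.neg hM)

theorem ST.sum (hM : 0 < M) {κ : Type*} (s : Finset κ) {F : κ → ι → Spacetime → ℝ}
    (hF : ∀ a ∈ s, ST M t C k m q (F a)) : ST M t C k m q fun i p => ∑ a ∈ s, F a i p := by
  classical
  induction s using Finset.induction_on with
  | empty => simpa using ST.zero
  | insert a s ha ih =>
    simp only [Finset.sum_insert ha]
    exact (hF a (by simp)).add hM (ih fun k hk => hF k (by simp [hk]))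

theorem ST.pd_succ (hM : 0 < M) (hF : ST M t C k (m + 1) q F) (j : Fin 3) :
    ST M t C k m (q + 1) fun i => pd M (t i) j.succ (F i) :=
  ST.of_op (d := 1) (e := 1) hM (fun t F => pd M t j.succ F)
    (fun _ _ hF => contDiffOn_pd hM hF _) (fun _ _ hF _ hp => pd_comm hM hF _ _ hp)
    (fun _ _ _ hs hF => (hF.ds j).congr fun i _ hx => (ds_slice hM (hs i) le_rfl hx j).symm) hF le_rfl

theorem ST.pd (hM : 0 < M) (hF : ST M t C (k + 1) m q F) (a : Fin 4) :
    ST M t C k m (q + 1) fun i => pd M (t i) a (F i) := by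
  refine Fin.cases hF.dt (fun j => ?_) a
  exact hF.shift.pd_succ hM j

/-- Time derivatives of higher order. -/
theorem ST.of_dt_dt (hF : ST M t C (k + 1) (m + 1) q F)
    (hG : ST M t C k m (q + 2) fun i => LinearisedGravity.pd M (t i) 0 (LinearisedGravity.pd M (t i) 0 (F i))) :
    ST M t C (k + 2) m q F := by
  refine ⟨hF.smooth, hF.so.mono (by omega), fun i => hF.dt.smooth i, hF.dt.so.mono (by omega), ?_⟩
  rwa [show q + 1 + 1 = q + 2 by ring]

theorem ST.zero_one {m : ℕ} (hs : ∀ i, ContDiffOn ℝ ∞ (F i) (future M (t i)))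
    (h0 : SO M C (m + 1) q fun i x => F i (t i, x)) (hM : 0 < M)
    (h1 : SO M C m (q + 1) fun i x => LinearisedGravity.pd M (t i) 0 (F i) (t i, x)) :
    ST M t C 1 m q F := ⟨hs, h0, fun i => contDiffOn_pd hM (hs i) 0, h1⟩

end STFamilies

end LinearisedGravity

end

noncomputable section

set_option linter.unusedSimpArgs false

namespace LinearisedGravity

open MeasureTheory

/-! ## Spherical means -/

section Averages

variable {M : ℝ} (hM : 0 < M) {t₀ : ℝ} {F G : Spacetime → ℝ}

theorem area_eq : area = 4 * Real.pi := by
  rw [area, measureReal_def, Measure.toSphere_apply_univ, EuclideanSpace.volume_ball_fin_three]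
  simp only [finrank_euclideanSpace_fin, ENNReal.toReal_mul, ENNReal.toReal_pow]
  rw [ENNReal.toReal_ofReal (by norm_num), ENNReal.toReal_ofReal (by positivity)]
  simp; ring

/-- The radial derivative. -/
def drF (M t₀ : ℝ) (F : Spacetime → ℝ) (p : Spacetime) : ℝ := ∑ k, xhat p.2 k * pd M t₀ (Fin.succ k) F p

include hM in
theorem contDiffOn_drF (hF : ContDiffOn ℝ ∞ F (future M t₀)) :
    ContDiffOn ℝ ∞ (drF M t₀ F) (future M t₀) :=
  ContDiffOn.sum fun k _ => (contDiffOn_static (sy_xhat hM k).smooth).mul (contDiffOn_pd hM hF _)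

/-- The coordinate functionals on spacetime. -/
def coordL : Fin 4 → Spacetime →L[ℝ] ℝ :=
  Fin.cons (ContinuousLinearMap.fst ℝ ℝ Space)
    fun j => (EuclideanSpace.proj (𝕜 := ℝ) j).comp (ContinuousLinearMap.snd ℝ ℝ Space)

theorem spacetime_eq (v : Spacetime) : v = ∑ a, coordL a v • basis4 a := by
  rw [Fin.sum_univ_succ]
  simp only [coordL, basis4, Fin.cons_zero, Fin.cons_succ]
  refine Prod.ext ?_ ?_
  · simp [Prod.fst_sum]
  · simp only [Prod.snd_add, Prod.snd_sum, Prod.smul_snd, smul_zero, zero_add]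
    exact (sum_coord_single v.2).symm

theorem fderivWithin_eq_sum_pd (F : Spacetime → ℝ) (p v : Spacetime) :
    fderivWithin ℝ F (future M t₀) p v = ∑ a, coordL a v * pd M t₀ a F p := by
  conv_lhs => rw [spacetime_eq v, map_sum]
  exact Finset.sum_congr rfl fun a _ => by rw [map_smul]; rfl

theorem norm_smul_mem_ext {x y : Space} (hx : x ∈ ext M) (hy : ‖y‖ = 1) : ‖x‖ • y ∈ ext M := by
  change 2 * M ≤ ‖_‖
  rw [norm_smul, hy, norm_norm, mul_one]; exact hx

include hM in
theorem xhat_norm_smul {x y : Space} (hx : x ∈ ext M) (hy : ‖y‖ = 1) (k : Fin 3) :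
    xhat (‖x‖ • y) k = y k := by
  have := norm_pos_of_mem_ext hM hx
  rw [xhat, norm_smul, hy, norm_norm, mul_one, PiLp.smul_apply, smul_eq_mul]
  field_simp

include hM in
theorem hasFDerivWithinAt_sphAvg (hF : ContDiffOn ℝ ∞ F (future M t₀)) {p : Spacetime}
    (hp : p ∈ future M t₀) : HasFDerivWithinAt (sphAvg F)
      (sphAvg (pd M t₀ 0 F) p • coordL 0 +
        ∑ j : Fin 3, (xhat p.2 j * sphAvg (drF M t₀ F) p) • coordL j.succ) (future M t₀) p := by
  have hx0 := norm_pos_of_mem_ext hM hp.2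
  set c : ℝ × ℝ → Sph → Spacetime := fun τ y => (τ.1, τ.2 • y.1)
  set c' : ℝ × ℝ → Sph → ℝ × ℝ →L[ℝ] Spacetime := fun _ y =>
    (ContinuousLinearMap.fst ℝ ℝ ℝ).prod ((ContinuousLinearMap.snd ℝ ℝ ℝ).smulRight y.1)
  have hm : ∀ τ ∈ Set.Ici t₀ ×ˢ Set.Ici (2 * M), ∀ y, c τ y ∈ future M t₀ := fun τ hτ y => by
    refine ⟨hτ.1, ?_⟩
    have h1 : 2 * M ≤ τ.2 := hτ.2
    change 2 * M ≤ ‖τ.2 • y.1‖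
    rw [norm_smul, norm_sph, mul_one, Real.norm_eq_abs, abs_of_nonneg (by linarith)]
    exact h1
  have hτ : (p.1, ‖p.2‖) ∈ Set.Ici t₀ ×ˢ Set.Ici (2 * M) := ⟨hp.1, hp.2⟩
  have hcc' : Continuous fun q : (ℝ × ℝ) × Sph => c' q.1 q.2 := by
    have h1 : Continuous fun v : Space => (ContinuousLinearMap.fst ℝ ℝ ℝ).prod
        ((ContinuousLinearMap.snd ℝ ℝ ℝ).smulRight v) := by
      have h2 : (fun v : Space => (ContinuousLinearMap.fst ℝ ℝ ℝ).prod
        ((ContinuousLinearMap.snd ℝ ℝ ℝ).smulRight v)) = fun v =>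
          (ContinuousLinearMap.inl ℝ ℝ Space).comp (ContinuousLinearMap.fst ℝ ℝ ℝ) +
          (ContinuousLinearMap.inr ℝ ℝ Space).comp ((ContinuousLinearMap.snd ℝ ℝ ℝ).smulRight v) := by
        funext v; ext <;> simp
      rw [h2]
      exact continuous_const.add (continuous_const.clm_comp
        ((ContinuousLinearMap.smulRightL ℝ (ℝ × ℝ) Space (ContinuousLinearMap.snd ℝ ℝ ℝ)).continuous))
    exact h1.comp (continuous_subtype_val.comp continuous_snd)
  have hcc : Continuous fun q : (ℝ × ℝ) × Sph => c q.1 q.2 := by fun_prop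
  have h := hasFDerivWithinAt_integral_comp (μ := sphMeas) (goodSet_future hM t₀) hF
    ((convex_Ici t₀).prod (convex_Ici (2 * M))) (c := c) (c' := c')
    (fun τ _ y => by
      refine HasFDerivAt.hasFDerivWithinAt ?_
      exact (ContinuousLinearMap.fst ℝ ℝ ℝ).hasFDerivAt.prodMk
        ((ContinuousLinearMap.snd ℝ ℝ ℝ).hasFDerivAt.smul_const y.1)) hm hcc hcc' hτ
  have hr : HasFDerivWithinAt (fun q : Spacetime => (q.1, ‖q.2‖))
      ((ContinuousLinearMap.fst ℝ ℝ Space).prod (∑ j, xhat p.2 j • coordL (Fin.succ j)))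
      (future M t₀) p := by
    refine hasFDerivWithinAt_fst.prodMk ?_
    have h1 := ((contDiffOn_static (t₀ := t₀) (contDiffOn_norm_ext hM)).differentiableOn (by simp) p
      hp).hasFDerivWithinAt
    convert h1 using 1
    refine ContinuousLinearMap.ext fun v => ?_
    have h2 : ∀ a, fderivWithin ℝ (fun q : Spacetime => ‖q.2‖) (future M t₀) p (basis4 a) =
      (Fin.cons 0 (xhat p.2) : Fin 4 → ℝ) a := by
      refine Fin.cases (pd_zero_static hM (contDiffOn_norm_ext hM) hp) fun j => ?_
      refine (pd_succ_static hM (contDiffOn_norm_ext hM) hp j).trans ?_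
      rw [ds_norm hM j hp.2]; simp only [Fin.cons_succ, xhat, div_eq_mul_inv]
    conv_rhs => rw [spacetime_eq v, map_sum]
    simp only [map_smul, h2, Fin.sum_univ_succ (n := 3), Fin.cons_zero, Fin.cons_succ, smul_eq_mul,
      mul_zero, zero_add, sum_apply, smul_apply]
    exact Finset.sum_congr rfl fun j _ => mul_comm _ _
  have h3 := (h.comp p hr (fun q hq => Set.mk_mem_prod hq.1 hq.2)).const_mul (1 / (4 * Real.pi))
  refine h3.congr_fderiv ?_ |>.congr (fun q _ => rfl) rfl
  refine ContinuousLinearMap.ext fun v => ?_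
  have hint : Integrable (fun y => (fderivWithin ℝ F (future M t₀) (c (p.1, ‖p.2‖) y)).comp
      (c' (p.1, ‖p.2‖) y)) sphMeas := by
    refine integrable_of_continuous ?_
    have h4 : ContinuousOn (fderivWithin ℝ F (future M t₀)) (future M t₀) :=
      hF.continuousOn_fderivWithin (goodSet_future hM t₀).unique (by simp)
    have h5 : ContinuousOn (fun y => (fderivWithin ℝ F (future M t₀) (c (p.1, ‖p.2‖) y)).comp
      (c' (p.1, ‖p.2‖) y)) Set.univ :=
      (h4.comp (hcc.comp (Continuous.prodMk_right (p.1, ‖p.2‖))).continuousOn fun y _ => hm _ hτ y).clm_comp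
        (hcc'.comp (Continuous.prodMk_right (p.1, ‖p.2‖))).continuousOn
    exact continuousOn_univ.1 h5
  have hcont : ∀ G : Spacetime → ℝ, ContDiffOn ℝ ∞ G (future M t₀) →
      Integrable (fun y : Sph => G (p.1, ‖p.2‖ • y.1)) sphMeas := fun G hG => by
    refine integrable_of_continuous (continuousOn_univ.1 ?_)
    exact hG.continuousOn.comp (hcc.comp (Continuous.prodMk_right (p.1, ‖p.2‖))).continuousOn
      fun y _ => hm _ hτ y
  have e : ∀ y : Sph, ((fderivWithin ℝ F (future M t₀) (c (p.1, ‖p.2‖) y)).comp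
      (c' (p.1, ‖p.2‖) y)) (v.1, ∑ j, xhat p.2 j * coordL (Fin.succ j) v) =
      v.1 * pd M t₀ 0 F (p.1, ‖p.2‖ • y.1) + (∑ j, xhat p.2 j * coordL (Fin.succ j) v) *
        drF M t₀ F (p.1, ‖p.2‖ • y.1) := fun y => by
    rw [ContinuousLinearMap.comp_apply, fderivWithin_eq_sum_pd, Fin.sum_univ_succ, drF, Finset.mul_sum]
    congr 1
    refine Finset.sum_congr rfl fun k _ => ?_
    rw [xhat_norm_smul hM hp.2 (norm_sph y)]
    have e2 : coordL (Fin.succ k) ((c' (p.1, ‖p.2‖) y) (v.1, ∑ j, xhat p.2 j * coordL (Fin.succ j) v)) =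
        (∑ j, xhat p.2 j * coordL (Fin.succ j) v) * y.1 k := rfl
    rw [e2]; ring
  simp only [smul_apply, ContinuousLinearMap.comp_apply,
    ContinuousLinearMap.prod_apply, add_apply, sum_apply,
    smul_eq_mul, ContinuousLinearMap.coe_fst']
  rw [ContinuousLinearMap.integral_apply hint, integral_congr_ae (Filter.Eventually.of_forall e),
    integral_add ((hcont _ (contDiffOn_pd hM hF 0)).const_mul _)
      ((hcont _ (contDiffOn_drF hM hF)).const_mul _), integral_const_mul, integral_const_mul]
  simp only [sphAvg, sphereInt, Finset.sum_mul]
  simp only [coordL, Fin.cons_zero, Fin.cons_succ, ContinuousLinearMap.coe_fst']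
  rw [mul_add, Finset.mul_sum]
  congr 1
  · ring
  · exact Finset.sum_congr rfl fun k _ => by ring

include hM in
theorem contDiffOn_sphAvg (hF : ContDiffOn ℝ ∞ F (future M t₀)) :
    ContDiffOn ℝ ∞ (sphAvg F) (future M t₀) := by
  have key : ∀ (n : ℕ) (F : Spacetime → ℝ), ContDiffOn ℝ ∞ F (future M t₀) →
      ContDiffOn ℝ n (sphAvg F) (future M t₀) := by
    intro n
    induction n with
    | zero =>
      intro F hF
      exact contDiffOn_zero.2 fun p hp => (hasFDerivWithinAt_sphAvg hM hF hp).continuousWithinAt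
    | succ n ih =>
      intro F hF
      have h1 := fun p hp => hasFDerivWithinAt_sphAvg hM hF (p := p) hp
      push_cast
      rw [contDiffOn_succ_iff_fderivWithin (goodSet_future hM t₀).unique]
      refine ⟨fun p hp => (h1 p hp).differentiableWithinAt, by simp, ?_⟩
      refine ContDiffOn.congr (f := fun p => sphAvg (pd M t₀ 0 F) p • coordL 0 +
        ∑ j : Fin 3, (xhat p.2 j * sphAvg (drF M t₀ F) p) • coordL j.succ) ?_
        fun p hp => (h1 p hp).fderivWithin ((goodSet_future hM t₀).unique p hp)
      refine ((ih _ (contDiffOn_pd hM hF 0)).smul contDiffOn_const).add (ContDiffOn.sum fun j _ => ?_)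
      exact (((contDiffOn_static (sy_xhat hM j).smooth).of_le (by exact_mod_cast le_top)).mul
        (ih _ (contDiffOn_drF hM hF))).smul contDiffOn_const
  exact contDiffOn_infty.2 fun n => key n F hF

include hM in
theorem pd_zero_sphAvg (hF : ContDiffOn ℝ ∞ F (future M t₀)) {p : Spacetime}
    (hp : p ∈ future M t₀) : pd M t₀ 0 (sphAvg F) p = sphAvg (pd M t₀ 0 F) p := by
  rw [pd, (hasFDerivWithinAt_sphAvg hM hF hp).fderivWithin ((goodSet_future hM t₀).unique p hp)]
  simp [coordL, basis4]

include hM in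
theorem pd_succ_sphAvg (hF : ContDiffOn ℝ ∞ F (future M t₀)) {p : Spacetime}
    (hp : p ∈ future M t₀) (j : Fin 3) :
    pd M t₀ j.succ (sphAvg F) p = xhat p.2 j * sphAvg (drF M t₀ F) p := by
  rw [pd, (hasFDerivWithinAt_sphAvg hM hF hp).fderivWithin ((goodSet_future hM t₀).unique p hp)]
  simp [coordL, basis4, Pi.single_apply, Finset.sum_ite_eq]

theorem sphAvg_congr (h : ∀ p ∈ future M t₀, F p = G p) {p : Spacetime} (hp : p ∈ future M t₀) :
    sphAvg F p = sphAvg G p := by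
  simp only [sphAvg, sphereInt]
  congr 1
  exact integral_congr_ae (Filter.Eventually.of_forall fun y =>
    h _ (mem_future hp.1 (norm_smul_mem_ext hp.2 (norm_sph y))))

variable {ι : Type*} {C : ι → ℝ} {m k : ℕ} {q : ℝ} {t : ι → ℝ}

/-- The spherical mean of a function on `Σ`. -/
def avg (f : Space → ℝ) (x : Space) : ℝ := sphAvg (fun p => f p.2) (0, x)

include hM in
theorem contDiffOn_avg {f : Space → ℝ} (hf : ContDiffOn ℝ ∞ f (ext M)) :
    ContDiffOn ℝ ∞ (avg f) (ext M) :=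
  contDiffOn_slice (contDiffOn_sphAvg hM (contDiffOn_static (t₀ := 0) hf)) le_rfl

include hM in
theorem ds_avg {f : Space → ℝ} (hf : ContDiffOn ℝ ∞ f (ext M)) (j : Fin 3) {x : Space}
    (hx : x ∈ ext M) : ds M j (avg f) x = xhat x j * avg (fun y => ∑ k, xhat y k * ds M k f y) x := by
  have hs := contDiffOn_static (t₀ := 0) hf
  have hp : ((0 : ℝ), x) ∈ future M 0 := mem_future le_rfl hx
  refine (ds_slice hM (contDiffOn_sphAvg hM hs) le_rfl hx j).trans ?_
  rw [pd_succ_sphAvg hM hs hp]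
  congr 1
  refine sphAvg_congr (fun p hp => ?_) hp
  exact Finset.sum_congr rfl fun k _ => by rw [pd_succ_static hM hf hp]

include hM in
theorem SO.avg {F : ι → Space → ℝ} (hF : SO M C m q F) : SO M C m q fun i => avg (F i) := by
  have hw : ∀ {q : ℝ} {F : ι → Space → ℝ}, Wt M C q F → Wt M C q fun i => LinearisedGravity.avg (F i) := by
    rintro q F ⟨h1, B, hB, h2⟩
    refine ⟨fun i => contDiffOn_avg hM (h1 i), B, hB, fun i x hx => ?_⟩
    have h3 : ‖∫ y : Sph, F i (‖x‖ • y.1) ∂sphMeas‖ ≤ B * C i * ‖x‖ ^ (-q) * area :=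
      norm_integral_le_of_norm_le_const (Filter.Eventually.of_forall fun y => by
        have := h2 i _ (norm_smul_mem_ext hx (norm_sph y))
        rwa [norm_smul, norm_norm, norm_sph, mul_one] at this)
    have hπ := Real.pi_pos
    change |1 / (4 * Real.pi) * ∫ y : Sph, F i (‖x‖ • y.1) ∂sphMeas| ≤ _
    rw [abs_mul, abs_of_pos (by positivity : 0 < 1 / (4 * Real.pi))]
    rw [area_eq, Real.norm_eq_abs] at h3
    rw [div_mul_eq_mul_div, one_mul, div_le_iff₀ (by positivity)]
    exact h3
  induction m generalizing q F with
  | zero => exact hw hF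
  | succ m ih =>
    refine ⟨hw hF.1, fun j => ?_⟩
    have h1 := ih (SO.sum hM Finset.univ fun k _ => (hF.ds k).mul hM (sy_xhat hM k)
      (q := q + 1) (by linarith))
    exact (h1.mul hM (sy_xhat hM j) (q := q + 1) (by linarith)).congr
      fun i x hx => ds_avg hM (hF.smooth i) j hx

theorem ST.sphAvg (hM : 0 < M) {F : ι → Spacetime → ℝ} (hF : ST M t C k m q F) :
    ST M t C k m q fun i => sphAvg (F i) :=
  ST.of_op (d := 0) (e := 0) hM (fun _ F => LinearisedGravity.sphAvg F)
    (fun _ _ hF => contDiffOn_sphAvg hM hF) (fun _ _ hF _ hp => pd_zero_sphAvg hM hF hp)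
    (fun _ _ _ _ hF => by rw [add_zero]; exact SO.avg hM hF) hF (by linarith)

end Averages

end LinearisedGravity

end

noncomputable section

set_option linter.unusedSimpArgs false

namespace LinearisedGravity

open MeasureTheory

/-! ## Elliptic estimates on the spheres -/

namespace RotAlg

variable {A : Type*} [CommRing A] [Algebra ℝ A] {Ω : Fin 3 → Derivation ℝ A A}

theorem der_two (D : Derivation ℝ A A) : D 2 = 0 := by simpa using D.map_natCast 2

/-- The operator `D(D + 2)`, where `D` is the Laplacian of the unit sphere. -/
def ell (Ω : Fin 3 → Derivation ℝ A A) (f : A) : A := lap Ω (lap Ω f + 2 * f)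

theorem ell_comm {D : Derivation ℝ A A} (hD : ∀ g, lap Ω (D g) = D (lap Ω g)) (f : A) :
    ell Ω (D f) = D (ell Ω f) := by
  have : lap Ω (D f) + 2 * D f = D (lap Ω f + 2 * f) := by
    rw [hD, map_add, Derivation.leibniz, der_two]; simp
  rw [ell, this, hD, ell]

end RotAlg

section EllipticSlice

variable {M : ℝ} (hM : 0 < M) {ι : Type*} {C : ι → ℝ} {m : ℕ} {q q₁ q₂ : ℝ}

/-- The weighted classes for families in the algebra of smooth functions. -/
def SOm (M : ℝ) {ι : Type*} (C : ι → ℝ) (m : ℕ) (q : ℝ) (f : ι → Sm (ext M)) : Prop :=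
  SO M C m q fun i => Sm.rep (f i)

theorem SO.som {F : ι → Space → ℝ} (h : SO M C m q F) (hF : ∀ i, ContDiffOn ℝ ∞ (F i) (ext M)) :
    SOm M C m q fun i => Sm.mk (F i) (hF i) := h.congr fun i _ hx => Sm.rep_mk (hF i) hx

theorem SOm.so {f : ι → Sm (ext M)} (h : SOm M C m q f) {F : ι → Space → ℝ}
    (hF : ∀ i (x : ext M), F i x = (f i).1 x) : SO M C m q F :=
  h.congr fun i x hx => by rw [hF i ⟨x, hx⟩, ← Sm.rep_apply]

variable {f g : ι → Sm (ext M)}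

theorem SOm.add (h1 : SOm M C m q f) (h2 : SOm M C m q g) (hM : 0 < M) :
    SOm M C m q fun i => f i + g i :=
  (SO.add hM h1 h2).congr fun i x hx => Sm.rep_apply (f i + g i) ⟨x, hx⟩ |>.trans (by
    change (f i).1 _ + (g i).1 _ = _
    rw [← Sm.rep_apply, ← Sm.rep_apply])

theorem SOm.mul (h1 : SOm M C m q₂ f) (hM : 0 < M) {a : Sm (ext M)} {a' : Space → ℝ} (ha : Sy M q₁ a')
    (haa : ∀ x : ext M, a.1 x = a' x) (hq : q ≤ q₁ + q₂) : SOm M C m q fun i => a * f i :=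
  (SO.mul hM ha h1 hq).congr fun i x hx => Sm.rep_apply (a * f i) ⟨x, hx⟩ |>.trans (by
    change a.1 _ * (f i).1 _ = _
    rw [haa, ← Sm.rep_apply])

theorem SOm.neg (h1 : SOm M C m q f) (hM : 0 < M) : SOm M C m q fun i => -f i :=
  (SO.neg hM h1).congr fun i x hx => Sm.rep_apply (-f i) ⟨x, hx⟩ |>.trans (by
    change -(f i).1 _ = _
    rw [← Sm.rep_apply])

theorem SOm.sub (h1 : SOm M C m q f) (h2 : SOm M C m q g) (hM : 0 < M) :
    SOm M C m q fun i => f i - g i := by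
  simp only [sub_eq_add_neg]; exact h1.add (h2.neg hM) hM

theorem SOm.mono {m' : ℕ} (h1 : SOm M C m q f) (hm : m' ≤ m) : SOm M C m' q f := SO.mono h1 hm

theorem SOm.dS (h1 : SOm M C (m + 1) q f) (j : Fin 3) : SOm M C m (q + 1) fun i => dS hM j (f i) :=
  (h1.2 j).congr fun i x hx => by
    rw [Sm.rep_apply (LinearisedGravity.dS hM j (f i)) ⟨x, hx⟩]
    conv_lhs => rw [← Sm.mk_rep (f i)]
    rw [dS_mk_apply]

theorem SOm.of_dS (h0 : SOm M C 0 q f) (h1 : ∀ j, SOm M C m (q + 1) fun i => LinearisedGravity.dS hM j (f i)) :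
    SOm M C (m + 1) q f :=
  ⟨h0, fun j => (h1 j).congr fun i x hx => by
    rw [Sm.rep_apply (LinearisedGravity.dS hM j (f i)) ⟨x, hx⟩]
    conv_rhs => rw [← Sm.mk_rep (f i)]
    rw [dS_mk_apply]⟩

theorem SOm.euler (h1 : SOm M C (m + 1) q f) : SOm M C m q fun i => euler hM (f i) := by
  have h2 : ∀ j, SOm M C m q fun i => XS M j * LinearisedGravity.dS hM j (f i) := fun j =>
    (h1.dS hM j).mul hM (sy_coord hM j) (fun _ => rfl) (by linarith)
  exact ((h2 0).add (h2 1) hM).add (h2 2) hM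

theorem SOm.rot (h1 : SOm M C (m + 1) q f) (a : Fin 3) : SOm M C m q fun i => rot hM a (f i) := by
  have h2 : ∀ b c, SOm M C m q fun i => XS M b * LinearisedGravity.dS hM c (f i) := fun b c =>
    (h1.dS hM c).mul hM (sy_coord hM b) (fun _ => rfl) (by linarith)
  fin_cases a
  · exact (h2 1 2).sub (h2 2 1) hM
  · exact (h2 2 0).sub (h2 0 2) hM
  · exact (h2 0 1).sub (h2 1 0) hM

theorem SOm.of_euler_rot (h0 : SOm M C 0 q f) (h1 : SOm M C m q fun i => LinearisedGravity.euler hM (f i))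
    (h2 : ∀ a, SOm M C m q fun i => LinearisedGravity.rot hM a (f i)) : SOm M C (m + 1) q f := by
  have hy : ∀ {g : ι → Sm (ext M)} (a : Fin 3), SOm M C m q g → SOm M C m q fun i => yS hM a * g i :=
    fun a hg => hg.mul hM (sy_xhat hM a) (fun x => yS_apply' hM a x) (by linarith)
  refine SOm.of_dS hM h0 fun j => ?_
  simp only [dS_eq_del]
  refine SOm.mul ?_ hM (sy_norm_inv hM) (fun _ => rfl) (by linarith : q + 1 ≤ 1 + q)
  refine (hy j h1).add ?_ hM
  fin_cases j
  · exact (hy 2 (h2 1)).sub (hy 1 (h2 2)) hM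
  · exact (hy 0 (h2 2)).sub (hy 2 (h2 0)) hM
  · exact (hy 1 (h2 0)).sub (hy 0 (h2 1)) hM

/-- Vanishing projection to `l = 0, 1`. -/
def Orth (f : Sm (ext M)) : Prop :=
  ∀ (R : ℝ) (hR : 2 * M ≤ R), sI hM hR f = 0 ∧ ∀ i, sI hM hR (f * yS hM i) = 0

theorem sI_eq_avg {R : ℝ} (hR : 2 * M ≤ R) (f : Sm (ext M)) {x : Space} (hx : ‖x‖ = R) :
    sI hM hR f = 4 * Real.pi * avg (Sm.rep f) x := by
  have hπ := Real.pi_pos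
  conv_lhs => rw [← Sm.mk_rep f]
  rw [sI_mk, avg, sphAvg]
  simp only [hx]; field_simp

theorem exists_norm_eq {R : ℝ} (hR : 0 < R) : ∃ x : Space, ‖x‖ = R :=
  ⟨EuclideanSpace.single 0 R, by simp [abs_of_pos hR]⟩

/-- Spherical means commute with the radial derivative. -/
theorem sI_euler {f : Sm (ext M)} (hf : ∀ (R : ℝ) (hR : 2 * M ≤ R), sI hM hR f = 0) {R : ℝ}
    (hR : 2 * M ≤ R) : sI hM hR (euler hM f) = 0 := by
  have hR0 : 0 < R := by linarith
  have hπ := Real.pi_pos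
  obtain ⟨x, hx⟩ := exists_norm_eq hR0
  have hxe : x ∈ ext M := by change 2 * M ≤ ‖x‖; rw [hx]; exact hR
  have h0 : ∀ y ∈ ext M, avg (Sm.rep f) y = 0 := fun y hy => by
    have := hf ‖y‖ hy
    rw [sI_eq_avg hM hy f rfl] at this
    exact (mul_eq_zero.1 this).resolve_left (by positivity)
  have h1 : ∀ j, xhat x j * avg (fun y => ∑ k, xhat y k * ds M k (Sm.rep f) y) x = 0 := fun j => by
    rw [← ds_avg hM (Sm.rep_smooth f) j hxe, ds, dd_congr h0 hxe, dd_const]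
  have h2 := xhat_sq (norm_pos_of_mem_ext hM hxe)
  have h3 : avg (fun y => ∑ k, xhat y k * ds M k (Sm.rep f) y) x = 0 := by
    linear_combination xhat x 0 * h1 0 + xhat x 1 * h1 1 + xhat x 2 * h1 2
      - avg (fun y => ∑ k, xhat y k * ds M k (Sm.rep f) y) x * h2
  have h4 : sI hM hR (euler hM f) = R * (4 * Real.pi * avg (fun y => ∑ k, xhat y k * ds M k (Sm.rep f) y) x) := by
    rw [sI_eq_avg hM hR _ hx, avg, sphAvg, avg, sphAvg]
    simp only [sphereInt, hx]
    have : ∀ y : Sph, Sm.rep (euler hM f) (R • y.1) =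
        R * ∑ k, xhat (R • y.1) k * ds M k (Sm.rep f) (R • y.1) := fun y => by
      have e := Sm.rep_apply (euler hM f) (sphPt hM hR y)
      have e2 := norm_sphPt hM hR y
      rw [show (sphPt hM hR y).1 = R • y.1 from rfl] at e e2
      rw [e, Finset.mul_sum, Fin.sum_univ_three]
      conv_lhs => rw [← Sm.mk_rep f]
      rw [euler_apply]
      have e3 : ∀ k, (R • y.1) k = R * xhat (R • y.1) k := fun k => by
        rw [xhat, e2]; field_simp
      rw [← Sm.ev_apply]
      simp only [map_add, map_mul, Sm.ev_apply, dS_mk_apply, XS_apply]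
      rw [show (sphPt hM hR y).1 = R • y.1 from rfl, e3 0, e3 1, e3 2]; ring
    simp only [this]
    rw [integral_const_mul]; ring
  rw [h4, h3]; ring

theorem Orth.euler {f : Sm (ext M)} (hf : Orth hM f) : Orth hM (euler hM f) := fun R hR =>
  ⟨sI_euler hM (fun R hR => (hf R hR).1) hR, fun i => by
    have h1 := sI_euler hM (f := f * yS hM i) (fun R hR => (hf R hR).2 i) hR
    rwa [Derivation.leibniz, euler_yS, smul_zero, zero_add, smul_eq_mul, mul_comm] at h1⟩

theorem Orth.rot {f : Sm (ext M)} (hf : Orth hM f) (a : Fin 3) : Orth hM (rot hM a f) := fun R hR =>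
  ⟨sI_rot hM hR a f, fun i => by
    have h := rotAlg hM
    rw [sI_rot_mul]
    have h0 := (hf R hR).2
    fin_cases a <;> fin_cases i <;>
      simp [h.y00, h.y01, h.y02, h.y10, h.y11, h.y12, h.y20, h.y21, h.y22, h0]⟩

variable {hM}

theorem abs_le_of_elliptic {f F : Sm (ext M)} (hf : Orth hM f)
    (h : RotAlg.ell (rot hM) f = F) {R : ℝ} (hR : 2 * M ≤ R) {B : ℝ}
    (hB : 0 ≤ B) (hF : ∀ x : ext M, ‖x.1‖ = R → |F.1 x| ≤ B) (x : ext M) (hx : ‖x.1‖ = R) :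
    |f.1 x| ≤ 20301 * B := by
  have key : ∀ ε : ℝ, 0 < ε → |f.1 x| ≤ 20301 * (B + ε) := fun ε hε => by
    have h1 := abs_le_of_abs_lap_le hM hR (RotAlg.lap (rot hM) f + 2 * f)
      (by rw [map_add, sI_lap, sI_two_mul, (hf R hR).1]; ring) (by linarith : 0 < B + ε)
      (fun x hx => by
        rw [show RotAlg.lap (rot hM) (RotAlg.lap (rot hM) f + 2 * f) = F from h]
        linarith [hF x hx])
    have h2 := abs_le_of_abs_lap_add_le hM hR f (hf R hR).1 (hf R hR).2
      (by linarith : 0 < 201 * (B + ε)) h1 x hx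
    linarith
  refine le_of_forall_pos_le_add fun ε hε => ?_
  have := key (ε / 20301) (by positivity)
  linarith

theorem abs_le_of_zeta' {G F : Sm (ext M)} (hG : Orth hM G)
    (h : RotAlg.lap (rot hM) G + (2 - algebraMap ℝ _ (6 * M) * qS hM) * G = F) {R : ℝ}
    (hR : 2 * M ≤ R) {B : ℝ} (hB : 0 ≤ B) (hF : ∀ x : ext M, ‖x.1‖ = R → |F.1 x| ≤ B) (x : ext M)
    (hx : ‖x.1‖ = R) : |G.1 x| ≤ 201 * (R / (2 * M)) * B := by
  have hM' := hM
  have hR0 : 0 < R := by linarith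
  refine le_of_forall_pos_le_add fun ε hε => ?_
  have := abs_le_of_zeta hM hR G F (hG R hR).1 (B := B + ε / (201 * (R / (2 * M))))
    (by positivity) (fun x hx => by
      have : 0 < ε / (201 * (R / (2 * M))) := by positivity
      linarith [hF x hx]) h x hx
  refine this.trans (le_of_eq ?_)
  field_simp

theorem SOm.elliptic {f F : ι → Sm (ext M)} (hF : SOm M C m q F) (hf : ∀ i, Orth hM (f i))
    (h : ∀ i, RotAlg.ell (LinearisedGravity.rot hM) (f i) = F i) : SOm M C m q f := by
  induction m generalizing f F with
  | zero =>
    obtain ⟨h1, B, hB, h2⟩ := hF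
    refine ⟨fun i => Sm.rep_smooth _, 20301 * B, by positivity, fun i x hx => ?_⟩
    have h3 := abs_le_of_elliptic (hf i) (h i) hx ((abs_nonneg _).trans (h2 i x hx))
      (fun y hy => by rw [← Sm.rep_apply, ← hy]; exact h2 i y.1 y.2) ⟨x, hx⟩ rfl
    rw [← Sm.rep_apply] at h3
    exact h3.trans (le_of_eq (by ring))
  | succ m ih =>
    have h0 := ih (hF.mono (Nat.le_succ m)) hf h
    refine SOm.of_euler_rot hM (h0.mono (Nat.zero_le _)) ?_ fun a => ?_
    · exact ih (hF.euler hM) (fun i => (hf i).euler hM)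
        fun i => by rw [RotAlg.ell_comm (lap_euler hM), h]
    · exact ih (hF.rot hM a) (fun i => (hf i).rot hM a)
        fun i => by rw [RotAlg.ell_comm ((rotAlg hM).lap_rot a), h]

theorem SOm.zeta {G F : ι → Sm (ext M)} (hF : SOm M C m q F) (hG : ∀ i, Orth hM (G i))
    (h : ∀ i, RotAlg.lap (LinearisedGravity.rot hM) (G i) +
      (2 - algebraMap ℝ _ (6 * M) * qS hM) * G i = F i) :
    SOm M C m (q - 1) G := by
  induction m generalizing G F with
  | zero =>
    obtain ⟨h1, B, hB, h2⟩ := hF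
    refine ⟨fun i => Sm.rep_smooth _, 201 / (2 * M) * B, by have := hM; positivity, fun i x hx => ?_⟩
    have hx0 := norm_pos_of_mem_ext hM hx
    have h3 := abs_le_of_zeta' (hG i) (h i) hx ((abs_nonneg _).trans (h2 i x hx))
      (fun y hy => by rw [← Sm.rep_apply, ← hy]; exact h2 i y.1 y.2) ⟨x, hx⟩ rfl
    rw [← Sm.rep_apply] at h3
    refine h3.trans (le_of_eq ?_)
    rw [show -(q - 1) = -q + 1 by ring, Real.rpow_add_one hx0.ne']; ring
  | succ m ih =>
    have h0 := ih (hF.mono (Nat.le_succ m)) hG h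
    refine SOm.of_euler_rot hM (h0.mono (Nat.zero_le _)) ?_ fun a => ?_
    · refine ih (F := fun i => LinearisedGravity.euler hM (F i) - algebraMap ℝ _ (6 * M) * qS hM * G i)
        ?_ (fun i => (hG i).euler hM) fun i => ?_
      · refine (hF.euler hM).sub ?_ hM
        exact h0.mul hM ((sy_norm_inv hM).const_mul hM (6 * M)) (fun _ => rfl) (by linarith)
      · rw [lap_euler, ← h i]
        simp only [map_add, map_sub, Derivation.leibniz, smul_eq_mul, euler_qS,
          Derivation.map_algebraMap, mul_zero, add_zero]
        rw [RotAlg.der_two]; ring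
    · refine ih (F := fun i => LinearisedGravity.rot hM a (F i)) (hF.rot hM a) (fun i => (hG i).rot hM a)
        fun i => ?_
      rw [(rotAlg hM).lap_rot, ← h i]
      simp only [map_add, map_sub, Derivation.leibniz, smul_eq_mul, rot_qS,
        Derivation.map_algebraMap, mul_zero, add_zero]
      rw [RotAlg.der_two]; ring

theorem eq_zero_of_lap {f : Sm (ext M)} (hf : ∀ (R : ℝ) (hR : 2 * M ≤ R), sI hM hR f = 0)
    (h : RotAlg.lap (rot hM) f = 0) : f = 0 := Sm.ext' fun x => by
  have key : ∀ ε : ℝ, 0 < ε → |f.1 x| ≤ 0 + ε := fun ε hε => by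
    have := abs_le_of_abs_lap_le hM (R := ‖x.1‖) x.2 f (hf _ x.2) (B := ε / 201) (by positivity)
      (fun y _ => by
        rw [h]
        change |(0 : ℝ)| ≤ _
        rw [abs_zero]; positivity) x rfl
    linarith
  have := le_of_forall_pos_le_add key
  exact abs_nonpos_iff.1 this

theorem eq_zero_of_elliptic {f : Sm (ext M)} (hf : Orth hM f)
    (h : RotAlg.ell (rot hM) f = 0) : f = 0 := Sm.ext' fun x => by
  have := abs_le_of_elliptic hf h x.2 le_rfl (fun y _ => (abs_zero (α := ℝ)).le) x rfl
  rw [mul_zero] at this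
  exact abs_nonpos_iff.1 this

end EllipticSlice

end LinearisedGravity

end

noncomputable section

set_option linter.unusedSimpArgs false

namespace LinearisedGravity

open MeasureTheory

/-! ## The operators `𝒯_f`, `𝒯_ξ` and `𝒟₁^*` -/

namespace RotAlg

variable {A : Type*} [CommRing A] [Algebra ℝ A] {Ω : Fin 3 → Derivation ℝ A A} {y : Fin 3 → A}
  (h : RotAlg Ω y)
include h

theorem rot_del_eq (f g : A) : Ω 0 f * Ω 0 g + Ω 1 f * Ω 1 g + Ω 2 f * Ω 2 g =
    del Ω y 0 f * del Ω y 0 g + del Ω y 1 f * del Ω y 1 g + del Ω y 2 f * del Ω y 2 g :=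
  (h.sum_del_mul_del f g).symm

variable {ζ : Fin 3 → A} (hζ : y 0 * ζ 0 + y 1 * ζ 1 + y 2 * ζ 2 = 0)
include hζ

theorem sum_y_lap : y 0 * lap Ω (ζ 0) + y 1 * lap Ω (ζ 1) + y 2 * lap Ω (ζ 2) =
    -2 * ∑ b, del Ω y b (ζ b) := by
  have h1 := congrArg (lap Ω) hζ
  have hz : lap Ω (0 : A) = 0 := by simp [lap]
  have e : ∀ a, Ω 0 (y a) * Ω 0 (ζ a) + Ω 1 (y a) * Ω 1 (ζ a) + Ω 2 (y a) * Ω 2 (ζ a) =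
      del Ω y a (ζ a) := fun a => by
    rw [h.rot_del_eq]
    have h2 := y_del (Ω := Ω) (y := y) (ζ a)
    simp only [h.del_y]
    fin_cases a <;>
      simp only [Fin.zero_eta, Fin.mk_one, Fin.reduceFinMk, Fin.isValue, if_true, Fin.reduceEq,
        if_false, zero_ne_one, one_ne_zero] at h2 ⊢
    · linear_combination (-y 0) * h2
    · linear_combination (-y 1) * h2
    · linear_combination (-y 2) * h2
  rw [lap_add, lap_add, lap_mul, lap_mul, lap_mul, hz, e, e, e, h.lap_y, h.lap_y, h.lap_y] at h1
  rw [Fin.sum_univ_three]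
  linear_combination h1 + 2 * hζ

theorem sum_y_div_sym : ∑ c, y c * (lap Ω (ζ c) + 2 * ζ c + 2 * y c * ∑ b, del Ω y b (ζ b)) = 0 := by
  have h1 := h.sum_y_lap hζ
  have h2 := h.sq
  rw [Fin.sum_univ_three]
  linear_combination h1 + 2 * hζ + 2 * (∑ b, del Ω y b (ζ b)) * h2

theorem div_div_sym : ∑ c, del Ω y c (lap Ω (ζ c) + 2 * ζ c + 2 * y c * ∑ b, del Ω y b (ζ b)) =
    lap Ω (∑ b, del Ω y b (ζ b)) + 2 * ∑ b, del Ω y b (ζ b) := by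
  have h1 := h.sum_y_lap hζ
  have h2 := h.sq
  have hr := y_del (Ω := Ω) (y := y) (∑ b, del Ω y b (ζ b))
  have e := fun c => h.lap_del c (ζ c)
  have e0 := e 0
  have e1 := e 1
  have e2 := e 2
  set d := ∑ b, del Ω y b (ζ b) with hd
  have hl : lap Ω d = lap Ω (del Ω y 0 (ζ 0)) + lap Ω (del Ω y 1 (ζ 1)) + lap Ω (del Ω y 2 (ζ 2)) := by
    rw [hd, Fin.sum_univ_three, lap_add, lap_add]
  have hd' : d = del Ω y 0 (ζ 0) + del Ω y 1 (ζ 1) + del Ω y 2 (ζ 2) := by rw [hd, Fin.sum_univ_three]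
  rw [Fin.sum_univ_three]
  simp only [map_add, Derivation.leibniz, smul_eq_mul, der_two, h.del_y, if_true, mul_zero, add_zero]
  linear_combination (-1) * hl - e0 - e1 - e2 + 2 * h1 + 2 * hr - 2 * hd' - 2 * d * h2

omit hζ in
theorem curl_div_sym : ∑ c, Ω c (lap Ω (ζ c) + 2 * ζ c + 2 * y c * ∑ b, del Ω y b (ζ b)) =
    lap Ω (∑ b, Ω b (ζ b)) + 2 * ∑ b, Ω b (ζ b) := by
  have hr := h.rad (∑ b, del Ω y b (ζ b))
  set d := ∑ b, del Ω y b (ζ b)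
  simp only [Fin.sum_univ_three, map_add, Derivation.leibniz, smul_eq_mul, der_two, lap_add, h.lap_rot,
    h.y00, h.y11, h.y22, mul_zero, add_zero]
  linear_combination 2 * hr

theorem sum_y_sym (c : Fin 3) :
    ∑ a, y a * (del Ω y a (ζ c) + y c * ζ a + (del Ω y c (ζ a) + y a * ζ c)
      - ((if a = c then 1 else 0) - y a * y c) * ∑ b, del Ω y b (ζ b)) = 0 := by
  have hs := h.sq
  have hr := y_del (Ω := Ω) (y := y) (ζ c)
  have hd := congrArg (del Ω y c) hζ
  set d := ∑ b, del Ω y b (ζ b)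
  simp only [map_add, map_zero, Derivation.leibniz, smul_eq_mul, h.del_y] at hd
  rw [Fin.sum_univ_three]
  fin_cases c <;>
    simp only [Fin.zero_eta, Fin.mk_one, Fin.reduceFinMk, Fin.isValue, if_true, Fin.reduceEq,
      if_false, zero_ne_one, one_ne_zero] at hd hr ⊢
  · linear_combination hr + 2 * y 0 * hζ + hd + (ζ 0 + y 0 * d) * hs
  · linear_combination hr + 2 * y 1 * hζ + hd + (ζ 1 + y 1 * d) * hs
  · linear_combination hr + 2 * y 2 * hζ + hd + (ζ 2 + y 2 * d) * hs

theorem trace_sym :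
    ∑ a, (del Ω y a (ζ a) + y a * ζ a + (del Ω y a (ζ a) + y a * ζ a)
      - ((if a = a then 1 else 0) - y a * y a) * ∑ b, del Ω y b (ζ b)) = 0 := by
  have hs := h.sq
  simp only [Fin.sum_univ_three, if_true]
  linear_combination 2 * hζ + (del Ω y 0 (ζ 0) + del Ω y 1 (ζ 1) + del Ω y 2 (ζ 2)) * hs

omit h hζ in
theorem lap_const_mul {q : A} (hq : ∀ a, Ω a q = 0) (f : A) : lap Ω (q * f) = q * lap Ω f := by
  simp only [lap, Derivation.leibniz, smul_eq_mul, hq, mul_zero, add_zero]; ring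

omit h hζ in
theorem ell_eq (f : A) : ell Ω f = lap Ω (lap Ω f) + 2 * lap Ω f := by
  rw [ell, lap_add, two_mul, lap_add, two_mul]

omit h hζ in
theorem mul_lap_add {q r : A} (hq : ∀ a, Ω a q = 0) (hr : r * q = 1) (f : A) :
    r * (lap Ω (q * lap Ω f) + 2 * (q * lap Ω f)) = ell Ω f := by
  rw [lap_const_mul hq, ell_eq]
  linear_combination (lap Ω (lap Ω f) + 2 * lap Ω f) * hr

omit hζ in
theorem lap_eq_zero {P Q : A} (he : ∀ a, del Ω y a P + Ω a Q = 0) : lap Ω P = 0 ∧ lap Ω Q = 0 := by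
  constructor
  · rw [← h.lap_eq_del]
    have h0 := congrArg (del Ω y 0) (he 0)
    have h1 := congrArg (del Ω y 1) (he 1)
    have h2 := congrArg (del Ω y 2) (he 2)
    simp only [map_add, map_zero] at h0 h1 h2
    linear_combination h0 + h1 + h2 - h.del_rot Q
  · have h0 := congrArg (Ω 0) (he 0)
    have h1 := congrArg (Ω 1) (he 1)
    have h2 := congrArg (Ω 2) (he 2)
    simp only [map_add, map_zero] at h0 h1 h2
    rw [lap]
    linear_combination h0 + h1 + h2 - h.rot_del P

end RotAlg

section Operators

variable {M : ℝ} (hM : 0 < M)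

/-- A sphere 1-form. -/
def vec (ξ : Fin 3 → Sm (ext M)) : (Fin 1 → Fin 3) → Sm (ext M) := fun I => ξ (I 0)

/-- A sphere 2-tensor. -/
def mat (W : Fin 3 → Fin 3 → Sm (ext M)) : (Fin 2 → Fin 3) → Sm (ext M) := fun I => W (I 0) (I 1)

/-- The derivations `δ`. -/
abbrev dl (i : Fin 3) : Derivation ℝ (Sm (ext M)) (Sm (ext M)) := RotAlg.del (rot hM) (yS hM) i

theorem Reps.congr {k : ℕ} {T : SField k} {S S' : (Fin k → Fin 3) → Sm (ext M)} (h : Reps T S)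
    (e : ∀ I, S I = S' I) : Reps T S' := fun x I => by rw [h x I, e]

theorem Reps.smul {k : ℕ} {T : SField k} {S : (Fin k → Fin 3) → Sm (ext M)} (h : Reps T S)
    {f : Space → ℝ} {φ : Sm (ext M)} (hf : ∀ x : ext M, f x = φ.1 x) :
    Reps (fun x I => f x * T x I) (fun I => φ * S I) := fun x I => by
  simp only [hf, h x I]; rfl

theorem reps_angD {k : ℕ} {T : SField k} {S : (Fin k → Fin 3) → Sm (ext M)} (h : Reps T S) :
    Reps (angD M T) (fun I => qS hM * rAngS hM S I) := fun x I => by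
  have h1 := h.rAng hM x I
  have := (norm_pos_of_mem_ext hM x.2).ne'
  have h2 : (qS hM * rAngS hM S I).1 x = ‖x.1‖⁻¹ * (rAngS hM S I).1 x := rfl
  rw [h2, ← h1]; field_simp

theorem rAngS_scalar (φ : Sm (ext M)) (I : Fin 1 → Fin 3) :
    rAngS hM (fun _ : Fin 0 → Fin 3 => φ) I = dl hM (I 0) φ := by
  simp [rAngS]

variable {ξ : Fin 3 → Sm (ext M)}

theorem angS_vec (h : ∑ i, yS hM i * ξ i = 0) : AngS hM (vec ξ) := fun m I => by
  rw [← h]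
  refine Finset.sum_congr rfl fun i _ => ?_
  rw [Subsingleton.elim m 0]; simp [vec]

theorem rAngS_vec (h : ∑ i, yS hM i * ξ i = 0) (I : Fin 2 → Fin 3) :
    rAngS hM (vec ξ) I = dl hM (I 0) (ξ (I 1)) + yS hM (I 1) * ξ (I 0) := by
  have h1 := del_eq_rAngS hM (angS_vec hM h) (I 0) (fun _ => I 1)
  have h2 : (Fin.cons (I 0) (fun _ : Fin 1 => I 1) : Fin 2 → Fin 3) = I := by
    funext i; fin_cases i <;> rfl
  rw [h2] at h1
  simp only [vec, Finset.univ_unique, Finset.sum_singleton, Fin.default_eq_zero, Function.update_self] at h1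
  rw [h1]; exact (sub_add_cancel _ _).symm

variable {W : Fin 3 → Fin 3 → Sm (ext M)}

theorem angS_mat (h1 : ∀ c, ∑ i, yS hM i * W i c = 0) (h2 : ∀ c, ∑ i, yS hM i * W c i = 0) :
    AngS hM (mat W) := fun m I => by
  fin_cases m
  · rw [← h1 (I 1)]; exact Finset.sum_congr rfl fun i _ => by simp [mat]
  · rw [← h2 (I 0)]; exact Finset.sum_congr rfl fun i _ => by simp [mat]

theorem rAngS_mat (h1 : ∀ c, ∑ i, yS hM i * W i c = 0) (h2 : ∀ c, ∑ i, yS hM i * W c i = 0)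
    (c a b : Fin 3) : rAngS hM (mat W) (Fin.cons c ![a, b]) =
      dl hM c (W a b) + (yS hM a * W c b + yS hM b * W a c) := by
  have h3 := del_eq_rAngS hM (angS_mat hM h1 h2) c ![a, b]
  simp only [mat, Fin.sum_univ_two, Matrix.cons_val_zero, Matrix.cons_val_one, Function.update_self,
    ne_eq, zero_ne_one, one_ne_zero, not_false_eq_true, Function.update_of_ne] at h3
  rw [h3]; exact (sub_add_cancel _ _).symm

theorem dl_qS (i : Fin 3) : dl hM i (qS hM) = 0 := by
  fin_cases i <;> simp [RotAlg.del_zero, RotAlg.del_one, RotAlg.del_two, rot_qS]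

theorem reps_sdiv_vec {T : SField 1} (hT : Reps T (vec ξ)) (h : ∑ i, yS hM i * ξ i = 0) :
    Reps (sdiv M T) (fun _ => qS hM * ∑ j, dl hM j (ξ j)) := fun x I => by
  have h1 := reps_angD hM hT
  have h2 : ∀ j : Fin 3, angD M T x (Fin.cons j (Fin.cons j I)) =
      (qS hM * (dl hM j (ξ j) + yS hM j * ξ j)).1 x := fun j => by
    refine (h1 x _).trans ?_
    beta_reduce
    rw [rAngS_vec hM h]; rfl
  simp only [sdiv, h2]
  rw [← Sm.ev_apply]
  simp only [← Sm.ev_apply x (qS hM * (_ + _))]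
  rw [← map_sum, ← Finset.mul_sum, Finset.sum_add_distrib, h, add_zero]

theorem areaForm_apply (x : ext M) (i j : Fin 3) : areaForm x.1 i j =
    (![![0, yS hM 2, -yS hM 1], ![-yS hM 2, 0, yS hM 0], ![yS hM 1, -yS hM 0, 0]] i j).1 x := by
  have h : ∀ i, (-yS hM i).1 x = -(yS hM i).1 x := fun _ => rfl
  have h0 : (0 : Sm (ext M)).1 x = 0 := rfl
  rw [areaForm_eq]
  fin_cases i <;> fin_cases j <;> simp [yS_apply', h, h0]

theorem reps_scurl {T : SField 1} (hT : Reps T (vec ξ)) (h : ∑ i, yS hM i * ξ i = 0) :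
    Reps (scurl M T) (fun _ => qS hM * ∑ j, rot hM j (ξ j)) := fun x I => by
  have h1 := reps_angD hM hT
  have h2 : ∀ a b : Fin 3, angD M T x ![a, b] =
      (qS hM * (dl hM a (ξ b) + yS hM b * ξ a)).1 x := fun a b => by
    refine (h1 x _).trans ?_
    beta_reduce
    rw [rAngS_vec hM h]; rfl
  have e : ∀ b, rot hM b (ξ b) = _ := fun b => rfl
  obtain ⟨r0, -, -⟩ := (rotAlg hM).rot_eq (ξ 0)
  obtain ⟨-, r1, -⟩ := (rotAlg hM).rot_eq (ξ 1)
  obtain ⟨-, -, r2⟩ := (rotAlg hM).rot_eq (ξ 2)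
  simp only [scurl, h2, areaForm_apply hM]
  rw [← Sm.ev_apply, Fin.sum_univ_three (fun j => rot hM j (ξ j)), r0, r1, r2]
  simp only [← Sm.ev_apply x, ← map_mul, ← map_sum]
  congr 1
  simp only [Fin.sum_univ_three, Matrix.cons_val_zero, Matrix.cons_val_one, Matrix.cons_val]
  ring

/-- The rescaled symmetrised traceless derivative. -/
def symS (ζ : Fin 3 → Sm (ext M)) (a c : Fin 3) : Sm (ext M) :=
  dl hM a (ζ c) + yS hM c * ζ a + (dl hM c (ζ a) + yS hM a * ζ c)
      - ((if a = c then 1 else 0) - yS hM a * yS hM c) * ∑ b, dl hM b (ζ b)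

/-- The rescaled divergence of `symS`. -/
def divSymS (ζ : Fin 3 → Sm (ext M)) (c : Fin 3) : Sm (ext M) :=
  RotAlg.lap (rot hM) (ζ c) + 2 * ζ c + 2 * yS hM c * ∑ b, dl hM b (ζ b)

theorem reps_tfD {T : SField 1} (hT : Reps T (vec ξ)) (h : ∑ i, yS hM i * ξ i = 0) :
    Reps (tfD M T) (mat fun a c => qS hM * symS hM ξ a c) := fun x I => by
  have h1 := reps_angD hM hT
  have h2 : ∀ a b : Fin 3, angD M T x ![a, b] =
      (qS hM * (dl hM a (ξ b) + yS hM b * ξ a)).1 x := fun a b => by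
    refine (h1 x _).trans ?_
    beta_reduce
    rw [rAngS_vec hM h]; rfl
  rw [tfD, h2, h2, reps_sdiv_vec hM hT h x, ← projS_apply hM]
  simp only [← Sm.ev_apply x, ← map_mul, ← map_sum, ← map_add, ← map_sub]
  congr 1
  simp only [mat, symS, projS]
  ring

theorem reps_sdiv_tfD {T : SField 1} (hT : Reps T (vec ξ)) (h : ∑ i, yS hM i * ξ i = 0) :
    Reps (sdiv M (tfD M T)) (vec fun c => qS hM * qS hM * divSymS hM ξ c) := fun x I => by
  have h3 : yS hM 0 * ξ 0 + yS hM 1 * ξ 1 + yS hM 2 * ξ 2 = 0 := by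
    rw [← h, Fin.sum_univ_three]
  have hs : ∀ a c, symS hM ξ a c = symS hM ξ c a := fun a c => by
    simp only [symS, eq_comm (a := a) (b := c)]; ring
  have hV : ∀ c, ∑ a, yS hM a * symS hM ξ a c = 0 := (rotAlg hM).sum_y_sym h3
  have hW1 : ∀ c, ∑ i, yS hM i * (qS hM * symS hM ξ i c) = 0 := fun c => by
    have := congrArg (fun z => qS hM * z) (hV c)
    simp only [Finset.mul_sum, mul_zero] at this
    rw [← this]; exact Finset.sum_congr rfl fun i _ => by ring
  have hW2 : ∀ c, ∑ i, yS hM i * (qS hM * symS hM ξ c i) = 0 := fun c => by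
    simp only [hs c]; exact hW1 c
  have h1 := reps_angD hM (reps_tfD hM hT h)
  have h2 : ∀ j : Fin 3, angD M (tfD M T) x (Fin.cons j (Fin.cons j I)) =
      (qS hM * (qS hM * dl hM j (symS hM ξ j (I 0)) + (yS hM j * (qS hM * symS hM ξ j (I 0))
        + yS hM (I 0) * (qS hM * symS hM ξ j j)))).1 x := fun j => by
    have e : (Fin.cons j (Fin.cons j I) : Fin 3 → Fin 3) = Fin.cons j ![j, I 0] := by
      funext i; fin_cases i <;> rfl
    refine (h1 x _).trans ?_
    beta_reduce
    rw [e, rAngS_mat hM hW1 hW2]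
    simp only [Derivation.leibniz, smul_eq_mul, dl_qS, mul_zero, add_zero]
  simp only [sdiv, h2]
  simp only [← Sm.ev_apply x, ← map_sum]
  congr 1
  have e1 : ∑ j, dl hM j (symS hM ξ j (I 0)) = divSymS hM ξ (I 0) := (rotAlg hM).div_sym ξ h3 (I 0)
  have e2 : ∑ j, symS hM ξ j j = 0 := (rotAlg hM).trace_sym h3
  rw [← Finset.mul_sum, Finset.sum_add_distrib, Finset.sum_add_distrib, ← Finset.mul_sum, e1,
    hW1, ← Finset.mul_sum, ← Finset.mul_sum, e2]
  simp only [vec]; ring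

theorem sum_y_divSymS (h : ∑ i, yS hM i * ξ i = 0) :
    ∑ i, yS hM i * (qS hM * qS hM * divSymS hM ξ i) = 0 := by
  have h3 : yS hM 0 * ξ 0 + yS hM 1 * ξ 1 + yS hM 2 * ξ 2 = 0 := by
    rw [← h, Fin.sum_univ_three]
  have h1 := congrArg (fun z => qS hM * qS hM * z) ((rotAlg hM).sum_y_div_sym h3)
  simp only [Finset.mul_sum, mul_zero] at h1
  rw [← h1]; exact Finset.sum_congr rfl fun i _ => by simp only [divSymS, Finset.mul_sum]; ring

theorem reps_div_div {T : SField 1} (hT : Reps T (vec ξ)) (h : ∑ i, yS hM i * ξ i = 0) :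
    Reps (fun x I => ‖x‖ ^ 4 * sdiv M (sdiv M (tfD M T)) x I) (fun _ => rS hM *
      (RotAlg.lap (rot hM) (∑ b, dl hM b (ξ b)) + 2 * ∑ b, dl hM b (ξ b))) := by
  have h3 : yS hM 0 * ξ 0 + yS hM 1 * ξ 1 + yS hM 2 * ξ 2 = 0 := by
    rw [← h, Fin.sum_univ_three]
  refine ((reps_sdiv_vec hM (reps_sdiv_tfD hM hT h) (sum_y_divSymS hM h)).smul
    (f := fun x => ‖x‖ ^ 4) (φ := rS hM ^ 4) fun x => rfl).congr fun _ => ?_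
  have e1 : ∑ c, dl hM c (divSymS hM ξ c) = _ := (rotAlg hM).div_div_sym h3
  simp only [Derivation.leibniz, smul_eq_mul, dl_qS, mul_zero, add_zero, ← Finset.mul_sum]
  rw [← e1]
  have := rS_qS hM
  generalize ∑ c, dl hM c (divSymS hM ξ c) = z
  linear_combination (rS hM ^ 3 * qS hM ^ 2 + rS hM ^ 2 * qS hM + rS hM) * z * this

theorem reps_curl_div {T : SField 1} (hT : Reps T (vec ξ)) (h : ∑ i, yS hM i * ξ i = 0) :
    Reps (fun x I => ‖x‖ ^ 4 * scurl M (sdiv M (tfD M T)) x I) (fun _ => rS hM *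
      (RotAlg.lap (rot hM) (∑ b, rot hM b (ξ b)) + 2 * ∑ b, rot hM b (ξ b))) := by
  refine ((reps_scurl hM (reps_sdiv_tfD hM hT h) (sum_y_divSymS hM h)).smul
    (f := fun x => ‖x‖ ^ 4) (φ := rS hM ^ 4) fun x => rfl).congr fun _ => ?_
  have e1 : ∑ c, rot hM c (divSymS hM ξ c) = _ := (rotAlg hM).curl_div_sym (ζ := ξ)
  simp only [Derivation.leibniz, smul_eq_mul, rot_qS, mul_zero, add_zero, ← Finset.mul_sum]
  rw [← e1]
  have := rS_qS hM
  generalize ∑ c, rot hM c (divSymS hM ξ c) = z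
  linear_combination (rS hM ^ 3 * qS hM ^ 2 + rS hM ^ 2 * qS hM + rS hM) * z * this

variable {e o : SField 0} {φ ψ : Sm (ext M)}

theorem reps_grad (he : Reps e fun _ => φ) : Reps (angD M e) (vec fun a => qS hM * dl hM a φ) :=
  (reps_angD hM he).congr fun I => by rw [rAngS_scalar]; rfl

theorem sum_y_grad (φ : Sm (ext M)) : ∑ i, yS hM i * (qS hM * dl hM i φ) = 0 := by
  have := RotAlg.y_del (Ω := rot hM) (y := yS hM) φ
  rw [Fin.sum_univ_three]
  linear_combination qS hM * this

theorem reps_sdiv_grad (he : Reps e fun _ => φ) :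
    Reps (sdiv M (angD M e)) fun _ => qS hM * qS hM * RotAlg.lap (rot hM) φ :=
  (reps_sdiv_vec hM (reps_grad hM he) (sum_y_grad hM φ)).congr fun _ => by
    simp only [Derivation.leibniz, smul_eq_mul, dl_qS, mul_zero, add_zero, ← Finset.mul_sum]
    rw [Fin.sum_univ_three, (rotAlg hM).lap_eq_del]; ring

theorem reps_Tf (he : Reps e fun _ => φ) : Reps (Tf M e) fun _ => RotAlg.ell (rot hM) φ := by
  refine (reps_div_div hM (reps_grad hM he) (sum_y_grad hM φ)).congr fun _ => ?_
  simp only [Derivation.leibniz, smul_eq_mul, dl_qS, mul_zero, add_zero, ← Finset.mul_sum]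
  rw [Fin.sum_univ_three, (rotAlg hM).lap_eq_del]
  exact RotAlg.mul_lap_add (rot_qS hM) (rS_qS hM) φ

theorem reps_D1star (he : Reps e fun _ => φ) (ho : Reps o fun _ => ψ) :
    Reps (D1star M e o) (vec fun a => -(qS hM * (dl hM a φ + rot hM a ψ))) := fun x I => by
  have h1 := reps_grad hM he x I
  have h2 : ∀ a, angD M o x ![a] = (qS hM * dl hM a ψ).1 x := fun a => reps_grad hM ho x ![a]
  obtain ⟨r0, r1, r2⟩ := (rotAlg hM).rot_eq ψ
  simp only [D1star, star, h1, h2, areaForm_apply hM]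
  simp only [← Sm.ev_apply x, ← map_mul, ← map_sum, ← map_neg, ← map_sub]
  congr 1
  simp only [vec]
  generalize I 0 = b
  fin_cases b <;>
    simp only [Fin.zero_eta, Fin.mk_one, Fin.reduceFinMk, Fin.sum_univ_three, Matrix.cons_val_zero, Matrix.cons_val_one, Matrix.cons_val]
  · rw [r0]; ring
  · rw [r1]; ring
  · rw [r2]; ring

/-- The vector `𝒟₁^*(φ, ψ)`. -/
def d1S (φ ψ : Sm (ext M)) (a : Fin 3) : Sm (ext M) := -(qS hM * (dl hM a φ + rot hM a ψ))

theorem sum_y_d1S (φ ψ : Sm (ext M)) : ∑ i, yS hM i * d1S hM φ ψ i = 0 := by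
  have h1 := RotAlg.y_del (Ω := rot hM) (y := yS hM) φ
  have h2 := (rotAlg hM).rad ψ
  simp only [Fin.sum_univ_three, d1S]
  linear_combination (-qS hM) * h1 - qS hM * h2

theorem sum_dl_d1S (φ ψ : Sm (ext M)) :
    ∑ i, dl hM i (d1S hM φ ψ i) = qS hM * RotAlg.lap (rot hM) (-φ) := by
  have h1 := (rotAlg hM).lap_eq_del φ
  have h2 := (rotAlg hM).del_rot ψ
  simp only [Fin.sum_univ_three, d1S, map_neg, map_add, Derivation.leibniz, smul_eq_mul, dl_qS,
    mul_zero, add_zero, RotAlg.lap_neg]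
  linear_combination (-qS hM) * h1 - qS hM * h2

theorem sum_rot_d1S (φ ψ : Sm (ext M)) :
    ∑ i, rot hM i (d1S hM φ ψ i) = qS hM * RotAlg.lap (rot hM) (-ψ) := by
  have h1 : RotAlg.lap (rot hM) ψ = _ := rfl
  have h2 := (rotAlg hM).rot_del φ
  simp only [RotAlg.lap] at h1
  simp only [Fin.sum_univ_three, d1S, map_neg, map_add, Derivation.leibniz, smul_eq_mul, rot_qS,
    mul_zero, add_zero, RotAlg.lap]
  linear_combination (-qS hM) * h2

theorem reps_Tv {T : SField 1} (hT : Reps T (vec (d1S hM φ ψ))) :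
    Reps (Tv M T) (vec (d1S hM (RotAlg.ell (rot hM) (-φ)) (RotAlg.ell (rot hM) (-ψ)))) := by
  have h1 := sum_y_d1S hM φ ψ
  refine reps_D1star hM ((reps_div_div hM hT h1).congr fun _ => ?_)
    ((reps_curl_div hM hT h1).congr fun _ => ?_)
  · rw [sum_dl_d1S]; exact RotAlg.mul_lap_add (rot_qS hM) (rS_qS hM) _
  · rw [sum_rot_d1S]; exact RotAlg.mul_lap_add (rot_qS hM) (rS_qS hM) _

/-- The kernel of `𝒟₁^*`. -/
theorem d1S_injective {φ ψ φ' ψ' : Sm (ext M)}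
    (he : ∀ a, d1S hM φ ψ a = d1S hM φ' ψ' a)
    (h0 : ∀ (R : ℝ) (hR : 2 * M ≤ R), sI hM hR φ = sI hM hR φ' ∧ sI hM hR ψ = sI hM hR ψ') :
    φ = φ' ∧ ψ = ψ' := by
  have h1 := (rotAlg hM).lap_eq_zero (P := φ - φ') (Q := ψ - ψ') fun a => by
    have h2 := he a
    simp only [d1S] at h2
    simp only [map_sub]
    linear_combination (-rS hM) * h2 - (dl hM a φ - dl hM a φ' + rot hM a ψ - rot hM a ψ') * rS_qS hM
  constructor
  · refine sub_eq_zero.1 (eq_zero_of_lap (hM := hM) (fun R hR => ?_) h1.1)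
    rw [map_sub, (h0 R hR).1, sub_self]
  · refine sub_eq_zero.1 (eq_zero_of_lap (hM := hM) (fun R hR => ?_) h1.2)
    rw [map_sub, (h0 R hR).2, sub_self]

end Operators

end LinearisedGravity

end

noncomputable section

set_option linter.unusedSimpArgs false

namespace LinearisedGravity

open MeasureTheory

/-! ## Elliptic estimates on the spheres for functions on spacetime -/

section SpacetimeElliptic

variable {M : ℝ} (hM : 0 < M) {t s : ℝ}

/-- Coordinate derivations on spacetime. -/
def dF (t : ℝ) (a : Fin 4) : Derivation ℝ (Sm (future M t)) (Sm (future M t)) :=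
  (goodSet_future hM t).der (basis4 a)

theorem dF_mk_apply {f : Spacetime → ℝ} (hf : ContDiffOn ℝ ∞ f (future M t)) (a : Fin 4)
    (p : future M t) : (dF hM t a (Sm.mk f hf)).1 p = pd M t a f p := by
  rw [dF, GoodSet.der_mk]; rfl

theorem dF_apply (g : Sm (future M t)) (a : Fin 4) (p : future M t) :
    (dF hM t a g).1 p = pd M t a (Sm.rep g) p := by
  conv_lhs => rw [← Sm.mk_rep g]
  rw [dF_mk_apply]

theorem dF_comm (a b : Fin 4) (g : Sm (future M t)) : dF hM t a (dF hM t b g) = dF hM t b (dF hM t a g) :=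
  (goodSet_future hM t).der_comm g

/-- Time-independent functions on spacetime. -/
def statF (t : ℝ) (g : Sm (ext M)) : Sm (future M t) :=
  Sm.mk (fun p => Sm.rep g p.2) (contDiffOn_static (Sm.rep_smooth g))

theorem dF_statF (g : Sm (ext M)) : dF hM t 0 (statF t g) = 0 := Sm.ext' fun p => by
  rw [statF, dF_mk_apply, pd_zero_static hM (Sm.rep_smooth g) p.2]; rfl

/-- Restriction to a slice. -/
def slS (hs : t ≤ s) : Sm (future M t) →+* Sm (ext M) where
  toFun g := Sm.mk (fun x => Sm.rep g (s, x)) (contDiffOn_slice (Sm.rep_smooth g) hs)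
  map_one' := Sm.ext' fun x => Sm.rep_apply (1 : Sm (future M t)) ⟨(s, x), mem_future hs x.2⟩
  map_zero' := Sm.ext' fun x => Sm.rep_apply (0 : Sm (future M t)) ⟨(s, x), mem_future hs x.2⟩
  map_add' f g := Sm.ext' fun x => by
    have h := fun f : Sm (future M t) => Sm.rep_apply f ⟨(s, x), mem_future hs x.2⟩
    refine (h (f + g)).trans ?_
    rw [← Sm.ev_apply, map_add, Sm.ev_apply, Sm.ev_apply, ← h, ← h]; rfl
  map_mul' f g := Sm.ext' fun x => by
    have h := fun f : Sm (future M t) => Sm.rep_apply f ⟨(s, x), mem_future hs x.2⟩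
    refine (h (f * g)).trans ?_
    rw [← Sm.ev_apply, map_mul, Sm.ev_apply, Sm.ev_apply, ← h, ← h]; rfl

theorem slS_apply (hs : t ≤ s) (g : Sm (future M t)) (x : ext M) :
    (slS hs g).1 x = Sm.rep g (s, x) := rfl

theorem slS_mk (hs : t ≤ s) {f : Spacetime → ℝ} (hf : ContDiffOn ℝ ∞ f (future M t)) :
    slS hs (Sm.mk f hf) = Sm.mk (fun x => f (s, x)) (contDiffOn_slice hf hs) :=
  Sm.mk_eq (hf := contDiffOn_slice (Sm.rep_smooth _) hs) fun _ hx => Sm.rep_mk hf (mem_future hs hx)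

theorem slS_statF (hs : t ≤ s) (g : Sm (ext M)) : slS hs (statF t g) = g := by
  rw [statF, slS_mk]; exact Sm.mk_rep g

theorem ext_of_slS {f g : Sm (future M t)} (h : ∀ s (hs : t ≤ s), slS hs f = slS hs g) : f = g :=
  Sm.ext' fun p => by
    have := congrFun (congrArg Subtype.val (h p.1.1 p.2.1)) ⟨p.1.2, p.2.2⟩
    rw [← Sm.rep_apply, ← Sm.rep_apply]; exact this

theorem slS_dF (hs : t ≤ s) (j : Fin 3) (g : Sm (future M t)) :
    slS hs (dF hM t j.succ g) = dS hM j (slS hs g) := Sm.ext' fun x => by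
  rw [slS_apply, Sm.rep_apply _ ⟨(s, x.1), mem_future hs x.2⟩, dF_apply,
    ← ds_slice hM (Sm.rep_smooth g) hs x.2]
  exact (dS_mk_apply hM (contDiffOn_slice (Sm.rep_smooth g) hs) j x).symm

/-- The rotation fields on spacetime. -/
def rotF (t : ℝ) : Fin 3 → Derivation ℝ (Sm (future M t)) (Sm (future M t)) :=
  ![statF t (XS M 1) • dF hM t 3 - statF t (XS M 2) • dF hM t 2,
    statF t (XS M 2) • dF hM t 1 - statF t (XS M 0) • dF hM t 3,
    statF t (XS M 0) • dF hM t 2 - statF t (XS M 1) • dF hM t 1]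

theorem slS_rotF (hs : t ≤ s) (a : Fin 3) (g : Sm (future M t)) :
    slS hs (rotF hM t a g) = rot hM a (slS hs g) := by
  have h := fun (b c : Fin 3) => show slS hs (statF t (XS M b) * dF hM t c.succ g) = _ by
    rw [map_mul, slS_statF, slS_dF]
  fin_cases a
  · exact (map_sub _ _ _).trans (congrArg₂ _ (h 1 2) (h 2 1))
  · exact (map_sub _ _ _).trans (congrArg₂ _ (h 2 0) (h 0 2))
  · exact (map_sub _ _ _).trans (congrArg₂ _ (h 0 1) (h 1 0))

theorem rotF_dF (a : Fin 3) (g : Sm (future M t)) :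
    rotF hM t a (dF hM t 0 g) = dF hM t 0 (rotF hM t a g) := by
  have h : ∀ (b : Fin 3) (c : Fin 4), statF t (XS M b) * dF hM t c (dF hM t 0 g) =
      dF hM t 0 (statF t (XS M b) * dF hM t c g) := fun b c => by
    rw [Derivation.leibniz, dF_statF, smul_zero, add_zero, dF_comm, smul_eq_mul]
  fin_cases a
  · exact (congrArg₂ _ (h 1 3) (h 2 2)).trans (map_sub _ _ _).symm
  · exact (congrArg₂ _ (h 2 1) (h 0 3)).trans (map_sub _ _ _).symm
  · exact (congrArg₂ _ (h 0 2) (h 1 1)).trans (map_sub _ _ _).symm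

theorem slS_lap (hs : t ≤ s) (g : Sm (future M t)) :
    slS hs (RotAlg.lap (rotF hM t) g) = RotAlg.lap (rot hM) (slS hs g) := by
  simp only [RotAlg.lap, map_add, slS_rotF]

theorem slS_ell (hs : t ≤ s) (g : Sm (future M t)) :
    slS hs (RotAlg.ell (rotF hM t) g) = RotAlg.ell (rot hM) (slS hs g) := by
  simp only [RotAlg.ell, map_add, map_mul, map_ofNat, slS_lap]

theorem lap_dF (g : Sm (future M t)) :
    RotAlg.lap (rotF hM t) (dF hM t 0 g) = dF hM t 0 (RotAlg.lap (rotF hM t) g) := by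
  simp only [RotAlg.lap, map_add, rotF_dF]

variable {F G : Spacetime → ℝ}

include hM in
theorem vanishingL01_iff : VanishingL01 M t F ↔ ∀ p ∈ future M t, sphAvg F p = 0 ∧
    ∀ i, sphAvg (fun q => xhat q.2 i * F q) p = 0 := by
  have hπ : (1 / (4 * Real.pi) : ℝ) ≠ 0 := by positivity
  have key : ∀ p ∈ future M t, ∀ i, sphereInt (fun y => xhat (‖p.2‖ • y) i * F (p.1, ‖p.2‖ • y)) =
      sphereInt (fun y => F (p.1, ‖p.2‖ • y) * y i) := fun p hp i =>
    integral_congr_ae (Filter.Eventually.of_forall fun y => by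
      beta_reduce
      rw [xhat_norm_smul hM hp.2 (norm_sph y), mul_comm])
  constructor
  · intro h p hp
    obtain ⟨h1, h2⟩ := h p.1 hp.1 ‖p.2‖ hp.2
    exact ⟨by rw [sphAvg, h1, mul_zero], fun i => by rw [sphAvg, key p hp, h2 i, mul_zero]⟩
  · intro h s hs R hR
    obtain ⟨x, rfl⟩ := exists_norm_eq (show 0 < R by linarith)
    have hp : (s, x) ∈ future M t := mem_future hs hR
    obtain ⟨h1, h2⟩ := h _ hp
    exact ⟨(mul_eq_zero.1 h1).resolve_left hπ, fun i => by
      have := (mul_eq_zero.1 (h2 i)).resolve_left hπ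
      rwa [key _ hp] at this⟩

include hM in
theorem VanishingL01.dt (hF : ContDiffOn ℝ ∞ F (future M t)) (h : VanishingL01 M t F) :
    VanishingL01 M t (pd M t 0 F) := by
  rw [vanishingL01_iff hM] at h ⊢
  refine fun p hp => ⟨?_, fun i => ?_⟩
  · rw [← pd_zero_sphAvg hM hF hp, pd_congr (G := fun _ => 0) (fun q hq => (h q hq).1) 0 hp, pd_const]
  · have hx := contDiffOn_static (t₀ := t) (sy_xhat hM i).smooth
    rw [sphAvg_congr (G := pd M t 0 fun q => xhat q.2 i * F q) (fun q hq => by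
      rw [pd_mul hM hx hF 0 hq, pd_zero_static hM (sy_xhat hM i).smooth hq]; ring) hp,
      ← pd_zero_sphAvg hM (hx.mul hF) hp,
      pd_congr (G := fun _ => 0) (fun q hq => (h q hq).2 i) 0 hp, pd_const]

theorem orth_of_orthoL01 {f : Space → ℝ} (hf : ContDiffOn ℝ ∞ f (ext M))
    (h : ∀ R, 2 * M ≤ R → OrthoL01 f R) : Orth hM (Sm.mk f hf) := fun R hR => by
  obtain ⟨h1, h2⟩ := h R hR
  refine ⟨h1, fun i => (integral_congr_ae (Filter.Eventually.of_forall fun y => ?_)).trans (h2 i)⟩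
  have hx : ‖(sphPt hM hR y).1‖ = R := norm_sphPt hM hR y
  have : (yS hM i).1 (sphPt hM hR y) = y.1 i := by
    rw [yS_apply, xhat, hx, show (sphPt hM hR y).1 = R • y.1 from rfl]
    have : R ≠ 0 := by linarith
    simp; field_simp
  exact congrArg (f (R • y.1) * ·) this

theorem VanishingL01.orth (hF : ContDiffOn ℝ ∞ F (future M t)) (h : VanishingL01 M t F) (hs : t ≤ s) :
    Orth hM (slS hs (Sm.mk F hF)) := by
  rw [slS_mk]; exact orth_of_orthoL01 hM _ (h s hs)

theorem dF_mk (hF : ContDiffOn ℝ ∞ F (future M t)) (a : Fin 4) :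
    dF hM t a (Sm.mk F hF) = Sm.mk (pd M t a F) (contDiffOn_pd hM hF a) := by
  rw [dF, GoodSet.der_mk]; rfl

variable {ι : Type*} {t C : ι → ℝ} {k m : ℕ} {q : ℝ} {F G : ι → Spacetime → ℝ}
  (hGs : ∀ i, ContDiffOn ℝ ∞ (G i) (future M (t i))) (hG : ∀ i, VanishingL01 M (t i) (G i))
include hG

theorem ST.elliptic (hF : ST M t C k m q F)
    (h : ∀ i s (hs : t i ≤ s), RotAlg.ell (rot hM) (slS hs (Sm.mk (G i) (hGs i))) =
      slS hs (Sm.mk (F i) (hF.smooth i))) : ST M t C k m q G := by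
  have hR : ∀ i, RotAlg.ell (rotF hM (t i)) (Sm.mk (G i) (hGs i)) = Sm.mk (F i) (hF.smooth i) :=
    fun i => ext_of_slS fun s hs => by rw [slS_ell, h i s hs]
  rw [← add_zero q]
  refine ST.of_rel (d := 0) (fun t F G => ∃ (hF : ContDiffOn ℝ ∞ F (future M t))
    (hG : ContDiffOn ℝ ∞ G (future M t)), VanishingL01 M t G ∧
      RotAlg.ell (rotF hM t) (Sm.mk G hG) = Sm.mk F hF) ?_ ?_ ?_ hF fun i => ⟨hF.smooth i, hGs i, hG i, hR i⟩
  · rintro t F G ⟨_, hG, _⟩; exact hG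
  · rintro t F G ⟨hF, hG, hv, he⟩
    refine ⟨contDiffOn_pd hM hF 0, contDiffOn_pd hM hG 0, hv.dt hM hG, ?_⟩
    rw [← dF_mk hM hG, ← dF_mk hM hF, ← he]
    exact RotAlg.ell_comm (Ω := rotF hM t) (D := dF hM t 0) (lap_dF hM) (Sm.mk G hG)
  · intro m q F G hR hF
    rw [add_zero]
    choose h1 h2 h3 h4 using hR
    have hF' := SO.som (m := m) hF fun i => contDiffOn_slice (h1 i) le_rfl
    refine (SOm.elliptic (hM := hM) (f := fun i => slS le_rfl (Sm.mk (G i) (h2 i))) hF' (fun i => (h3 i).orth hM (h2 i) le_rfl) fun i => ?_).so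
      (F := fun i x => G i (t i, x)) fun i x => ?_
    · rw [← slS_ell, h4, slS_mk]
    · rw [slS_mk]; rfl

theorem ST.zeta_of_eq (hF : ST M t C k m q F)
    (h : ∀ i s (hs : t i ≤ s), RotAlg.lap (rot hM) (slS hs (Sm.mk (G i) (hGs i))) +
      (2 - algebraMap ℝ _ (6 * M) * qS hM) * slS hs (Sm.mk (G i) (hGs i)) =
      slS hs (Sm.mk (F i) (hF.smooth i))) : ST M t C k m (q - 1) G := by
  have hR : ∀ i, RotAlg.lap (rotF hM (t i)) (Sm.mk (G i) (hGs i)) +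
      statF (t i) (2 - algebraMap ℝ _ (6 * M) * qS hM) * Sm.mk (G i) (hGs i) =
        Sm.mk (F i) (hF.smooth i) := fun i => ext_of_slS fun s hs => by
    rw [map_add, map_mul, slS_statF, slS_lap, h i s hs]
  rw [sub_eq_add_neg]
  refine ST.of_rel (d := 0) (fun t F G => ∃ (hF : ContDiffOn ℝ ∞ F (future M t))
    (hG : ContDiffOn ℝ ∞ G (future M t)), VanishingL01 M t G ∧
      RotAlg.lap (rotF hM t) (Sm.mk G hG) +
        statF t (2 - algebraMap ℝ _ (6 * M) * qS hM) * Sm.mk G hG = Sm.mk F hF) ?_ ?_ ?_ hF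
      fun i => ⟨hF.smooth i, hGs i, hG i, hR i⟩
  · rintro t F G ⟨_, hG, _⟩; exact hG
  · rintro t F G ⟨hF, hG, hv, he⟩
    refine ⟨contDiffOn_pd hM hF 0, contDiffOn_pd hM hG 0, hv.dt hM hG, ?_⟩
    rw [← dF_mk hM hG, ← dF_mk hM hF, ← he, lap_dF, map_add, Derivation.leibniz, dF_statF,
      smul_zero, add_zero, smul_eq_mul]
  · intro m q F G hR hF
    rw [← sub_eq_add_neg]
    choose h1 h2 h3 h4 using hR
    have hF' := SO.som (m := m) hF fun i => contDiffOn_slice (h1 i) le_rfl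
    refine (SOm.zeta (hM := hM) (G := fun i => slS le_rfl (Sm.mk (G i) (h2 i))) hF' (fun i => (h3 i).orth hM (h2 i) le_rfl) fun i => ?_).so
      (F := fun i x => G i (t i, x)) fun i x => ?_
    · have := congrArg (slS le_rfl) (h4 i)
      rw [map_add, map_mul, slS_statF, slS_lap] at this
      rw [this, slS_mk]
    · rw [slS_mk]; rfl

end SpacetimeElliptic

end LinearisedGravity

end

noncomputable section

set_option linter.unusedSimpArgs false

namespace LinearisedGravity

open MeasureTheory

/-! ## Covariant derivatives in the weighted classes -/

section Symbols

variable {M : ℝ} (hM : 0 < M)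

include hM

theorem sy_ell (a : Fin 4) : Sy M 0 fun x => ell (0, x) a := by
  refine Fin.cases ?_ (fun j => ?_) a
  · exact sy_const hM 1
  · exact sy_xhat hM j

theorem sy_gM (a b : Fin 4) : Sy M 0 fun x => gM M (0, x) a b :=
  (sy_const hM (eta a b)).add hM
    ((sy_mu hM).mul hM ((sy_ell hM a).mul hM (sy_ell hM b) (by norm_num : (0 : ℝ) ≤ 0 + 0)) (by norm_num))

theorem sy_gInv (a b : Fin 4) : Sy M 0 fun x => gInv M (0, x) a b := by
  have h : ∀ a : Fin 4, Sy M 0 fun x => (Fin.cons (-1) (xhat x) : Fin 4 → ℝ) a := fun a => by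
    refine Fin.cases ?_ (fun j => ?_) a
    · exact sy_const hM (-1)
    · exact sy_xhat hM j
  exact (sy_const hM (eta a b)).sub hM
    ((sy_mu hM).mul hM ((h a).mul hM (h b) (by norm_num : (0 : ℝ) ≤ 0 + 0)) (by norm_num))

theorem sy_mu_div_hbar : Sy M 1 fun x => mu M x / hbar M x := by
  simp only [div_eq_mul_inv]
  exact (sy_mu hM).mul hM (sy_hbar_inv hM) (by norm_num)

theorem sy_nVec (a : Fin 4) : Sy M 0 fun x => nVec M (0, x) a := by
  refine Fin.cases (sy_hbar hM) (fun j => ?_) a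
  exact ((sy_mu_div_hbar hM).neg hM).mul hM (sy_xhat hM j) (by norm_num)

theorem sy_nuVec (a : Fin 4) : Sy M 0 fun x => nuVec M (0, x) a := by
  refine Fin.cases (sy_const hM 0) (fun j => ?_) a
  refine Sy.congr ((sy_hbar_inv hM).mul hM (sy_xhat hM j) (by norm_num : (0 : ℝ) ≤ 0 + 0)) fun x _ => ?_
  change 1 / _ * _ = _
  rw [one_div]

theorem sy_angVec (i : Fin 3) (a : Fin 4) : Sy M 0 fun x => angVec i (0, x) a := by
  refine Fin.cases (sy_const hM 0) (fun j => ?_) a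
  exact sy_proj hM i j

theorem sy_PVec (a : Fin 4) : Sy M 0 fun x => PVec M (0, x) a :=
  Sy.sum hM Finset.univ fun b _ => by
    refine (sy_gInv hM a b).mul hM (q₂ := 0) ?_ (by norm_num)
    refine Fin.cases (sy_const hM 0) (fun j => ?_) b
    exact sy_xhat hM j

omit hM in
/-- The coordinate derivatives of the components of the metric. -/
def dgM (M : ℝ) (a b d : Fin 4) (x : Space) : ℝ :=
  (Fin.cons 0 (fun j => ds M j (fun y => gM M (0, y) b d) x) : Fin 4 → ℝ) a

omit hM in
/-- The Christoffel symbols as functions on `Σ`. -/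
def gam (M : ℝ) (c a b : Fin 4) (x : Space) : ℝ :=
  1 / 2 * ∑ d, gInv M (0, x) c d * (dgM M a b d x + dgM M b a d x - dgM M d a b x)

theorem pd_gM {t : ℝ} (a b d : Fin 4) {p : Spacetime} (hp : p ∈ future M t) :
    pd M t a (fun q => gM M q b d) p = dgM M a b d p.2 := by
  refine Fin.cases ?_ (fun j => ?_) a
  · exact pd_zero_static hM (sy_gM hM b d).smooth hp
  · exact pd_succ_static hM (sy_gM hM b d).smooth hp j

theorem Gam_eq {t : ℝ} (c a b : Fin 4) {p : Spacetime} (hp : p ∈ future M t) :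
    Gam M t p c a b = gam M c a b p.2 := by
  simp only [Gam, pd_gM hM _ _ _ hp]; rfl

theorem sy_dgM (a b d : Fin 4) : Sy M 1 (dgM M a b d) := by
  refine Fin.cases sy_zero (fun j => ?_) a
  have := (sy_gM hM b d).ds j
  rwa [zero_add] at this

theorem sy_gam (c a b : Fin 4) : Sy M 1 (gam M c a b) :=
  Sy.const_mul hM _ (Sy.sum hM Finset.univ fun d _ => (sy_gInv hM c d).mul hM
    (((sy_dgM hM a b d).add hM (sy_dgM hM b a d)).sub hM (sy_dgM hM d a b)) (by norm_num))

end Symbols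

section CovD

variable {M : ℝ} {ι : Type*} {t C : ι → ℝ} {k m r : ℕ} {q q₁ q₂ : ℝ} {T : ι → TField r}

/-- The connection terms of the covariant derivative. -/
def conn (M t₀ : ℝ) {r : ℕ} (T : TField r) : TField (r + 1) := fun p I =>
  ∑ m, ∑ c, Gam M t₀ p c (I 0) (Fin.tail I m) * T p (Function.update (Fin.tail I) m c)

theorem ST.conn (hM : 0 < M) (hT : ∀ I, ST M t C k m q fun i p => T i p I) (I : Fin (r + 1) → Fin 4) :
    ST M t C k m (q + 1) fun i p => conn M (t i) (T i) p I :=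
  ST.congr (ST.sum hM Finset.univ fun j _ => ST.sum hM Finset.univ fun c _ =>
      (hT (Function.update (Fin.tail I) j c)).mul hM (sy_gam hM c (I 0) (Fin.tail I j))
        (by linarith : q + 1 ≤ 1 + q)) fun i p hp => by
    simp only [LinearisedGravity.conn, Gam_eq hM _ _ _ hp]

theorem covD_eq (t₀ : ℝ) (T : TField r) (p : Spacetime) (I : Fin (r + 1) → Fin 4) :
    covD M t₀ T p I = pd M t₀ (I 0) (fun q => T q (Fin.tail I)) p - conn M t₀ T p I := rfl

theorem ST.covD (hM : 0 < M) (hT : ∀ I, ST M t C (k + 1) m q fun i p => T i p I)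
    (I : Fin (r + 1) → Fin 4) : ST M t C k m (q + 1) fun i p => covD M (t i) (T i) p I :=
  ((hT (Fin.tail I)).pd hM (I 0)).sub hM (ST.conn hM (fun J => (hT J).pred) I)

/-- The second covariant derivative up to terms of lower order. -/
theorem ST.covD_covD (hM : 0 < M) (hT : ∀ I, ST M t C (k + 1) m q fun i p => T i p I)
    (a b : Fin 4) (I : Fin r → Fin 4) :
    ST M t C k m (q + 2) fun i p =>
      LinearisedGravity.covD M (t i) (LinearisedGravity.covD M (t i) (T i)) p (Fin.cons a (Fin.cons b I)) -
        LinearisedGravity.pd M (t i) a (LinearisedGravity.pd M (t i) b fun q => T i q I) p := by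
  have h1 := ST.conn hM hT (Fin.cons b I)
  have h2 := (h1.pd hM a).add hM (ST.conn hM (ST.covD hM hT) (Fin.cons a (Fin.cons b I)))
  rw [show q + 2 = q + 1 + 1 by ring]
  refine (h2.neg hM).congr fun i p hp => ?_
  have e := pd_sub hM (contDiffOn_pd hM ((hT I).smooth i) b) (h1.smooth i) a hp
  change LinearisedGravity.pd M (t i) a (fun q => LinearisedGravity.pd M (t i) b (fun q => T i q I) q -
    LinearisedGravity.conn M (t i) (T i) q (Fin.cons b I)) p -
    LinearisedGravity.conn M (t i) (LinearisedGravity.covD M (t i) (T i)) p (Fin.cons a (Fin.cons b I)) - _ = _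
  rw [e]
  ring

/-- Second time derivatives from a second order equation. -/
theorem ST.of_wave (hM : 0 < M) {F P : ι → Spacetime → ℝ} (hF : ST M t C (k + 1) (m + 1) q F)
    (hP : ST M t C k m (q + 2) P) {c : Fin 4 → Fin 4 → Space → ℝ} {e : Space → ℝ}
    (hc : ∀ a b, Sy M 0 (c a b)) (he : Sy M 0 e) (hce : ∀ x ∈ ext M, e x * c 0 0 x = 1)
    (h : ∀ i, ∀ p ∈ future M (t i), ∑ a, ∑ b, c a b p.2 *
      LinearisedGravity.pd M (t i) a (LinearisedGravity.pd M (t i) b (F i)) p = P i p) :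
    ST M t C (k + 2) m q F := by
  have h1 : ∀ (j : Fin 3) (b : Fin 4), ST M t C k m (q + 2) fun i p => c j.succ b p.2 *
      LinearisedGravity.pd M (t i) j.succ (LinearisedGravity.pd M (t i) b (F i)) p := fun j b => by
    have := (hF.pd hM b).pd_succ hM j
    exact this.mul hM (hc _ _) (by linarith)
  have h2 : ∀ (j : Fin 3), ST M t C k m (q + 2) fun i p => c 0 j.succ p.2 *
      LinearisedGravity.pd M (t i) 0 (LinearisedGravity.pd M (t i) j.succ (F i)) p := fun j => by
    refine (((hF.pd hM 0).pd_succ hM j).mul hM (hc 0 j.succ) (by linarith : q + 2 ≤ 0 + (q + 1 + 1))).congr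
      fun i p hp => ?_
    rw [pd_comm hM (hF.smooth i) 0 j.succ hp]
  refine hF.of_dt_dt (((hP.sub hM ((ST.sum hM Finset.univ fun j _ => h2 j).add hM (ST.sum hM Finset.univ
    fun j _ => ST.sum hM Finset.univ fun b _ => h1 j b))).mul hM he
      (by linarith : q + 2 ≤ 0 + (q + 2))).congr fun i p hp => ?_)
  have e1 := h i p hp
  have e2 := hce p.2 hp.2
  rw [Fin.sum_univ_succ, Fin.sum_univ_succ (f := fun b => c 0 b p.2 * _)] at e1
  rw [← e1]
  linear_combination (-LinearisedGravity.pd M (t i) 0 (LinearisedGravity.pd M (t i) 0 (F i)) p) * e2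

end CovD

/-! ## The Laplacian on the spheres -/

section AngLap

variable {M : ℝ} (hM : 0 < M) {t s : ℝ} {F G : Spacetime → ℝ}

/-- The rotation fields applied to functions on spacetime. -/
def rotT (M t : ℝ) (a : Fin 3) (F : Spacetime → ℝ) (p : Spacetime) : ℝ :=
  p.2 (a + 1) * pd M t (a + 2).succ F p - p.2 (a + 2) * pd M t (a + 1).succ F p

theorem rotF_mk_apply (hF : ContDiffOn ℝ ∞ F (future M t)) (a : Fin 3) (p : future M t) :
    (rotF hM t a (Sm.mk F hF)).1 p = rotT M t a F p := by
  have h : ∀ (b : Fin 3) (c : Fin 4), (statF t (XS M b) * dF hM t c (Sm.mk F hF)).1 p =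
      p.1.2 b * pd M t c F p := fun b c => by
    rw [← Sm.ev_apply, map_mul, Sm.ev_apply, Sm.ev_apply, dF_mk_apply]
    exact congrArg (· * _) (Sm.rep_apply (XS M b) ⟨p.1.2, p.2.2⟩)
  have h2 : ∀ f g : Sm (future M t), (f - g).1 p = f.1 p - g.1 p := fun f g => by
    rw [← Sm.ev_apply, map_sub]; rfl
  fin_cases a
  · exact (h2 _ _).trans (congrArg₂ _ (h 1 3) (h 2 2))
  · exact (h2 _ _).trans (congrArg₂ _ (h 2 1) (h 0 3))
  · exact (h2 _ _).trans (congrArg₂ _ (h 0 2) (h 1 1))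

include hM in
theorem contDiffOn_rotT (hF : ContDiffOn ℝ ∞ F (future M t)) (a : Fin 3) :
    ContDiffOn ℝ ∞ (rotT M t a F) (future M t) :=
  ((contDiffOn_static (contDiff_coord _).contDiffOn).mul (contDiffOn_pd hM hF _)).sub
    ((contDiffOn_static (contDiff_coord _).contDiffOn).mul (contDiffOn_pd hM hF _))

theorem rotF_mk (hF : ContDiffOn ℝ ∞ F (future M t)) (a : Fin 3) :
    rotF hM t a (Sm.mk F hF) = Sm.mk (rotT M t a F) (contDiffOn_rotT hM hF a) :=
  Sm.ext' fun p => rotF_mk_apply hM hF a p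

theorem reps_slice (hs : t ≤ s) (hF : ContDiffOn ℝ ∞ F (future M t)) :
    Reps (slice F s) fun _ => slS hs (Sm.mk F hF) := fun x _ => by rw [slS_mk]; rfl

theorem angLap_apply (hF : ContDiffOn ℝ ∞ F (future M t)) (hs : t ≤ s) (x : ext M) :
    angLap M F (s, x) = (qS hM * qS hM * RotAlg.lap (rot hM) (slS hs (Sm.mk F hF))).1 x :=
  reps_sdiv_grad hM (reps_slice hs hF) x ![]

include hM in
theorem angLap_eq (hF : ContDiffOn ℝ ∞ F (future M t)) {p : Spacetime} (hp : p ∈ future M t) :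
    angLap M F p = ‖p.2‖⁻¹ * ‖p.2‖⁻¹ * ∑ a, rotT M t a (rotT M t a F) p := by
  have h1 : ∀ a, rotT M t a (rotT M t a F) p =
      (rot hM a (rot hM a (slS hp.1 (Sm.mk F hF)))).1 ⟨p.2, hp.2⟩ := fun a => by
    rw [← slS_rotF, ← slS_rotF, rotF_mk, rotF_mk, slS_mk]; rfl
  refine (angLap_apply hM hF hp.1 ⟨p.2, hp.2⟩).trans ?_
  rw [← Sm.ev_apply]
  simp only [map_mul, RotAlg.lap, map_add, Sm.ev_apply, ← h1, Fin.sum_univ_three]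
  rfl

variable {ι : Type*} {t C : ι → ℝ} {k m : ℕ} {q : ℝ} {F G : ι → Spacetime → ℝ}

include hM

theorem ST.rotT (hF : ST M t C k (m + 1) q F) (a : Fin 3) :
    ST M t C k m q fun i => rotT M (t i) a (F i) :=
  ((hF.pd_succ hM _).mul hM (sy_coord hM _) (by linarith)).sub hM
    ((hF.pd_succ hM _).mul hM (sy_coord hM _) (by linarith))

theorem ST.angLap (hF : ST M t C k (m + 2) q F) : ST M t C k m (q + 2) fun i => angLap M (F i) := by
  have h := (sy_norm_inv hM).mul hM (sy_norm_inv hM) le_rfl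
  refine ((ST.sum hM Finset.univ fun a _ => ST.rotT hM (ST.rotT hM hF a) a).mul hM h
    (by linarith : q + 2 ≤ 1 + 1 + q)).congr fun i p hp => angLap_eq hM (hF.smooth i) hp

theorem ST.zeta (hF : ST M t C k m q F) (h : ∀ i, IsZeta M (t i) (F i) (G i)) :
    ST M t C k m (q - 1) G := by
  refine ST.zeta_of_eq hM (fun i => (h i).smooth) (fun i => (h i).vanishing) hF fun i s hs => ?_
  refine Sm.ext' fun x => ?_
  have e := (h i).eq (s, x.1) (mem_future hs x.2)
  have hr := norm_pos_of_mem_ext hM x.2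
  rw [angLap_apply hM (h i).smooth hs, ← Sm.ev_apply] at e
  rw [← Sm.ev_apply]
  simp only [map_mul, map_add, map_sub, map_ofNat, AlgHom.commutes] at e ⊢
  have e1 : Sm.ev x (qS hM) = ‖x.1‖⁻¹ := rfl
  have e2 : Sm.ev x (slS hs (Sm.mk (G i) (h i).smooth)) = G i (s, x) := by
    rw [slS_mk]; rfl
  have e3 : Sm.ev x (slS hs (Sm.mk (F i) (hF.smooth i))) = F i (s, x) := by
    rw [slS_mk]; rfl
  rw [e1] at e ⊢
  rw [e2]
  refine Eq.trans ?_ (e.trans e3.symm)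
  rw [Algebra.algebraMap_self_apply]
  field_simp
  ring

end AngLap

end LinearisedGravity

end

noncomputable section

set_option linter.unusedSimpArgs false

namespace LinearisedGravity

open MeasureTheory

/-! ## Frame components in the weighted classes -/

section Frame

variable {M : ℝ}

/-- Time-independent vector fields whose components are symbols of order `0`. -/
structure SymVec (M : ℝ) (u : Spacetime → Fin 4 → ℝ) : Prop where
  static : ∀ p a, u p a = u (0, p.2) a
  sy : ∀ a, Sy M 0 fun x => u (0, x) a

theorem symVec_n (hM : 0 < M) : SymVec M (nVec M) := ⟨fun _ _ => rfl, sy_nVec hM⟩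
theorem symVec_nu (hM : 0 < M) : SymVec M (nuVec M) := ⟨fun _ _ => rfl, sy_nuVec hM⟩
theorem symVec_ang (hM : 0 < M) (i : Fin 3) : SymVec M (angVec i) := ⟨fun _ _ => rfl, sy_angVec hM i⟩
theorem symVec_P (hM : 0 < M) : SymVec M (PVec M) := ⟨fun _ _ => rfl, sy_PVec hM⟩

variable {ι : Type*} {t C : ι → ℝ} {k m : ℕ} {q q₁ : ℝ} {X : ι → TField 2}
  {u w : Spacetime → Fin 4 → ℝ}

theorem ST.mul_vec (hM : 0 < M) {F : ι → Spacetime → ℝ} (hF : ST M t C k m q F) (hu : SymVec M u)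
    (a : Fin 4) : ST M t C k m q fun i p => u p a * F i p :=
  (hF.mul hM (hu.sy a) (by linarith)).congr fun i p _ => by rw [hu.static]

theorem ST.ev2 (hM : 0 < M) (hX : ∀ a b, ST M t C k m q fun i p => X i p ![a, b]) (hu : SymVec M u)
    (hw : SymVec M w) : ST M t C k m q fun i => ev2 (X i) u w :=
  ST.sum hM Finset.univ fun a _ => ST.sum hM Finset.univ fun b _ => by
    simp only [mul_assoc]
    exact ((hX a b).mul_vec hM hw b).mul_vec hM hu a

theorem ST.trQ (hM : 0 < M) (hX : ∀ a b, ST M t C k m q fun i p => X i p ![a, b]) :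
    ST M t C k m q fun i => trQ M (X i) :=
  ((ST.ev2 hM hX (symVec_n hM) (symVec_n hM)).neg hM).add hM (ST.ev2 hM hX (symVec_nu hM) (symVec_nu hM))

theorem ST.hatNN (hM : 0 < M) (hX : ∀ a b, ST M t C k m q fun i p => X i p ![a, b]) :
    ST M t C k m q fun i => hatNN M (X i) :=
  (((ST.ev2 hM hX (symVec_n hM) (symVec_n hM)).add hM
    (ST.ev2 hM hX (symVec_nu hM) (symVec_nu hM))).const_mul hM (1 / 2)).congr fun i p _ => by
      rw [LinearisedGravity.hatNN]; ring

theorem ST.hatNV (hM : 0 < M) (hX : ∀ a b, ST M t C k m q fun i p => X i p ![a, b]) :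
    ST M t C k m q fun i => hatNV M (X i) := ST.ev2 hM hX (symVec_n hM) (symVec_nu hM)

theorem ST.trS (hM : 0 < M) (hX : ∀ a b, ST M t C k m q fun i p => X i p ![a, b]) :
    ST M t C k m q fun i => trS (X i) :=
  ST.sum hM Finset.univ fun i _ => ST.ev2 hM hX (symVec_ang hM i) (symVec_ang hM i)

theorem ST.mixed (hM : 0 < M) (hX : ∀ a b, ST M t C k m q fun i p => X i p ![a, b]) (hu : SymVec M u)
    (I : Fin 1 → Fin 3) : ST M t C k m q fun i p => mixed (X i) u p.1 p.2 I :=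
  ST.ev2 hM hX hu (symVec_ang hM (I 0))

theorem ST.hatS (hM : 0 < M) (hX : ∀ a b, ST M t C k m q fun i p => X i p ![a, b])
    (I : Fin 2 → Fin 3) : ST M t C k m q fun i p => hatS (X i) p.1 p.2 I :=
  (ST.ev2 hM hX (symVec_ang hM (I 0)) (symVec_ang hM (I 1))).sub hM
    ((ST.trS hM hX).mul hM ((sy_proj hM (I 0) (I 1)).const_mul hM (1 / 2)) (by linarith))

/-- The spanning set `n, ν` and the projections of the coordinate fields to the spheres. -/
def fr (M : ℝ) : Fin 5 → Spacetime → Fin 4 → ℝ := Fin.cons (nVec M) (Fin.cons (nuVec M) angVec)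

/-- The coefficients of the coordinate vector fields with respect to `fr`. -/
def frCoef (M : ℝ) (a : Fin 4) (A : Fin 5) (x : Space) : ℝ :=
  (Fin.cons (Fin.cons (1 / hbar M x) (Fin.cons (mu M x / hbar M x) 0))
    (fun i => Fin.cons 0 (Fin.cons (hbar M x * xhat x i) (Pi.single i 1))) : Fin 4 → Fin 5 → ℝ) a A

theorem symVec_fr (hM : 0 < M) (A : Fin 5) : SymVec M (fr M A) := by
  refine Fin.cases (symVec_n hM) (fun A => ?_) A
  exact Fin.cases (symVec_nu hM) (fun i => symVec_ang hM i) A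

theorem sy_frCoef (hM : 0 < M) (a : Fin 4) (A : Fin 5) : Sy M 0 (frCoef M a A) := by
  refine Fin.cases ?_ (fun i => ?_) a
  · refine Fin.cases ?_ (fun A => Fin.cases ?_ (fun j => ?_) A) A
    · exact (sy_hbar_inv hM).congr fun x _ => one_div _
    · exact (sy_mu_div_hbar hM).weaken hM (by norm_num)
    · exact sy_zero
  · refine Fin.cases ?_ (fun A => Fin.cases ?_ (fun j => ?_) A) A
    · exact sy_zero
    · exact (sy_hbar hM).mul hM (sy_xhat hM i) (by norm_num)
    · exact sy_const hM _

theorem sum_frCoef (hM : 0 < M) {p : Spacetime} (hp : p.2 ∈ ext M) (a b : Fin 4) :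
    ∑ A, frCoef M a A p.2 * fr M A p b = if a = b then 1 else 0 := by
  have h := (hbar_pos hM hp).ne'
  rw [Fin.sum_univ_succ, Fin.sum_univ_succ]
  refine Fin.cases ?_ (fun i => ?_) a <;> refine Fin.cases ?_ (fun j => ?_) b
  · simp [frCoef, fr, nVec, nuVec, angVec, h]
  · simp [frCoef, fr, nVec, nuVec, angVec, Fin.succ_ne_zero, (Fin.succ_ne_zero _).symm]
    field_simp; ring
  · simp [frCoef, fr, nVec, nuVec, angVec, Fin.succ_ne_zero, (Fin.succ_ne_zero _).symm]
  · simp [frCoef, fr, nVec, nuVec, angVec, proj, Pi.single_apply]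
    field_simp; ring

theorem eq_sum_ev1 (hM : 0 < M) (v : TField 1) {p : Spacetime} (hp : p.2 ∈ ext M) (a : Fin 4) :
    v p ![a] = ∑ A, frCoef M a A p.2 * LinearisedGravity.ev1 v (fr M A) p := by
  simp only [LinearisedGravity.ev1, Finset.mul_sum]
  rw [Finset.sum_comm]
  simp only [← mul_assoc, ← Finset.sum_mul, sum_frCoef hM hp]
  simp

theorem eq_sum_ev2 (hM : 0 < M) (X : TField 2) {p : Spacetime} (hp : p.2 ∈ ext M) (a b : Fin 4) :
    X p ![a, b] = ∑ A, ∑ B, frCoef M a A p.2 * frCoef M b B p.2 *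
      LinearisedGravity.ev2 X (fr M A) (fr M B) p := by
  have h : ∀ A B, frCoef M a A p.2 * frCoef M b B p.2 * LinearisedGravity.ev2 X (fr M A) (fr M B) p =
      ∑ c, ∑ d, (frCoef M a A p.2 * fr M A p c) * ((frCoef M b B p.2 * fr M B p d) * X p ![c, d]) :=
    fun A B => by
      simp only [LinearisedGravity.ev2, Finset.mul_sum]
      exact Finset.sum_congr rfl fun c _ => Finset.sum_congr rfl fun d _ => by ring
  simp only [h]
  have h2 : ∀ A, ∑ B, ∑ c, ∑ d, (frCoef M a A p.2 * fr M A p c) *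
      ((frCoef M b B p.2 * fr M B p d) * X p ![c, d]) =
      ∑ c, (frCoef M a A p.2 * fr M A p c) * X p ![c, b] := fun A => by
    rw [Finset.sum_comm]
    refine Finset.sum_congr rfl fun c _ => ?_
    rw [Finset.sum_comm]
    simp only [← Finset.mul_sum, ← Finset.sum_mul, sum_frCoef hM hp]
    simp
  simp only [h2]
  rw [Finset.sum_comm]
  simp only [← Finset.sum_mul, sum_frCoef hM hp]
  simp

theorem ST.of_ev1 (hM : 0 < M) {v : ι → TField 1} (h : ∀ A, ST M t C k m q fun i => LinearisedGravity.ev1 (v i) (fr M A))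
    (a : Fin 4) : ST M t C k m q fun i p => v i p ![a] :=
  (ST.sum hM Finset.univ fun A _ => (h A).mul hM (sy_frCoef hM a A) (by linarith)).congr
    fun i p hp => eq_sum_ev1 hM (v i) hp.2 a

theorem ST.of_ev2 (hM : 0 < M) (h : ∀ A B, ST M t C k m q fun i => LinearisedGravity.ev2 (X i) (fr M A) (fr M B))
    (a b : Fin 4) : ST M t C k m q fun i p => X i p ![a, b] :=
  (ST.sum hM Finset.univ fun A _ => ST.sum hM Finset.univ fun B _ =>
    (h A B).mul hM ((sy_frCoef hM a A).mul hM (sy_frCoef hM b B) (by linarith : (0 : ℝ) ≤ 0 + 0))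
      (by linarith)).congr fun i p hp => eq_sum_ev2 hM (X i) hp.2 a b

theorem ev2_symm {t : ℝ} {X : TField 2} (hX : SymmT M t X) (u w : Spacetime → Fin 4 → ℝ)
    {p : Spacetime} (hp : p ∈ future M t) :
    LinearisedGravity.ev2 X u w p = LinearisedGravity.ev2 X w u p := by
  simp only [LinearisedGravity.ev2]
  rw [Finset.sum_comm]
  exact Finset.sum_congr rfl fun a _ => Finset.sum_congr rfl fun b _ => by
    rw [hX p hp b a]; ring

/-- A symmetric tensor is controlled by its parts. -/
theorem ST.of_parts (hM : 0 < M) (hs : ∀ i, SymmT M (t i) (X i))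
    (h1 : ST M t C k m q fun i => LinearisedGravity.hatNN M (X i))
    (h2 : ST M t C k m q fun i => LinearisedGravity.hatNV M (X i))
    (h3 : ST M t C k m q fun i => LinearisedGravity.trQ M (X i))
    (h4 : ∀ I, ST M t C k m q fun i p => LinearisedGravity.mixed (X i) (nVec M) p.1 p.2 I)
    (h5 : ∀ I, ST M t C k m q fun i p => LinearisedGravity.mixed (X i) (nuVec M) p.1 p.2 I)
    (h6 : ∀ I, ST M t C k m q fun i p => LinearisedGravity.hatS (X i) p.1 p.2 I)
    (h7 : ST M t C k m q fun i => LinearisedGravity.trS (X i)) (a b : Fin 4) :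
    ST M t C k m q fun i p => X i p ![a, b] := by
  have hnn : ST M t C k m q fun i => LinearisedGravity.ev2 (X i) (nVec M) (nVec M) :=
    (h1.sub hM (h3.const_mul hM (1 / 2))).congr fun i p _ => by
      simp only [LinearisedGravity.hatNN, LinearisedGravity.trQ]; ring
  have hvv : ST M t C k m q fun i => LinearisedGravity.ev2 (X i) (nuVec M) (nuVec M) :=
    (h1.add hM (h3.const_mul hM (1 / 2))).congr fun i p _ => by
      simp only [LinearisedGravity.hatNN, LinearisedGravity.trQ]; ring
  have hss : ∀ c d : Fin 3, ST M t C k m q fun i => LinearisedGravity.ev2 (X i) (angVec c) (angVec d) :=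
    fun c d => ((h6 ![c, d]).add hM (h7.mul hM ((sy_proj hM c d).const_mul hM (1 / 2))
      (by linarith : q ≤ 0 + q))).congr fun i p _ => by
        simp [LinearisedGravity.hatS]
  have sw : ∀ {u w : Spacetime → Fin 4 → ℝ}, ST M t C k m q (fun i => LinearisedGravity.ev2 (X i) u w) →
      ST M t C k m q (fun i => LinearisedGravity.ev2 (X i) w u) := fun h =>
    h.congr fun i p hp => ev2_symm (hs i) _ _ hp
  refine ST.of_ev2 hM (fun A B => ?_) a b
  refine Fin.cases ?_ (fun A => Fin.cases ?_ (fun c => ?_) A) A <;>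
    refine Fin.cases ?_ (fun B => Fin.cases ?_ (fun d => ?_) B) B
  · exact hnn
  · exact h2
  · exact h4 ![d]
  · exact sw h2
  · exact hvv
  · exact h5 ![d]
  · exact sw (h4 ![c])
  · exact sw (h5 ![c])
  · exact hss c d

end Frame

/-! ## Scalar wave equations -/

section ScalarWave

variable {M : ℝ} {ι : Type*} {t C : ι → ℝ} {k m : ℕ} {q : ℝ} {F P : ι → Spacetime → ℝ}
  {u : Spacetime → Fin 4 → ℝ}

theorem ST.dirD (hM : 0 < M) (hF : ST M t C (k + 1) m q F) (hu : SymVec M u) :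
    ST M t C k m (q + 1) fun i => dirD M (t i) u (F i) :=
  ST.sum hM Finset.univ fun a _ => (hF.pd hM a).mul_vec hM hu a

theorem ST.hess (hM : 0 < M) (hF : ST M t C (k + 2) m q F) (a b : Fin 4) :
    ST M t C k m (q + 2) fun i p => hess M (t i) (F i) p ![a, b] := by
  rw [show q + 2 = q + 1 + 1 by ring]
  exact ST.covD hM (ST.covD hM (T := fun i => scal (F i)) fun _ => hF) _

theorem ST.hess_sub (hM : 0 < M) (hF : ST M t C (k + 1) m q F) (a b : Fin 4) :
    ST M t C k m (q + 2) fun i p => LinearisedGravity.hess M (t i) (F i) p ![a, b] -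
      LinearisedGravity.pd M (t i) a (LinearisedGravity.pd M (t i) b (F i)) p :=
  ST.covD_covD hM (T := fun i => scal (F i)) (fun _ => hF) a b ![]

theorem ev2_sub (X Y : TField 2) (u w : Spacetime → Fin 4 → ℝ) (p : Spacetime) :
    ev2 (X - Y) u w p = ev2 X u w p - ev2 Y u w p := by
  simp only [ev2, Pi.sub_apply, mul_sub, Finset.sum_sub_distrib]

theorem hbar_inv_sq (hM : 0 < M) {x : Space} (hx : x ∈ ext M) :
    -((hbar M x)⁻¹ * (hbar M x)⁻¹) * (-(hbar M x * hbar M x)) = 1 := by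
  have := (hbar_pos hM hx).ne'
  field_simp

/-- Gain of a time derivative from a scalar wave equation. -/
theorem ST.of_scalar_wave (hM : 0 < M) (hF : ST M t C (k + 1) (m + 1) q F) (hP : ST M t C k m (q + 2) P)
    (h : ∀ i, ∀ p ∈ future M (t i), boxQ M (t i) (F i) p + LinearisedGravity.angLap M (F i) p = P i p) :
    ST M t C (k + 2) m q F := by
  have hL : ST M t C k m (q + 2) fun i => LinearisedGravity.trQ M (LinearisedGravity.hess M (t i) (F i) -
      fun p I => LinearisedGravity.pd M (t i) (I 0) (LinearisedGravity.pd M (t i) (I 1) (F i)) p) :=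
    ST.trQ hM fun a b => ST.hess_sub hM (hF.mono (by omega)) a b
  refine ST.of_wave hM hF ((hP.sub hM (ST.angLap hM hF.shift)).sub hM hL)
    (c := fun a b x => -(nVec M (0, x) a * nVec M (0, x) b) + nuVec M (0, x) a * nuVec M (0, x) b)
    (e := fun x => -((hbar M x)⁻¹ * (hbar M x)⁻¹)) (fun a b => ?_) ?_ (fun x hx => ?_) fun i p hp => ?_
  · exact (((sy_nVec hM a).mul hM (sy_nVec hM b) (by linarith : (0 : ℝ) ≤ 0 + 0)).neg hM).add hM
      ((sy_nuVec hM a).mul hM (sy_nuVec hM b) (by linarith))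
  · exact ((sy_hbar_inv hM).mul hM (sy_hbar_inv hM) (by linarith : (0 : ℝ) ≤ 0 + 0)).neg hM
  · rw [← hbar_inv_sq hM hx]
    simp [nVec, nuVec]
  · rw [← h i p hp, boxQ]
    simp only [LinearisedGravity.trQ, ev2_sub]
    simp only [LinearisedGravity.ev2, add_mul, Finset.sum_add_distrib,
      neg_mul, Finset.sum_neg_distrib]
    have e1 : ∀ a, nVec M (0, p.2) a = nVec M p a := fun a => rfl
    have e2 : ∀ a, nuVec M (0, p.2) a = nuVec M p a := fun a => rfl
    simp only [e1, e2, Matrix.cons_val_zero, Matrix.cons_val_one]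
    ring

theorem dirD_n_apply (hM : 0 < M) {t : ℝ} {F : Spacetime → ℝ} {p : Spacetime} (hp : p.2 ∈ ext M) :
    pd M t 0 F p = (hbar M p.2)⁻¹ * dirD M t (nVec M) F p +
      (hbar M p.2)⁻¹ * (mu M p.2 / hbar M p.2) * ∑ j, xhat p.2 j * pd M t j.succ F p := by
  have := (hbar_pos hM hp).ne'
  rw [dirD, Fin.sum_univ_succ]
  simp only [nVec, Fin.cons_zero, Fin.cons_succ, neg_mul, Finset.sum_neg_distrib, mul_assoc,
    ← Finset.mul_sum]
  field_simp
  ring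

/-- Solutions of scalar wave equations with Cauchy data in the weighted classes. -/
theorem ST.scalar_wave (hM : 0 < M) (hs : ∀ i, ContDiffOn ℝ ∞ (F i) (future M (t i)))
    (h0 : SO M C (m + 3) q fun i x => F i (t i, x))
    (h1 : SO M C (m + 2) (q + 1) fun i x => LinearisedGravity.dirD M (t i) (nVec M) (F i) (t i, x))
    (hP : ∀ k m, ST M t C k m q F → ST M t C k m (q + 2) P)
    (h : ∀ i, ∀ p ∈ future M (t i), boxQ M (t i) (F i) p + LinearisedGravity.angLap M (F i) p = P i p) :
    ST M t C 3 m q F := by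
  have h2 : ∀ j : Fin 3, SO M C (m + 2) (q + 1) fun i x => xhat x j *
      LinearisedGravity.pd M (t i) j.succ (F i) (t i, x) := fun j =>
    SO.mul hM (sy_xhat hM j) ((h0.ds j).congr fun i x hx => (ds_slice hM (hs i) le_rfl hx j).symm)
      (by linarith)
  have h3 := (sy_hbar_inv hM).mul hM (sy_mu_div_hbar hM) (by linarith : (0 : ℝ) ≤ 0 + 1)
  have h4 : ST M t C 1 (m + 2) q F := ST.zero_one hs h0 hM
    (((SO.mul hM (sy_hbar_inv hM) h1 (by linarith : q + 1 ≤ 0 + (q + 1))).add hM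
      (SO.mul hM h3 (SO.sum hM Finset.univ fun j _ => h2 j) (by linarith))).congr fun i x hx => by
        rw [dirD_n_apply hM (p := (t i, x)) hx])
  have h5 : ST M t C 2 (m + 1) q F := ST.of_scalar_wave hM h4
    (hP 0 (m + 1) (h4.pred.mono (by omega))) h
  exact ST.of_scalar_wave hM h5 (hP 1 m (h5.pred.mono (by omega))) h

end ScalarWave

end LinearisedGravity

end

noncomputable section

set_option linter.unusedSimpArgs false

namespace LinearisedGravity

open MeasureTheory

/-! ## The Regge--Wheeler and Zerilli equations -/

section ReggeWheelerZerilli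

variable {M : ℝ} (hM : 0 < M) {ι : Type*} {t C : ι → ℝ} {k m : ℕ} {q : ℝ} {𝒟 : ι → SeedData}

include hM

theorem sy_norm_inv_two : Sy M 2 fun x => ‖x‖⁻¹ * ‖x‖⁻¹ :=
  (sy_norm_inv hM).mul hM (sy_norm_inv hM) (by norm_num)

theorem sy_norm_inv_three : Sy M 3 fun x => ‖x‖⁻¹ * ‖x‖⁻¹ * ‖x‖⁻¹ :=
  (sy_norm_inv_two hM).mul hM (sy_norm_inv hM) (by norm_num)

theorem ST.reggeWheeler {Φ : ι → Spacetime → ℝ} (h : ∀ i, IsReggeWheeler M (t i) (𝒟 i) (Φ i))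
    (h0 : SO M C (m + 3) q fun i => (𝒟 i).Φ₀) (h1 : SO M C (m + 2) (q + 1) fun i => (𝒟 i).Φ₁) :
    ST M t C 3 m q Φ := by
  refine ST.scalar_wave (P := fun i p => -(6 / ‖p.2‖ ^ 2 * (M / ‖p.2‖) * Φ i p)) hM
    (fun i => (h i).smooth) (h0.congr fun i x hx => ((h i).init x hx).1)
    (h1.congr fun i x hx => ((h i).init x hx).2) (fun k m hF => ?_) fun i => (h i).eq
  refine (hF.mul hM ((sy_norm_inv_three hM).const_mul hM (-(6 * M))) (by linarith)).congr fun i p hp => ?_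
  have := norm_pos_of_mem_ext hM hp.2
  field_simp

theorem ST.zerilli {Ψ Z₁ Z₂ : ι → Spacetime → ℝ} (h : ∀ i, IsZerilli M (t i) (𝒟 i) (Ψ i) (Z₁ i) (Z₂ i))
    (h0 : SO M C (m + 3) q fun i => (𝒟 i).Ψ₀) (h1 : SO M C (m + 2) (q + 1) fun i => (𝒟 i).Ψ₁) :
    ST M t C 3 m q Ψ := by
  refine ST.scalar_wave (P := fun i p => -(6 / ‖p.2‖ ^ 2 * (M / ‖p.2‖) * Ψ i p)
      + 24 / ‖p.2‖ ^ 3 * (M / ‖p.2‖) * (‖p.2‖ - 3 * M) * Z₁ i p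
      + 72 / ‖p.2‖ ^ 3 * (M / ‖p.2‖) * (M / ‖p.2‖) * (‖p.2‖ - 2 * M) * Z₂ i p) hM
    (fun i => (h i).smooth) (h0.congr fun i x hx => ((h i).init x hx).1)
    (h1.congr fun i x hx => ((h i).init x hx).2) (fun k m hF => ?_) fun i => (h i).eq
  have hZ1 := hF.zeta hM fun i => (h i).zeta₁
  have hZ2 := hZ1.zeta hM fun i => (h i).zeta₂
  have s1 := sy_norm_inv_three hM
  have s0 : ∀ c : ℝ, Sy M 0 fun x => 1 - c * ‖x‖⁻¹ := fun c =>
    (sy_const hM 1).sub hM (((sy_norm_inv hM).const_mul hM c).weaken hM (by norm_num))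
  refine (((hF.mul hM (s1.const_mul hM (-(6 * M))) (by linarith : q + 2 ≤ 3 + q)).add hM
    (hZ1.mul hM ((s1.mul hM (s0 (3 * M)) (by linarith : (3 : ℝ) ≤ 3 + 0)).const_mul hM (24 * M))
      (by linarith))).add hM
    (hZ2.mul hM (((s1.mul hM (sy_norm_inv hM) (by linarith : (4 : ℝ) ≤ 3 + 1)).mul hM (s0 (2 * M))
      (by linarith : (4 : ℝ) ≤ 4 + 0)).const_mul hM (72 * (M * M)))
      (by linarith))).congr fun i p hp => ?_
  have := norm_pos_of_mem_ext hM hp.2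
  field_simp

end ReggeWheelerZerilli

section Smooth

variable {M s : ℝ} {X : TField 2} {u w : Spacetime → Fin 4 → ℝ}

theorem SymVec.smooth (hu : SymVec M u) (a : Fin 4) : ContDiffOn ℝ ∞ (fun p => u p a) (future M s) :=
  (contDiffOn_static (hu.sy a).smooth).congr fun p _ => hu.static p a

theorem contDiffOn_ev2 (hX : SmoothT M s X) (hu : SymVec M u) (hw : SymVec M w) :
    ContDiffOn ℝ ∞ (ev2 X u w) (future M s) :=
  ContDiffOn.sum fun a _ => ContDiffOn.sum fun b _ => ((hu.smooth a).mul (hw.smooth b)).mul (hX ![a, b])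

theorem contDiffOn_hatNN (hM : 0 < M) (hX : SmoothT M s X) :
    ContDiffOn ℝ ∞ (hatNN M X) (future M s) :=
  ((contDiffOn_ev2 hX (symVec_n hM) (symVec_n hM)).add
    (contDiffOn_ev2 hX (symVec_nu hM) (symVec_nu hM))).div_const 2

theorem contDiffOn_trQ (hM : 0 < M) (hX : SmoothT M s X) : ContDiffOn ℝ ∞ (trQ M X) (future M s) :=
  (contDiffOn_ev2 hX (symVec_n hM) (symVec_n hM)).neg.add
    (contDiffOn_ev2 hX (symVec_nu hM) (symVec_nu hM))

theorem contDiffOn_trS (hM : 0 < M) (hX : SmoothT M s X) : ContDiffOn ℝ ∞ (trS X) (future M s) :=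
  ContDiffOn.sum fun i _ => contDiffOn_ev2 hX (symVec_ang hM i) (symVec_ang hM i)

end Smooth

/-! ## The metric determined by `Φ` and `Ψ` -/

section RWMetric

variable {M : ℝ} (hM : 0 < M) {ι : Type*} {t C : ι → ℝ} {k m : ℕ} {q : ℝ}

section Radial

variable {s : ℝ} {F : Spacetime → ℝ} {u : Spacetime → Fin 4 → ℝ}

theorem sphAvg_mul_radial {g : Space → ℝ} (hg : ∀ x y, ‖x‖ = ‖y‖ → g x = g y) (F : Spacetime → ℝ)
    (p : Spacetime) : sphAvg (fun p => g p.2 * F p) p = g p.2 * sphAvg F p := by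
  simp only [sphAvg, sphereInt]
  rw [mul_left_comm, ← integral_const_mul (g p.2)]
  congr 2
  funext y
  beta_reduce
  rw [hg (‖p.2‖ • y.1) p.2 (by rw [norm_smul, norm_sph]; simp)]

theorem mu_radial : ∀ x y : Space, ‖x‖ = ‖y‖ → mu M x = mu M y := fun x y h => by rw [mu, mu, h]

theorem hbar_radial : ∀ x y : Space, ‖x‖ = ‖y‖ → hbar M x = hbar M y := fun x y h => by
  rw [hbar, hbar, mu_radial x y h]

theorem sphAvg_add {F G : Spacetime → ℝ} (hF : ContDiffOn ℝ ∞ F (future M s))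
    (hG : ContDiffOn ℝ ∞ G (future M s)) {p : Spacetime} (hp : p ∈ future M s) :
    sphAvg (fun p => F p + G p) p = sphAvg F p + sphAvg G p := by
  have hc : ∀ F : Spacetime → ℝ, ContDiffOn ℝ ∞ F (future M s) →
      Integrable (fun y : Sph => F (p.1, ‖p.2‖ • y.1)) sphMeas := fun F hF =>
    integrable_of_continuous (hF.continuousOn.comp_continuous (by fun_prop)
      fun y => mem_future hp.1 (norm_smul_mem_ext hp.2 (norm_sph y)))
  simp only [sphAvg, sphereInt]
  rw [← mul_add, ← integral_add (hc F hF) (hc G hG)]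

include hM

theorem sphAvg_drF_eq_zero (hF : ContDiffOn ℝ ∞ F (future M s)) (h : ∀ p ∈ future M s, sphAvg F p = 0)
    {p : Spacetime} (hp : p ∈ future M s) : sphAvg (drF M s F) p = 0 := by
  have h1 : ∀ j : Fin 3, xhat p.2 j * sphAvg (drF M s F) p = 0 := fun j => by
    rw [← pd_succ_sphAvg hM hF hp, pd_congr (G := fun _ => 0) h _ hp, pd_const]
  have h2 := xhat_sq (norm_pos_of_mem_ext hM hp.2)
  linear_combination xhat p.2 0 * h1 0 + xhat p.2 1 * h1 1 + xhat p.2 2 * h1 2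
      - sphAvg (drF M s F) p * h2

/-- The mean of `u(F)`, for `u = a ∂_t + b ∂_r` with radial coefficients. -/
theorem sphAvg_dirD_eq_zero (hF : ContDiffOn ℝ ∞ F (future M s)) (h : ∀ p ∈ future M s, sphAvg F p = 0)
    {a b : Space → ℝ} (ha : ∀ x y, ‖x‖ = ‖y‖ → a x = a y) (hb : ∀ x y, ‖x‖ = ‖y‖ → b x = b y)
    (has : Sy M 0 a) (hbs : Sy M 0 b)
    (hu : ∀ p, u p = Fin.cons (a p.2) fun j => b p.2 * xhat p.2 j)
    {p : Spacetime} (hp : p ∈ future M s) : sphAvg (dirD M s u F) p = 0 := by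
  have e : ∀ p, dirD M s u F p = a p.2 * pd M s 0 F p + b p.2 * drF M s F p := fun p => by
    rw [dirD, Fin.sum_univ_succ, hu, drF, Finset.mul_sum]
    simp only [Fin.cons_zero, Fin.cons_succ, mul_assoc]
  rw [sphAvg_congr (fun p _ => e p) hp, sphAvg_add (M := M) (s := s)
    ((contDiffOn_static has.smooth).mul (contDiffOn_pd hM hF 0))
    ((contDiffOn_static hbs.smooth).mul (contDiffOn_drF hM hF)) hp, sphAvg_mul_radial ha,
    sphAvg_mul_radial hb, sphAvg_drF_eq_zero hM hF h hp, ← pd_zero_sphAvg hM hF hp,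
    pd_congr (G := fun _ => 0) h 0 hp, pd_const]
  ring

end Radial

include hM

theorem sI_slS_eq_zero {t s : ℝ} (hs : t ≤ s) {F : Spacetime → ℝ} (hF : ContDiffOn ℝ ∞ F (future M t))
    (h : ∀ p ∈ future M t, sphAvg F p = 0) {R : ℝ} (hR : 2 * M ≤ R) :
    sI hM hR (slS hs (Sm.mk F hF)) = 0 := by
  obtain ⟨x, rfl⟩ := exists_norm_eq (show 0 < R by linarith)
  have := h (s, x) (mem_future hs hR)
  rw [sphAvg] at this
  have hπ : (1 / (4 * Real.pi) : ℝ) ≠ 0 := by positivity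
  rw [slS_mk, sI_mk]
  exact (mul_eq_zero.1 this).resolve_left hπ

/-- Elliptic estimate for functions `F` with `𝒯_f F = G`. -/
theorem ST.of_Tf {F G : ι → Spacetime → ℝ} (hG : ST M t C k m q G)
    (hF : ∀ i, ContDiffOn ℝ ∞ (F i) (future M (t i))) (hv : ∀ i, VanishingL01 M (t i) (F i))
    (h : ∀ i s, t i ≤ s → ∀ x ∈ ext M, Tf M (slice (F i) s) x ![] = G i (s, x)) :
    ST M t C k m q F :=
  ST.elliptic hM hF hv hG fun i s hs => Sm.ext' fun x => by
    rw [← reps_Tf hM (reps_slice hs (hF i)) x ![], h i s hs x x.2, slS_mk]; rfl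

/-- Elliptic estimate for mixed components. -/
theorem st_mixed_of_Tv {X : ι → TField 2} {u : Spacetime → Fin 4 → ℝ} {η : ι → Spacetime → ℝ}
    (hη : ST M t C k (m + 1) q η) (hη0 : ∀ i, ∀ p ∈ future M (t i), sphAvg (η i) p = 0)
    (hX : ∀ i, MixedVanishing M (t i) (X i) u)
    (h : ∀ i s, t i ≤ s → ∀ x ∈ ext M, ∀ I, Tv M (mixed (X i) u s) x I =
      D1star M (fun _ _ => 0) (slice (η i) s) x I) (I : Fin 1 → Fin 3) :
    ST M t C k m (q + 1) fun i p => mixed (X i) u p.1 p.2 I := by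
  choose e o he ho hev hov heo using hX
  have key : ∀ i s (hs : t i ≤ s), slS hs (Sm.mk (e i) (he i)) = 0 ∧
      RotAlg.ell (rot hM) (-slS hs (Sm.mk (o i) (ho i))) = slS hs (Sm.mk (η i) (hη.smooth i)) := fun i s hs => by
    have r1 : Reps (mixed (X i) u s) (vec (d1S hM (slS hs (Sm.mk (e i) (he i))) (slS hs (Sm.mk (o i) (ho i))))) :=
      fun x I => (heo i s hs x x.2 I).trans
        (reps_D1star hM (reps_slice hs (he i)) (reps_slice hs (ho i)) x I)
    have r2 := reps_Tv hM r1
    have r3 := reps_D1star hM (e := fun _ _ => 0) (φ := 0) (fun x I => rfl) (reps_slice hs (hη.smooth i))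
    have l0 : ∀ (R : ℝ) (hR : 2 * M ≤ R) (f : Sm (ext M)), sI hM hR (RotAlg.ell (rot hM) f) = 0 :=
      fun R hR f => sI_lap hM hR _
    obtain ⟨k1, k2⟩ := d1S_injective hM (φ' := 0) (ψ' := slS hs (Sm.mk (η i) (hη.smooth i)))
      (fun a => Sm.ext' fun x => by
        have := (r2 x ![a]).symm.trans ((h i s hs x x.2 ![a]).trans (r3 x ![a]))
        exact this) fun R hR => ⟨by rw [l0, map_zero], by
          rw [l0, sI_slS_eq_zero hM hs (hη.smooth i) (hη0 i)]⟩
    refine ⟨?_, k2⟩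
    have ho := (hev i).orth hM (he i) hs
    have : -slS hs (Sm.mk (e i) (he i)) = 0 := eq_zero_of_elliptic (fun R hR => by
      obtain ⟨a, b⟩ := ho R hR
      exact ⟨by rw [map_neg, a, neg_zero], fun i => by rw [neg_mul, map_neg, b i, neg_zero]⟩) k1
    exact neg_eq_zero.1 this
  have hell_neg : ∀ f : Sm (ext M), RotAlg.ell (rot hM) (-f) = -RotAlg.ell (rot hM) f := fun f => by
    rw [RotAlg.ell, RotAlg.ell, RotAlg.lap_neg, mul_neg, ← neg_add, RotAlg.lap_neg]
  have hos : ST M t C k (m + 1) q o := ST.elliptic hM ho hov (hη.neg hM) fun i s hs => by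
    have := (key i s hs).2
    rw [hell_neg] at this
    rw [← neg_neg (RotAlg.ell _ _), this, slS_mk, slS_mk]; rfl
  refine (((ST.rotT hM hos (I 0)).mul hM (sy_norm_inv hM) (by linarith : q + 1 ≤ 1 + q)).neg hM).congr
    fun i p hp => ?_
  have r3 := reps_D1star hM (reps_slice hp.1 (he i)) (reps_slice hp.1 (ho i)) ⟨p.2, hp.2⟩ I
  refine (heo i p.1 hp.1 p.2 hp.2 I).trans (r3.trans ?_)
  rw [(key i p.1 hp.1).1]
  simp only [vec, map_zero, zero_add, ← Sm.ev_apply, map_neg, map_mul]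
  rw [← slS_rotF, rotF_mk, slS_mk]
  rfl

omit hM in
theorem VanishingL01.sphAvg_eq_zero (hM : 0 < M) {t : ℝ} {F : Spacetime → ℝ} (h : VanishingL01 M t F)
    {p : Spacetime} (hp : p ∈ future M t) : sphAvg F p = 0 := ((vanishingL01_iff hM).1 h p hp).1

theorem ST.rTimes {F : ι → Spacetime → ℝ} (hF : ST M t C k m q F) :
    ST M t C k m (q - 1) fun i => rTimes (F i) := hF.mul hM (sy_norm hM) (by linarith)

theorem dirD_rFun {t : ℝ} (u : Spacetime → Fin 4 → ℝ) {p : Spacetime} (hp : p ∈ future M t) :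
    dirD M t u rFun p = ∑ j : Fin 3, u p j.succ * xhat p.2 j := by
  have hn := contDiffOn_norm_ext hM
  have h0 : pd M t 0 rFun p = 0 := pd_zero_static hM hn hp
  have h1 : ∀ j : Fin 3, pd M t j.succ rFun p = xhat p.2 j := fun j =>
    (pd_succ_static hM hn hp j).trans ((ds_norm hM j hp.2).trans (div_eq_mul_inv _ _).symm)
  rw [dirD, Fin.sum_univ_succ, h0]
  simp only [h1, mul_zero, zero_add]

theorem st_mul_dirD_rFun {F : ι → Spacetime → ℝ} (hF : ST M t C k m q F) {u : Spacetime → Fin 4 → ℝ}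
    (hu : SymVec M u) : ST M t C k m (q + 1) fun i p => 6 * mu M p.2 * (dirD M (t i) u rFun p * F i p) := by
  refine (hF.mul hM (((sy_mu hM).const_mul hM 6).mul hM (Sy.sum hM Finset.univ fun j _ =>
    (hu.sy (Fin.succ j)).mul hM (sy_xhat hM j) (by linarith : (0 : ℝ) ≤ 0 + 0))
      (by linarith : (1 : ℝ) ≤ 1 + 0)) (by linarith)).congr fun i p hp => ?_
  simp only [dirD_rFun hM u hp, hu.static p]
  ring

theorem st_rwMetric {Φ Ψ Z₁ : ι → Spacetime → ℝ} {h : ι → TField 2}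
    (hR : ∀ i, IsRWMetric M (t i) (Φ i) (Ψ i) (Z₁ i) (h i)) (hΦ : ST M t C 3 m q Φ)
    (hv : ∀ i, VanishingL01 M (t i) (Φ i)) (hΨ : ST M t C 3 m q Ψ)
    (hZ : ∀ i, IsZeta M (t i) (Ψ i) (Z₁ i)) (a b : Fin 4) :
    ST M t C 1 m (q + 1) fun i p => h i p ![a, b] := by
  have hn := symVec_n hM
  have hnu := symVec_nu hM
  have hH : ∀ a b, ST M t C 1 m (q + 1) fun i p => hess M (t i) (rTimes (Ψ i)) p ![a, b] := fun a b => by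
    have := ST.hess hM (ST.rTimes hM hΨ) a b
    rwa [show q - 1 + 2 = q + 1 by ring] at this
  choose Wn Wν hWn hWν hW using fun i => (hR i).hatQ
  have sW : ∀ {u : Spacetime → Fin 4 → ℝ} {W : ι → Spacetime → ℝ}, SymVec M u →
      (∀ i, IsZeta M (t i) (dirD M (t i) u (Ψ i)) (W i)) → ST M t C 1 m q W := fun hu hW => by
    have := (ST.dirD hM hΨ.pred hu).zeta hM hW
    rwa [show q + 1 - 1 = q by ring] at this
  have sWn := sW hn hWn
  have sWν := sW hnu hWν
  have hm : ∀ i s, t i ≤ s → ∀ x ∈ ext M, (s, x) ∈ future M (t i) := fun i s hs x hx => mem_future hs hx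
  have h1 : ST M t C 1 m (q + 1) fun i => hatNN M (h i) := by
    refine ST.of_Tf hM (((ST.hatNN hM hH).const_mul hM 2).add hM
      ((st_mul_dirD_rFun hM sWn hn).add hM (st_mul_dirD_rFun hM sWν hnu)))
      (fun i => contDiffOn_hatNN hM (hR i).smooth)
      (fun i => (hR i).vanishing.1) fun i s hs x hx => ?_
    rw [(hW i s hs x hx).1]; ring
  have h2 : ST M t C 1 m (q + 1) fun i => hatNV M (h i) := by
    refine ST.of_Tf hM (((ST.hatNV hM hH).const_mul hM 2).add hM
      ((st_mul_dirD_rFun hM sWν hn).add hM (st_mul_dirD_rFun hM sWn hnu)))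
      (fun i => contDiffOn_ev2 (hR i).smooth hn hnu)
      (fun i => (hR i).vanishing.2.1) fun i s hs x hx => ?_
    rw [(hW i s hs x hx).2]; ring
  have h7 : ST M t C 1 m (q + 1) fun i => trS (h i) := by
    have g1 := ((ST.angLap hM (hΨ.shift.shift)).mul hM (sy_norm hM)
      (by linarith : q + 1 ≤ -1 + (q + 2))).const_mul hM (-2)
    have g2 := (ST.dirD hM hΨ.pred (symVec_P hM)).const_mul hM 4
    have g3 := (hΨ.zeta hM hZ).pred.pred.mul hM (((sy_mu hM).mul hM ((sy_norm_inv hM).mul hM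
      ((sy_const hM 1).sub hM ((sy_mu hM).weaken hM (by norm_num))) (by linarith : (1 : ℝ) ≤ 1 + 0))
      (by linarith : (2 : ℝ) ≤ 1 + 1)).const_mul hM 12) (by linarith : q + 1 ≤ 2 + (q - 1))
    refine ST.of_Tf hM ((g1.add hM g2).add hM g3)
      (fun i => contDiffOn_trS hM (hR i).smooth)
      (fun i => (hR i).vanishing.2.2.2.2.2) fun i s hs x hx => ?_
    rw [(hR i).traceS s hs x hx]; ring
  have hrΦ := ST.rTimes hM hΦ
  have hrv : ∀ i, ∀ p ∈ future M (t i), sphAvg (rTimes (Φ i)) p = 0 := fun i p hp => by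
    have := sphAvg_mul_radial (g := fun x => ‖x‖) (fun x y h => h) (Φ i) p
    rw [(hv i).sphAvg_eq_zero hM hp, mul_zero] at this
    exact this
  have hη : ∀ u, SymVec M u → ST M t C 1 (m + 1) q fun i => dirD M (t i) u (rTimes (Φ i)) := fun u hu => by
    have := (ST.dirD hM hrΦ hu).shift
    rwa [show q - 1 + 1 = q by ring] at this
  have h4 : ∀ I, ST M t C 1 m (q + 1) fun i p => mixed (h i) (nVec M) p.1 p.2 I :=
    st_mixed_of_Tv hM (hη _ hnu) (fun i p hp => sphAvg_dirD_eq_zero hM (hrΦ.smooth i) (hrv i)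
      (a := fun _ => 0) (b := fun x => 1 / hbar M x) (fun _ _ _ => rfl)
      (fun x y h => by rw [hbar_radial x y h]) sy_zero ((sy_hbar_inv hM).congr fun x _ => one_div _)
      (fun p => rfl) hp)
      (fun i => (hR i).vanishing.2.2.2.1) fun i s hs x hx I => ((hR i).mixed s hs x hx I).1
  have h5 : ∀ I, ST M t C 1 m (q + 1) fun i p => mixed (h i) (nuVec M) p.1 p.2 I :=
    st_mixed_of_Tv hM (hη _ hn) (fun i p hp => sphAvg_dirD_eq_zero hM (hrΦ.smooth i) (hrv i)
      (a := hbar M) (b := fun x => -(mu M x / hbar M x)) hbar_radial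
      (fun x y h => by rw [mu_radial x y h, hbar_radial x y h]) (sy_hbar hM)
      (((sy_mu_div_hbar hM).neg hM).weaken hM (by norm_num)) (fun p => rfl) hp)
      (fun i => (hR i).vanishing.2.2.2.2.1) fun i s hs x hx I => ((hR i).mixed s hs x hx I).2
  exact ST.of_parts hM (fun i => (hR i).symm) h1 h2
    (ST.zero.congr fun i p hp => (hR i).traceQ p hp) h4 h5
    (fun I => ST.zero.congr fun i p hp => (hR i).hatS p.1 hp.1 p.2 hp.2 I) h7 a b

end RWMetric

end LinearisedGravity

end

noncomputable section

set_option linter.unusedSimpArgs false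

namespace LinearisedGravity

open MeasureTheory

/-! ## The pure gauge solution -/

section Gauge

variable {M : ℝ} {ι : Type*} {t C : ι → ℝ} {k m : ℕ} {q : ℝ}

theorem smoothT_covD (hM : 0 < M) {s : ℝ} {r : ℕ} {T : TField r} (hT : SmoothT M s T) :
    SmoothT M s (covD M s T) := fun I =>
  (contDiffOn_pd hM (hT _) _).sub (ContDiffOn.sum fun j _ => ContDiffOn.sum fun c _ =>
    ((contDiffOn_static (sy_gam hM c (I 0) (Fin.tail I j)).smooth).congr
      fun _ hp => Gam_eq hM _ _ _ hp).mul (hT _))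

theorem symVec_lower (hM : 0 < M) {u : Spacetime → Fin 4 → ℝ} (hu : SymVec M u) :
    SymVec M (lower M u) := by
  refine ⟨fun p a => ?_, fun a => ?_⟩
  · simp only [lower, hu.static p]; rfl
  · exact Sy.sum hM Finset.univ fun b _ => (sy_gM hM a b).mul hM (hu.sy b) (by linarith : (0 : ℝ) ≤ 0 + 0)

theorem ST.hatZero (hM : 0 < M) {X : ι → TField 2} (hX : ∀ a b, ST M t C k m q fun i p => X i p ![a, b])
    (a b : Fin 4) : ST M t C k m q fun i p => hatZero M (X i) p a b := by
  have hn := symVec_lower hM (symVec_n hM)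
  have hnu := symVec_lower hM (symVec_nu hM)
  have h1 := ST.sphAvg hM (ST.hatNN hM hX)
  have h2 := ST.sphAvg hM (ST.hatNV hM hX)
  have key : ∀ {F : ι → Spacetime → ℝ} {u w : Spacetime → Fin 4 → ℝ} (a b : Fin 4), ST M t C k m q F →
      SymVec M u → SymVec M w → ST M t C k m q fun i p => u p a * (w p b * F i p) :=
    fun a b h hu hw => (h.mul_vec hM hw b).mul_vec hM hu a
  refine (((key a b h1 hn hn).add hM (key a b h1 hnu hnu)).sub hM
    ((key a b h2 hn hnu).add hM (key a b h2 hnu hn))).congr fun i p _ => ?_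
  rw [LinearisedGravity.hatZero]; ring

theorem ST.gaugeMap (hM : 0 < M) {X : ι → TField 2} (hX : ∀ a b, ST M t C k m q fun i p => X i p ![a, b])
    (I : Fin 1 → Fin 4) : ST M t C k m (q + 1) fun i p => gaugeMap M (X i) p I := by
  have hP := symVec_P hM
  have hd : Sy M 0 fun x => drCov (0, x) (I 0) := by
    refine Fin.cases (sy_const hM 0) (fun j => ?_) (I 0)
    exact sy_xhat hM j
  have h1 : ST M t C k m q fun i p => ∑ a, PVec M p a * X i p ![a, I 0] :=
    ST.sum hM Finset.univ fun a _ => (hX a (I 0)).mul_vec hM hP a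
  have h2 : ST M t C k m q fun i p => ∑ a, PVec M p a * LinearisedGravity.hatZero M (X i) p a (I 0) :=
    ST.sum hM Finset.univ fun a _ => (ST.hatZero hM hX a (I 0)).mul_vec hM hP a
  have h3 := (ST.trS hM hX).mul hM hd (by linarith : q ≤ 0 + q)
  refine (((h1.const_mul hM 2).sub hM (h2.add hM h3)).mul hM (sy_norm_inv hM)
    (by linarith : q + 1 ≤ 1 + q)).congr fun i p hp => ?_
  rw [LinearisedGravity.gaugeMap, show drCov p (I 0) = drCov (0, p.2) (I 0) from rfl]
  have := norm_pos_of_mem_ext hM hp.2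
  field_simp
  ring

theorem ST.lieMetric (hM : 0 < M) {v : ι → TField 1} (hv : ∀ I, ST M t C (k + 1) m q fun i p => v i p I)
    (a b : Fin 4) : ST M t C k m (q + 1) fun i p => lieMetric M (t i) (v i) p ![a, b] :=
  (ST.covD hM hv ![a, b]).add hM (ST.covD hM hv ![b, a])

/-- Gain of a time derivative from the wave equation for the generator of a pure gauge solution. -/
theorem ST.of_gauge (hM : 0 < M) {v : ι → TField 1} (hv : ∀ I, ST M t C (k + 1) (m + 1) q fun i p => v i p I)
    (h : ∀ i, ∀ p ∈ future M (t i), ∀ a, box M (t i) (v i) p ![a] =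
      LinearisedGravity.gaugeMap M (LinearisedGravity.lieMetric M (t i) (v i)) p ![a]) (a : Fin 4) :
    ST M t C (k + 2) m q fun i p => v i p ![a] := by
  have hG := ST.gaugeMap hM (ST.lieMetric hM fun I => (hv I).mono (Nat.le_succ m)) ![a]
  rw [show q + 1 + 1 = q + 2 by ring] at hG
  have hL : ST M t C k m (q + 2) fun i p => ∑ b, ∑ c, gInv M (0, p.2) b c *
      (LinearisedGravity.covD M (t i) (LinearisedGravity.covD M (t i) (v i)) p (Fin.cons b (Fin.cons c ![a])) -
        LinearisedGravity.pd M (t i) b (LinearisedGravity.pd M (t i) c fun q => v i q ![a]) p) :=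
    ST.sum hM Finset.univ fun b _ => ST.sum hM Finset.univ fun c _ =>
      (ST.covD_covD hM (fun I => (hv I).mono (Nat.le_succ m)) b c ![a]).mul hM (sy_gInv hM b c) (by linarith)
  refine ST.of_wave hM (hv ![a]) (hG.sub hM hL) (c := fun b c x => gInv M (0, x) b c)
    (e := fun x => -((hbar M x)⁻¹ * (hbar M x)⁻¹)) (sy_gInv hM) ?_ (fun x hx => ?_) fun i p hp => ?_
  · exact ((sy_hbar_inv hM).mul hM (sy_hbar_inv hM) (by linarith : (0 : ℝ) ≤ 0 + 0)).neg hM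
  · rw [← hbar_inv_sq hM hx]
    have := hbar_sq hM hx
    simp [gInv, eta]
    linear_combination ((hbar M x)⁻¹ * (hbar M x)⁻¹) * (-this)
  · rw [← h i p hp a, box]
    simp only [mul_sub, Finset.sum_sub_distrib]
    exact (sub_sub_cancel _ _).symm

/-- The generator of the pure gauge solution in terms of its Cauchy data. -/
theorem st_gaugeGenerator (hM : 0 < M) {v : ι → TField 1} {𝒟 : ι → SeedData}
    (h : ∀ i, IsGaugeGenerator M (t i) (𝒟 i) (v i))
    (vn : SO M C (m + 2) q fun i => (𝒟 i).vn) (vν : SO M C (m + 2) q fun i => (𝒟 i).vν)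
    (vS : ∀ j, SO M C (m + 2) q fun i x => (𝒟 i).vS x ![j])
    (wn : SO M C (m + 1) (q + 1) fun i => (𝒟 i).wn) (wν : SO M C (m + 1) (q + 1) fun i => (𝒟 i).wν)
    (wS : ∀ j, SO M C (m + 1) (q + 1) fun i x => (𝒟 i).wS x ![j]) (a : Fin 4) :
    ST M t C 2 m q fun i p => v i p ![a] := by
  have hs : ∀ i, SmoothT M (t i) (v i) := fun i => (h i).smooth
  have hI : ∀ I : Fin 1 → Fin 4, I = ![I 0] := fun I => by
    funext j; fin_cases j; rfl
  have ev1_smooth : ∀ i (Y : TField 1), SmoothT M (t i) Y → ∀ A,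
      ContDiffOn ℝ ∞ (ev1 Y (fr M A)) (future M (t i)) := fun i Y hY A =>
    ContDiffOn.sum fun a _ => ((symVec_fr hM A).smooth a).mul (hY ![a])
  have h0 : ∀ a, ST M t C 0 (m + 2) q fun i p => v i p ![a] := ST.of_ev1 hM fun A =>
    ⟨fun i => ev1_smooth i _ (hs i) A, by
      refine Fin.cases ?_ (fun A => Fin.cases ?_ (fun c => ?_) A) A
      · exact vn.congr fun i x hx => ((h i).init x hx).1
      · exact vν.congr fun i x hx => ((h i).init x hx).2.1
      · exact (vS c).congr fun i x hx => ((h i).init x hx).2.2.1 c⟩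
  set Y : ι → TField 1 := fun i p I => ∑ c, nVec M p c * covD M (t i) (v i) p ![c, I 0] with hY
  have hYs : ∀ i, SmoothT M (t i) (Y i) := fun i I => ContDiffOn.sum fun c _ =>
    ((symVec_n hM).smooth c).mul (smoothT_covD hM (hs i) _)
  have hYe : ∀ i A p, ev1 (Y i) (fr M A) p = ev2 (covD M (t i) (v i)) (nVec M) (fr M A) p := fun i A p => by
    simp only [hY, ev1, ev2, Finset.mul_sum]
    rw [Finset.sum_comm]
    exact Finset.sum_congr rfl fun c _ => Finset.sum_congr rfl fun a _ => by
      simp only [Matrix.cons_val_zero]; ring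
  have h1 : ∀ a, ST M t C 0 (m + 1) (q + 1) fun i p => Y i p ![a] := ST.of_ev1 hM fun A =>
    ⟨fun i => ev1_smooth i _ (hYs i) A, by
      refine SO.congr (F := fun i x => ev2 (covD M (t i) (v i)) (nVec M) (fr M A) (t i, x)) ?_
        fun i x hx => hYe i A _
      refine Fin.cases ?_ (fun A => Fin.cases ?_ (fun c => ?_) A) A
      · exact wn.congr fun i x hx => ((h i).init x hx).2.2.2.1
      · exact wν.congr fun i x hx => ((h i).init x hx).2.2.2.2.1
      · exact (wS c).congr fun i x hx => ((h i).init x hx).2.2.2.2.2 c⟩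
  have h2 : ∀ a, ST M t C 0 (m + 1) (q + 1) fun i => pd M (t i) 0 fun p => v i p ![a] := fun a => by
    have hc : ∀ c, ST M t C 0 (m + 1) (q + 1) fun i p => conn M (t i) (v i) p ![c, a] := fun c =>
      (ST.conn hM (fun I => by rw [hI I]; exact h0 _) ![c, a]).mono (by omega)
    have hp : ∀ j : Fin 3, ST M t C 0 (m + 1) (q + 1) fun i => pd M (t i) j.succ fun p => v i p ![a] :=
      fun j => (h0 a).pd_succ hM j
    refine ((((h1 a).add hM (ST.sum hM Finset.univ fun c _ => (hc c).mul_vec hM (symVec_n hM) c)).sub hM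
      (ST.sum hM Finset.univ fun j _ => (hp j).mul_vec hM (symVec_n hM) (Fin.succ j))).mul hM
        (sy_hbar_inv hM) (by linarith : q + 1 ≤ 0 + (q + 1))).congr fun i p hp => ?_
    have e : Y i p ![a] = ∑ c, nVec M p c * (pd M (t i) c (fun p => v i p ![a]) p - conn M (t i) (v i) p ![c, a]) := rfl
    have := (hbar_pos hM hp.2).ne'
    rw [e]
    simp only [mul_sub, Finset.sum_sub_distrib, sub_add_cancel]
    rw [Fin.sum_univ_succ, show nVec M p 0 = hbar M p.2 from rfl]
    field_simp
    ring
  have h3 : ∀ I, ST M t C 1 (m + 1) q fun i p => v i p I := fun I => by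
    rw [hI I]
    exact ST.zero_one (fun i => hs i _) (h0 _).so hM (h2 _).so
  exact ST.of_gauge (k := 0) hM h3 (fun i => (h i).eq) a

end Gauge

end LinearisedGravity

end

noncomputable section

set_option linter.unusedSimpArgs false

namespace LinearisedGravity

open MeasureTheory

/-! ## Initial data in the weighted classes -/

section Induced

variable {M : ℝ} {ι : Type*} {t C : ι → ℝ} {k m : ℕ} {q : ℝ} {X : ι → TField 2}
  {u w : Spacetime → Fin 4 → ℝ} {A B : ι → InitialData}

theorem vec_two {α : Type*} (I : Fin 2 → α) : I = ![I 0, I 1] := by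
  funext j; fin_cases j <;> rfl

theorem ST.covD_two (hM : 0 < M) (hX : ∀ a b, ST M t C (k + 1) m q fun i p => X i p ![a, b]) (a b c : Fin 4) :
    ST M t C k m (q + 1) fun i p => LinearisedGravity.covD M (t i) (X i) p ![a, b, c] :=
  ST.covD hM (fun I => by rw [vec_two I]; exact hX _ _) _

theorem ST.dGam (hM : 0 < M) (hX : ∀ a b, ST M t C (k + 1) m q fun i p => X i p ![a, b])
    (hu : SymVec M u) (hw : SymVec M w) :
    ST M t C k m (q + 1) fun i => dGam M (t i) (X i) u w := by
  refine ST.const_mul hM (1 / 2) (ST.sum hM Finset.univ fun a _ => ST.sum hM Finset.univ fun b _ =>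
    ST.sum hM Finset.univ fun c _ => ?_)
  simp only [mul_assoc]
  exact (((((ST.covD_two hM hX c a b).sub hM (ST.covD_two hM hX a b c)).sub hM
    (ST.covD_two hM hX b a c)).mul_vec hM (symVec_n hM) c).mul_vec hM hw b).mul_vec hM hu a

theorem sy_kNuNu (hM : 0 < M) : Sy M 2 (kNuNu M) := by
  have h := sy_hbar_inv hM
  refine ((((sy_mu hM).mul hM ((sy_const hM 2).add hM ((sy_mu hM).weaken hM (by norm_num)))
    (by norm_num : (1 : ℝ) ≤ 1 + 0)).mul hM ((h.mul hM (h.mul hM h (by norm_num : (0 : ℝ) ≤ 0 + 0))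
      (by norm_num : (0 : ℝ) ≤ 0 + 0)).mul hM (sy_norm_inv hM) (by norm_num : (1 : ℝ) ≤ 0 + 1))
      (by norm_num : (2 : ℝ) ≤ 1 + 1)).const_mul hM (1 / 2)).congr fun x hx => ?_
  have := (hbar_pos hM hx).ne'
  have := (norm_pos_of_mem_ext hM hx).ne'
  rw [kNuNu]; field_simp

theorem sy_kTrS (hM : 0 < M) : Sy M 2 (kTrS M) := by
  refine (((sy_mu hM).mul hM ((sy_hbar_inv hM).mul hM (sy_norm_inv hM) (by norm_num : (1 : ℝ) ≤ 0 + 1))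
      (by norm_num : (2 : ℝ) ≤ 1 + 1)).const_mul hM (-2)).congr fun x hx => ?_
  have := (hbar_pos hM hx).ne'
  have := (norm_pos_of_mem_ext hM hx).ne'
  rw [kTrS]; field_simp

/-- Initial data in the weighted classes. -/
structure IDSO (M : ℝ) {ι : Type*} (C : ι → ℝ) (m : ℕ) (q : ℝ) (A : ι → InitialData) : Prop where
  lapse : ∀ I, SO M C (m + 1) q fun i x => (A i).lapse x I
  shiftR : ∀ I, SO M C (m + 1) q fun i x => (A i).shiftR x I
  shiftS : ∀ I, SO M C (m + 1) q fun i x => (A i).shiftS x I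
  hR : ∀ I, SO M C (m + 1) q fun i x => (A i).hR x I
  hS : ∀ I, SO M C (m + 1) q fun i x => (A i).hS x I
  hHat : ∀ I, SO M C (m + 1) q fun i x => (A i).hHat x I
  hTr : ∀ I, SO M C (m + 1) q fun i x => (A i).hTr x I
  kR : ∀ I, SO M C m (q + 1) fun i x => (A i).kR x I
  kS : ∀ I, SO M C m (q + 1) fun i x => (A i).kS x I
  kHat : ∀ I, SO M C m (q + 1) fun i x => (A i).kHat x I
  kTr : ∀ I, SO M C m (q + 1) fun i x => (A i).kTr x I

theorem IDSO.add (hM : 0 < M) (hA : IDSO M C m q A) (hB : IDSO M C m q B) :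
    IDSO M C m q fun i => A i + B i :=
  ⟨fun I => (hA.lapse I).add hM (hB.lapse I), fun I => (hA.shiftR I).add hM (hB.shiftR I),
    fun I => (hA.shiftS I).add hM (hB.shiftS I), fun I => (hA.hR I).add hM (hB.hR I),
    fun I => (hA.hS I).add hM (hB.hS I), fun I => (hA.hHat I).add hM (hB.hHat I),
    fun I => (hA.hTr I).add hM (hB.hTr I), fun I => (hA.kR I).add hM (hB.kR I),
    fun I => (hA.kS I).add hM (hB.kS I), fun I => (hA.kHat I).add hM (hB.kHat I),
    fun I => (hA.kTr I).add hM (hB.kTr I)⟩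

theorem IDSO.congr (hA : IDSO M C m q A) (h : ∀ i, (B i).EqOn M (A i)) : IDSO M C m q B :=
  ⟨fun I => (hA.lapse I).congr fun i x hx => congrFun (h i x hx).1 I,
    fun I => (hA.shiftR I).congr fun i x hx => congrFun (h i x hx).2.1 I,
    fun I => (hA.shiftS I).congr fun i x hx => congrFun (h i x hx).2.2.1 I,
    fun I => (hA.hR I).congr fun i x hx => congrFun (h i x hx).2.2.2.1 I,
    fun I => (hA.hS I).congr fun i x hx => congrFun (h i x hx).2.2.2.2.1 I,
    fun I => (hA.hHat I).congr fun i x hx => congrFun (h i x hx).2.2.2.2.2.1 I,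
    fun I => (hA.hTr I).congr fun i x hx => congrFun (h i x hx).2.2.2.2.2.2.1 I,
    fun I => (hA.kR I).congr fun i x hx => congrFun (h i x hx).2.2.2.2.2.2.2.1 I,
    fun I => (hA.kS I).congr fun i x hx => congrFun (h i x hx).2.2.2.2.2.2.2.2.1 I,
    fun I => (hA.kHat I).congr fun i x hx => congrFun (h i x hx).2.2.2.2.2.2.2.2.2.1 I,
    fun I => (hA.kTr I).congr fun i x hx => congrFun (h i x hx).2.2.2.2.2.2.2.2.2.2 I⟩

/-- Finitely many bounds with constants proportional to `C` combine. -/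
theorem exists_and {P Q : ι → ℝ → Prop} (hC : ∀ i, 0 ≤ C i) (hP : ∀ i b b', b ≤ b' → P i b → P i b')
    (hQ : ∀ i b b', b ≤ b' → Q i b → Q i b') (h1 : ∃ b, 0 ≤ b ∧ ∀ i, P i (b * C i))
    (h2 : ∃ b, 0 ≤ b ∧ ∀ i, Q i (b * C i)) : ∃ b, 0 ≤ b ∧ ∀ i, P i (b * C i) ∧ Q i (b * C i) := by
  obtain ⟨b, hb, h1⟩ := h1
  obtain ⟨b', hb', h2⟩ := h2
  exact ⟨b + b', by positivity, fun i =>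
    ⟨hP i _ _ (mul_le_mul_of_nonneg_right (by linarith) (hC i)) (h1 i),
      hQ i _ _ (mul_le_mul_of_nonneg_right (by linarith) (hC i)) (h2 i)⟩⟩

theorem BoundedBy.mono {r : ℕ} {T : SField r} {b b' : ℝ} (hb : b ≤ b') (h : BoundedBy M m q b T) :
    BoundedBy M m q b' T := fun x hx => (h x hx).trans hb

theorem IDSO.exists_bound (hM : 0 < M) (hC : ∀ i, 0 ≤ C i) (hA : IDSO M C m q A) :
    ∃ b, 0 ≤ b ∧ ∀ i, (A i).MetricBoundedBy M (m + 1) q (b * C i) ∧ (A i).KBoundedBy M m (q + 1) (b * C i) := by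
  have mA : ∀ {P Q : ι → ℝ → Prop}, (∀ i b b', b ≤ b' → P i b → P i b') →
      (∀ i b b', b ≤ b' → Q i b → Q i b') → ∀ i b b', b ≤ b' → P i b ∧ Q i b → P i b' ∧ Q i b' :=
    fun h1 h2 i b b' hb h => ⟨h1 i b b' hb h.1, h2 i b b' hb h.2⟩
  have mB : ∀ {r m' : ℕ} {q' : ℝ} {T : ι → SField r} (i : ι) (b b' : ℝ), b ≤ b' → BoundedBy M m' q' b (T i) →
      BoundedBy M m' q' b' (T i) := fun _ _ _ hb h => h.mono hb
  have m2 := fun {P Q} h1 h2 => mA (P := P) (Q := Q) h1 h2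
  have k3 := mA (mB (T := fun i => (A i).kHat) (m' := m) (q' := q + 1)) (mB (T := fun i => (A i).kTr) (m' := m) (q' := q + 1))
  have k2 := mA (mB (T := fun i => (A i).kS) (m' := m) (q' := q + 1)) k3
  have k1 := mA (mB (T := fun i => (A i).kR) (m' := m) (q' := q + 1)) k2
  have g6 := mA (mB (T := fun i => (A i).hHat) (m' := m + 1) (q' := q)) (mB (T := fun i => (A i).hTr) (m' := m + 1) (q' := q))
  have g5 := mA (mB (T := fun i => (A i).hS) (m' := m + 1) (q' := q)) g6
  have g4 := mA (mB (T := fun i => (A i).hR) (m' := m + 1) (q' := q)) g5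
  have g3 := mA (mB (T := fun i => (A i).shiftS) (m' := m + 1) (q' := q)) g4
  have g2 := mA (mB (T := fun i => (A i).shiftR) (m' := m + 1) (q' := q)) g3
  have g1 := mA (mB (T := fun i => (A i).lapse) (m' := m + 1) (q' := q)) g2
  exact exists_and hC g1 k1
    (exists_and hC mB g2 (exists_boundedBy hM hA.lapse) <| exists_and hC mB g3 (exists_boundedBy hM hA.shiftR) <|
      exists_and hC mB g4 (exists_boundedBy hM hA.shiftS) <| exists_and hC mB g5 (exists_boundedBy hM hA.hR) <|
      exists_and hC mB g6 (exists_boundedBy hM hA.hS) <|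
      exists_and hC mB mB (exists_boundedBy hM hA.hHat) (exists_boundedBy hM hA.hTr))
    (exists_and hC mB k2 (exists_boundedBy hM hA.kR) <| exists_and hC mB k3 (exists_boundedBy hM hA.kS) <|
      exists_and hC mB mB (exists_boundedBy hM hA.kHat) (exists_boundedBy hM hA.kTr))

theorem idso_induced (hM : 0 < M) (hX : ∀ a b, ST M t C 1 m q fun i p => X i p ![a, b]) :
    IDSO M C m q fun i => induced M (t i) (X i) := by
  have hn := symVec_n hM
  have hnu := symVec_nu hM
  have ha := symVec_ang hM
  have nn := (ST.ev2 hM hX hn hn).so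
  have nv := (ST.ev2 hM hX hn hnu).so
  have vv := (ST.ev2 hM hX hnu hnu).so
  have mn := fun I => (ST.mixed hM hX hn I).so
  have mv := fun I => (ST.mixed hM hX hnu I).so
  have hS := fun I => (ST.hatS hM hX I).so
  have tS := (ST.trS hM hX).so
  have lw : ∀ {F : ι → Space → ℝ} {g : Space → ℝ}, Sy M 2 g → SO M C (m + 1) q F →
      SO M C m (q + 1) fun i x => g x * F i x := fun hg hF => SO.mul hM hg (hF.mono (Nat.le_succ m)) (by linarith)
  have z : ∀ {F : ι → Space → ℝ} {g : Space → ℝ}, Sy M 0 g → SO M C (m + 1) q F →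
      SO M C (m + 1) q fun i x => g x * F i x := fun hg hF => SO.mul hM hg hF (by linarith)
  have hi := sy_hbar_inv hM
  have hμ := (sy_mu hM).weaken hM (by norm_num : (0 : ℝ) ≤ 1)
  have kN := sy_kNuNu hM
  have kT := sy_kTrS hM
  have G : ∀ {u w}, SymVec M u → SymVec M w → SO M C m (q + 1) fun i x => dGam M (t i) (X i) u w (t i, x) :=
    fun hu hw => (ST.dGam hM hX hu hw).so
  have d1 : ∀ I, SO M C m (q + 1) fun i x => dkNuNu M (t i) (X i) x I := fun I =>
    ((G hnu hnu).sub hM (lw (kN.const_mul hM (1 / 2)) nn)).congr fun i x _ => by rw [dkNuNu]; ring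
  have d2 : ∀ I, SO M C m (q + 1) fun i x => dkNuS M (t i) (X i) x I := fun I => G hnu (ha (I 0))
  have d3 : ∀ I, SO M C m (q + 1) fun i x => dkS M (t i) (X i) x I := fun I =>
    ((G (ha (I 0)) (ha (I 1))).sub hM (lw ((kT.mul hM (sy_proj hM (I 0) (I 1))
      (by norm_num : (2 : ℝ) ≤ 2 + 0)).const_mul hM (1 / 4)) nn)).congr fun i x _ => by rw [dkS]; ring
  have d4 : ∀ I, SO M C m (q + 1) fun i x => dkSTr M (t i) (X i) x I := fun I =>
    SO.sum hM Finset.univ fun j _ => d3 ![j, j]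
  have d5 : ∀ I, SO M C m (q + 1) fun i x => dTrK M (t i) (X i) x I := fun I =>
    (((d1 I).add hM (d4 I)).sub hM ((lw kN vv).add hM (lw (kT.const_mul hM (1 / 2)) tS))).congr
      fun i x _ => by rw [dTrK]
  refine ⟨fun I => (z (hi.const_mul hM (-(1 / 2))) nn).congr fun i x _ => ?_,
    fun I => nv.add hM (z hμ vv), fun I => (z hi ((mn I).add hM (z hμ (mv I)))).congr fun i x _ => ?_,
    fun I => (z ((sy_hbar hM).const_mul hM (1 / 2)) vv).congr fun i x _ => ?_,
    fun I => z (sy_hbar hM) (mv I), fun I => hS I, fun I => tS,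
    fun I => ((d1 I).sub hM (lw kN vv)).sub hM ((d5 I).const_mul hM (1 / 3)),
    fun I => (d2 I).sub hM (lw (kT.const_mul hM (1 / 2)) (mv I)),
    fun I => ((d3 I).sub hM (SO.mul hM ((sy_proj hM (I 0) (I 1)).const_mul hM (1 / 2)) (d4 ![])
      (by linarith))).sub hM (lw (kT.const_mul hM (1 / 2)) (hS I)), d5⟩
  · simp only [induced, LinearisedGravity.lapse]; ring
  · simp only [induced, one_div]
  · simp only [induced]; ring

end Induced

/-! ## Initial data constructed from seed data -/

section Constructed

variable {M s : ℝ} {ι : Type*} {t C : ι → ℝ} {m : ℕ} {𝒟 : ι → SeedData} {A : ι → InitialData}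

theorem isAngular_zero (T : SField 0) : IsAngular M T := fun _ _ j => j.elim0

theorem StronglyAF.nonneg {n : ℕ} {c : ℝ} {𝒟 : SeedData} (h : 𝒟.StronglyAF M s n c) : 0 ≤ c := by
  obtain ⟨x⟩ := ext_nonempty M
  exact le_trans (Finset.sum_nonneg fun i _ => Finset.sum_nonneg fun j _ => Real.sqrt_nonneg _)
    (h.Φ₀ x.1 x.2)

theorem idso_constructed (hM : 0 < M) (hsm : ∀ i, (𝒟 i).IsSmooth M)
    (haf : ∀ i, (𝒟 i).StronglyAF M s (m + 5) (C i)) (hA : ∀ i, IsConstructed M (t i) (𝒟 i) (A i)) :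
    IDSO M C m (3 / 2 + s) fun i => A i - induced M (t i) (kerr M (𝒟 i).mass (𝒟 i).spin) := by
  choose Φ Ψ Z₁ Z₂ h v hΦ hΨ hh hv hA using hA
  have so0 : ∀ {n : ℕ} {q : ℝ} {f : ι → Space → ℝ}, (∀ i, ContDiffOn ℝ ∞ (f i) (ext M)) →
      (∀ i, BoundedBy M n q (C i) (fn (f i))) → SO M C n q f := fun hf hB =>
    so_of_boundedBy hM (T := fun i => fn (_)) (fun i _ => hf i) (fun i => isAngular_zero _) hB ![]
  have so1 : ∀ {n : ℕ} {q : ℝ} {f : ι → SField 1}, (∀ i, SmoothS M (f i)) → (∀ i, IsAngular M (f i)) →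
      (∀ i, BoundedBy M n q (C i) (f i)) → ∀ j, SO M C n q fun i x => f i x ![j] := fun hf ha hB j =>
    so_of_boundedBy hM hf ha hB ![j]
  have e : (3 / 2 + s : ℝ) = 1 / 2 + s + 1 := by ring
  have sΦ : ST M t C 3 m (1 / 2 + s) Φ := ST.reggeWheeler hM hΦ
    (so0 (fun i => (hsm i).Φ₀) fun i => (haf i).Φ₀)
    (by rw [← e]; exact so0 (fun i => (hsm i).Φ₁) fun i => (haf i).Φ₁)
  have sΨ : ST M t C 3 m (1 / 2 + s) Ψ := ST.zerilli hM hΨ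
    (so0 (fun i => (hsm i).Ψ₀) fun i => (haf i).Ψ₀)
    (by rw [← e]; exact so0 (fun i => (hsm i).Ψ₁) fun i => (haf i).Ψ₁)
  have s1 : ∀ a b, ST M t C 1 m (3 / 2 + s) fun i p => h i p ![a, b] := fun a b => by
    rw [e]
    exact st_rwMetric hM hh sΦ (fun i => (hΦ i).vanishing) sΨ (fun i => (hΨ i).zeta₁) a b
  have sv : ∀ a, ST M t C 2 m (1 / 2 + s) fun i p => v i p ![a] := fun a => by
    have l1 : m + 2 ≤ m + 5 + 1 := by omega
    have l2 : m + 1 ≤ m + 5 := by omega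
    refine st_gaugeGenerator hM hv ((so0 (fun i => (hsm i).vn) fun i => (haf i).vn).mono l1)
      ((so0 (fun i => (hsm i).vν) fun i => (haf i).vν).mono l1)
      (fun j => (so1 (fun i => (hsm i).vS) (fun i => (hsm i).vS_angular) (fun i => (haf i).vS) j).mono l1)
      ?_ ?_ (fun j => ?_) a <;> rw [← e]
    · exact (so0 (fun i => (hsm i).wn) fun i => (haf i).wn).mono l2
    · exact (so0 (fun i => (hsm i).wν) fun i => (haf i).wν).mono l2
    · exact (so1 (fun i => (hsm i).wS) (fun i => (hsm i).wS_angular) (fun i => (haf i).wS) j).mono l2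
  have s3 : ∀ a b, ST M t C 1 m (3 / 2 + s) fun i p => lieMetric M (t i) (v i) p ![a, b] := fun a b => by
    rw [e]
    exact ST.lieMetric hM (fun I => by
      rw [show I = ![I 0] from by funext j; fin_cases j; rfl]; exact sv _) a b
  refine ((idso_induced hM s1).add hM (idso_induced hM s3)).congr fun i x hx => ?_
  obtain ⟨a1, a2, a3, a4, a5, a6, a7, a8, a9, a10, a11⟩ := hA i x hx
  have key : ∀ {α : Type} {a b c d : α → ℝ}, a = b + c + d → a - c = b + d := fun h => by rw [h]; abel
  exact ⟨key a1, key a2, key a3, key a4, key a5, key a6, key a7, key a8, key a9, key a10, key a11⟩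

end Constructed

end LinearisedGravity

end

noncomputable section

set_option linter.unusedSimpArgs false

namespace LinearisedGravity

open MeasureTheory

/-! ## The linearised Kerr solution: derivatives of its components -/

section KerrComponents

variable {M : ℝ} (hM : 0 < M) {t : ℝ} {p : Spacetime} (spin : Fin 3 → ℝ)

/-- The projection to the spheres with spacetime indices. -/
def proj4 (p : Spacetime) (a b : Fin 4) : ℝ :=
  (Fin.cons 0 (fun i => (Fin.cons 0 (proj p.2 i) : Fin 4 → ℝ) b) : Fin 4 → ℝ) a

/-- The vector `-∂_t + ∂_r`, which is `ell` with raised index. -/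
def ellUp (p : Spacetime) : Fin 4 → ℝ := Fin.cons (-1) (xhat p.2)

/-- The antisymmetric matrix associated with the axis of rotation. -/
def spinMat : Fin 4 → Fin 4 → ℝ :=
  ![![0, 0, 0, 0], ![0, 0, spin 2, -spin 1], ![0, -spin 2, 0, spin 0], ![0, spin 1, -spin 0, 0]]

theorem mu_eq (x : Space) : mu M x = 2 * M * ‖x‖⁻¹ := div_eq_mul_inv _ _

include hM

theorem ds_xhat (i j : Fin 3) {x : Space} (hx : x ∈ ext M) :
    ds M i (fun y => xhat y j) x = ‖x‖⁻¹ * proj x i j := by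
  have h : ds M i (fun y => xhat y j) x = (dS hM i (yS hM j)).1 ⟨x, hx⟩ := by
    have := dS_mk_apply hM (sy_xhat hM j).smooth i ⟨x, hx⟩
    rw [← this]
    congr 2
  rw [h, ← Sm.ev_apply]
  simp only [yS, Derivation.leibniz, smul_eq_mul, dS_XS, dS_qS, map_add, map_mul, map_neg]
  have e : ∀ k, Sm.ev (⟨x, hx⟩ : ext M) (XS M k) = x k := fun k => rfl
  have e2 : Sm.ev (⟨x, hx⟩ : ext M) (qS hM) = ‖x‖⁻¹ := rfl
  rw [e, e, e2, proj, xhat, xhat]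
  split_ifs <;> simp only [map_one, map_zero] <;> ring

theorem pd_static_xhat (b : Fin 4) (j : Fin 3) (hp : p ∈ future M t) :
    pd M t b (fun q => xhat q.2 j) p = ‖p.2‖⁻¹ * proj4 p b j.succ := by
  refine Fin.cases ?_ (fun i => ?_) b
  · rw [pd_zero_static hM (sy_xhat hM j).smooth hp]; simp [proj4]
  · rw [pd_succ_static hM (sy_xhat hM j).smooth hp, ds_xhat hM i j hp.2]; simp [proj4]

theorem pd_ell (b c : Fin 4) (hp : p ∈ future M t) :
    pd M t b (fun q => ell q c) p = ‖p.2‖⁻¹ * proj4 p b c := by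
  refine Fin.cases ?_ (fun j => pd_static_xhat hM b j hp) c
  have : proj4 p b 0 = 0 := by refine Fin.cases ?_ (fun i => ?_) b <;> simp [proj4]
  rw [this, mul_zero]; exact pd_const 1 b p

theorem pd_drCov (b c : Fin 4) (hp : p ∈ future M t) :
    pd M t b (fun q => drCov q c) p = ‖p.2‖⁻¹ * proj4 p b c := by
  refine Fin.cases ?_ (fun j => pd_static_xhat hM b j hp) c
  have : proj4 p b 0 = 0 := by refine Fin.cases ?_ (fun i => ?_) b <;> simp [proj4]
  rw [this, mul_zero]; exact pd_const 0 b p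

theorem pd_norm_inv (b : Fin 4) (hp : p ∈ future M t) :
    pd M t b (fun q => ‖q.2‖⁻¹) p = -(‖p.2‖⁻¹ * ‖p.2‖⁻¹ * drCov p b) := by
  have hs := (sy_norm_inv hM).smooth
  refine Fin.cases ?_ (fun i => ?_) b
  · rw [pd_zero_static hM hs hp]; simp [drCov]
  · rw [pd_succ_static hM hs hp]
    have := dS_mk_apply hM (contDiffOn_norm_inv hM) i ⟨p.2, hp.2⟩
    rw [← this, show Sm.mk _ _ = qS hM from rfl, dS_qS, ← Sm.ev_apply]
    simp only [map_neg, map_mul]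
    have e : ∀ k, Sm.ev (⟨p.2, hp.2⟩ : ext M) (XS M k) = p.2 k := fun k => rfl
    have e2 : Sm.ev (⟨p.2, hp.2⟩ : ext M) (qS hM) = ‖p.2‖⁻¹ := rfl
    rw [e, e2]; simp only [drCov, Fin.cons_succ, xhat]; ring

omit hM in
theorem smooth_static {g : Space → ℝ} {r : ℝ} (hg : Sy M r g) :
    ContDiffOn ℝ ∞ (fun p : Spacetime => g p.2) (future M t) := contDiffOn_static hg.smooth

theorem sy_drCov (a : Fin 4) : Sy M 0 fun x => drCov (0, x) a := by
  refine Fin.cases (sy_const hM 0) (fun j => ?_) a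
  exact sy_xhat hM j

omit hM in
theorem kerrCov_eq (p : Spacetime) (a : Fin 4) :
    kerrCov M p a = 2 * M * ‖p.2‖⁻¹ * ell p a + drCov p a := by
  rw [← mu_eq]
  refine Fin.cases ?_ (fun i => ?_) a <;> simp [kerrCov, ell, drCov]; ring

theorem sy_kerrCov (a : Fin 4) : Sy M 0 fun x => kerrCov M (0, x) a := by
  simp only [kerrCov_eq]
  exact ((((sy_norm_inv hM).const_mul hM (2 * M)).mul hM (sy_ell hM a) (by norm_num : (0 : ℝ) ≤ 1 + 0))).add hM
    (sy_drCov hM a)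

theorem pd_kerrCov (b c : Fin 4) (hp : p ∈ future M t) :
    pd M t b (fun q => kerrCov M q c) p = ‖p.2‖⁻¹ * (1 + mu M p.2) * proj4 p b c
      - mu M p.2 * ‖p.2‖⁻¹ * (drCov p b * ell p c) := by
  simp only [kerrCov_eq, mu_eq]
  have h1 := smooth_static (t := t) (sy_norm_inv hM)
  have h2 : ContDiffOn ℝ ∞ (fun q => ell q c) (future M t) := smooth_static (sy_ell hM c)
  have h3 : ContDiffOn ℝ ∞ (fun q => drCov q c) (future M t) := smooth_static (sy_drCov hM c)
  have h4 : ContDiffOn ℝ ∞ (fun q : Spacetime => 2 * M * ‖q.2‖⁻¹) (future M t) := contDiffOn_const.mul h1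
  rw [pd_add hM (h4.mul h2) h3 b hp, pd_mul hM h4 h2 b hp, pd_const_mul hM _ h1 b hp, pd_norm_inv hM b hp,
    pd_ell hM b c hp, pd_drCov hM b c hp]
  ring

/-- The function `spin · x̂`. -/
def spinS : Sm (ext M) := ∑ j, algebraMap ℝ (Sm (ext M)) (spin j) * yS hM j

theorem reps_spinS : Reps (fn fun x => ∑ j, spin j * xhat x j) fun _ => spinS hM spin := fun x I => by
  rw [← Sm.ev_apply]
  simp only [spinS, map_sum, map_mul, AlgHom.commutes]
  rfl

theorem spinCov_succ (hp : p.2 ∈ ext M) (i : Fin 3) :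
    spinCov M spin p i.succ = (qS hM * rot hM i (spinS hM spin)).1 ⟨p.2, hp⟩ := by
  have h1 := reps_D1star hM (e := fun _ _ => 0) (φ := 0) (fun x I => rfl) (reps_spinS hM spin) ⟨p.2, hp⟩ ![i]
  have h0 := reps_grad hM (e := fun _ _ => 0) (φ := 0) (fun x I => rfl) ⟨p.2, hp⟩ ![i]
  rw [D1star, h0] at h1
  rw [show spinCov M spin p i.succ = star (angD M (fn fun x => ∑ j, spin j * xhat x j)) p.2 ![i] from rfl]
  simp only [vec, map_zero, mul_zero, zero_add, Matrix.cons_val_zero] at h1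
  rw [← Sm.ev_apply, map_zero, neg_zero, zero_sub, ← Sm.ev_apply, map_neg] at h1
  exact neg_injective h1

theorem spinCov_eq (hp : p.2 ∈ ext M) (a : Fin 4) :
    spinCov M spin p a = ‖p.2‖⁻¹ * ∑ c, spinMat spin a c * drCov p c := by
  refine Fin.cases ?_ (fun i => ?_) a
  · simp [spinCov, spinMat, Fin.sum_univ_four]
  · rw [spinCov_succ hM spin hp, ← Sm.ev_apply, spinS]
    have hr := rotAlg hM
    have e : ∀ k, Sm.ev (⟨p.2, hp⟩ : ext M) (yS hM k) = xhat p.2 k := fun k => yS_apply' hM k _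
    have e2 : Sm.ev (⟨p.2, hp⟩ : ext M) (qS hM) = ‖p.2‖⁻¹ := rfl
    simp only [Fin.sum_univ_three, map_add, map_mul, Derivation.leibniz, Derivation.map_algebraMap,
      smul_eq_mul, mul_zero, add_zero, AlgHom.commutes, e2, Fin.sum_univ_four]
    have c0 : drCov p 0 = 0 := rfl
    have c1 : drCov p 1 = xhat p.2 0 := rfl
    have c2 : drCov p 2 = xhat p.2 1 := rfl
    have c3 : drCov p 3 = xhat p.2 2 := rfl
    rw [c0, c1, c2, c3]
    fin_cases i <;>
      simp [hr.y00, hr.y01, hr.y02, hr.y10, hr.y11, hr.y12, hr.y20, hr.y21, hr.y22, e, spinMat] <;>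
      ring_nf <;> simp [Algebra.algebraMap_self_apply]

theorem sy_spinCov (a : Fin 4) : Sy M 1 fun x => spinCov M spin (0, x) a :=
  Sy.congr ((sy_norm_inv hM).mul hM (Sy.sum hM Finset.univ fun c _ => (sy_drCov hM c).const_mul hM
    (spinMat spin a c)) (by norm_num : (1 : ℝ) ≤ 1 + 0)) fun x hx => by
      exact spinCov_eq hM spin (p := (0, x)) hx a

theorem pd_spinCov (b c : Fin 4) (hp : p ∈ future M t) :
    pd M t b (fun q => spinCov M spin q c) p = ‖p.2‖⁻¹ * ‖p.2‖⁻¹ * (∑ d, spinMat spin c d * proj4 p b d)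
      - ‖p.2‖⁻¹ * drCov p b * spinCov M spin p c := by
  rw [pd_congr (fun q hq => spinCov_eq hM spin hq.2 c) b hp]
  have h3 : ∀ d, ContDiffOn ℝ ∞ (fun q => drCov q d) (future M t) := fun d => smooth_static (sy_drCov hM d)
  have h4 : ∀ d, ContDiffOn ℝ ∞ (fun q => spinMat spin c d * drCov q d) (future M t) := fun d =>
    contDiffOn_const.mul (h3 d)
  rw [pd_mul hM (smooth_static (sy_norm_inv hM)) (ContDiffOn.sum fun d _ => h4 d) b hp,
    pd_sum hM Finset.univ (fun d _ => h4 d) b hp, pd_norm_inv hM b hp, spinCov_eq hM spin hp.2]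
  have e : ∀ d, pd M t b (fun q => spinMat spin c d * drCov q d) p =
      ‖p.2‖⁻¹ * (spinMat spin c d * proj4 p b d) := fun d => by
    rw [pd_const_mul hM _ (h3 d) b hp, pd_drCov hM b d hp]; ring
  simp only [e, ← Finset.mul_sum]
  ring

end KerrComponents

end LinearisedGravity

end

noncomputable section

set_option linter.unusedSimpArgs false

namespace LinearisedGravity

open MeasureTheory

/-! ## Contractions on the Schwarzschild background -/

section Contractions

variable {M : ℝ} {p : Spacetime} (spin : Fin 3 → ℝ)

theorem ell_val (p : Spacetime) : ell p 0 = 1 ∧ ell p 1 = xhat p.2 0 ∧ ell p 2 = xhat p.2 1 ∧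
    ell p 3 = xhat p.2 2 := ⟨rfl, rfl, rfl, rfl⟩

theorem ellUp_val (p : Spacetime) : ellUp p 0 = -1 ∧ ellUp p 1 = xhat p.2 0 ∧ ellUp p 2 = xhat p.2 1 ∧
    ellUp p 3 = xhat p.2 2 := ⟨rfl, rfl, rfl, rfl⟩

theorem drCov_val (p : Spacetime) : drCov p 0 = 0 ∧ drCov p 1 = xhat p.2 0 ∧ drCov p 2 = xhat p.2 1 ∧
    drCov p 3 = xhat p.2 2 := ⟨rfl, rfl, rfl, rfl⟩

theorem proj4_eq (p : Spacetime) (a b : Fin 4) : proj4 p a b =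
    (if a = b ∧ a ≠ 0 then 1 else 0) - drCov p a * drCov p b := by
  refine Fin.cases ?_ (fun i => ?_) a <;> refine Fin.cases ?_ (fun j => ?_) b <;>
    simp [proj4, drCov, proj, Fin.succ_ne_zero, (Fin.succ_ne_zero _).symm]

theorem proj4_symm (p : Spacetime) (a b : Fin 4) : proj4 p a b = proj4 p b a := by
  rw [proj4_eq, proj4_eq]
  by_cases h : a = b
  · subst h; ring
  · simp [h, Ne.symm h]; ring

theorem sum_eta (a : Fin 4) (f : Fin 4 → ℝ) : ∑ b, eta a b * f b = (if a = 0 then -1 else 1) * f a := by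
  simp only [eta]
  rw [Finset.sum_eq_single a (fun b _ hb => by simp [Ne.symm hb]) (by simp)]
  simp

theorem sum_gInv (p : Spacetime) (a : Fin 4) (f : Fin 4 → ℝ) : ∑ b, gInv M p a b * f b =
    (if a = 0 then -1 else 1) * f a - mu M p.2 * ellUp p a * ∑ b, ellUp p b * f b := by
  rw [← sum_eta, Finset.mul_sum, ← Finset.sum_sub_distrib]
  exact Finset.sum_congr rfl fun b _ => by rw [gInv, ellUp]; ring

theorem spinCov_zero (p : Spacetime) : spinCov M spin p 0 = 0 := rfl

variable (hM : 0 < M) (hp : p.2 ∈ ext M)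
include hM hp

theorem sum_drCov_sq : ∑ b, drCov p b * drCov p b = 1 := by
  obtain ⟨y0, y1, y2, y3⟩ := drCov_val p
  have h := xhat_sq (norm_pos_of_mem_ext hM hp)
  rw [Fin.sum_univ_four, y0, y1, y2, y3]; linear_combination h

theorem sum_ellUp_drCov : ∑ b, ellUp p b * drCov p b = 1 := by
  obtain ⟨y0, y1, y2, y3⟩ := drCov_val p
  obtain ⟨l0, l1, l2, l3⟩ := ellUp_val p
  have h := xhat_sq (norm_pos_of_mem_ext hM hp)
  rw [Fin.sum_univ_four, y0, y1, y2, y3, l0, l1, l2, l3]; linear_combination h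

theorem sum_ellUp_ell : ∑ b, ellUp p b * ell p b = 0 := by
  obtain ⟨y0, y1, y2, y3⟩ := ell_val p
  obtain ⟨l0, l1, l2, l3⟩ := ellUp_val p
  have h := xhat_sq (norm_pos_of_mem_ext hM hp)
  rw [Fin.sum_univ_four, y0, y1, y2, y3, l0, l1, l2, l3]; linear_combination h

theorem sum_drCov_ell : ∑ b, drCov p b * ell p b = 1 := by
  obtain ⟨y0, y1, y2, y3⟩ := ell_val p
  obtain ⟨l0, l1, l2, l3⟩ := drCov_val p
  have h := xhat_sq (norm_pos_of_mem_ext hM hp)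
  rw [Fin.sum_univ_four, y0, y1, y2, y3, l0, l1, l2, l3]; linear_combination h

theorem sum_drCov_spinCov : ∑ b, drCov p b * spinCov M spin p b = 0 := by
  simp only [spinCov_eq hM spin hp, Fin.sum_univ_four, spinMat]
  simp
  ring

theorem sum_ellUp_spinCov : ∑ b, ellUp p b * spinCov M spin p b = 0 := by
  rw [← sum_drCov_spinCov spin hM hp, Fin.sum_univ_succ, Fin.sum_univ_succ (f := fun b => drCov p b * _),
    spinCov_zero]
  simp [ellUp, drCov]

theorem sum_proj4_drCov (a : Fin 4) : ∑ b, proj4 p a b * drCov p b = 0 := by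
  have h := sum_drCov_sq hM hp
  have h2 : ∑ b, (if a = b ∧ a ≠ 0 then (1 : ℝ) else 0) * drCov p b = drCov p a := by
    rw [Finset.sum_eq_single a (fun b _ hb => by simp [Ne.symm hb]) (by simp)]
    by_cases ha : a = 0
    · subst ha; simp [drCov]
    · simp [ha]
  simp only [proj4_eq, sub_mul, Finset.sum_sub_distrib, h2, mul_assoc, ← Finset.mul_sum, h]
  ring

omit hM hp in
theorem sum_proj4_of_succ {f g : Fin 4 → ℝ} (hfg : ∀ j : Fin 3, f j.succ = g j.succ) (a : Fin 4) :
    ∑ b, proj4 p a b * f b = ∑ b, proj4 p a b * g b := by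
  have : proj4 p a 0 = 0 := by rw [proj4_eq]; simp [drCov]
  rw [Fin.sum_univ_succ, Fin.sum_univ_succ (f := fun b => proj4 p a b * g b), this]
  simp only [hfg, zero_mul]

theorem sum_proj4_ellUp (a : Fin 4) : ∑ b, proj4 p a b * ellUp p b = 0 := by
  rw [← sum_proj4_drCov hM hp a]
  exact sum_proj4_of_succ (f := ellUp p) (g := drCov p) (fun j => rfl) a

theorem sum_proj4_spinCov (a : Fin 4) : ∑ b, proj4 p a b * spinCov M spin p b = spinCov M spin p a := by
  have h := sum_drCov_spinCov spin hM hp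
  have h2 : ∑ b, (if a = b ∧ a ≠ 0 then (1 : ℝ) else 0) * spinCov M spin p b = spinCov M spin p a := by
    rw [Finset.sum_eq_single a (fun b _ hb => by simp [Ne.symm hb]) (by simp)]
    by_cases ha : a = 0
    · subst ha; simp [spinCov_zero]
    · simp [ha]
  simp only [proj4_eq, sub_mul, Finset.sum_sub_distrib, h2, mul_assoc, ← Finset.mul_sum, h]
  ring

theorem raise_ell (a : Fin 4) : ∑ b, gInv M p a b * ell p b = ellUp p a := by
  rw [sum_gInv, sum_ellUp_ell hM hp]
  refine Fin.cases ?_ (fun i => ?_) a <;> simp [ell, ellUp]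

theorem raise_drCov (a : Fin 4) : ∑ b, gInv M p a b * drCov p b = drCov p a - mu M p.2 * ellUp p a := by
  rw [sum_gInv, sum_ellUp_drCov hM hp]
  refine Fin.cases ?_ (fun i => ?_) a <;> simp [drCov, ellUp]

theorem raise_spinCov (a : Fin 4) : ∑ b, gInv M p a b * spinCov M spin p b = spinCov M spin p a := by
  rw [sum_gInv, sum_ellUp_spinCov spin hM hp]
  by_cases ha : a = 0
  · subst ha; simp [spinCov_zero]
  · simp [ha]

theorem raise_kerrCov (a : Fin 4) : ∑ b, gInv M p a b * kerrCov M p b = drCov p a := by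
  have h1 := raise_ell hM hp a
  have h2 := raise_drCov hM hp a
  simp only [kerrCov_eq, ← mu_eq, mul_add, Finset.sum_add_distrib, h2]
  simp only [mul_left_comm _ (mu M p.2), ← Finset.mul_sum, h1]
  ring

omit hM hp in
theorem contract_mul {g gu : Fin 4 → ℝ} (hg : ∀ a, ∑ b, gInv M p a b * g b = gu a) (f : Fin 4 → ℝ) :
    ∑ b, ∑ c, gInv M p b c * (f b * g c) = ∑ b, f b * gu b := by
  refine Finset.sum_congr rfl fun b _ => ?_
  rw [← hg, Finset.mul_sum]
  exact Finset.sum_congr rfl fun c _ => by ring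

theorem contract_proj4 : ∑ b, ∑ c, gInv M p b c * proj4 p b c = 2 := by
  have h : ∀ b, ∑ c, ellUp p c * proj4 p b c = 0 := fun b => by
    rw [← sum_proj4_ellUp hM hp b]; exact Finset.sum_congr rfl fun c _ => mul_comm _ _
  simp only [sum_gInv, h, mul_zero, sub_zero]
  simp only [Fin.sum_univ_four, proj4_eq]
  obtain ⟨y0, y1, y2, y3⟩ := drCov_val p
  have h := xhat_sq (norm_pos_of_mem_ext hM hp)
  simp [y0, y1, y2, y3]
  linear_combination -h

theorem contract_spinMat : ∑ b, ∑ c, gInv M p b c * (∑ d, spinMat spin c d * proj4 p b d) = 0 := by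
  have h : ∑ b, ellUp p b * (∑ c, ellUp p c * ∑ d, spinMat spin c d * proj4 p b d) = 0 := by
    have e : ∀ b, ellUp p b * (∑ c, ellUp p c * ∑ d, spinMat spin c d * proj4 p b d) =
        ∑ c, ∑ d, ellUp p c * spinMat spin c d * (proj4 p d b * ellUp p b) := fun b => by
      simp only [Finset.mul_sum]
      exact Finset.sum_congr rfl fun c _ => Finset.sum_congr rfl fun d _ => by
        rw [proj4_symm p b d]; ring
    simp only [e]
    rw [Finset.sum_comm]
    refine Finset.sum_eq_zero fun c _ => ?_
    rw [Finset.sum_comm]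
    refine Finset.sum_eq_zero fun d _ => ?_
    rw [← Finset.mul_sum, sum_proj4_ellUp hM hp, mul_zero]
  simp only [sum_gInv, Finset.sum_sub_distrib]
  simp only [mul_assoc, ← Finset.mul_sum, h, mul_zero, sub_zero]
  simp only [Fin.sum_univ_four, proj4_eq, spinMat]
  obtain ⟨y0, y1, y2, y3⟩ := drCov_val p
  simp [y0, y1, y2, y3]
  ring

end Contractions

section Christoffel

variable {M : ℝ} (hM : 0 < M) {t : ℝ} {p : Spacetime}
include hM

theorem pd_gM_eq (a b d : Fin 4) (hp : p ∈ future M t) : pd M t a (fun q => gM M q b d) p =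
    mu M p.2 * ‖p.2‖⁻¹ * (-(drCov p a * (ell p b * ell p d)) + proj4 p a b * ell p d + ell p b * proj4 p a d) := by
  have h2 : ∀ c, ContDiffOn ℝ ∞ (fun q => ell q c) (future M t) := fun c => smooth_static (sy_ell hM c)
  have h1 : ContDiffOn ℝ ∞ (fun q : Spacetime => 2 * M * ‖q.2‖⁻¹) (future M t) :=
    contDiffOn_const.mul (smooth_static (sy_norm_inv hM))
  simp only [gM, mu_eq]
  rw [pd_add hM contDiffOn_const (h1.mul ((h2 b).mul (h2 d))) a hp, pd_const,
    pd_mul hM h1 ((h2 b).mul (h2 d)) a hp, pd_mul hM (h2 b) (h2 d) a hp,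
    pd_const_mul hM _ (smooth_static (sy_norm_inv hM)) a hp, pd_norm_inv hM a hp, pd_ell hM a b hp, pd_ell hM a d hp]
  ring

/-- The Christoffel symbols of the Schwarzschild metric in Kerr--Schild form. -/
theorem Gam_kerrSchild (c a b : Fin 4) (hp : p ∈ future M t) : Gam M t p c a b =
    1 / 2 * (mu M p.2 * ‖p.2‖⁻¹) * (2 * proj4 p a b - drCov p a * ell p b - drCov p b * ell p a
      - mu M p.2 * (ell p a * ell p b)) * ellUp p c
      + 1 / 2 * (mu M p.2 * ‖p.2‖⁻¹) * (ell p a * ell p b) * drCov p c := by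
  have e : ∀ d, gInv M p c d * (pd M t a (fun q => gM M q b d) p + pd M t b (fun q => gM M q a d) p
      - pd M t d (fun q => gM M q a b) p) = mu M p.2 * ‖p.2‖⁻¹ *
        (2 * proj4 p a b - drCov p a * ell p b - drCov p b * ell p a) * (gInv M p c d * ell p d) +
        mu M p.2 * ‖p.2‖⁻¹ * (ell p a * ell p b) * (gInv M p c d * drCov p d) := fun d => by
    rw [pd_gM_eq hM a b d hp, pd_gM_eq hM b a d hp, pd_gM_eq hM d a b hp, proj4_symm p b a,
      proj4_symm p d a, proj4_symm p d b]
    ring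
  simp only [Gam, e, Finset.sum_add_distrib, ← Finset.mul_sum, raise_ell hM hp.2, raise_drCov hM hp.2]
  ring

end Christoffel

end LinearisedGravity

end

noncomputable section

set_option linter.unusedSimpArgs false

namespace LinearisedGravity

open MeasureTheory

/-! ## The linearised Kerr solution satisfies the gauge condition -/

section KerrGauge

variable {M mass : ℝ} {spin : Fin 3 → ℝ} {t : ℝ} {p : Spacetime}

theorem covD_two_apply (X : TField 2) (a b c : Fin 4) : covD M t X p ![a, b, c] =
    pd M t a (fun q => X q ![b, c]) p - ∑ d, Gam M t p d a b * X p ![d, c]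
      - ∑ d, Gam M t p d a c * X p ![b, d] := by
  have h0 : ∀ d, Function.update (Fin.tail ![a, b, c]) 0 d = ![d, c] := fun d => by
    funext j; fin_cases j <;> rfl
  have h1 : ∀ d, Function.update (Fin.tail ![a, b, c]) 1 d = ![b, d] := fun d => by
    funext j; fin_cases j <;> rfl
  simp only [covD, Fin.sum_univ_two, h0, h1, sub_sub]
  rfl

theorem kerr_apply (q : Spacetime) (a b : Fin 4) : kerr M mass spin q ![a, b] =
    2 * mass * ‖q.2‖⁻¹ * (ell q a * ell q b)
      + (kerrCov M q a * spinCov M spin q b + spinCov M spin q a * kerrCov M q b) := by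
  rw [kerr, div_eq_mul_inv]; rfl

theorem kerr_symm : SymmT M t (kerr M mass spin) := fun q _ a b => by
  rw [kerr_apply, kerr_apply]; ring

variable (hM : 0 < M)
include hM

theorem kerr_sy (a b : Fin 4) : Sy M 1 fun x => kerr M mass spin (0, x) ![a, b] := by
  simp only [kerr_apply]
  exact (((sy_norm_inv hM).const_mul hM (2 * mass)).mul hM ((sy_ell hM a).mul hM (sy_ell hM b)
    (by norm_num : (0 : ℝ) ≤ 0 + 0)) (by norm_num : (1 : ℝ) ≤ 1 + 0)).add hM
    (((sy_kerrCov hM a).mul hM (sy_spinCov hM spin b) (by norm_num : (1 : ℝ) ≤ 0 + 1)).add hM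
      ((sy_spinCov hM spin a).mul hM (sy_kerrCov hM b) (by norm_num : (1 : ℝ) ≤ 1 + 0)))

theorem kerr_smooth : SmoothT M t (kerr M mass spin) := fun I => by
  rw [vec_two I]; exact smooth_static (kerr_sy hM _ _)

theorem pd_kerr (b c a : Fin 4) (hp : p ∈ future M t) :
    pd M t b (fun q => kerr M mass spin q ![c, a]) p =
      2 * mass * (-(‖p.2‖⁻¹ * ‖p.2‖⁻¹ * drCov p b) * (ell p c * ell p a) +
        ‖p.2‖⁻¹ * (ell p c * (‖p.2‖⁻¹ * proj4 p b a) + ell p a * (‖p.2‖⁻¹ * proj4 p b c)))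
      + (kerrCov M p c * (pd M t b (fun q => spinCov M spin q a) p)
        + spinCov M spin p a * (pd M t b (fun q => kerrCov M q c) p)
        + (spinCov M spin p c * (pd M t b (fun q => kerrCov M q a) p)
        + kerrCov M p a * (pd M t b (fun q => spinCov M spin q c) p))) := by
  have hl : ∀ c, ContDiffOn ℝ ∞ (fun q => ell q c) (future M t) := fun c => smooth_static (sy_ell hM c)
  have hk : ∀ c, ContDiffOn ℝ ∞ (fun q => kerrCov M q c) (future M t) := fun c => smooth_static (sy_kerrCov hM c)
  have hs : ∀ c, ContDiffOn ℝ ∞ (fun q => spinCov M spin q c) (future M t) := fun c =>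
    smooth_static (sy_spinCov hM spin c)
  have hq := smooth_static (t := t) (sy_norm_inv hM)
  have hq2 : ContDiffOn ℝ ∞ (fun q : Spacetime => 2 * mass * ‖q.2‖⁻¹) (future M t) := contDiffOn_const.mul hq
  simp only [kerr_apply]
  rw [pd_add hM (hq2.mul ((hl c).mul (hl a))) (((hk c).mul (hs a)).add ((hs c).mul (hk a))) b hp,
    pd_mul hM hq2 ((hl c).mul (hl a)) b hp, pd_mul hM (hl c) (hl a) b hp, pd_const_mul hM _ hq b hp,
    pd_norm_inv hM b hp, pd_ell hM b c hp, pd_ell hM b a hp,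
    pd_add hM ((hk c).mul (hs a)) ((hs c).mul (hk a)) b hp,
    pd_mul hM (hk c) (hs a) b hp, pd_mul hM (hs c) (hk a) b hp]
  ring

omit hM in
theorem sum_mul_kerrCov (f : Fin 4 → ℝ) : ∑ d, f d * kerrCov M p d =
    mu M p.2 * (∑ d, f d * ell p d) + ∑ d, f d * drCov p d := by
  rw [Finset.mul_sum, ← Finset.sum_add_distrib]
  exact Finset.sum_congr rfl fun d _ => by rw [kerrCov_eq, mu_eq]; ring

omit hM in
theorem sum_mul_kerr (f : Fin 4 → ℝ) (a : Fin 4) : ∑ d, f d * kerr M mass spin p ![d, a] =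
    2 * mass * ‖p.2‖⁻¹ * ell p a * (∑ d, f d * ell p d)
      + (spinCov M spin p a * (∑ d, f d * kerrCov M p d) + kerrCov M p a * (∑ d, f d * spinCov M spin p d)) := by
  simp only [Finset.mul_sum, ← Finset.sum_add_distrib]
  exact Finset.sum_congr rfl fun d _ => by rw [kerr_apply]; ring

variable (hp : p ∈ future M t)
include hp

theorem sum_ellUp_kerr (a : Fin 4) : ∑ d, ellUp p d * kerr M mass spin p ![d, a] = spinCov M spin p a := by
  rw [sum_mul_kerr, sum_mul_kerrCov, sum_ellUp_ell hM hp.2, sum_ellUp_drCov hM hp.2,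
    sum_ellUp_spinCov spin hM hp.2]
  ring

theorem sum_drCov_kerr (a : Fin 4) : ∑ d, drCov p d * kerr M mass spin p ![d, a] =
    2 * mass * ‖p.2‖⁻¹ * ell p a + (1 + mu M p.2) * spinCov M spin p a := by
  rw [sum_mul_kerr, sum_mul_kerrCov, sum_drCov_ell hM hp.2, sum_drCov_sq hM hp.2,
    sum_drCov_spinCov spin hM hp.2]
  ring

theorem sum_Gam_kerr (b c a : Fin 4) : ∑ d, Gam M t p d b c * kerr M mass spin p ![d, a] =
    1 / 2 * (mu M p.2 * ‖p.2‖⁻¹) * (2 * proj4 p b c - drCov p b * ell p c - drCov p c * ell p b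
      - mu M p.2 * (ell p b * ell p c)) * spinCov M spin p a
      + 1 / 2 * (mu M p.2 * ‖p.2‖⁻¹) * (ell p b * ell p c) *
        (2 * mass * ‖p.2‖⁻¹ * ell p a + (1 + mu M p.2) * spinCov M spin p a) := by
  have h1 := sum_ellUp_kerr (mass := mass) (spin := spin) hM hp a
  have h2 := sum_drCov_kerr (mass := mass) (spin := spin) hM hp a
  rw [← h2]
  conv_rhs => arg 1; rw [← h1]
  rw [Finset.mul_sum, Finset.mul_sum, ← Finset.sum_add_distrib]
  exact Finset.sum_congr rfl fun d _ => by rw [Gam_kerrSchild hM d b c hp]; ring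

theorem div_kerr (a : Fin 4) : ∑ b, ∑ c, gInv M p b c * covD M t (kerr M mass spin) p ![b, c, a] =
    2 * mass * (‖p.2‖⁻¹ * ‖p.2‖⁻¹) * ell p a + 2 * ‖p.2‖⁻¹ * spinCov M spin p a := by
  have hx := hp.2
  set r := ‖p.2‖⁻¹ with hr
  set μ := mu M p.2 with hμ
  set W : Fin 4 → Fin 4 → ℝ := fun b c => ∑ d, spinMat spin c d * proj4 p b d with hW
  have rl := raise_ell hM hx
  have rs := raise_spinCov spin hM hx
  have rk := raise_kerrCov hM hx
  have sy : ∀ (f : Fin 4 → ℝ) c, ∑ b, proj4 p b c * f b = ∑ b, proj4 p c b * f b := fun f c =>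
    Finset.sum_congr rfl fun b _ => by rw [proj4_symm]
  have t1 := (contract_mul rl (drCov p)).trans
    ((Finset.sum_congr rfl fun b _ => mul_comm _ _).trans (sum_ellUp_drCov hM hx))
  have t2 := contract_proj4 hM hx
  have t3 := (contract_mul rl fun b => proj4 p b a).trans ((sy _ a).trans (sum_proj4_ellUp hM hx a))
  have t4 : ∑ b, ∑ c, gInv M p b c * (W b a * kerrCov M p c) = 0 := by
    rw [contract_mul rk fun b => W b a]
    simp only [hW, Finset.sum_mul]
    rw [Finset.sum_comm]
    refine Finset.sum_eq_zero fun d _ => ?_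
    simp only [mul_assoc, ← Finset.mul_sum, sy, sum_proj4_drCov hM hx, mul_zero]
  have t5 := (contract_mul rk (drCov p)).trans (sum_drCov_sq hM hx)
  have t6 : ∑ b, ∑ c, gInv M p b c * W b c = 0 := contract_spinMat spin hM hx
  have t7 := (contract_mul rs (drCov p)).trans (sum_drCov_spinCov spin hM hx)
  have t8 := (contract_mul rs fun b => proj4 p b a).trans ((sy _ a).trans (sum_proj4_spinCov spin hM hx a))
  have t9 : ∑ b, ∑ c, gInv M p b c * (ell p b * drCov p c) = 1 := by
    rw [contract_mul (raise_drCov hM hx)]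
    have e : ∀ b, ell p b * (drCov p b - mu M p.2 * ellUp p b) =
        drCov p b * ell p b - mu M p.2 * (ellUp p b * ell p b) := fun b => by ring
    simp only [e, Finset.sum_sub_distrib, ← Finset.mul_sum, sum_drCov_ell hM hx, sum_ellUp_ell hM hx]
    ring
  have t10 := (contract_mul rl (ell p)).trans
    ((Finset.sum_congr rfl fun b _ => mul_comm _ _).trans (sum_ellUp_ell hM hx))
  have t11 : ∑ b, ∑ c, gInv M p b c * (ell p b * spinCov M spin p c) = 0 := by
    rw [contract_mul rs, ← sum_drCov_spinCov spin hM hx, Fin.sum_univ_succ,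
      Fin.sum_univ_succ (f := fun b => drCov p b * _), spinCov_zero]
    simp [ell, drCov]
  have e : ∀ b c, gInv M p b c * covD M t (kerr M mass spin) p ![b, c, a] =
      (-(2 * mass * (r * r) * ell p a) - 1 / 2 * μ * r * spinCov M spin p a) * (gInv M p b c * (drCov p b * ell p c))
      + (2 * mass * (r * r) * ell p a + r * spinCov M spin p a) * (gInv M p b c * proj4 p b c)
      + (2 * mass * (r * r)) * (gInv M p b c * (proj4 p b a * ell p c))
      + r * r * (gInv M p b c * (W b a * kerrCov M p c))
      + (-(r * spinCov M spin p a)) * (gInv M p b c * (drCov p b * kerrCov M p c))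
      + r * r * kerrCov M p a * (gInv M p b c * W b c)
      + (-(r * kerrCov M p a) - 1 / 2 * μ * r * ell p a) * (gInv M p b c * (drCov p b * spinCov M spin p c))
      + r * (gInv M p b c * (proj4 p b a * spinCov M spin p c))
      + 1 / 2 * μ * r * spinCov M spin p a * (gInv M p b c * (ell p b * drCov p c))
      + (1 / 2 * μ * r * (μ * spinCov M spin p a - (2 * mass * r * ell p a + (1 + μ) * spinCov M spin p a)
          - 2 * mass * r * ell p a)) * (gInv M p b c * (ell p b * ell p c))
      + (1 / 2 * μ * r * (drCov p a - ell p a)) * (gInv M p b c * (ell p b * spinCov M spin p c)) :=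
    fun b c => by
      have s1 : ∑ d, Gam M t p d b a * kerr M mass spin p ![c, d] =
          ∑ d, Gam M t p d b a * kerr M mass spin p ![d, c] :=
        Finset.sum_congr rfl fun d _ => by rw [kerr_symm p hp c d]
      rw [covD_two_apply, s1, sum_Gam_kerr hM hp, sum_Gam_kerr hM hp, pd_kerr hM b c a hp,
        pd_spinCov hM spin b a hp, pd_spinCov hM spin b c hp, pd_kerrCov hM b c hp, pd_kerrCov hM b a hp]
      ring
  simp only [e, Finset.sum_add_distrib, ← Finset.mul_sum]
  rw [t1, t2, t3, t4, t5, t6, t7, t8, t9, t10, t11]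
  ring

end KerrGauge

end LinearisedGravity

end

noncomputable section

set_option linter.unusedSimpArgs false

namespace LinearisedGravity

open MeasureTheory

/-! ## The parts of the linearised Kerr solution -/

section KerrParts

variable {M mass : ℝ} {spin : Fin 3 → ℝ} {t : ℝ} {p : Spacetime}

theorem nVec_eq (hM : 0 < M) (hp : p.2 ∈ ext M) (a : Fin 4) :
    nVec M p a = -hbar M p.2 * ellUp p a + 1 / hbar M p.2 * drCov p a := by
  have h := hbar_sq hM hp
  have h0 := (hbar_pos hM hp).ne'
  refine Fin.cases ?_ (fun i => ?_) a
  · simp [nVec, ellUp, drCov]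
  · simp only [nVec, ellUp, drCov, Fin.cons_succ]
    field_simp
    rw [h]; ring

theorem nuVec_eq (a : Fin 4) : nuVec M p a = 1 / hbar M p.2 * drCov p a := by
  refine Fin.cases ?_ (fun i => ?_) a <;> simp [nuVec, drCov]

theorem angVec_eq (i : Fin 3) (a : Fin 4) : angVec i p a = proj4 p i.succ a := rfl

theorem PVec_eq (hM : 0 < M) (hp : p.2 ∈ ext M) (a : Fin 4) :
    PVec M p a = drCov p a - mu M p.2 * ellUp p a := raise_drCov hM hp a

theorem sum_proj4_ell (hM : 0 < M) (hp : p.2 ∈ ext M) (a : Fin 4) : ∑ b, proj4 p a b * ell p b = 0 := by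
  rw [← sum_proj4_drCov hM hp a]
  exact sum_proj4_of_succ (f := ell p) (g := drCov p) (fun j => rfl) a

theorem ev2_kerr (u w : Spacetime → Fin 4 → ℝ) : ev2 (kerr M mass spin) u w p =
    2 * mass * ‖p.2‖⁻¹ * ((∑ a, u p a * ell p a) * ∑ b, w p b * ell p b)
      + (∑ a, u p a * kerrCov M p a) * (∑ b, w p b * spinCov M spin p b)
      + (∑ a, u p a * spinCov M spin p a) * ∑ b, w p b * kerrCov M p b := by
  have e : ∀ a b, u p a * w p b * kerr M mass spin p ![a, b] =
      2 * mass * ‖p.2‖⁻¹ * ((u p a * ell p a) * (w p b * ell p b))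
      + (u p a * kerrCov M p a) * (w p b * spinCov M spin p b)
      + (u p a * spinCov M spin p a) * (w p b * kerrCov M p b) := fun a b => by
    rw [kerr_apply]; ring
  simp only [ev2, e, Finset.sum_add_distrib, ← Finset.mul_sum, Finset.sum_mul_sum]

variable (hM : 0 < M) (hp : p.2 ∈ ext M)
include hM hp

theorem sum_nVec (f : Fin 4 → ℝ) : ∑ a, nVec M p a * f a =
    -hbar M p.2 * (∑ a, ellUp p a * f a) + 1 / hbar M p.2 * ∑ a, drCov p a * f a := by
  rw [Finset.mul_sum, Finset.mul_sum, ← Finset.sum_add_distrib]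
  exact Finset.sum_congr rfl fun a _ => by rw [nVec_eq hM hp]; ring

omit hM hp in
theorem sum_nuVec (f : Fin 4 → ℝ) : ∑ a, nuVec M p a * f a = 1 / hbar M p.2 * ∑ a, drCov p a * f a := by
  rw [Finset.mul_sum]
  exact Finset.sum_congr rfl fun a _ => by rw [nuVec_eq]; ring

theorem sum_PVec (f : Fin 4 → ℝ) : ∑ a, PVec M p a * f a =
    (∑ a, drCov p a * f a) - mu M p.2 * ∑ a, ellUp p a * f a := by
  rw [Finset.mul_sum, ← Finset.sum_sub_distrib]
  exact Finset.sum_congr rfl fun a _ => by rw [PVec_eq hM hp]; ring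

theorem kerr_pairings :
    (∑ a, nVec M p a * ell p a = 1 / hbar M p.2) ∧ (∑ a, nuVec M p a * ell p a = 1 / hbar M p.2) ∧
    (∀ i, ∑ a, angVec i p a * ell p a = 0) ∧ (∑ a, nVec M p a * kerrCov M p a = 0) ∧
    (∑ a, nuVec M p a * kerrCov M p a = hbar M p.2) ∧ (∀ i, ∑ a, angVec i p a * kerrCov M p a = 0) ∧
    (∑ a, nVec M p a * spinCov M spin p a = 0) ∧ (∑ a, nuVec M p a * spinCov M spin p a = 0) ∧
    ∀ i : Fin 3, ∑ a, angVec i p a * spinCov M spin p a = spinCov M spin p i.succ := by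
  have h := hbar_sq hM hp
  have h0 := (hbar_pos hM hp).ne'
  have hk : ∑ a, ellUp p a * kerrCov M p a = 1 := by
    rw [sum_mul_kerrCov, sum_ellUp_ell hM hp, sum_ellUp_drCov hM hp]; ring
  have hk2 : ∑ a, drCov p a * kerrCov M p a = 1 + mu M p.2 := by
    rw [sum_mul_kerrCov, sum_drCov_ell hM hp, sum_drCov_sq hM hp]; ring
  refine ⟨?_, ?_, fun i => ?_, ?_, ?_, fun i => ?_, ?_, ?_, fun i => ?_⟩
  · rw [sum_nVec hM hp, sum_ellUp_ell hM hp, sum_drCov_ell hM hp]; ring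
  · rw [sum_nuVec, sum_drCov_ell hM hp]; ring
  · simp only [angVec_eq, sum_proj4_ell hM hp]
  · rw [sum_nVec hM hp, hk, hk2, ← h]; field_simp; ring
  · rw [sum_nuVec, hk2, ← h]; field_simp
  · rw [sum_mul_kerrCov]; simp only [angVec_eq, sum_proj4_ell hM hp, sum_proj4_drCov hM hp]; ring
  · rw [sum_nVec hM hp, sum_ellUp_spinCov spin hM hp, sum_drCov_spinCov spin hM hp]; ring
  · rw [sum_nuVec, sum_drCov_spinCov spin hM hp]; ring
  · simp only [angVec_eq, sum_proj4_spinCov spin hM hp]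

theorem hatNN_kerr : hatNN M (kerr M mass spin) p =
    2 * mass * ‖p.2‖⁻¹ * (1 / hbar M p.2 * (1 / hbar M p.2)) := by
  obtain ⟨n1, v1, -, -, -, -, n3, v3, -⟩ := kerr_pairings (spin := spin) hM hp
  rw [hatNN, ev2_kerr, ev2_kerr, n1, v1, n3, v3]; ring

theorem hatNV_kerr : hatNV M (kerr M mass spin) p =
    2 * mass * ‖p.2‖⁻¹ * (1 / hbar M p.2 * (1 / hbar M p.2)) := by
  obtain ⟨n1, v1, -, -, -, -, n3, v3, -⟩ := kerr_pairings (spin := spin) hM hp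
  rw [hatNV, ev2_kerr, n1, v1, n3, v3]; ring

theorem trQ_kerr : trQ M (kerr M mass spin) p = 0 := by
  obtain ⟨n1, v1, -, -, -, -, n3, v3, -⟩ := kerr_pairings (spin := spin) hM hp
  rw [trQ, ev2_kerr, ev2_kerr, n1, v1, n3, v3]; ring

theorem ang_kerr (i j : Fin 3) : ev2 (kerr M mass spin) (angVec i) (angVec j) p = 0 := by
  obtain ⟨-, -, a1, -, -, a2, -, -, -⟩ := kerr_pairings (spin := spin) hM hp
  rw [ev2_kerr, a1, a2, a2]; ring

theorem trS_kerr : trS (kerr M mass spin) p = 0 :=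
  Finset.sum_eq_zero fun i _ => ang_kerr hM hp i i

theorem n_ang_kerr (i : Fin 3) : ev2 (kerr M mass spin) (nVec M) (angVec i) p = 0 := by
  obtain ⟨-, -, a1, n2, -, -, n3, -, -⟩ := kerr_pairings (spin := spin) hM hp
  rw [ev2_kerr, a1, n2, n3]; ring

theorem nu_ang_kerr (i : Fin 3) : ev2 (kerr M mass spin) (nuVec M) (angVec i) p =
    hbar M p.2 * spinCov M spin p i.succ := by
  obtain ⟨-, -, a1, -, v2, -, -, v3, a3⟩ := kerr_pairings (spin := spin) hM hp
  rw [ev2_kerr, a1, v2, v3, a3]; ring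

theorem trace4_kerr (I : Fin 0 → Fin 4) : trace4 M (kerr M mass spin) p I = 0 := by
  have e : ∀ a b, gInv M p a b * kerr M mass spin p ![a, b] =
      2 * mass * ‖p.2‖⁻¹ * (gInv M p a b * (ell p a * ell p b))
      + gInv M p a b * (kerrCov M p a * spinCov M spin p b)
      + gInv M p a b * (spinCov M spin p a * kerrCov M p b) := fun a b => by rw [kerr_apply]; ring
  have s := sum_mul_kerrCov (M := M) (p := p) (spinCov M spin p)
  have s2 : ∀ f g : Fin 4 → ℝ, ∑ b, f b * g b = ∑ b, g b * f b := fun f g =>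
    Finset.sum_congr rfl fun b _ => mul_comm _ _
  simp only [trace4, e, Finset.sum_add_distrib, ← Finset.mul_sum]
  rw [contract_mul (raise_ell hM hp) (ell p), contract_mul (raise_spinCov spin hM hp) (kerrCov M p),
    contract_mul (raise_kerrCov hM hp) (spinCov M spin p), s2 (ell p), sum_ellUp_ell hM hp,
    s2 (spinCov M spin p) (drCov p), sum_drCov_spinCov spin hM hp, s2, s,
    s2 (spinCov M spin p) (drCov p), sum_drCov_spinCov spin hM hp]
  rw [Fin.sum_univ_succ, spinCov_zero]
  have := sum_drCov_spinCov spin hM hp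
  rw [Fin.sum_univ_succ, spinCov_zero] at this
  simp only [mul_zero, zero_add, zero_mul, add_zero] at this ⊢
  have e3 : ∑ i : Fin 3, spinCov M spin p i.succ * ell p i.succ = 0 := by
    rw [← this]; exact Finset.sum_congr rfl fun i _ => mul_comm _ _
  rw [e3]; ring

theorem lower_sub (a : Fin 4) : lower M (nVec M) p a - lower M (nuVec M) p a = -hbar M p.2 * ell p a := by
  have e : ∀ b, gM M p a b * nVec M p b - gM M p a b * nuVec M p b =
      -hbar M p.2 * (eta a b * ellUp p b) + -hbar M p.2 * mu M p.2 * ell p a * (ellUp p b * ell p b) := fun b => by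
    rw [nVec_eq hM hp, nuVec_eq, gM]; ring
  simp only [lower, ← Finset.sum_sub_distrib, e, Finset.sum_add_distrib, ← Finset.mul_sum,
    sum_ellUp_ell hM hp, sum_eta]
  refine Fin.cases ?_ (fun i => ?_) a <;> simp [ellUp, ell]

omit hM hp in
theorem sphAvg_eq_of_const {F : Spacetime → ℝ} {c : ℝ}
    (h : ∀ y : Metric.sphere (0 : Space) 1, F (p.1, ‖p.2‖ • y.1) = c) : sphAvg F p = c := by
  rw [sphAvg, sphereInt, integral_congr_ae (Filter.Eventually.of_forall h), integral_const, smul_eq_mul]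
  change 1 / (4 * Real.pi) * (area * c) = c
  rw [area_eq]
  field_simp

theorem hatZero_kerr (a b : Fin 4) : hatZero M (kerr M mass spin) p a b =
    2 * mass * ‖p.2‖⁻¹ * (ell p a * ell p b) := by
  have h0 := (hbar_pos hM hp).ne'
  have hr := norm_pos_of_mem_ext hM hp
  have key : ∀ F : Spacetime → ℝ, (∀ q : Spacetime, q.2 ∈ ext M → F q =
      2 * mass * ‖q.2‖⁻¹ * (1 / hbar M q.2 * (1 / hbar M q.2))) →
      sphAvg F p = 2 * mass * ‖p.2‖⁻¹ * (1 / hbar M p.2 * (1 / hbar M p.2)) := fun F hF => by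
    have e : ∀ y : Metric.sphere (0 : Space) 1, F (p.1, ‖p.2‖ • y.1) = F p := fun y => by
      have hn : ‖‖p.2‖ • y.1‖ = ‖p.2‖ := by rw [norm_smul, norm_norm, mem_sphere_zero_iff_norm.1 y.2, mul_one]
      rw [hF _ (show 2 * M ≤ _ by rw [hn]; exact hp), hF p hp]
      simp only [hn, hbar_radial _ _ hn]
    rw [← hF p hp]; exact sphAvg_eq_of_const e
  rw [hatZero, key _ fun q hq => hatNN_kerr hM hq, key _ fun q hq => hatNV_kerr hM hq]
  have h1 := lower_sub hM hp a
  have h2 := lower_sub hM hp b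
  have : ∀ A x y x' y' : ℝ, A * (x * x' + y * y') - A * (x * y' + y * x') = A * ((x - y) * (x' - y')) :=
    fun A x y x' y' => by ring
  rw [this, h1, h2]
  field_simp

theorem gaugeMap_kerr (a : Fin 4) : gaugeMap M (kerr M mass spin) p ![a] =
    2 * mass * (‖p.2‖⁻¹ * ‖p.2‖⁻¹) * ell p a + 2 * ‖p.2‖⁻¹ * spinCov M spin p a := by
  have hl : ∑ b, PVec M p b * ell p b = 1 := by
    rw [sum_PVec hM hp, sum_drCov_ell hM hp, sum_ellUp_ell hM hp]; ring
  have hs : ∑ b, PVec M p b * spinCov M spin p b = 0 := by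
    rw [sum_PVec hM hp, sum_drCov_spinCov spin hM hp, sum_ellUp_spinCov spin hM hp]; ring
  have hd : ∑ b, PVec M p b * drCov p b = 1 - mu M p.2 := by
    rw [sum_PVec hM hp, sum_drCov_sq hM hp, sum_ellUp_drCov hM hp]; ring
  have e : ∀ b, PVec M p b * (2 * mass * ‖p.2‖⁻¹ * (ell p b * ell p a)) =
      2 * mass * ‖p.2‖⁻¹ * ell p a * (PVec M p b * ell p b) := fun b => by ring
  simp only [gaugeMap, Matrix.cons_val_zero, trS_kerr hM hp, hatZero_kerr hM hp, e, ← Finset.mul_sum]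
  rw [sum_mul_kerr, sum_mul_kerrCov, hl, hs, hd]
  ring

end KerrParts

section KerrSupport

variable {M mass : ℝ} {spin : Fin 3 → ℝ} {t : ℝ} (hM : 0 < M)
include hM

theorem kerr_gauge {p : Spacetime} (hp : p ∈ future M t) (a : Fin 4) :
    (∑ b, ∑ c, gInv M p b c * covD M t (kerr M mass spin) p ![b, c, a])
      - 1 / 2 * covD M t (trace4 M (kerr M mass spin)) p ![a] = gaugeMap M (kerr M mass spin) p ![a] := by
  have h0 : covD M t (trace4 M (kerr M mass spin)) p ![a] = 0 := by
    rw [covD, pd_congr (G := fun _ => 0) (fun q hq => trace4_kerr hM hq.2 _) _ hp, pd_const]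
    simp
  rw [h0, div_kerr hM hp, gaugeMap_kerr hM hp.2]; ring

omit hM in
theorem supportedL01_of_radial {F : Spacetime → ℝ} {g : Space → ℝ} (hg : ∀ x y, ‖x‖ = ‖y‖ → g x = g y)
    (hF : ∀ p : Spacetime, p.2 ∈ ext M → F p = g p.2) (hM : 0 < M) : SupportedL01 M t F := fun s _ R hR => by
  obtain ⟨x, hx⟩ := exists_norm_eq (show 0 < R by linarith)
  refine ⟨g x, 0, fun y hy => ?_⟩
  have hn : ‖R • y‖ = R := by rw [norm_smul, hy, mul_one, Real.norm_of_nonneg (by linarith)]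
  rw [hF (s, R • y) (show 2 * M ≤ ‖R • y‖ by rw [hn]; exact hR)]
  simp only [Pi.zero_apply, zero_mul, Finset.sum_const_zero, add_zero]
  exact hg _ _ (hn.trans hx.symm)

theorem mixedSupported_kerr_nu : MixedSupported M t (kerr M mass spin) (nuVec M) := by
  set oS : Sm (ext M) := -(lapseS hM * (1 + algebraMap ℝ _ (2 * M) * qS hM) * spinS hM spin) with ho
  have hv : ∀ x : ext M, oS.1 x = -(hbar M x.1 * ∑ j, spin j * xhat x.1 j) := fun x => by
    have h1 := hbar_sq hM x.2
    have h4 := (hbar_pos hM x.2).ne'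
    have h2 : (spinS hM spin).1 x = ∑ j, spin j * xhat x.1 j := (reps_spinS hM spin x ![]).symm
    have h3 : (lapseS hM).1 x = (hbar M x.1)⁻¹ := rfl
    have h5 : (qS hM).1 x = ‖x.1‖⁻¹ := rfl
    rw [ho, ← Sm.ev_apply]
    simp only [map_neg, map_mul, map_add, map_one, AlgHom.commutes, Algebra.algebraMap_self_apply]
    rw [Sm.ev_apply, Sm.ev_apply, Sm.ev_apply, h2, h3, h5, ← mu_eq, ← h1]
    field_simp
  have hs := contDiffOn_static (t₀ := t) (Sm.rep_smooth oS)
  refine ⟨fun _ => 0, fun p => Sm.rep oS p.2, contDiffOn_const, hs, fun s _ R _ =>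
    ⟨0, 0, fun y _ => by simp⟩, fun s _ R hR => ?_, fun s hs x hx I => ?_⟩
  · obtain ⟨x, hx⟩ := exists_norm_eq (show 0 < R by linarith)
    refine ⟨0, fun j => -(hbar M x * spin j), fun y hy => ?_⟩
    have hn : ‖R • y‖ = R := by rw [norm_smul, hy, mul_one, Real.norm_of_nonneg (by linarith)]
    have hm : R • y ∈ ext M := show 2 * M ≤ ‖R • y‖ by rw [hn]; exact hR
    have hR0 : R ≠ 0 := by linarith [show 0 < R by linarith]
    change Sm.rep oS (R • y) = _
    rw [show Sm.rep oS (R • y) = oS.1 ⟨R • y, hm⟩ from Sm.rep_apply oS ⟨_, hm⟩, hv,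
      hbar_radial (R • y) x (hn.trans hx.symm), zero_add, Finset.mul_sum, ← Finset.sum_neg_distrib]
    refine Finset.sum_congr rfl fun j _ => ?_
    have : xhat (R • y) j = y j := by
      rw [xhat, hn]; change R * y j / R = _; field_simp
    rw [this]; ring
  · have r := reps_D1star hM (e := fun _ _ => 0) (φ := 0) (ψ := oS) (fun x I => rfl)
      (o := slice (fun p => Sm.rep oS p.2) s) (fun x I => Sm.rep_apply oS x) ⟨x, hx⟩ I
    refine Eq.trans ?_ r.symm
    rw [mixed, nu_ang_kerr hM (p := (s, x)) hx, spinCov_succ hM spin (p := (s, x)) hx]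
    have e : hbar M x = Sm.ev (⟨x, hx⟩ : ext M) (lapseS hM * (1 + algebraMap ℝ _ (2 * M) * qS hM)) := by
      have h1 := hbar_sq hM hx
      have h4 := (hbar_pos hM hx).ne'
      simp only [map_mul, map_add, map_one, AlgHom.commutes, Algebra.algebraMap_self_apply]
      change _ = (hbar M x)⁻¹ * (1 + 2 * M * ‖x‖⁻¹)
      rw [← mu_eq, ← h1]
      field_simp
    rw [← Sm.ev_apply]
    change hbar M x * _ = _
    rw [e, ← map_mul]
    refine Eq.trans ?_ (Sm.ev_apply _ _)
    simp only [vec, ho, map_neg, Derivation.leibniz, map_zero, map_add, rot_lapseS, rot_qS, smul_eq_mul,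
      Derivation.map_algebraMap, Derivation.map_one_eq_zero]
    rw [← map_neg]
    congr 1
    ring

theorem kerr_supported : MetricSupported M t (kerr M mass spin) := by
  have hA : ∀ x y : Space, ‖x‖ = ‖y‖ → 2 * mass * ‖x‖⁻¹ * (1 / hbar M x * (1 / hbar M x)) =
      2 * mass * ‖y‖⁻¹ * (1 / hbar M y * (1 / hbar M y)) := fun x y h => by rw [h, hbar_radial x y h]
  have h0 : ∀ x y : Space, ‖x‖ = ‖y‖ → (0 : ℝ) = 0 := fun _ _ _ => rfl
  refine ⟨supportedL01_of_radial hA (fun p hp => hatNN_kerr hM hp) hM,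
    supportedL01_of_radial hA (fun p hp => hatNV_kerr hM hp) hM,
    supportedL01_of_radial h0 (fun p hp => trQ_kerr hM hp) hM, ?_, mixedSupported_kerr_nu hM,
    supportedL01_of_radial h0 (fun p hp => trS_kerr hM hp) hM, fun s _ x hx I => ?_⟩
  · refine ⟨fun _ => 0, fun _ => 0, contDiffOn_const, contDiffOn_const, fun s _ R _ =>
      ⟨0, 0, fun y _ => by simp⟩, fun s _ R _ => ⟨0, 0, fun y _ => by simp⟩, fun s hs x hx I => ?_⟩
    have r := reps_D1star hM (e := slice (fun _ => 0) s) (φ := 0) (ψ := 0) (fun x I => rfl)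
      (o := slice (fun _ => 0) s) (fun x I => rfl) ⟨x, hx⟩ I
    rw [mixed, n_ang_kerr hM (p := (s, x)) hx, r]
    simp only [vec, map_zero, add_zero, mul_zero, neg_zero]; rfl
  · rw [hatS, ang_kerr hM (p := (s, x)) hx, trS_kerr hM (p := (s, x)) hx]; ring

end KerrSupport

end LinearisedGravity

end

noncomputable section

set_option linter.unusedSimpArgs false

namespace LinearisedGravity

open MeasureTheory

/-! ## Linearity -/

section Linearity

variable {M t : ℝ} {X Y : TField 2} {p : Spacetime}

theorem mixed_sub (X Y : TField 2) (u : Spacetime → Fin 4 → ℝ) (s : ℝ) (x : Space) (I : Fin 1 → Fin 3) :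
    mixed (X - Y) u s x I = mixed X u s x I - mixed Y u s x I := ev2_sub X Y u _ _

theorem hatNN_sub (X Y : TField 2) (p : Spacetime) : hatNN M (X - Y) p = hatNN M X p - hatNN M Y p := by
  simp only [hatNN, ev2_sub]; ring

theorem hatNV_sub (X Y : TField 2) (p : Spacetime) : hatNV M (X - Y) p = hatNV M X p - hatNV M Y p :=
  ev2_sub X Y _ _ p

theorem trQ_sub (X Y : TField 2) (p : Spacetime) : trQ M (X - Y) p = trQ M X p - trQ M Y p := by
  simp only [trQ, ev2_sub]; ring

theorem trS_sub (X Y : TField 2) (p : Spacetime) : trS (X - Y) p = trS X p - trS Y p := by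
  simp only [trS, ev2_sub, Finset.sum_sub_distrib]

theorem hatS_sub (X Y : TField 2) (s : ℝ) (x : Space) (I : Fin 2 → Fin 3) :
    hatS (X - Y) s x I = hatS X s x I - hatS Y s x I := by
  simp only [hatS, ev2_sub, trS_sub]; ring

theorem SymmT.sub (hX : SymmT M t X) (hY : SymmT M t Y) : SymmT M t (X - Y) := fun p hp a b => by
  rw [Pi.sub_apply, Pi.sub_apply, Pi.sub_apply, hX p hp, hY p hp]

theorem SmoothT.sub {r : ℕ} {X Y : TField r} (hX : SmoothT M t X) (hY : SmoothT M t Y) : SmoothT M t (X - Y) :=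
  fun I => (hX I).sub (hY I)

theorem sphAvg_sub {F G : Spacetime → ℝ} (hF : ContDiffOn ℝ ∞ F (future M t))
    (hG : ContDiffOn ℝ ∞ G (future M t)) (hp : p ∈ future M t) :
    sphAvg (fun p => F p - G p) p = sphAvg F p - sphAvg G p := by
  have h := sphAvg_add (hF.sub hG) hG hp
  simp only [sub_add_cancel] at h
  linear_combination -h

variable (hM : 0 < M)
include hM

theorem covD_sub {r : ℕ} {X Y : TField r} (hX : SmoothT M t X) (hY : SmoothT M t Y) (hp : p ∈ future M t)
    (I : Fin (r + 1) → Fin 4) : covD M t (X - Y) p I = covD M t X p I - covD M t Y p I := by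
  simp only [covD_eq, conn, Pi.sub_apply]
  rw [pd_sub hM (hX _) (hY _) _ hp]
  simp only [mul_sub, Finset.sum_sub_distrib]
  ring

variable (hX : SmoothT M t X) (hY : SmoothT M t Y) (hp : p ∈ future M t)
include hX hY hp

theorem dGam_sub (u w : Spacetime → Fin 4 → ℝ) :
    dGam M t (X - Y) u w p = dGam M t X u w p - dGam M t Y u w p := by
  simp only [dGam, covD_sub hM hX hY hp, ← mul_sub, ← Finset.sum_sub_distrib]
  congr 1
  exact Finset.sum_congr rfl fun a _ => Finset.sum_congr rfl fun b _ => Finset.sum_congr rfl fun c _ => by ring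

theorem gaugeMap_sub (I : Fin 1 → Fin 4) :
    gaugeMap M (X - Y) p I = gaugeMap M X p I - gaugeMap M Y p I := by
  have h1 : sphAvg (hatNN M (X - Y)) p = sphAvg (hatNN M X) p - sphAvg (hatNN M Y) p :=
    (sphAvg_congr (fun q _ => hatNN_sub X Y q) hp).trans
      (sphAvg_sub (contDiffOn_hatNN hM hX) (contDiffOn_hatNN hM hY) hp)
  have h2 : sphAvg (hatNV M (X - Y)) p = sphAvg (hatNV M X) p - sphAvg (hatNV M Y) p :=
    (sphAvg_congr (fun q _ => hatNV_sub X Y q) hp).trans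
      (sphAvg_sub (contDiffOn_ev2 hX (symVec_n hM) (symVec_nu hM))
        (contDiffOn_ev2 hY (symVec_n hM) (symVec_nu hM)) hp)
  have h3 : ∀ a, hatZero M (X - Y) p a (I 0) = hatZero M X p a (I 0) - hatZero M Y p a (I 0) := fun a => by
    simp only [hatZero, h1, h2]; ring
  simp only [gaugeMap, h3, trS_sub, Pi.sub_apply, mul_sub, Finset.sum_sub_distrib]
  ring

/-- The gauge condition. -/
def IsGauge (M t : ℝ) (X : TField 2) : Prop := ∀ p ∈ future M t, ∀ a,
  (∑ b, ∑ c, gInv M p b c * covD M t X p ![b, c, a]) - 1 / 2 * covD M t (trace4 M X) p ![a] =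
    gaugeMap M X p ![a]

omit hX hY hp hM in
theorem smoothT_trace4 (hM : 0 < M) (hX : SmoothT M t X) : SmoothT M t (trace4 M X) := fun _ =>
  ContDiffOn.sum fun a _ => ContDiffOn.sum fun b _ => (contDiffOn_static (sy_gInv hM a b).smooth).mul (hX _)

omit hp in
theorem IsGauge.sub (hgX : IsGauge M t X) (hgY : IsGauge M t Y) : IsGauge M t (X - Y) := fun p hp a => by
  have h1 : trace4 M (X - Y) = trace4 M X - trace4 M Y := by
    funext q I
    simp only [trace4, Pi.sub_apply, mul_sub, Finset.sum_sub_distrib]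
  rw [h1, covD_sub hM (smoothT_trace4 hM hX) (smoothT_trace4 hM hY) hp, gaugeMap_sub hM hX hY hp,
    ← hgX p hp, ← hgY p hp]
  simp only [covD_sub hM hX hY hp, mul_sub, Finset.sum_sub_distrib]
  ring

omit hp in
theorem induced_sub : (induced M t (X - Y)).EqOn M (induced M t X - induced M t Y) := fun x hx => by
  have hp := mem_future (M := M) (t₀ := t) le_rfl hx
  have d1 : ∀ I, dkNuNu M t (X - Y) x I = dkNuNu M t X x I - dkNuNu M t Y x I := fun I => by
    simp only [dkNuNu, dGam_sub hM hX hY hp, ev2_sub]; ring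
  have d2 : ∀ I, dkNuS M t (X - Y) x I = dkNuS M t X x I - dkNuS M t Y x I := fun I =>
    dGam_sub hM hX hY hp _ _
  have d3 : ∀ I, dkS M t (X - Y) x I = dkS M t X x I - dkS M t Y x I := fun I => by
    simp only [dkS, dGam_sub hM hX hY hp, ev2_sub]; ring
  have d4 : ∀ I, dkSTr M t (X - Y) x I = dkSTr M t X x I - dkSTr M t Y x I := fun I => by
    simp only [dkSTr, d3, Finset.sum_sub_distrib]
  have d5 : ∀ I, dTrK M t (X - Y) x I = dTrK M t X x I - dTrK M t Y x I := fun I => by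
    simp only [dTrK, d1, d4, ev2_sub, trS_sub]; ring
  refine ⟨funext fun I => ?_, funext fun I => ?_, funext fun I => ?_, funext fun I => ?_, funext fun I => ?_,
    funext fun I => hatS_sub X Y t x I, funext fun I => trS_sub X Y _, funext fun I => ?_, funext fun I => ?_,
    funext fun I => ?_, funext fun I => d5 I⟩
  · change _ = (induced M t X).lapse x I - (induced M t Y).lapse x I
    simp only [induced, ev2_sub]; ring
  · change _ = (induced M t X).shiftR x I - (induced M t Y).shiftR x I
    simp only [induced, ev2_sub]; ring
  · change _ = (induced M t X).shiftS x I - (induced M t Y).shiftS x I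
    simp only [induced, mixed_sub]; ring
  · change _ = (induced M t X).hR x I - (induced M t Y).hR x I
    simp only [induced, ev2_sub]; ring
  · change _ = (induced M t X).hS x I - (induced M t Y).hS x I
    simp only [induced, mixed_sub]; ring
  · change _ = (induced M t X).kR x I - (induced M t Y).kR x I
    simp only [induced, ev2_sub, d1, d5]; ring
  · change _ = (induced M t X).kS x I - (induced M t Y).kS x I
    simp only [induced, mixed_sub, d2]; ring
  · change _ = (induced M t X).kHat x I - (induced M t Y).kHat x I
    simp only [induced, d3, d4, hatS_sub]; ring

end Linearity

/-! ## A metric in the gauge is controlled by its initial data -/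

section Recover

variable {M : ℝ} (hM : 0 < M) {ι : Type*} {t C : ι → ℝ} {m : ℕ} {q : ℝ} {X : ι → TField 2}
  (hs : ∀ i, SmoothT M (t i) (X i)) (hsy : ∀ i, SymmT M (t i) (X i))
  (hI : IDSO M C m q fun i => induced M (t i) (X i))
include hM hs hI

theorem st_slice_of_induced_nn : ST M t C 0 (m + 1) q fun i => ev2 (X i) (nVec M) (nVec M) :=
  ⟨fun i => contDiffOn_ev2 (hs i) (symVec_n hM) (symVec_n hM),
    ((hI.lapse ![]).mul hM ((sy_hbar hM).const_mul hM (-2)) (by linarith)).congr fun i x hx => by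
      have := (hbar_pos hM hx).ne'
      simp only [induced, lapse]; field_simp⟩

theorem st_slice_of_induced_vv : ST M t C 0 (m + 1) q fun i => ev2 (X i) (nuVec M) (nuVec M) :=
  ⟨fun i => contDiffOn_ev2 (hs i) (symVec_nu hM) (symVec_nu hM),
    ((hI.hR ![]).mul hM ((sy_hbar_inv hM).const_mul hM 2) (by linarith)).congr fun i x hx => by
      have := (hbar_pos hM hx).ne'
      simp only [induced]; field_simp⟩

theorem st_slice_of_induced_mv (I : Fin 1 → Fin 3) :
    ST M t C 0 (m + 1) q fun i p => mixed (X i) (nuVec M) p.1 p.2 I :=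
  ⟨fun i => contDiffOn_ev2 (hs i) (symVec_nu hM) (symVec_ang hM (I 0)),
    ((hI.hS I).mul hM (sy_hbar_inv hM) (by linarith)).congr fun i x hx => by
      have := (hbar_pos hM hx).ne'
      simp only [induced]; field_simp⟩

include hsy in
theorem st_slice_of_induced (a b : Fin 4) : ST M t C 0 (m + 1) q fun i p => X i p ![a, b] := by
  have nn := st_slice_of_induced_nn hM hs hI
  have vv := st_slice_of_induced_vv hM hs hI
  have mv := st_slice_of_induced_mv hM hs hI
  have hμ := (sy_mu hM).weaken hM (by norm_num : (0 : ℝ) ≤ 1)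
  have lin : ∀ {F : ι → Space → ℝ} {g : Space → ℝ}, Sy M 0 g → SO M C (m + 1) q F →
      SO M C (m + 1) q fun i x => g x * F i x := fun hg hF => hF.mul hM hg (by linarith)
  refine ST.of_parts hM hsy (((nn.add hM vv).const_mul hM (1 / 2)).congr fun i p _ => ?_) ?_
    ((vv.sub hM nn).congr fun i p _ => ?_) (fun I => ?_) mv (fun I => ?_) ?_ a b
  · rw [hatNN]; ring
  · exact ⟨fun i => contDiffOn_ev2 (hs i) (symVec_n hM) (symVec_nu hM),
      ((hI.shiftR ![]).sub hM (lin hμ vv.so)).congr fun i x hx => by simp only [induced, hatNV]; ring⟩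
  · rw [trQ]; ring
  · exact ⟨fun i => contDiffOn_ev2 (hs i) (symVec_n hM) (symVec_ang hM (I 0)),
      ((lin (sy_hbar hM) (hI.shiftS I)).sub hM (lin hμ (mv I).so)).congr fun i x hx => by
        have := (hbar_pos hM hx).ne'
        simp only [induced]; field_simp; ring⟩
  · exact ⟨fun i => (contDiffOn_ev2 (hs i) (symVec_ang hM (I 0)) (symVec_ang hM (I 1))).sub
      ((contDiffOn_const.mul (contDiffOn_static (sy_proj hM (I 0) (I 1)).smooth)).mul (contDiffOn_trS hM (hs i))),
      (hI.hHat I)⟩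
  · exact ⟨fun i => contDiffOn_trS hM (hs i), hI.hTr ![]⟩

omit hs hI in
theorem contDiffOn_dGam {s : ℝ} {X : TField 2} {u w : Spacetime → Fin 4 → ℝ} (hX : SmoothT M s X)
    (hu : SymVec M u) (hw : SymVec M w) : ContDiffOn ℝ ∞ (dGam M s X u w) (future M s) := by
  have h := smoothT_covD hM hX
  exact contDiffOn_const.mul (ContDiffOn.sum fun a _ => ContDiffOn.sum fun b _ => ContDiffOn.sum fun c _ =>
    (((hu.smooth a).mul (hw.smooth b)).mul ((symVec_n hM).smooth c)).mul (((h _).sub (h _)).sub (h _)))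

include hsy in
theorem st_dGam_of_induced (A B : Fin 4) :
    ST M t C 0 m (q + 1) fun i => dGam M (t i) (X i) (fr M A.succ) (fr M B.succ) := by
  have hX := st_slice_of_induced hM hs hsy hI
  have hn := symVec_n hM
  have hnu := symVec_nu hM
  have ha := symVec_ang hM
  have nn := (ST.ev2 hM hX hn hn).so
  have vv := (ST.ev2 hM hX hnu hnu).so
  have mv := fun I => (ST.mixed hM hX hnu I).so
  have hS := fun I => (ST.hatS hM hX I).so
  have tS := (ST.trS hM hX).so
  have lw : ∀ {F : ι → Space → ℝ} {g : Space → ℝ}, Sy M 2 g → SO M C (m + 1) q F →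
      SO M C m (q + 1) fun i x => g x * F i x := fun hg hF => SO.mul hM hg (hF.mono (Nat.le_succ m)) (by linarith)
  have kN := sy_kNuNu hM
  have kT := sy_kTrS hM
  have d1 : ∀ I, SO M C m (q + 1) fun i x => dkNuNu M (t i) (X i) x I := fun I =>
    (((hI.kR I).add hM (lw kN vv)).add hM ((hI.kTr I).const_mul hM (1 / 3))).congr fun i x hx => by
      simp only [induced]; ring
  have d4 : ∀ I, SO M C m (q + 1) fun i x => dkSTr M (t i) (X i) x I := fun I =>
    (((hI.kTr I).sub hM (d1 I)).add hM ((lw kN vv).add hM (lw (kT.const_mul hM (1 / 2)) tS))).congr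
      fun i x hx => by simp only [induced, dTrK]; ring
  have d2 : ∀ I, SO M C m (q + 1) fun i x => dkNuS M (t i) (X i) x I := fun I =>
    ((hI.kS I).add hM (lw (kT.const_mul hM (1 / 2)) (mv I))).congr fun i x hx => by simp only [induced]; ring
  have d3 : ∀ I, SO M C m (q + 1) fun i x => dkS M (t i) (X i) x I := fun I =>
    (((hI.kHat I).add hM (SO.mul hM ((sy_proj hM (I 0) (I 1)).const_mul hM (1 / 2)) (d4 ![])
      (by linarith))).add hM (lw (kT.const_mul hM (1 / 2)) (hS I))).congr fun i x hx => by
        simp only [induced]; ring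
  refine ⟨fun i => contDiffOn_dGam hM (hs i) (symVec_fr hM _) (symVec_fr hM _), ?_⟩
  have sym : ∀ u w : Spacetime → Fin 4 → ℝ, ∀ i, ∀ x ∈ ext M, dGam M (t i) (X i) u w (t i, x) =
      dGam M (t i) (X i) w u (t i, x) := fun u w i x hx => by
    have hp := mem_future (M := M) (t₀ := t i) le_rfl hx
    have hc : ∀ c a b, covD M (t i) (X i) (t i, x) ![c, a, b] = covD M (t i) (X i) (t i, x) ![c, b, a] :=
      fun c a b => by
        rw [covD_two_apply, covD_two_apply, pd_congr (fun q hq => hsy i q hq a b) c hp, sub_sub, sub_sub,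
          add_comm (∑ d, _)]
        congr 2 <;> exact Finset.sum_congr rfl fun d _ => by rw [hsy i _ hp]
    simp only [dGam]
    rw [Finset.sum_comm]
    congr 1
    exact Finset.sum_congr rfl fun a _ => Finset.sum_congr rfl fun b _ => Finset.sum_congr rfl fun c _ => by
      rw [hc c b a]; ring
  have aug : ∀ j : Fin 3, SO M C m (q + 1) fun i x => dGam M (t i) (X i) (nuVec M) (angVec j) (t i, x) :=
    fun j => d2 ![j]
  refine Fin.cases ?_ (fun j => ?_) A <;> refine Fin.cases ?_ (fun l => ?_) B
  · exact ((d1 ![]).add hM (lw (kN.const_mul hM (1 / 2)) nn)).congr fun i x hx => by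
      change dGam M (t i) (X i) (nuVec M) (nuVec M) (t i, x) = _
      rw [dkNuNu]; ring
  · exact aug l
  · exact (aug j).congr fun i x hx => sym _ _ i x hx
  · exact ((d3 ![j, l]).add hM (lw ((kT.mul hM (sy_proj hM j l) (by norm_num : (2 : ℝ) ≤ 2 + 0)).const_mul hM
      (1 / 4)) nn)).congr fun i x hx => by
        change dGam M (t i) (X i) (angVec j) (angVec l) (t i, x) = _
        simp only [dkS, Matrix.cons_val_zero, Matrix.cons_val_one]; ring

end Recover

end LinearisedGravity

end

noncomputable section

set_option linter.unusedSimpArgs false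

namespace LinearisedGravity

open MeasureTheory

/-! ## Recovering the time derivative -/

section RecoverDt

variable {M : ℝ} (hM : 0 < M) {ι : Type*} {t C : ι → ℝ} {m : ℕ} {q : ℝ} {X : ι → TField 2}
  (hX : ∀ a b, ST M t C 0 (m + 1) q fun i p => X i p ![a, b])
include hM hX

theorem st_covD_succ (j : Fin 3) (a b : Fin 4) :
    ST M t C 0 m (q + 1) fun i p => covD M (t i) (X i) p ![j.succ, a, b] :=
  ((hX a b).pd_succ hM j).sub hM (ST.conn hM (fun I => by
    rw [vec_two I]; exact (hX _ _).mono (Nat.le_succ m)) ![j.succ, a, b])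

theorem st_covD_zero (a b : Fin 4) : ST M t C 0 m (q + 1) fun i p =>
    covD M (t i) (X i) p ![0, a, b] - pd M (t i) 0 (fun p => X i p ![a, b]) p :=
  ((ST.conn hM (T := X) (fun I => by
    rw [vec_two I]; exact (hX _ _).mono (Nat.le_succ m)) ![0, a, b]).neg hM).congr fun i p _ => by
      have e : covD M (t i) (X i) p ![0, a, b] = pd M (t i) 0 (fun p => X i p ![a, b]) p -
        conn M (t i) (X i) p ![0, a, b] := rfl
      rw [e]; ring

/-- The time derivative of a tensor field, component by component. -/
def dtT (M t : ℝ) (X : TField 2) : TField 2 := fun p I => pd M t 0 (fun q => X q I) p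

theorem st_dGam_sub {u w : Spacetime → Fin 4 → ℝ} (hu : SymVec M u) (hw : SymVec M w)
    (hu0 : ∀ p, u p 0 = 0) (hw0 : ∀ p, w p 0 = 0) : ST M t C 0 m (q + 1) fun i p =>
      dGam M (t i) (X i) u w p - 1 / 2 * hbar M p.2 * ev2 (dtT M (t i) (X i)) u w p := by
  have hn := symVec_n hM
  have key : ∀ a b c : Fin 4, ST M t C 0 m (q + 1) fun i p => u p a * (w p b * (nVec M p c *
      (covD M (t i) (X i) p ![c, a, b] - covD M (t i) (X i) p ![a, b, c] - covD M (t i) (X i) p ![b, a, c]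
        - if c = 0 then dtT M (t i) (X i) p ![a, b] else 0))) := fun a b c => by
    refine Fin.cases ?_ (fun a => ?_) a
    · simp only [hu0, zero_mul]; exact ST.zero
    refine Fin.cases ?_ (fun b => ?_) b
    · simp only [hw0, zero_mul, mul_zero]; exact ST.zero
    refine ((ST.mul_vec hM ?_ hn c).mul_vec hM hw _).mul_vec hM hu _
    have h1 := st_covD_succ hM hX
    refine Fin.cases ?_ (fun c => ?_) c
    · exact (((st_covD_zero hM hX a.succ b.succ).sub hM (h1 a b.succ 0)).sub hM (h1 b a.succ 0)).congr
        fun i p _ => by simp only [if_true, dtT]; ring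
    · exact (((h1 c a.succ b.succ).sub hM (h1 a b.succ c.succ)).sub hM (h1 b a.succ c.succ)).congr
        fun i p _ => by simp only [Fin.succ_ne_zero, if_false, sub_zero]
  refine ((ST.sum hM Finset.univ fun a _ => ST.sum hM Finset.univ fun b _ =>
    ST.sum hM Finset.univ fun c _ => key a b c).const_mul hM (1 / 2)).congr fun i p _ => ?_
  have e : ∀ a b, ∑ c, u p a * (w p b * (nVec M p c *
      (covD M (t i) (X i) p ![c, a, b] - covD M (t i) (X i) p ![a, b, c] - covD M (t i) (X i) p ![b, a, c]
        - if c = 0 then dtT M (t i) (X i) p ![a, b] else 0))) = (∑ c, u p a * w p b * nVec M p c *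
      (covD M (t i) (X i) p ![c, a, b] - covD M (t i) (X i) p ![a, b, c] - covD M (t i) (X i) p ![b, a, c]))
        - hbar M p.2 * (u p a * w p b * dtT M (t i) (X i) p ![a, b]) := fun a b => by
    have h0 : nVec M p 0 = hbar M p.2 := rfl
    have : hbar M p.2 * (u p a * w p b * dtT M (t i) (X i) p ![a, b]) =
        ∑ c, u p a * w p b * nVec M p c * if c = 0 then dtT M (t i) (X i) p ![a, b] else 0 := by
      simp [h0]; ring
    rw [this, ← Finset.sum_sub_distrib]
    exact Finset.sum_congr rfl fun c _ => by ring
  simp only [e, Finset.sum_sub_distrib, ← Finset.mul_sum]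
  rw [dGam, ev2]; ring

theorem st_dt_space (hG : ∀ A B : Fin 4, ST M t C 0 m (q + 1) fun i =>
    dGam M (t i) (X i) (fr M A.succ) (fr M B.succ)) (a b : Fin 3) :
    ST M t C 0 m (q + 1) fun i p => dtT M (t i) (X i) p ![a.succ, b.succ] := by
  have h0 : ∀ A : Fin 4, ∀ p, fr M A.succ p 0 = 0 := fun A p => by
    refine Fin.cases rfl (fun j => ?_) A; rfl
  have h1 : ∀ A B : Fin 4, ST M t C 0 m (q + 1) fun i => ev2 (dtT M (t i) (X i)) (fr M A.succ) (fr M B.succ) :=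
    fun A B => (((hG A B).sub hM (st_dGam_sub hM hX (symVec_fr hM _) (symVec_fr hM _) (h0 A) (h0 B))).mul hM
      ((sy_hbar_inv hM).const_mul hM 2) (by linarith)).congr fun i p hp => by
        have := (hbar_pos hM hp.2).ne'
        field_simp; ring
  refine (ST.sum hM Finset.univ fun A _ => ST.sum hM Finset.univ fun B _ =>
    (h1 A B).mul hM ((sy_frCoef hM a.succ A.succ).mul hM (sy_frCoef hM b.succ B.succ)
      (by linarith : (0 : ℝ) ≤ 0 + 0)) (by linarith)).congr fun i p hp => ?_
  rw [eq_sum_ev2 hM (dtT M (t i) (X i)) hp.2, Fin.sum_univ_succ]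
  have z : ∀ a : Fin 3, frCoef M a.succ 0 p.2 = 0 := fun a => rfl
  simp only [z, zero_mul, Finset.sum_const_zero, zero_add]
  refine Finset.sum_congr rfl fun A _ => ?_
  rw [Fin.sum_univ_succ, z]; simp only [mul_zero, zero_mul, zero_add]

variable (hs : ∀ i, SmoothT M (t i) (X i)) (hsy : ∀ i, SymmT M (t i) (X i)) (hg : ∀ i, IsGauge M (t i) (X i))

omit hX in
theorem gInv_zero_zero {p : Spacetime} (hp : p.2 ∈ ext M) : gInv M p 0 0 = -hbar M p.2 ^ 2 := by
  rw [hbar_sq hM hp]; simp [gInv, eta]; ring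

include hg in
theorem st_gauge_dt (a : Fin 4) : ST M t C 0 m (q + 1) fun i p =>
    (∑ c, gInv M p 0 c * dtT M (t i) (X i) p ![c, a]) - 1 / 2 * pd M (t i) a (fun q => trace4 M (X i) q ![]) p := by
  have hf := ST.gaugeMap hM (fun a b => (hX a b).mono (Nat.le_succ m)) ![a]
  have h0 : ∀ c, ST M t C 0 m (q + 1) fun i p => gInv M p 0 c *
      (covD M (t i) (X i) p ![0, c, a] - dtT M (t i) (X i) p ![c, a]) := fun c =>
    ((st_covD_zero hM hX c a).mul hM (sy_gInv hM 0 c) (by linarith)).congr fun i p _ => rfl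
  have h1 : ∀ (b : Fin 3) c, ST M t C 0 m (q + 1) fun i p => gInv M p b.succ c *
      covD M (t i) (X i) p ![b.succ, c, a] := fun b c =>
    ((st_covD_succ hM hX b c a).mul hM (sy_gInv hM b.succ c) (by linarith)).congr fun i p _ => rfl
  refine ((hf.sub hM (ST.sum hM Finset.univ fun c _ => h0 c)).sub hM (ST.sum hM Finset.univ fun b _ =>
    ST.sum hM Finset.univ fun c _ => h1 b c)).congr fun i p hp => ?_
  have e := hg i p hp a
  have e2 : covD M (t i) (trace4 M (X i)) p ![a] = pd M (t i) a (fun q => trace4 M (X i) q ![]) p := by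
    rw [covD_eq, conn]; simp
  rw [Fin.sum_univ_succ, e2] at e
  simp only [mul_sub, Finset.sum_sub_distrib]
  linear_combination e

theorem st_trace4 : ST M t C 0 (m + 1) q fun i p => trace4 M (X i) p ![] :=
  ST.sum hM Finset.univ fun a _ => ST.sum hM Finset.univ fun b _ =>
    ((hX a b).mul hM (sy_gInv hM a b) (by linarith)).congr fun i p _ => rfl

omit hX in
theorem pd_zero_trace4 {s : ℝ} {X : TField 2} (hX : SmoothT M s X) {p : Spacetime} (hp : p ∈ future M s) :
    pd M s 0 (fun q => trace4 M X q ![]) p = ∑ a, ∑ b, gInv M p a b * dtT M s X p ![a, b] := by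
  have hg := fun a b => contDiffOn_static (t₀ := s) (sy_gInv hM a b).smooth
  have h1 : ∀ a b, ContDiffOn ℝ ∞ (fun q => gInv M q a b * X q ![a, b]) (future M s) := fun a b =>
    (hg a b).mul (hX _)
  have e := pd_sum hM Finset.univ (fun a _ => ContDiffOn.sum fun b (_ : b ∈ Finset.univ) => h1 a b) 0 hp
  refine e.trans (Finset.sum_congr rfl fun a _ => ?_)
  rw [pd_sum hM Finset.univ (fun b _ => h1 a b) 0 hp]
  refine Finset.sum_congr rfl fun b _ => ?_
  rw [pd_mul hM (F := fun q => gInv M q a b) (hg a b) (hX _) 0 hp, show pd M s 0 (fun q => gInv M q a b) p = 0 from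
    pd_zero_static hM (sy_gInv hM a b).smooth hp, mul_zero, add_zero]
  rfl

include hs hsy hg in
theorem st_of_gauge (hG : ∀ A B : Fin 4, ST M t C 0 m (q + 1) fun i =>
    dGam M (t i) (X i) (fr M A.succ) (fr M B.succ)) (a b : Fin 4) :
    ST M t C 1 m q fun i p => X i p ![a, b] := by
  have sp := st_dt_space hM hX hG
  have sm : ∀ i, SmoothT M (t i) (dtT M (t i) (X i)) := fun i I => contDiffOn_pd hM (hs i I) 0
  have ssy : ∀ i, SymmT M (t i) (dtT M (t i) (X i)) := fun i p hp a b => pd_congr (fun q hq => hsy i q hq a b) 0 hp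
  have gm : ∀ {F : ι → Spacetime → ℝ} (a b : Fin 4), ST M t C 0 m (q + 1) F →
      ST M t C 0 m (q + 1) fun i p => gInv M p a b * F i p := fun a b hF =>
    (hF.mul hM (sy_gInv hM a b) (by linarith)).congr fun i p _ => rfl
  have hi2 : Sy M 0 fun x => (hbar M x)⁻¹ * (hbar M x)⁻¹ := (sy_hbar_inv hM).mul hM (sy_hbar_inv hM) (by linarith)
  have mix : ∀ j : Fin 3, ST M t C 0 m (q + 1) fun i p => dtT M (t i) (X i) p ![0, j.succ] := fun j => by
    refine ((((st_gauge_dt hM hX hg j.succ).add hM (((st_trace4 hM hX).pd_succ hM j).const_mul hM (1 / 2))).sub hM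
      (ST.sum hM Finset.univ fun l _ => gm 0 (Fin.succ l) (sp l j))).mul hM (hi2.const_mul hM (-1))
        (by linarith)).congr fun i p hp => ?_
    have := (hbar_pos hM hp.2).ne'
    rw [Fin.sum_univ_succ, gInv_zero_zero hM hp.2]
    field_simp; ring
  have zz : ST M t C 0 m (q + 1) fun i p => dtT M (t i) (X i) p ![0, 0] := by
    refine (((st_gauge_dt hM hX hg 0).add hM ((ST.sum hM Finset.univ fun j _ => ST.sum hM Finset.univ fun l _ =>
      gm (Fin.succ j) (Fin.succ l) (sp j l)).const_mul hM (1 / 2))).mul hM (hi2.const_mul hM (-2))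
        (by linarith)).congr fun i p hp => ?_
    have := (hbar_pos hM hp.2).ne'
    have gs : ∀ j : Fin 3, gInv M p j.succ 0 = gInv M p 0 j.succ := fun j => by
      simp only [gInv, eta, Fin.succ_ne_zero, (Fin.succ_ne_zero j).symm, if_false]; ring
    have s1 : ∑ j : Fin 3, gInv M p j.succ 0 * dtT M (t i) (X i) p ![j.succ, 0] =
        ∑ j : Fin 3, gInv M p 0 j.succ * dtT M (t i) (X i) p ![j.succ, 0] :=
      Finset.sum_congr rfl fun j _ => by rw [gs]
    have s2 : ∑ j : Fin 3, gInv M p 0 j.succ * dtT M (t i) (X i) p ![0, j.succ] =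
        ∑ j : Fin 3, gInv M p 0 j.succ * dtT M (t i) (X i) p ![j.succ, 0] :=
      Finset.sum_congr rfl fun j _ => by rw [ssy i p hp]
    rw [pd_zero_trace4 hM (hs i) hp, Fin.sum_univ_succ (f := fun a => ∑ b, _),
      Fin.sum_univ_succ, Fin.sum_univ_succ (f := fun b => gInv M p 0 b * dtT M (t i) (X i) p ![0, b]),
      gInv_zero_zero hM hp.2]
    simp only [Fin.sum_univ_succ (f := fun b => gInv M p (Fin.succ _) b * _), Finset.sum_add_distrib]
    rw [s1, s2]
    field_simp; ring
  refine ST.zero_one (fun i => hs i _) (hX a b).so hM (ST.so (k := 0) (t := t)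
    (F := fun i p => dtT M (t i) (X i) p ![a, b]) ?_)
  refine Fin.cases ?_ (fun a => ?_) a <;> refine Fin.cases ?_ (fun b => ?_) b
  · exact zz
  · exact mix b
  · exact (mix a).congr fun i p hp => ssy i p hp _ _
  · exact sp a b

end RecoverDt

end LinearisedGravity

end

noncomputable section

set_option linter.unusedSimpArgs false

namespace LinearisedGravity

open MeasureTheory

theorem fin_three_cases (i : Fin 3) : i = 0 ∨ i = 1 ∨ i = 2 := by fin_cases i <;> simp

namespace RotAlg

variable {A : Type*} [CommRing A] [Algebra ℝ A] {Ω : Fin 3 → Derivation ℝ A A} {y : Fin 3 → A}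

/-- The area form of the unit sphere. -/
def area (y : Fin 3 → A) (i j : Fin 3) : A := ![![0, y 2, -y 1], ![-y 2, 0, y 0], ![y 1, -y 0, 0]] i j

variable (h : RotAlg Ω y)
include h

theorem rot_y (a j : Fin 3) : Ω a (y j) = -area y a j := by
  fin_cases a <;> fin_cases j <;>
    simp [area, h.y00, h.y01, h.y02, h.y10, h.y11, h.y12, h.y20, h.y21, h.y22]

theorem star_grad (q φ ψ : A) (j : Fin 3) :
    ∑ k, area y k j * -(q * (del Ω y k φ + Ω k ψ)) = -(q * (Ω j φ - del Ω y j ψ)) := by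
  obtain ⟨r0, r1, r2⟩ := h.rot_eq φ
  have d0 := del_zero (Ω := Ω) (y := y) ψ
  have d1 := del_one (Ω := Ω) (y := y) ψ
  have d2 := del_two (Ω := Ω) (y := y) ψ
  obtain rfl | rfl | rfl := fin_three_cases j <;> simp only [area, Fin.sum_univ_three,
    Matrix.cons_val_zero, Matrix.cons_val_one, Matrix.cons_val]
  · linear_combination q * r0 - q * d0
  · linear_combination q * r1 - q * d1
  · linear_combination q * r2 - q * d2

end RotAlg

/-! ## The projection to `l = 0, 1` on one sphere -/

section SphereProjection

variable {M : ℝ} (hM : 0 < M) {R : ℝ} (hR : 2 * M ≤ R)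

theorem eq_zero_of_sI_mul_self {g : Sm (ext M)} (h : sI hM hR (g * g) = 0) {x : ext M} (hx : ‖x.1‖ = R) :
    g.1 x = 0 := by
  have hR0 : 0 < R := by linarith
  have hc : Continuous fun y => (g * g).1 (sphPt hM hR y) :=
    continuous_comp_sphPt hM hR (g * g)
  have h1 := (integral_eq_zero_iff_of_nonneg (f := fun y => (g * g).1 (sphPt hM hR y))
    (fun y => mul_self_nonneg (g.1 _)) (integrable_sphPt hM hR _)).1 h
  have h2 := congrFun ((Continuous.ae_eq_iff_eq sphMeas hc continuous_const).1 h1)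
    ⟨R⁻¹ • x.1, by rw [mem_sphere_zero_iff_norm, norm_smul, hx, norm_inv, Real.norm_of_nonneg hR0.le]; field_simp⟩
  have h3 : sphPt hM hR ⟨R⁻¹ • x.1, by
      rw [mem_sphere_zero_iff_norm, norm_smul, hx, norm_inv, Real.norm_of_nonneg hR0.le]; field_simp⟩ = x :=
    Subtype.ext (by change R • R⁻¹ • x.1 = x.1; rw [smul_smul, mul_inv_cancel₀ hR0.ne', one_smul])
  rw [h3] at h2
  exact mul_self_eq_zero.1 h2

/-- Rotations are tangential. -/
theorem rot_eq_zero_of_eq_zero {g : Sm (ext M)} (h : ∀ x : ext M, ‖x.1‖ = R → g.1 x = 0) (a : Fin 3)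
    {x : ext M} (hx : ‖x.1‖ = R) : (rot hM a g).1 x = 0 := by
  have hR : 2 * M ≤ R := hx ▸ x.2
  refine eq_zero_of_sI_mul_self hM hR ?_ hx
  rw [sI_rot_mul, neg_eq_zero, ← map_zero (sI hM hR)]
  refine sI_congr hM hR fun z hz => ?_
  change g.1 z * _ = 0
  rw [h z hz, zero_mul]

theorem sI_y (i : Fin 3) : sI hM hR (yS hM i) = 0 := by
  have h := rotAlg hM
  obtain rfl | rfl | rfl := fin_three_cases i
  · rw [← h.y21, sI_rot]
  · rw [← h.y02, sI_rot]
  · rw [← h.y10, sI_rot]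

theorem sI_y_mul_y (i j : Fin 3) : sI hM hR (yS hM i * yS hM j) = if i = j then 4 * Real.pi / 3 else 0 := by
  have h := rotAlg hM
  have e : ∀ a b c, sI hM hR (rot hM a (yS hM b * yS hM c)) = 0 := fun a b c => sI_rot hM hR a _
  simp only [Derivation.leibniz, smul_eq_mul] at e
  have e1 := e 2 0 1
  have e2 := e 1 0 2
  have e3 := e 2 0 0
  have e4 := e 0 1 1
  have e5 := e 1 2 2
  have e6 := (congrArg (sI hM hR) h.sq).trans (sI_one hM hR)
  rw [area_eq] at e6
  simp only [h.y20, h.y21, h.y10, h.y12, h.y01, mul_neg, map_add, map_neg] at e1 e2 e3 e4 e5 e6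
  have c10 := mul_comm (yS hM 1) (yS hM 0)
  have c20 := mul_comm (yS hM 2) (yS hM 0)
  have c21 := mul_comm (yS hM 2) (yS hM 1)
  rw [c20] at e5
  fin_cases i <;> fin_cases j <;> simp [c10, c20, c21] <;> linarith

theorem sI_dl (i : Fin 3) (f : Sm (ext M)) : sI hM hR (dl hM i f) = 2 * sI hM hR (f * yS hM i) := by
  have h := rotAlg hM
  have e : ∀ a b, sI hM hR (yS hM b * rot hM a f) = -sI hM hR (f * rot hM a (yS hM b)) := fun a b => by
    rw [mul_comm, sI_rot_mul]
  obtain rfl | rfl | rfl := fin_three_cases i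
  · rw [dl, RotAlg.del_zero, map_sub, e, e, h.y12, h.y21, mul_neg, map_neg]; ring
  · rw [dl, RotAlg.del_one, map_sub, e, e, h.y20, h.y02, mul_neg, map_neg]; ring
  · rw [dl, RotAlg.del_two, map_sub, e, e, h.y01, h.y10, mul_neg, map_neg]; ring

theorem sI_qS_mul (f : Sm (ext M)) : sI hM hR (qS hM * f) = R⁻¹ * sI hM hR f := by
  rw [← sI_const_mul]
  refine sI_congr hM hR fun x hx => ?_
  change ‖x.1‖⁻¹ * _ = R⁻¹ * _
  rw [hx]

/-- The area form. -/
def areaS (i j : Fin 3) : Sm (ext M) := RotAlg.area (yS hM) i j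

theorem rot_y (a j : Fin 3) : rot hM a (yS hM j) = -areaS hM a j := (rotAlg hM).rot_y a j

theorem star_d1S (φ ψ : Sm (ext M)) (j : Fin 3) :
    ∑ k, areaS hM k j * d1S hM φ ψ k = -(qS hM * (rot hM j φ - dl hM j ψ)) := (rotAlg hM).star_grad _ φ ψ j

variable {f g φ ψ : Sm (ext M)} {c c' : ℝ} {b b' : Fin 3 → ℝ}

theorem sI_supported (hf : ∀ x : ext M, ‖x.1‖ = R → f.1 x = c + ∑ i, b i * xhat x.1 i) :
    sI hM hR f = 4 * Real.pi * c ∧ ∀ i, sI hM hR (f * yS hM i) = 4 * Real.pi / 3 * b i := by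
  have e : ∀ x : ext M, ‖x.1‖ = R →
      f.1 x = (algebraMap ℝ (Sm (ext M)) c + ∑ i, algebraMap ℝ _ (b i) * yS hM i).1 x := fun x hx => by
    rw [hf x hx, ← Sm.ev_apply]
    simp only [map_add, map_sum, map_mul, AlgHom.commutes, Algebra.algebraMap_self_apply, Sm.ev_apply, yS_apply']
  refine ⟨?_, fun i => ?_⟩
  · rw [sI_congr hM hR e]
    simp only [map_add, map_sum, sI_const, sI_const_mul, sI_y, area_eq, mul_zero, Finset.sum_const_zero, add_zero]
    ring
  · have : sI hM hR (f * yS hM i) = sI hM hR ((algebraMap ℝ (Sm (ext M)) c + ∑ i, algebraMap ℝ _ (b i) * yS hM i)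
        * yS hM i) := sI_congr hM hR fun x hx => congrArg (· * (yS hM i).1 x) (e x hx)
    rw [this]
    simp only [add_mul, Finset.sum_mul, mul_assoc, map_add, map_sum, sI_const_mul, sI_y, sI_y_mul_y]
    simp; ring

theorem rot_supported (hf : ∀ x : ext M, ‖x.1‖ = R → f.1 x = c + ∑ i, b i * xhat x.1 i) (a : Fin 3)
    {x : ext M} (hx : ‖x.1‖ = R) : (rot hM a f).1 x = -∑ i, b i * areaForm x.1 a i := by
  have h := rot_eq_zero_of_eq_zero hM (R := R)
    (g := f - (algebraMap ℝ (Sm (ext M)) c + ∑ i, algebraMap ℝ _ (b i) * yS hM i)) (fun x hx => by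
      rw [← Sm.ev_apply, map_sub, Sm.ev_apply, hf x hx]
      simp only [map_add, map_sum, map_mul, AlgHom.commutes, Algebra.algebraMap_self_apply, Sm.ev_apply, yS_apply',
        sub_self]) a hx
  simp only [map_sub, map_add, map_sum, Derivation.leibniz, Derivation.map_algebraMap, smul_eq_mul, mul_zero,
    add_zero, zero_add, rot_y] at h
  rw [← Sm.ev_apply] at h ⊢
  have ea : ∀ i, Sm.ev x (areaS hM a i) = areaForm x.1 a i := fun i => (areaForm_apply hM x a i).symm
  simp only [map_sub, map_sum, map_mul, map_neg, AlgHom.commutes, Algebra.algebraMap_self_apply, ea] at h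
  rw [sub_eq_zero.1 h, ← Finset.sum_neg_distrib]
  exact Finset.sum_congr rfl fun i _ => by ring

theorem dl_supported (hf : ∀ x : ext M, ‖x.1‖ = R → f.1 x = c + ∑ i, b i * xhat x.1 i) (a : Fin 3)
    {x : ext M} (hx : ‖x.1‖ = R) : (dl hM a f).1 x = ∑ i, b i * proj x.1 a i := by
  have hr := fun a => rot_supported hM hf a hx
  have hq := xhat_sq (norm_pos_of_mem_ext hM x.2)
  have ey : ∀ i, Sm.ev x (yS hM i) = xhat x.1 i := fun i => yS_apply' hM i x
  have er : ∀ i, Sm.ev x (rot hM i f) = _ := hr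
  rw [← Sm.ev_apply]
  simp only [areaForm_eq, proj, Fin.sum_univ_three] at er ⊢
  obtain rfl | rfl | rfl := fin_three_cases a
  · rw [dl, RotAlg.del_zero]; simp only [map_sub, map_mul, er, ey]; simp
    linear_combination b 0 * hq
  · rw [dl, RotAlg.del_one]; simp only [map_sub, map_mul, er, ey]; simp
    linear_combination b 1 * hq
  · rw [dl, RotAlg.del_two]; simp only [map_sub, map_mul, er, ey]; simp
    linear_combination b 2 * hq

/-- The part of a 1-form supported on `l = 0, 1` in terms of means of the 1-form. -/
theorem d1S_supported (hf : ∀ x : ext M, ‖x.1‖ = R → f.1 x = c + ∑ i, b i * xhat x.1 i)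
    (hg : ∀ x : ext M, ‖x.1‖ = R → g.1 x = c' + ∑ i, b' i * xhat x.1 i)
    (hφ : ∀ i, sI hM hR (φ * yS hM i) = 0) (hψ : ∀ i, sI hM hR (ψ * yS hM i) = 0) (a : Fin 3)
    {x : ext M} (hx : ‖x.1‖ = R) : (d1S hM f g a).1 x = 3 / 2 * ∑ j,
      (proj x.1 a j * (1 / (4 * Real.pi) * sI hM hR (d1S hM (φ + f) (ψ + g) j)) + areaForm x.1 a j *
        (1 / (4 * Real.pi) * sI hM hR (∑ k, areaS hM k j * d1S hM (φ + f) (ψ + g) k))) := by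
  have hπ := Real.pi_pos.ne'
  have h1 : ∀ j, 1 / (4 * Real.pi) * sI hM hR (d1S hM (φ + f) (ψ + g) j) = -(2 / 3) * R⁻¹ * b j := fun j => by
    rw [d1S, map_neg, sI_qS_mul, map_add, sI_rot, sI_dl, add_mul, map_add, hφ, (sI_supported hM hR hf).2]
    field_simp; ring
  have h2 : ∀ j, 1 / (4 * Real.pi) * sI hM hR (∑ k, areaS hM k j * d1S hM (φ + f) (ψ + g) k) =
      2 / 3 * R⁻¹ * b' j := fun j => by
    rw [star_d1S, map_neg, sI_qS_mul, map_sub, sI_rot, sI_dl, add_mul, map_add, hψ, (sI_supported hM hR hg).2]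
    field_simp; ring
  have e : (d1S hM f g a).1 x = -(R⁻¹ * ((dl hM a f).1 x + (rot hM a g).1 x)) := by
    rw [← hx, d1S, ← Sm.ev_apply]; simp only [map_neg, map_mul, map_add]; rfl
  rw [e, dl_supported hM hf a hx, rot_supported hM hg a hx, ← sub_eq_add_neg, ← Finset.sum_sub_distrib,
    Finset.mul_sum, Finset.mul_sum, ← Finset.sum_neg_distrib]
  exact Finset.sum_congr rfl fun j _ => by rw [h1, h2]; ring

end SphereProjection

end LinearisedGravity

end

noncomputable section

set_option linter.unusedSimpArgs false

namespace LinearisedGravity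

open MeasureTheory

/-! ## The projection away from `l = 0, 1` -/

section Projection

variable {M t s : ℝ} (hM : 0 < M)

theorem sphAvg_eq_sI {F : Spacetime → ℝ} {f : Sm (ext M)} {x : Space} (hx : 2 * M ≤ ‖x‖)
    (h : ∀ z : ext M, F (s, z) = f.1 z) :
    sphAvg F (s, x) = 1 / (4 * Real.pi) * sI hM hx f := by
  rw [sphAvg, sI_apply]
  exact congrArg _ (integral_congr_ae (Filter.Eventually.of_forall fun y => h (sphPt hM hx y)))

include hM in
theorem SupportedL01.on_sphere {F : Spacetime → ℝ} (h : SupportedL01 M t F) (hs : t ≤ s) {R : ℝ} (hR : 2 * M ≤ R) :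
    ∃ (c : ℝ) (b : Fin 3 → ℝ), ∀ x : Space, ‖x‖ = R → F (s, x) = c + ∑ i, b i * xhat x i := by
  obtain ⟨c, b, h⟩ := h s hs R hR
  refine ⟨c, b, fun x hx => ?_⟩
  have hR0 : R ≠ 0 := by linarith
  have := h (R⁻¹ • x) (by rw [norm_smul, norm_inv, hx, Real.norm_of_nonneg (by linarith), inv_mul_cancel₀ hR0])
  rw [smul_smul, mul_inv_cancel₀ hR0, one_smul] at this
  rw [this]
  simp [xhat, hx, div_eq_inv_mul]

theorem SupportedL01.sub {F G : Spacetime → ℝ} (hF : SupportedL01 M t F) (hG : SupportedL01 M t G) :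
    SupportedL01 M t fun p => F p - G p := fun s hs R hR => by
  obtain ⟨c, b, h⟩ := hF s hs R hR
  obtain ⟨c', b', h'⟩ := hG s hs R hR
  refine ⟨c - c', fun i => b i - b' i, fun y hy => ?_⟩
  beta_reduce
  rw [h y hy, h' y hy]
  simp only [sub_mul, Finset.sum_sub_distrib]; ring

include hM

theorem eq_of_supportedL01 {F G : Spacetime → ℝ} (hF : ContDiffOn ℝ ∞ F (future M t))
    (hG : ContDiffOn ℝ ∞ G (future M t)) (hv : VanishingL01 M t G) (h : SupportedL01 M t fun p => F p - G p)
    {p : Spacetime} (hp : p ∈ future M t) :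
    G p = F p - (sphAvg F p + 3 * ∑ i, xhat p.2 i * sphAvg (fun q => xhat q.2 i * F q) p) := by
  obtain ⟨s, x⟩ := p
  obtain ⟨hs, hx⟩ := hp
  obtain ⟨c, b, h⟩ := h.on_sphere hM hs hx
  have hπ := Real.pi_pos.ne'
  set f := Sm.mk (fun x => F (s, x)) (contDiffOn_slice hF hs)
  set g := Sm.mk (fun x => G (s, x)) (contDiffOn_slice hG hs)
  have h1 := sI_supported hM hx (f := f - g) (c := c) (b := b) fun z hz => h z hz
  obtain ⟨g0, gi⟩ := hv.orth hM hG hs _ hx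
  rw [slS_mk] at g0 gi
  have e0 : sphAvg F (s, x) = c := by
    rw [sphAvg_eq_sI hM hx (f := f) fun z => rfl]
    have := h1.1
    rw [map_sub, g0, sub_zero] at this
    rw [this]; field_simp
  have ei : ∀ i, 3 * sphAvg (fun q => xhat q.2 i * F q) (s, x) = b i := fun i => by
    rw [sphAvg_eq_sI hM hx (f := f * yS hM i) fun z => by
      rw [← yS_apply' hM i z, mul_comm]; rfl]
    have := h1.2 i
    rw [sub_mul, map_sub, gi, sub_zero] at this
    rw [this]; field_simp
  have := h x rfl
  simp only [Finset.mul_sum, mul_left_comm (3 : ℝ), ei, e0]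
  simp only [mul_comm (xhat x _)]
  linear_combination -this

theorem MixedSupported.sub {X Y : TField 2} {u : Spacetime → Fin 4 → ℝ} (hX : MixedSupported M t X u)
    (hY : MixedSupported M t Y u) : MixedSupported M t (X - Y) u := by
  obtain ⟨e, o, he, ho, se, so, h⟩ := hX
  obtain ⟨e', o', he', ho', se', so', h'⟩ := hY
  refine ⟨_, _, he.sub he', ho.sub ho', se.sub se', so.sub so', fun s hs x hx I => ?_⟩
  rw [mixed_sub, h s hs x hx, h' s hs x hx,
    reps_D1star hM (reps_slice hs he) (reps_slice hs ho) ⟨x, hx⟩,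
    reps_D1star hM (reps_slice hs he') (reps_slice hs ho') ⟨x, hx⟩,
    reps_D1star hM (e := slice (fun p => e p - e' p) s) (o := slice (fun p => o p - o' p) s)
      (φ := slS hs (Sm.mk e he) - slS hs (Sm.mk e' he')) (ψ := slS hs (Sm.mk o ho) - slS hs (Sm.mk o' ho'))
      (fun x _ => by rw [slS_mk, slS_mk]; rfl) (fun x _ => by rw [slS_mk, slS_mk]; rfl) ⟨x, hx⟩]
  simp only [vec, dl, ← Sm.ev_apply, RotAlg.del, map_sub, map_neg, map_mul, map_add, map_sum]
  ring

theorem MetricSupported.sub {X Y : TField 2} (hX : MetricSupported M t X) (hY : MetricSupported M t Y) :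
    MetricSupported M t (X - Y) := by
  obtain ⟨a1, a2, a3, a4, a5, a6, a7⟩ := hX
  obtain ⟨b1, b2, b3, b4, b5, b6, b7⟩ := hY
  refine ⟨?_, ?_, ?_, a4.sub hM b4, a5.sub hM b5, ?_, fun s hs x hx I => by
    rw [hatS_sub, a7 s hs x hx, b7 s hs x hx, sub_zero]⟩
  · rw [show hatNN M (X - Y) = fun p => _ from funext (hatNN_sub X Y)]; exact a1.sub b1
  · rw [show hatNV M (X - Y) = fun p => _ from funext (hatNV_sub X Y)]; exact a2.sub b2
  · rw [show trQ M (X - Y) = fun p => _ from funext (trQ_sub X Y)]; exact a3.sub b3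
  · rw [show trS (X - Y) = fun p => _ from funext (trS_sub X Y)]; exact a6.sub b6

theorem mixed_eq_of_supported {X Y : TField 2} {u : Spacetime → Fin 4 → ℝ} (hY : MixedVanishing M t Y u)
    (h : MixedSupported M t (X - Y) u) {p : Spacetime} (hp : p ∈ future M t) (a : Fin 3) :
    mixed Y u p.1 p.2 ![a] = mixed X u p.1 p.2 ![a] - 3 / 2 * ∑ j,
      (proj p.2 a j * sphAvg (fun q => mixed X u q.1 q.2 ![j]) p +
        areaForm p.2 a j * sphAvg (fun q => ∑ k, areaForm q.2 k j * mixed X u q.1 q.2 ![k]) p) := by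
  obtain ⟨e, o, he, ho, ve, vo, h1⟩ := hY
  obtain ⟨e', o', he', ho', se, so, h2⟩ := h
  obtain ⟨s, x⟩ := p
  obtain ⟨hs, hx⟩ := hp
  obtain ⟨c, b, hf⟩ := se.on_sphere hM hs hx
  obtain ⟨c', b', hg⟩ := so.on_sphere hM hs hx
  set φ := slS hs (Sm.mk e he) with hφ
  set ψ := slS hs (Sm.mk o ho) with hψ
  set f := slS hs (Sm.mk e' he') with hf'
  set g := slS hs (Sm.mk o' ho') with hg'
  have r1 : ∀ (z : ext M) a, mixed Y u s z ![a] = (d1S hM φ ψ a).1 z := fun z a => by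
    rw [h1 s hs z z.2]; exact reps_D1star hM (reps_slice hs he) (reps_slice hs ho) z ![a]
  have r2 : ∀ (z : ext M) a, mixed X u s z ![a] - mixed Y u s z ![a] = (d1S hM f g a).1 z := fun z a => by
    rw [← mixed_sub, h2 s hs z z.2]; exact reps_D1star hM (reps_slice hs he') (reps_slice hs ho') z ![a]
  have r3 : ∀ (z : ext M) a, mixed X u s z ![a] = (d1S hM (φ + f) (ψ + g) a).1 z := fun z a => by
    have e : d1S hM (φ + f) (ψ + g) a = d1S hM φ ψ a + d1S hM f g a := by
      simp only [d1S, dl, RotAlg.del, map_add, mul_add, Finset.sum_add_distrib]; ring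
    rw [e, ← Sm.ev_apply, map_add, Sm.ev_apply, Sm.ev_apply, ← r1, ← r2]; ring
  have key := d1S_supported hM hx (f := f) (g := g) (φ := φ) (ψ := ψ) (c := c) (c' := c') (b := b) (b' := b')
    (fun z hz => by rw [hf', slS_mk]; exact hf z hz) (fun z hz => by rw [hg', slS_mk]; exact hg z hz)
    (ve.orth hM he hs _ hx).2 (vo.orth hM ho hs _ hx).2 a (x := ⟨x, hx⟩) rfl
  rw [← r2] at key
  have a1 : ∀ j, sphAvg (fun q => mixed X u q.1 q.2 ![j]) (s, x) = _ := fun j =>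
    sphAvg_eq_sI hM hx (f := d1S hM (φ + f) (ψ + g) j) fun z => r3 z j
  have a2 : ∀ j, sphAvg (fun q => ∑ k, areaForm q.2 k j * mixed X u q.1 q.2 ![k]) (s, x) = _ := fun j =>
    sphAvg_eq_sI hM hx (f := ∑ k, areaS hM k j * d1S hM (φ + f) (ψ + g) k) fun z => by
      rw [← Sm.ev_apply, map_sum]
      refine Finset.sum_congr rfl fun k _ => ?_
      rw [map_mul, Sm.ev_apply, Sm.ev_apply, ← r3]
      exact congrArg (· * _) (areaForm_apply hM z k j)
  simp only [a1, a2]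
  linear_combination -key

end Projection

section Projection

variable {M : ℝ} (hM : 0 < M) {ι : Type*} {t C : ι → ℝ} {k m : ℕ} {q : ℝ}
include hM

theorem ST.of_supportedL01 {F G : ι → Spacetime → ℝ} (hF : ST M t C k m q F)
    (hG : ∀ i, ContDiffOn ℝ ∞ (G i) (future M (t i))) (hv : ∀ i, VanishingL01 M (t i) (G i))
    (h : ∀ i, SupportedL01 M (t i) fun p => F i p - G i p) : ST M t C k m q G :=
  (hF.sub hM (hF.sphAvg hM |>.add hM <| ST.const_mul hM 3 <| ST.sum hM Finset.univ fun j _ =>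
    (ST.sphAvg hM (hF.mul hM (sy_xhat hM j) (by linarith))).mul hM (sy_xhat hM j) (by linarith))).congr
      fun i _ hp => eq_of_supportedL01 hM (hF.smooth i) (hG i) (hv i) (h i) hp

variable {X Y : ι → TField 2}

theorem st_mixed_of_supported {u : Spacetime → Fin 4 → ℝ}
    (hX : ∀ I, ST M t C k m q fun i p => mixed (X i) u p.1 p.2 I)
    (hY : ∀ i, MixedVanishing M (t i) (Y i) u) (h : ∀ i, MixedSupported M (t i) (X i - Y i) u) (I : Fin 1 → Fin 3) :
    ST M t C k m q fun i p => mixed (Y i) u p.1 p.2 I := by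
  have hI : I = ![I 0] := by funext j; rw [Subsingleton.elim j 0]; rfl
  rw [hI]
  exact ((hX ![I 0]).sub hM <| ST.const_mul hM (3 / 2) <| ST.sum hM Finset.univ fun j _ =>
    ((ST.sphAvg hM (hX ![j])).mul hM (sy_proj hM (I 0) j) (by linarith)).add hM
      ((ST.sphAvg hM <| ST.sum hM Finset.univ fun k _ => (hX ![k]).mul hM (sy_areaForm hM k j) (by linarith)).mul hM
        (sy_areaForm hM (I 0) j) (by linarith))).congr
      fun i _ hp => mixed_eq_of_supported hM (hY i) (h i) hp (I 0)

theorem st_of_metricSupported (hX : ∀ a b, ST M t C k m q fun i p => X i p ![a, b])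
    (hs : ∀ i, SmoothT M (t i) (Y i)) (hsy : ∀ i, SymmT M (t i) (Y i)) (hv : ∀ i, MetricVanishing M (t i) (Y i))
    (h : ∀ i, MetricSupported M (t i) (X i - Y i)) (a b : Fin 4) : ST M t C k m q fun i p => Y i p ![a, b] := by
  have hn := symVec_n hM
  have hnu := symVec_nu hM
  have c := fun i {u w} => contDiffOn_ev2 (u := u) (w := w) (hs i)
  refine ST.of_parts hM hsy ?_ ?_ ?_
    (st_mixed_of_supported hM (ST.mixed hM hX hn) (fun i => (hv i).2.2.2.1) fun i => (h i).2.2.2.1)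
    (st_mixed_of_supported hM (ST.mixed hM hX hnu) (fun i => (hv i).2.2.2.2.1) fun i => (h i).2.2.2.2.1)
    (fun I => (ST.hatS hM hX I).congr fun i p hp => ?_) ?_ a b
  · exact (ST.hatNN hM hX).of_supportedL01 hM (fun i => contDiffOn_hatNN hM (hs i)) (fun i => (hv i).1)
      fun i => by simpa only [← hatNN_sub] using (h i).1
  · exact (ST.hatNV hM hX).of_supportedL01 hM (fun i => c i hn hnu) (fun i => (hv i).2.1)
      fun i => by simpa only [← hatNV_sub] using (h i).2.1
  · exact (ST.trQ hM hX).of_supportedL01 hM (fun i => contDiffOn_trQ hM (hs i)) (fun i => (hv i).2.2.1)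
      fun i => by simpa only [← trQ_sub] using (h i).2.2.1
  · have := (h i).2.2.2.2.2.2 p.1 hp.1 p.2 hp.2 I
    rw [hatS_sub] at this
    linarith
  · exact (ST.trS hM hX).of_supportedL01 hM (fun i => contDiffOn_trS hM (hs i)) (fun i => (hv i).2.2.2.2.2)
      fun i => by simpa only [← trS_sub] using (h i).2.2.2.2.2.1

end Projection

end LinearisedGravity

end

noncomputable section

set_option linter.unusedSimpArgs false

namespace LinearisedGravity

/-! ## Bounds for solutions arising from seed data -/

section Bounds

variable {M : ℝ} (hM : 0 < M) {ι : Type*} {t C : ι → ℝ} {k m : ℕ} {q s : ℝ}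

theorem PartsBoundedBy.mono {t b b' : ℝ} {X : TField 2} (hb : b ≤ b') (h : PartsBoundedBy M t m q b X) :
    PartsBoundedBy M t m q b' X :=
  ⟨h.1.mono hb, h.2.1.mono hb, h.2.2.1.mono hb, h.2.2.2.1.mono hb, h.2.2.2.2.1.mono hb, h.2.2.2.2.2.1.mono hb,
    h.2.2.2.2.2.2.mono hb⟩

theorem InitialData.MetricBoundedBy.mono {b b' : ℝ} {A : InitialData} (hb : b ≤ b')
    (h : A.MetricBoundedBy M m q b) : A.MetricBoundedBy M m q b' :=
  ⟨h.1.mono hb, h.2.1.mono hb, h.2.2.1.mono hb, h.2.2.2.1.mono hb, h.2.2.2.2.1.mono hb, h.2.2.2.2.2.1.mono hb,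
    h.2.2.2.2.2.2.mono hb⟩

theorem InitialData.KBoundedBy.mono {b b' : ℝ} {A : InitialData} (hb : b ≤ b')
    (h : A.KBoundedBy M m q b) : A.KBoundedBy M m q b' :=
  ⟨h.1.mono hb, h.2.1.mono hb, h.2.2.1.mono hb, h.2.2.2.mono hb⟩

variable (hC : ∀ i, 0 ≤ C i)
include hM

include hC in
theorem exists_partsBoundedBy {X : ι → TField 2} (hX : ∀ a b, ST M t C k m q fun i p => X i p ![a, b]) :
    ∃ b, 0 ≤ b ∧ ∀ i, PartsBoundedBy M (t i) (m + k) q (b * C i) (X i) := by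
  obtain ⟨b₁, p₁, h₁⟩ := exists_boundedBy hM (T := fun i => slice (hatNN M (X i)) (t i))
    fun _ => (ST.hatNN hM hX).so
  obtain ⟨b₂, p₂, h₂⟩ := exists_boundedBy hM (T := fun i => slice (hatNV M (X i)) (t i))
    fun _ => (ST.hatNV hM hX).so
  obtain ⟨b₃, p₃, h₃⟩ := exists_boundedBy hM (T := fun i => slice (trQ M (X i)) (t i))
    fun _ => (ST.trQ hM hX).so
  obtain ⟨b₄, p₄, h₄⟩ := exists_boundedBy hM (T := fun i => mixed (X i) (nVec M) (t i))
    fun I => (ST.mixed hM hX (symVec_n hM) I).so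
  obtain ⟨b₅, p₅, h₅⟩ := exists_boundedBy hM (T := fun i => mixed (X i) (nuVec M) (t i))
    fun I => (ST.mixed hM hX (symVec_nu hM) I).so
  obtain ⟨b₆, p₆, h₆⟩ := exists_boundedBy hM (T := fun i => hatS (X i) (t i)) fun I => (ST.hatS hM hX I).so
  obtain ⟨b₇, p₇, h₇⟩ := exists_boundedBy hM (T := fun i => slice (trS (X i)) (t i))
    fun _ => (ST.trS hM hX).so
  have le : ∀ i {b}, b ≤ b₁ + b₂ + b₃ + b₄ + b₅ + b₆ + b₇ →
      b * C i ≤ (b₁ + b₂ + b₃ + b₄ + b₅ + b₆ + b₇) * C i := fun i _ h => mul_le_mul_of_nonneg_right h (hC i)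
  exact ⟨_, by positivity, fun i => ⟨(h₁ i).mono (le i (by linarith)), (h₂ i).mono (le i (by linarith)),
    (h₃ i).mono (le i (by linarith)), (h₄ i).mono (le i (by linarith)), (h₅ i).mono (le i (by linarith)),
    (h₆ i).mono (le i (by linarith)), (h₇ i).mono (le i (by linarith))⟩⟩

theorem ST.nablaN {X : ι → TField 2} (hX : ∀ a b, ST M t C (k + 1) m q fun i p => X i p ![a, b]) (a b : Fin 4) :
    ST M t C k m (q + 1) fun i p => nablaN M (t i) (X i) p ![a, b] :=
  ST.sum hM Finset.univ fun c _ => (ST.covD_two hM hX c a b).mul_vec hM (symVec_n hM) c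

include hC in
theorem exists_partsBoundedBy_nablaN {X : ι → TField 2} (hX : ∀ a b, ST M t C 1 m q fun i p => X i p ![a, b]) :
    ∃ b, 0 ≤ b ∧ ∀ i, PartsBoundedBy M (t i) (m + 1) q (b * C i) (X i) ∧
      PartsBoundedBy M (t i) m (q + 1) (b * C i) (LinearisedGravity.nablaN M (t i) (X i)) :=
  exists_and (P := fun i b => PartsBoundedBy M (t i) (m + 1) q b (X i))
    (Q := fun i b => PartsBoundedBy M (t i) m (q + 1) b (LinearisedGravity.nablaN M (t i) (X i)))
    hC (fun _ _ _ hb h => h.mono hb) (fun _ _ _ hb h => h.mono hb)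
    (exists_partsBoundedBy hM hC hX) (exists_partsBoundedBy hM hC (ST.nablaN hM hX))

variable {𝒟 : ι → SeedData} {h : ι → TField 2}

theorem st_of_arisesFrom (hsm : ∀ i, (𝒟 i).IsSmooth M) (haf : ∀ i, (𝒟 i).StronglyAF M s (m + 5) (C i))
    (hh : ∀ i, ArisesFrom M (t i) (𝒟 i) (h i)) (a b : Fin 4) :
    ST M t C 1 m (3 / 2 + s) fun i p => (h i - kerr M (𝒟 i).mass (𝒟 i).spin) p ![a, b] := by
  have hs : ∀ i, SmoothT M (t i) (h i - kerr M (𝒟 i).mass (𝒟 i).spin) := fun i =>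
    (hh i).1.smooth.sub (kerr_smooth hM)
  have hsy : ∀ i, SymmT M (t i) (h i - kerr M (𝒟 i).mass (𝒟 i).spin) := fun i => (hh i).1.symm.sub kerr_symm
  have hI := (idso_constructed hM hsm haf fun i => (hh i).2).congr fun i =>
    induced_sub hM (t := t i) (hh i).1.smooth (kerr_smooth hM)
  exact st_of_gauge hM (st_slice_of_induced hM hs hsy hI) hs hsy
    (fun i => IsGauge.sub hM (hh i).1.smooth (kerr_smooth hM) (hh i).1.gauge fun p hp a => kerr_gauge hM hp a)
    (st_dGam_of_induced hM hs hsy hI) a b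

theorem st_of_isProjectionAway (hsm : ∀ i, (𝒟 i).IsSmooth M) (haf : ∀ i, (𝒟 i).StronglyAF M s (m + 5) (C i))
    (hh : ∀ i, ArisesFrom M (t i) (𝒟 i) (h i)) {h' : ι → TField 2} (hp : ∀ i, IsProjectionAway M (t i) (h i) (h' i))
    (a b : Fin 4) : ST M t C 1 m (3 / 2 + s) fun i p => h' i p ![a, b] :=
  st_of_metricSupported hM (st_of_arisesFrom hM hsm haf hh) (fun i => (hp i).1) (fun i => (hp i).2.1)
    (fun i => (hp i).2.2.1) (fun i => by rw [sub_right_comm]; exact (hp i).2.2.2.sub hM (kerr_supported hM)) a b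

end Bounds

end LinearisedGravity

end

theorem mainTheorem12 (M : ℝ) (hM : 0 < M) (s : ℝ) (hs0 : 0 < s) (hs1 : s ≤ 1)
    (n : ℕ) (hn : 7 ≤ n) :
    ∃ K : ℝ, 0 < K ∧ ∀ (t₀ C : ℝ) (𝒟 : SeedData),
      𝒟.IsSmooth M → 𝒟.StronglyAF M s n C →
      (∀ A : InitialData, IsConstructed M t₀ 𝒟 A →
        (A - induced M t₀ (kerr M 𝒟.mass 𝒟.spin)).MetricBoundedBy M (n - 4) (3 / 2 + s) (K * C) ∧
        (A - induced M t₀ (kerr M 𝒟.mass 𝒟.spin)).KBoundedBy M (n - 5) (5 / 2 + s) (K * C)) ∧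
      (∀ h : TField 2, ArisesFrom M t₀ 𝒟 h →
        (PartsBoundedBy M t₀ (n - 4) (3 / 2 + s) (K * C) (h - kerr M 𝒟.mass 𝒟.spin) ∧
          PartsBoundedBy M t₀ (n - 5) (5 / 2 + s) (K * C)
            (nablaN M t₀ (h - kerr M 𝒟.mass 𝒟.spin))) ∧
        ∀ h' : TField 2, IsProjectionAway M t₀ h h' →
          PartsBoundedBy M t₀ (n - 4) (3 / 2 + s) (K * C) h' ∧
          PartsBoundedBy M t₀ (n - 5) (5 / 2 + s) (K * C) (nablaN M t₀ h')) := by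
  obtain ⟨m, rfl⟩ : ∃ m, n = m + 5 := ⟨n - 5, by omega⟩
  rw [show m + 5 - 4 = m + 1 by omega, show m + 5 - 5 = m by omega,
    show (5 / 2 + s : ℝ) = 3 / 2 + s + 1 by ring]
  obtain ⟨b₁, p₁, h₁⟩ := (idso_constructed hM (s := s) (m := m)
    (ι := {i : ℝ × ℝ × SeedData × InitialData // i.2.2.1.IsSmooth M ∧ i.2.2.1.StronglyAF M s (m + 5) i.2.1 ∧
      IsConstructed M i.1 i.2.2.1 i.2.2.2})
    (t := fun i => i.1.1) (C := fun i => i.1.2.1) (𝒟 := fun i => i.1.2.2.1) (A := fun i => i.1.2.2.2)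
    (fun i => i.2.1) (fun i => i.2.2.1) (fun i => i.2.2.2)).exists_bound hM fun i => StronglyAF.nonneg i.2.2.1
  obtain ⟨b₂, p₂, h₂⟩ := exists_partsBoundedBy_nablaN hM (fun i => StronglyAF.nonneg i.2.2.1)
    (st_of_arisesFrom hM (s := s) (m := m)
      (ι := {i : ℝ × ℝ × SeedData × TField 2 // i.2.2.1.IsSmooth M ∧ i.2.2.1.StronglyAF M s (m + 5) i.2.1 ∧
        ArisesFrom M i.1 i.2.2.1 i.2.2.2})
      (t := fun i => i.1.1) (C := fun i => i.1.2.1) (𝒟 := fun i => i.1.2.2.1) (h := fun i => i.1.2.2.2)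
      (fun i => i.2.1) (fun i => i.2.2.1) (fun i => i.2.2.2))
  obtain ⟨b₃, p₃, h₃⟩ := exists_partsBoundedBy_nablaN hM (fun i => StronglyAF.nonneg i.2.2.1)
    (st_of_isProjectionAway hM (s := s) (m := m)
      (ι := {i : ℝ × ℝ × SeedData × TField 2 × TField 2 // i.2.2.1.IsSmooth M ∧
        i.2.2.1.StronglyAF M s (m + 5) i.2.1 ∧ ArisesFrom M i.1 i.2.2.1 i.2.2.2.1 ∧
        IsProjectionAway M i.1 i.2.2.2.1 i.2.2.2.2})
      (t := fun i => i.1.1) (C := fun i => i.1.2.1) (𝒟 := fun i => i.1.2.2.1) (h := fun i => i.1.2.2.2.1)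
      (h' := fun i => i.1.2.2.2.2) (fun i => i.2.1) (fun i => i.2.2.1) (fun i => i.2.2.2.1) (fun i => i.2.2.2.2))
  refine ⟨b₁ + b₂ + b₃ + 1, by positivity, fun t₀ C 𝒟 hsm haf => ?_⟩
  have le : ∀ {b}, b ≤ b₁ + b₂ + b₃ + 1 → b * C ≤ (b₁ + b₂ + b₃ + 1) * C := fun h =>
    mul_le_mul_of_nonneg_right h (StronglyAF.nonneg haf)
  refine ⟨fun A hA => ?_, fun h hh => ⟨?_, fun h' hp => ?_⟩⟩
  · obtain ⟨e, f⟩ := h₁ ⟨(t₀, C, 𝒟, A), hsm, haf, hA⟩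
    exact ⟨e.mono (le (by linarith)), f.mono (le (by linarith))⟩
  · obtain ⟨e, f⟩ := h₂ ⟨(t₀, C, 𝒟, h), hsm, haf, hh⟩
    exact ⟨e.mono (le (by linarith)), f.mono (le (by linarith))⟩
  · obtain ⟨e, f⟩ := h₃ ⟨(t₀, C, 𝒟, h, h'), hsm, haf, hh, hp⟩
    exact ⟨e.mono (le (by linarith)), f.mono (le (by linarith))⟩
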